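/- Let $\omega=(0,1)$, and let $H^m_\#(\omega)$ be the space of $1$-periodic functions on $\mathbb R$ with weak derivatives up to order $m$ in $L^2(\omega)$, with norm $\|u\|_{H^m_\#(\omega)}^2=\sum_{k=0}^m\|\partial_x^k u\|_{L^2(\omega)}^2$. For a positive function $\eta(x,t)$ put $\Omega_\eta(t)=\{(x,z): x\in\omega,\ 0<z<\eta(x,t)\}$, $J^\eta=\sqrt{1+(\partial_x\eta)^2}$, $\mathbf n^\eta=(-\partial_x\eta,1)/J^\eta$, and let $\sigma_f(\mathbf v,p)=2\mathbb D(\mathbf v)-pI_2$ with $\mathbb D(\mathbf v)=\tfrac12(\nabla\mathbf v+(\nabla\mathbf v)^T)$ and $\mathbf e_z=(0,1)$. For $T>0$ and $\varepsilon>0$ consider the following fluid-structure interaction problem, written in the time variable measured in units of $\varepsilon^{-2}$, with all functions $1$-periodic in $x$: $$\varepsilon^2\partial_t\mathbf v+(\mathbf v\cdot\nabla)\mathbf v-\operatorname{div}\sigma_f(\mathbf v,p)=\mathbf f,\qquad \operatorname{div}\mathbf v=0\qquad\text{in }\Omega_\eta(t)\times(0,T),$$ $$\varrho_\varepsilon\,\varepsilon^4\partial_{tt}\eta-\delta_\varepsilon\,\varepsilon^2\partial_x^2\partial_t\eta+\beta_\varepsilon\,\partial_x^4\eta=-J^\eta\,\big(\sigma_f(\mathbf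 v,p)\mathbf n^\eta\big)(x,\eta(x,t),t)\cdot\mathbf e_z\qquad\text{in }\omega\times(0,T),$$ $$\mathbf v(x,\eta(x,t),t)=(0,\varepsilon^2\partial_t\eta(x,t)),\qquad \mathbf v(x,0,t)=0\qquad\text{in }\omega\times(0,T),$$ $$\mathbf v(\cdot,0)=0,\qquad \partial_t\eta(\cdot,0)=0,\qquad \eta(\cdot,0)=\varepsilon\eta_0,$$ with $\varrho_\varepsilon=\hat\varrho\,\varepsilon$, $\delta_\varepsilon=\hat\delta\,\varepsilon^{-r}$, $\beta_\varepsilon=\hat\beta\,\varepsilon^{-1}$, where $\hat\varrho,\hat\delta,\hat\beta>0$ and $r\in[1,3]$. A strong solution on $(0,T)$ is a triple $(\mathbf v,p,\eta)$ with $$\eta\in H^2(0,T;L^2(\omega))\cap L^2(0,T;H^4_\#(\omega)),\qquad \eta>0,\qquad \eta^{-1}\in L^\infty(0,T;L^\infty(\omega)),$$ $$\mathbf v\in H^1(0,T;L^2(\Omega_\eta(t)))\cap L^2(0,T;H^2(\Omega_\eta(t))),\qquad p\in L^2(0,T;H^1(\Omega_\eta(t))),$$ $\mathbf v,p$ periodic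 in $x$, for which the equations hold almost everywhere and the boundary and initial conditions hold in the sense of traces. **Corollary.** Let $\hat\varrho,\hat\delta,\hat\beta>0$, $r\in[1,3]$, $T>0$, $M>0$, and let $\eta_0\in H^3_\#(\omega)$ be strictly positive. There is a constant $C>0$, depending only on these data and not on $\varepsilon$, such that for every $\varepsilon>0$, every force $\mathbf f=\mathbf f^\varepsilon$, and every strong solution $(\mathbf v^\varepsilon,p^\varepsilon,\eta^\varepsilon)$ of the problem on $(0,T)$ with $$\|\mathbf f^\varepsilon\|_{L^\infty(0,T;L^\infty(\Omega_{\eta^\varepsilon}(t);\mathbb R^2))}\le M,$$ the displacement satisfies $$\|\eta^\varepsilon\|_{L^\infty(0,T;H^2_\#(\omega))}\le C\varepsilon .$$ -/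

import Mathlib

open MeasureTheory Set Filter Topology
open scoped ENNReal ContDiff

noncomputable section

namespace ThinFSI

/-! ### Weak derivatives and periodic Sobolev spaces -/

/-- `g` is the weak derivative of `u` on `U` in the direction `e`. -/
def HasWeakDeriv {E : Type*} [NormedAddCommGroup E] [NormedSpace ℝ E] [MeasureSpace E]
    (U : Set E) (e : E) (u g : E → ℝ) : Prop :=
  LocallyIntegrableOn u U volume ∧ LocallyIntegrableOn g U volume ∧
    ∀ φ : E → ℝ, ContDiff ℝ ∞ φ → HasCompactSupport φ → tsupport φ ⊆ U →
      ∫ q in U, u q * fderiv ℝ φ q e = - ∫ q in U, g q * φ q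

open Classical in
/-- The weak derivative of `u` on `U` in the direction `e` (unique almost everywhere on an open
set `U`; the value `0` if there is none). -/
def weakDeriv {E : Type*} [NormedAddCommGroup E] [NormedSpace ℝ E] [MeasureSpace E]
    (U : Set E) (e : E) (u : E → ℝ) : E → ℝ :=
  if h : ∃ g, HasWeakDeriv U e u g then h.choose else 0

/-- `u` has a weak derivative on `U` in the direction `e`, and it is square integrable on the
period cell `S` of `U`. -/
def HasL2WeakDeriv {E : Type*} [NormedAddCommGroup E] [NormedSpace ℝ E] [MeasureSpace E]
    (U S : Set E) (e : E) (u : E → ℝ) : Prop :=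
  (∃ g, HasWeakDeriv U e u g) ∧ MemLp (weakDeriv U e u) 2 (volume.restrict S)

/-- The weak derivative of order `k` of a function on the real line. -/
def weakDerivX (k : ℕ) (u : ℝ → ℝ) : ℝ → ℝ := (weakDeriv univ (1 : ℝ))^[k] u

/-- The space `H^m_#(ω)`, `ω = (0,1)`: functions on `ℝ` that are periodic of period `1` and have
weak derivatives on `ℝ` of order up to `m` that are square integrable on `ω`. -/
def MemHSharp (m : ℕ) (u : ℝ → ℝ) : Prop :=
  Function.Periodic u 1 ∧ MemLp u 2 (volume.restrict (Ioo 0 1)) ∧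
    ∀ k < m, HasL2WeakDeriv univ (Ioo 0 1) (1 : ℝ) (weakDerivX k u)

open Classical in
/-- The norm of `H^m_#(ω)`, equal to `∞` outside the space. -/
def hSharpNorm (m : ℕ) (u : ℝ → ℝ) : ℝ≥0∞ :=
  if MemHSharp m u then
    (∑ k ∈ Finset.range (m + 1), ∫⁻ x in Ioo (0 : ℝ) 1, ‖weakDerivX k u x‖ₑ ^ 2) ^ (1 / 2 : ℝ)
  else ∞

/-- The norm of `L^∞(0,T;H^m_#(ω))` of a function of `(x,t)`. -/
def linftyHSharpNorm (m : ℕ) (T : ℝ) (η : ℝ × ℝ → ℝ) : ℝ≥0∞ :=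
  essSup (fun t => hSharpNorm m fun x => η (x, t)) (volume.restrict (Ioo 0 T))

/-! ### Space-time domains

Points of the plate are `(x,t)` and points of the fluid are `(x,z,t)`. Functions that are periodic
in `x` are functions of `x ∈ ℝ` of period `1`, so that weak derivatives are taken on domains
unbounded in `x`, and norms over the part `0 < x < 1`. -/

/-- `ℝ × (0,T)`. -/
def plateDomain (T : ℝ) : Set (ℝ × ℝ) := univ ×ˢ Ioo 0 T

/-- `ω × (0,T)`. -/
def plateCell (T : ℝ) : Set (ℝ × ℝ) := Ioo 0 1 ×ˢ Ioo 0 T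

/-- The periodic extension of `Ω_η(t) × (0,T)`. -/
def fluidDomain (T : ℝ) (η : ℝ × ℝ → ℝ) : Set (ℝ × ℝ × ℝ) :=
  {q | q.2.2 ∈ Ioo 0 T ∧ q.2.1 ∈ Ioo 0 (η (q.1, q.2.2))}

/-- `Ω_η(t) × (0,T)`, that is, the set of all `(x,z,t)` with `0 < t < T`, `x ∈ ω` and
`0 < z < η(x,t)`. -/
def fluidCell (T : ℝ) (η : ℝ × ℝ → ℝ) : Set (ℝ × ℝ × ℝ) :=
  fluidDomain T η ∩ {q | q.1 ∈ Ioo 0 1}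

/-- The directions of `x` and `t` in plate space-time. -/
def plateX : ℝ × ℝ := (1, 0)
def plateT : ℝ × ℝ := (0, 1)

/-- The directions of `x` (index `0`) and `z` (index `1`), and of `t`, in fluid space-time. -/
def fluidDir : Fin 2 → ℝ × ℝ × ℝ := ![(1, 0, 0), (0, 1, 0)]
def fluidT : ℝ × ℝ × ℝ := (0, 0, 1)

/-- `∂_x^k η`. -/
def plateDx (T : ℝ) (k : ℕ) (η : ℝ × ℝ → ℝ) : ℝ × ℝ → ℝ :=
  (weakDeriv (plateDomain T) plateX)^[k] η

/-- `∂_t^k η`. -/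
def plateDt (T : ℝ) (k : ℕ) (η : ℝ × ℝ → ℝ) : ℝ × ℝ → ℝ :=
  (weakDeriv (plateDomain T) plateT)^[k] η

/-- `γ` is the trace of `g` on the moving boundary `z = η(x,t)`, in the sense of `L²` over
`(x,t) ∈ ω × (0,T)`. -/
def IsTopTrace (T : ℝ) (η : ℝ × ℝ → ℝ) (g : ℝ × ℝ × ℝ → ℝ) (γ : ℝ × ℝ → ℝ) : Prop :=
  MemLp γ 2 (volume.restrict (plateCell T)) ∧
    Tendsto (fun h : ℝ => (∫⁻ s in Ioo 0 h, ∫⁻ y in plateCell T,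
      ‖g (y.1, η y - s, y.2) - γ y‖ₑ ^ 2) / ENNReal.ofReal h) (𝓝[>] 0) (𝓝 0)

/-- `γ` is the trace of `g` on the rigid bottom `z = 0`, in the sense of `L²` over
`(x,t) ∈ ω × (0,T)`. -/
def IsBottomTrace (T : ℝ) (g : ℝ × ℝ × ℝ → ℝ) (γ : ℝ × ℝ → ℝ) : Prop :=
  MemLp γ 2 (volume.restrict (plateCell T)) ∧
    Tendsto (fun h : ℝ => (∫⁻ s in Ioo 0 h, ∫⁻ y in plateCell T,
      ‖g (y.1, s, y.2) - γ y‖ₑ ^ 2) / ENNReal.ofReal h) (𝓝[>] 0) (𝓝 0)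

/-! ### The fluid-structure interaction problem -/

/-- `(∇v)_{ij} = ∂_j v_i`. -/
def velGrad (T : ℝ) (η : ℝ × ℝ → ℝ) (v : ℝ × ℝ × ℝ → EuclideanSpace ℝ (Fin 2))
    (q : ℝ × ℝ × ℝ) : Matrix (Fin 2) (Fin 2) ℝ :=
  Matrix.of fun i j => weakDeriv (fluidDomain T η) (fluidDir j) (fun q' => v q' i) q

/-- `D(v)`, the symmetric part of the gradient. -/
def symGrad (T : ℝ) (η : ℝ × ℝ → ℝ) (v : ℝ × ℝ × ℝ → EuclideanSpace ℝ (Fin 2))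
    (q : ℝ × ℝ × ℝ) : Matrix (Fin 2) (Fin 2) ℝ :=
  (1 / 2 : ℝ) • (velGrad T η v q + (velGrad T η v q).transpose)

/-- The Cauchy stress tensor `σ_f(v,p) = 2 D(v) - p I`. -/
def stress (T : ℝ) (η : ℝ × ℝ → ℝ) (v : ℝ × ℝ × ℝ → EuclideanSpace ℝ (Fin 2))
    (p : ℝ × ℝ × ℝ → ℝ) (q : ℝ × ℝ × ℝ) : Matrix (Fin 2) (Fin 2) ℝ :=
  (2 : ℝ) • symGrad T η v q - p q • (1 : Matrix (Fin 2) (Fin 2) ℝ)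

/-- `J^η = √(1 + (∂_x η)²)`. -/
def surfaceJacobian (T : ℝ) (η : ℝ × ℝ → ℝ) (y : ℝ × ℝ) : ℝ :=
  Real.sqrt (1 + plateDx T 1 η y ^ 2)

/-- The unit outer normal to `Ω_η(t)` at the point `(x,η(x,t))`. -/
def outerNormal (T : ℝ) (η : ℝ × ℝ → ℝ) (y : ℝ × ℝ) : Fin 2 → ℝ :=
  ![- plateDx T 1 η y / surfaceJacobian T η y, 1 / surfaceJacobian T η y]

/-- `(v,p,η)` is a strong solution on `(0,T)` of the interaction problem between the
incompressible Navier-Stokes equations with force `f` and the visco-elastic plate with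
coefficients `ρ`, `δ`, `β`, with initial displacement `η₀`, and starting from rest. The number `κ`
is the inverse of the time unit: every `∂_t` of the unscaled problem (`κ = 1`) becomes `κ ∂_t`. -/
structure IsStrongSolution (ρ δ β κ T : ℝ) (η₀ : ℝ → ℝ)
    (f v : ℝ × ℝ × ℝ → EuclideanSpace ℝ (Fin 2)) (p : ℝ × ℝ × ℝ → ℝ) (η : ℝ × ℝ → ℝ) :
    Prop where
  /-- periodicity in `x` -/
  displacement_periodic : ∀ x t, η (x + 1, t) = η (x, t)
  velocity_periodic : ∀ x z t, v (x + 1, z, t) = v (x, z, t)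
  pressure_periodic : ∀ x z t, p (x + 1, z, t) = p (x, z, t)
  /-- `η` is its continuous representative -/
  displacement_continuous : ContinuousOn η (univ ×ˢ Icc 0 T)
  /-- `η⁻¹ ∈ L^∞(0,T;L^∞(ω))` -/
  displacement_lower : ∃ c > 0, ∀ y ∈ plateDomain T, c ≤ η y
  /-- `η ∈ H²(0,T;L²(ω)) ∩ L²(0,T;H⁴_#(ω))` -/
  displacement_memL2 : MemLp η 2 (volume.restrict (plateCell T))
  displacement_dt : ∀ k < 2, HasL2WeakDeriv (plateDomain T) (plateCell T) plateT (plateDt T k η)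
  displacement_dx : ∀ k < 4, HasL2WeakDeriv (plateDomain T) (plateCell T) plateX (plateDx T k η)
  /-- the intermediate derivatives `∂_x ∂_t η` and `∂_x² ∂_t η` (which, by interpolation, are in
  `L²` for every `η` in the above space) -/
  displacement_dtx : ∀ k < 2, HasL2WeakDeriv (plateDomain T) (plateCell T) plateX
    (plateDx T k (plateDt T 1 η))
  /-- `v ∈ H¹(0,T;L²(Ω_η(t))) ∩ L²(0,T;H²(Ω_η(t)))` -/
  velocity_memL2 : ∀ i, MemLp (fun q => v q i) 2 (volume.restrict (fluidCell T η))
  velocity_dt : ∀ i, HasL2WeakDeriv (fluidDomain T η) (fluidCell T η) fluidT (fun q => v q i)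
  velocity_dx : ∀ i j,
    HasL2WeakDeriv (fluidDomain T η) (fluidCell T η) (fluidDir j) (fun q => v q i)
  velocity_dxx : ∀ i j k, HasL2WeakDeriv (fluidDomain T η) (fluidCell T η) (fluidDir k)
    (fun q => velGrad T η v q i j)
  /-- `p ∈ L²(0,T;H¹(Ω_η(t)))` -/
  pressure_memL2 : MemLp p 2 (volume.restrict (fluidCell T η))
  pressure_dx : ∀ j, HasL2WeakDeriv (fluidDomain T η) (fluidCell T η) (fluidDir j) p
  /-- `κ ∂_t v + (v·∇)v - div σ_f(v,p) = f` -/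
  momentum : ∀ᵐ q ∂(volume.restrict (fluidCell T η)), ∀ i,
    κ * weakDeriv (fluidDomain T η) fluidT (fun q' => v q' i) q
      + ∑ j, v q j * velGrad T η v q i j
      - ∑ j, weakDeriv (fluidDomain T η) (fluidDir j) (fun q' => stress T η v p q' i j) q
      = f q i
  /-- `div v = 0` -/
  divergence_free : ∀ᵐ q ∂(volume.restrict (fluidCell T η)), ∑ i, velGrad T η v q i i = 0
  /-- the plate equation
  `ρ κ² ∂_tt η - δ κ ∂_x² ∂_t η + β ∂_x⁴ η = - J^η (σ_f(v,p) n^η)(x,η(x,t),t) · e_z`,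
  in which `S` is the trace of the stress tensor -/
  plate : ∃ S : ℝ × ℝ → Matrix (Fin 2) (Fin 2) ℝ,
    (∀ i j, IsTopTrace T η (fun q => stress T η v p q i j) (fun y => S y i j)) ∧
    ∀ᵐ y ∂(volume.restrict (plateCell T)),
      ρ * κ ^ 2 * plateDt T 2 η y - δ * κ * plateDx T 2 (plateDt T 1 η) y
        + β * plateDx T 4 η y
        = - surfaceJacobian T η y * (S y).mulVec (outerNormal T η y) 1
  /-- `v(x,η(x,t),t) = (0, κ ∂_t η(x,t))` -/
  kinematic_horizontal : IsTopTrace T η (fun q => v q 0) 0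
  kinematic_vertical : IsTopTrace T η (fun q => v q 1) (fun y => κ * plateDt T 1 η y)
  /-- `v(x,0,t) = 0` -/
  no_slip : ∀ i, IsBottomTrace T (fun q => v q i) 0
  /-- `η(·,0) = η₀` -/
  initial_displacement : ∀ x, η (x, 0) = η₀ x
  /-- `∂_t η(·,0) = 0`, as a trace at `t = 0` in the sense of `L²(ω)` -/
  initial_plate_velocity : Tendsto (fun h : ℝ =>
    (∫⁻ y in plateCell T ∩ {y | y.2 < h}, ‖plateDt T 1 η y‖ₑ ^ 2) / ENNReal.ofReal h)
    (𝓝[>] 0) (𝓝 0)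
  /-- `v(·,0) = 0`, as a trace at `t = 0` in the sense of `L²(Ω_η(t))` -/
  initial_velocity : Tendsto (fun h : ℝ =>
    (∫⁻ q in fluidCell T η ∩ {q | q.2.2 < h}, ‖v q‖ₑ ^ 2) / ENNReal.ofReal h)
    (𝓝[>] 0) (𝓝 0)

end ThinFSI

end

/-!
The bound is an energy estimate in which every constant can be followed through the scaling.

Write `κ = ε²` for the factor of the time derivatives, `φ = ε η₀` for the initial displacement, and
`Y(t) = ∫ (∂ₓ² η)²`. Testing the momentum equation with the velocity and the plate equation with the
plate velocity `κ ∂ₜη` cancels the work of the stress on the plate (`FlowField.work`,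
`PlateField.energy`) and leaves a balance between the kinetic and bending energies, the dissipation
`∫ σ : ∇v`, and the power `∫ v · f` of the force.

* *Dissipation.* For a divergence free velocity, `σ : ∇v = |∇v|² - 2 det ∇v`. The determinant is a
  divergence, of a field that is a multiple of the horizontal velocity, which vanishes on the bottom
  and on the plate; so its integral is zero (`FlowField.integral_det_eq_zero`) and the whole
  Dirichlet integral is available, without Korn's inequality.
* *Power of the force.* The vertical Poincaré inequality `∫ |v|² / η² ≤ 4 ∫ |∂_z v|²`
  (`FluidGeometry.poincare`) has a constant that does not depend on the domain. With Young's
  inequality it absorbs the velocity into the dissipation and leaves `M² ∫ η²` over the fluid, that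
  is `M² ∫ η³` over the period (`Interaction.energy_cell`, `Interaction.energy_weak`).
* *Thickness.* The flow is incompressible, so the mean displacement `m` is conserved
  (`Interaction.ae_integral_eq`). The slope has mean zero, so `|η - m| ≤ √Y`
  (`PlateField.ae_bounds`). Hence `η² ≤ 2 (Y + m²)` and `∫ η³ ≤ 2 m (Y + m²)`: one of the three
  powers of `η` is spent on the conserved mean, and the estimate becomes linear in `Y + m²`.

The motion starts from rest, so the initial energy is the bending energy of `φ`, and Gronwall's
inequality gives `Y(t) + m² ≤ (Y(0) + m²) exp (4 M² m t / (κ β))` (`Interaction.bending_le_exp`).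
For `m = ε ∫ η₀`, `κ = ε²` and `β = β̂ / ε` the rate of growth is `4 M² ∫ η₀ / β̂`, independent of `ε`,
while `Y(0) + m²` is a multiple of `ε²`. The inertia and the damping of the plate enter only through
their signs, so the damping exponent plays no role.

Three points need care at the regularity of a strong solution.

* `|v|²` need not be an admissible multiplier. The balance of kinetic energy is proved for a bounded
  truncation of `|v|²/2`, and the truncation is removed by dominated convergence, the acceleration
  being square integrable by the equation (`FlowField.kinetic_balance`).
* Boundary terms are obtained with a cutoff at distance `h` from the horizontal boundaries. As
  `h → 0` they are averages over thin layers, in which a function with a trace is close to its trace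
  in `L²`; this turns traces into a divergence theorem on the moving domain (`Flux.divergence`).
* The initial condition on the velocity concerns averages over short times, so the kinetic energy is
  only known to be small along some times `s → 0`. At those times the bending energy must exceed its
  initial value by little: the displacement, extended by `φ` to negative times, remains weakly
  differentiable in time, so that `Y(s) ≤ ∫ (∂ₓ² φ)² + ∫₀ˢ g` with `g` integrable
  (`PlateField.exists_bending_le`).
  The same bound shows that the slope is bounded, which the divergence theorem requires.

Weak derivatives are handled by mollification: the product and chain rules
(`HasWeakDeriv.mul_of_holder`, `HasWeakDeriv.comp_contDiff`) follow from local approximation by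
smooth functions, and integration by parts over a period cell (`HasWeakDeriv.integral_xCell_eq_zero`)
from a partition of unity along the period.
-/


noncomputable section

set_option linter.unusedSectionVars false

namespace ThinFSI

/-! ### Calculus of weak derivatives -/

section Calculus

variable {E : Type*} [NormedAddCommGroup E] [NormedSpace ℝ E] [FiniteDimensional ℝ E]
  [MeasureSpace E] [BorelSpace E] {U : Set E} {e : E} {u v g k : E → ℝ}

lemma setIntegral_eq_of_tsupport_subset {F : E → ℝ} {φ : E → ℝ} (hφ : tsupport φ ⊆ U)
    (hF : ∀ q, φ =ᶠ[𝓝 q] 0 → F q = 0) : ∫ q in U, F q = ∫ q, F q := by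
  refine setIntegral_eq_integral_of_forall_compl_eq_zero fun q hq => hF q ?_
  exact notMem_tsupport_iff_eventuallyEq.1 fun h => hq (hφ h)

lemma fderiv_apply_eq_zero_of_eventuallyEq {φ : E → ℝ} {q : E} (h : φ =ᶠ[𝓝 q] 0) :
    fderiv ℝ φ q e = 0 := by
  rw [h.fderiv_eq]; simp

theorem HasWeakDeriv.congr (h : HasWeakDeriv U e u g)
    (hu : ∀ᵐ q ∂volume.restrict U, u q = v q) (hg : ∀ᵐ q ∂volume.restrict U, g q = k q) :
    HasWeakDeriv U e v k := by
  have key : ∀ {a b : E → ℝ}, (∀ᵐ q ∂volume.restrict U, a q = b q) →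
      LocallyIntegrableOn a U volume → LocallyIntegrableOn b U volume := by
    intro a b hab ha x hx
    obtain ⟨s, hs, hi⟩ := ha x hx
    have hs' : U ∩ s ∈ 𝓝[U] x := inter_mem self_mem_nhdsWithin hs
    exact ⟨U ∩ s, hs', (hi.mono_set inter_subset_right).congr
      (ae_mono (Measure.restrict_mono inter_subset_left le_rfl) hab)⟩
  refine ⟨key hu h.1, key hg h.2.1, fun φ h1 h2 h3 => ?_⟩
  rw [← integral_congr_ae (hu.mono fun q hq => by simp only [hq] :
      (fun q => u q * fderiv ℝ φ q e) =ᵐ[volume.restrict U] fun q => v q * fderiv ℝ φ q e),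
    ← integral_congr_ae (hg.mono fun q hq => by simp only [hq] :
      (fun q => g q * φ q) =ᵐ[volume.restrict U] fun q => k q * φ q)]
  exact h.2.2 φ h1 h2 h3

theorem HasWeakDeriv.mono {V : Set E} (hVU : V ⊆ U) (h : HasWeakDeriv U e u g) :
    HasWeakDeriv V e u g := by
  refine ⟨h.1.mono_set hVU, h.2.1.mono_set hVU, fun φ h1 h2 h3 => ?_⟩
  have := h.2.2 φ h1 h2 (h3.trans hVU)
  rw [setIntegral_eq_of_tsupport_subset (φ := φ) (h3.trans hVU),
    setIntegral_eq_of_tsupport_subset (φ := φ) (h3.trans hVU)] at this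
  · rw [setIntegral_eq_of_tsupport_subset (φ := φ) h3,
      setIntegral_eq_of_tsupport_subset (φ := φ) h3, this]
    · intro q hq; simp [hq.eq_of_nhds]
    · intro q hq; simp [fderiv_apply_eq_zero_of_eventuallyEq hq]
  · intro q hq; simp [hq.eq_of_nhds]
  · intro q hq; simp [fderiv_apply_eq_zero_of_eventuallyEq hq]

lemma integrable_mul_test {a φ : E → ℝ} (ha : LocallyIntegrableOn a U volume)
    (hφ : Continuous φ) (hc : HasCompactSupport φ) (hs : tsupport φ ⊆ U) :
    Integrable (fun q => a q * φ q) := by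
  have h1 : IntegrableOn (fun q => a q * φ q) (tsupport φ) :=
    (ha.integrableOn_compact_subset hs hc).mul_continuousOn hφ.continuousOn hc
  rwa [integrableOn_iff_integrable_of_support_subset] at h1
  exact (Function.support_mul_subset_right _ _).trans (subset_tsupport φ)

lemma tsupport_fderiv_apply_subset' {φ : E → ℝ} : tsupport (fun q => fderiv ℝ φ q e) ⊆ tsupport φ :=
  tsupport_fderiv_apply_subset ℝ e

lemma integrable_mul_test_fderiv {a φ : E → ℝ} (ha : LocallyIntegrableOn a U volume)
    (hφ : ContDiff ℝ 1 φ) (hc : HasCompactSupport φ) (hs : tsupport φ ⊆ U) :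
    Integrable (fun q => a q * fderiv ℝ φ q e) := by
  refine integrable_mul_test ha ?_ (hc.fderiv_apply ℝ e) (tsupport_fderiv_apply_subset'.trans hs)
  exact (hφ.continuous_fderiv one_ne_zero).clm_apply continuous_const

/-- The defining identity of a weak derivative, with the integrals taken over the whole space. -/
theorem HasWeakDeriv.integral_eq (h : HasWeakDeriv U e u g) {φ : E → ℝ} (h1 : ContDiff ℝ ∞ φ)
    (h2 : HasCompactSupport φ) (h3 : tsupport φ ⊆ U) :
    ∫ q, u q * fderiv ℝ φ q e = - ∫ q, g q * φ q := by
  have := h.2.2 φ h1 h2 h3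
  rwa [setIntegral_eq_of_tsupport_subset (φ := φ) h3,
    setIntegral_eq_of_tsupport_subset (φ := φ) h3] at this
  · intro q hq; simp [hq.eq_of_nhds]
  · intro q hq; simp [fderiv_apply_eq_zero_of_eventuallyEq hq]

theorem HasWeakDeriv.of_integral_eq (hu : LocallyIntegrableOn u U volume)
    (hg : LocallyIntegrableOn g U volume)
    (h : ∀ φ : E → ℝ, ContDiff ℝ ∞ φ → HasCompactSupport φ → tsupport φ ⊆ U →
      ∫ q, u q * fderiv ℝ φ q e = - ∫ q, g q * φ q) : HasWeakDeriv U e u g := by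
  refine ⟨hu, hg, fun φ h1 h2 h3 => ?_⟩
  rw [setIntegral_eq_of_tsupport_subset (φ := φ) h3,
    setIntegral_eq_of_tsupport_subset (φ := φ) h3]
  · exact h φ h1 h2 h3
  · intro q hq; simp [hq.eq_of_nhds]
  · intro q hq; simp [fderiv_apply_eq_zero_of_eventuallyEq hq]

theorem HasWeakDeriv.unique (hU : IsOpen U) (h : HasWeakDeriv U e u g)
    (h' : HasWeakDeriv U e u k) : ∀ᵐ q ∂volume.restrict U, g q = k q := by
  have := hU.ae_eq_zero_of_integral_contDiff_smul_eq_zero (h.2.1.sub h'.2.1) (μ := volume)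
    fun φ h1 h2 h3 => by
      have i1 := integrable_mul_test h.2.1 h1.continuous h2 h3
      have i2 := integrable_mul_test h'.2.1 h1.continuous h2 h3
      have e1 := h.integral_eq h1 h2 h3
      have e2 := h'.integral_eq h1 h2 h3
      have : ∀ q, φ q • (g - k) q = g q * φ q - k q * φ q := fun q => by
        simp only [smul_eq_mul, Pi.sub_apply]; ring
      simp only [this]
      rw [integral_sub i1 i2]
      linarith
  rw [ae_restrict_iff' hU.measurableSet]
  exact this.mono fun q hq hqU => sub_eq_zero.1 (hq hqU)

theorem hasWeakDeriv_weakDeriv (h : ∃ g, HasWeakDeriv U e u g) :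
    HasWeakDeriv U e u (weakDeriv U e u) := by
  rw [weakDeriv, dif_pos h]; exact h.choose_spec

theorem HasWeakDeriv.weakDeriv_ae (hU : IsOpen U) (h : HasWeakDeriv U e u g) :
    ∀ᵐ q ∂volume.restrict U, weakDeriv U e u q = g q :=
  (hasWeakDeriv_weakDeriv ⟨g, h⟩).unique hU h

theorem HasWeakDeriv.add (h : HasWeakDeriv U e u g) (h' : HasWeakDeriv U e v k) :
    HasWeakDeriv U e (fun q => u q + v q) (fun q => g q + k q) := by
  refine .of_integral_eq (h.1.add h'.1) (h.2.1.add h'.2.1) fun φ h1 h2 h3 => ?_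
  simp only [add_mul]
  rw [integral_add (integrable_mul_test_fderiv h.1 (h1.of_le (by simp)) h2 h3)
    (integrable_mul_test_fderiv h'.1 (h1.of_le (by simp)) h2 h3),
    integral_add (integrable_mul_test h.2.1 h1.continuous h2 h3)
    (integrable_mul_test h'.2.1 h1.continuous h2 h3), h.integral_eq h1 h2 h3,
    h'.integral_eq h1 h2 h3]
  ring

theorem HasWeakDeriv.const_mul (c : ℝ) (h : HasWeakDeriv U e u g) :
    HasWeakDeriv U e (fun q => c * u q) (fun q => c * g q) := by
  refine .of_integral_eq (h.1.smul c) (h.2.1.smul c) fun φ h1 h2 h3 => ?_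
  simp only [mul_assoc]
  rw [integral_const_mul, integral_const_mul, h.integral_eq h1 h2 h3]
  ring

theorem HasWeakDeriv.sub (h : HasWeakDeriv U e u g) (h' : HasWeakDeriv U e v k) :
    HasWeakDeriv U e (fun q => u q - v q) (fun q => g q - k q) := by
  simpa [sub_eq_add_neg] using h.add (h'.const_mul (-1))

/-- Weak derivatives commute: if `∂_{e₁} ∂_{e₂} u` exists, then so does `∂_{e₂} ∂_{e₁} u`, and the
two agree. -/
theorem HasWeakDeriv.comm {e₁ e₂ : E} {g₁ g₂ : E → ℝ} (h₁ : HasWeakDeriv U e₁ u g₁)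
    (h₂ : HasWeakDeriv U e₂ u g₂) (h : HasWeakDeriv U e₁ g₂ k) : HasWeakDeriv U e₂ g₁ k := by
  refine .of_integral_eq h₁.2.1 h.2.1 fun φ h1 h2 h3 => ?_
  have hd : ∀ e : E, ContDiff ℝ ∞ (fun q => fderiv ℝ φ q e) := fun e =>
    (h1.fderiv_right (m := ∞) (by simp)).clm_apply contDiff_const
  have e1 := h₁.integral_eq (hd e₂) (h2.fderiv_apply ℝ e₂) (tsupport_fderiv_apply_subset'.trans h3)
  have e2 := h₂.integral_eq (hd e₁) (h2.fderiv_apply ℝ e₁) (tsupport_fderiv_apply_subset'.trans h3)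
  have e3 := h.integral_eq h1 h2 h3
  have hsymm : ∀ q, fderiv ℝ (fun q => fderiv ℝ φ q e₂) q e₁
      = fderiv ℝ (fun q => fderiv ℝ φ q e₁) q e₂ := fun q => by
    have hdf : DifferentiableAt ℝ (fderiv ℝ φ) q :=
      (h1.fderiv_right (m := ∞) (by simp)).differentiable (by simp) q
    have hs : IsSymmSndFDerivAt ℝ φ q := h1.contDiffAt.isSymmSndFDerivAt (by simp; exact WithTop.coe_le_coe.2 (le_top (α := ℕ∞)))
    have hk : ∀ e : E, fderiv ℝ (fun q => fderiv ℝ φ q e) q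
        = (fderiv ℝ (fderiv ℝ φ) q).flip e := fun e => by
      rw [fderiv_clm_apply hdf (differentiableAt_const e)]; simp
    rw [hk, hk, ContinuousLinearMap.flip_apply, ContinuousLinearMap.flip_apply]
    exact hs e₁ e₂
  simp only [hsymm] at e1
  linarith

variable [(volume : Measure E).IsAddHaarMeasure]

theorem hasWeakDeriv_of_contDiff (hu : ContDiff ℝ 1 u) :
    HasWeakDeriv U e u (fun q => fderiv ℝ u q e) := by
  have hc : Continuous (fun q => fderiv ℝ u q e) :=
    (hu.continuous_fderiv one_ne_zero).clm_apply continuous_const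
  refine .of_integral_eq (hu.continuous.locallyIntegrable.locallyIntegrableOn U)
    (hc.locallyIntegrable.locallyIntegrableOn U) fun φ h1 h2 h3 => ?_
  have l1 : LocallyIntegrableOn u U volume := hu.continuous.locallyIntegrable.locallyIntegrableOn U
  have l2 : LocallyIntegrableOn (fun q => fderiv ℝ u q e) U volume :=
    hc.locallyIntegrable.locallyIntegrableOn U
  refine integral_mul_fderiv_eq_neg_fderiv_mul_of_integrable (integrable_mul_test l2 h1.continuous h2 h3)
    (integrable_mul_test_fderiv l1 (h1.of_le (by simp)) h2 h3) (integrable_mul_test l1 h1.continuous h2 h3) ?_ ?_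
  · exact fun x _ => hu.differentiable one_ne_zero x
  · exact fun x _ => h1.differentiable (by simp) x

end Calculus

/-! ### Mollification -/

section Mollification

variable {E : Type*} [NormedAddCommGroup E] [NormedSpace ℝ E] [FiniteDimensional ℝ E]
  [MeasureSpace E] [BorelSpace E] [(volume : Measure E).IsAddHaarMeasure]
  {U : Set E} {e : E} {u v g k : E → ℝ} {p : ℝ≥0∞}

/-- Translations act continuously on `L^p`. -/
lemma tendsto_eLpNorm_translate_sub [Fact (1 ≤ p)] (hp : p ≠ ⊤) {f : E → ℝ}
    (hf : MemLp f p volume) :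
    Tendsto (fun t : E => eLpNorm (fun x => f (x - t) - f x) p volume) (𝓝 0) (𝓝 0) := by
  have : Fact (p ≠ ⊤) := ⟨hp⟩
  have hcont : Continuous fun t : E => DomAddAct.mk (-t) +ᵥ hf.toLp f := by
    exact (DomAddAct.continuous_mk.comp continuous_neg).vadd continuous_const
  have h0 : DomAddAct.mk (-(0 : E)) +ᵥ hf.toLp f = hf.toLp f := by simp
  have := (hcont.tendsto 0).edist (tendsto_const_nhds (x := hf.toLp f))
  rw [h0, edist_self] at this
  refine this.congr fun t => ?_
  rw [DomAddAct.mk_vadd_toLp, Lp.edist_toLp_toLp]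
  refine congrArg (fun F => eLpNorm F p volume) (funext fun x => ?_)
  simp [sub_eq_neg_add]

lemma lintegral_rpow_le_of_isProbabilityMeasure {α : Type*} [MeasurableSpace α] (ν : Measure α)
    [IsProbabilityMeasure ν] {F : α → ℝ} (hF : AEStronglyMeasurable F ν) {r : ℝ} (hr : 1 ≤ r) :
    (∫⁻ a, ‖F a‖ₑ ∂ν) ^ r ≤ ∫⁻ a, ‖F a‖ₑ ^ r ∂ν := by
  have h := eLpNorm'_le_eLpNorm'_of_exponent_le one_pos hr ν hF
  simp only [eLpNorm', ENNReal.rpow_one, div_one] at h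
  calc (∫⁻ a, ‖F a‖ₑ ∂ν) ^ r ≤ ((∫⁻ a, ‖F a‖ₑ ^ r ∂ν) ^ (1 / r)) ^ r :=
        ENNReal.rpow_le_rpow h (by linarith)
    _ = _ := by rw [← ENNReal.rpow_mul, one_div_mul_cancel (by linarith), ENNReal.rpow_one]

/-- Averaging against a probability density supported in a ball changes a function in `L^p` by no
more than the translations by vectors of that ball do. -/
lemma eLpNorm_mollify_sub_le [Fact (1 ≤ p)] (hp : p ≠ ⊤) {f : E → ℝ} (hf : MemLp f p volume)
    {ρ : E → ℝ} (hρ : Continuous ρ) (hρc : HasCompactSupport ρ) (hρ0 : ∀ t, 0 ≤ ρ t)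
    (hρ1 : ∫ t, ρ t = 1) {ε : ℝ≥0∞}
    (hε : ∀ t, ρ t ≠ 0 → eLpNorm (fun x => f (x - t) - f x) p volume ≤ ε) :
    eLpNorm (fun x => (∫ t, ρ t * f (x - t)) - f x) p volume ≤ ε := by
  have hp0 : p ≠ 0 := (zero_lt_one.trans_le (Fact.out : 1 ≤ p)).ne'
  have hr : 1 ≤ p.toReal := by
    rw [← ENNReal.toReal_one]; exact ENNReal.toReal_mono hp Fact.out
  have hr0 : 0 < p.toReal := by linarith
  set r := p.toReal with hrdef
  have hρi : Integrable ρ := hρ.integrable_of_hasCompactSupport hρc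
  set ν : Measure E := volume.withDensity fun t => ENNReal.ofReal (ρ t) with hν
  have hνac : ν ≪ volume := withDensity_absolutelyContinuous _ _
  have : IsProbabilityMeasure ν := ⟨by
    rw [hν, withDensity_apply _ MeasurableSet.univ, setLIntegral_univ,
      ← ofReal_integral_eq_lintegral_ofReal hρi (Eventually.of_forall hρ0), hρ1, ENNReal.ofReal_one]⟩
  have hloc : LocallyIntegrable f volume := hf.locallyIntegrable Fact.out
  have hint : ∀ x, Integrable fun t => ρ t * f (x - t) := fun x => by
    have h1 : Integrable fun s => ρ (x - s) * f s := by
      simpa using hloc.integrable_smul_left_of_hasCompactSupport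
        (hρ.comp (continuous_const.sub continuous_id))
        (hρc.comp_homeomorph (Homeomorph.subLeft x))
    simpa using h1.comp_sub_left x
  have hqmp : Measure.QuasiMeasurePreserving (fun z : E × E => z.1 - z.2)
      ((volume : Measure E).prod ν) volume := quasiMeasurePreserving_sub_of_right_invariant _ _
  have hmeas : AEStronglyMeasurable (fun z : E × E => f (z.1 - z.2) - f z.1)
      ((volume : Measure E).prod ν) :=
    (hf.1.comp_quasiMeasurePreserving hqmp).sub hf.1.comp_fst
  have hb : ∀ x, ‖(∫ t, ρ t * f (x - t)) - f x‖ₑ ≤ ∫⁻ t, ‖f (x - t) - f x‖ₑ ∂ν := fun x => by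
    have h1 : (∫ t, ρ t * f (x - t)) - f x = ∫ t, ρ t * (f (x - t) - f x) := by
      simp only [mul_sub]
      rw [integral_sub (hint x) (hρi.mul_const _), integral_mul_const, hρ1, one_mul]
    rw [h1]
    refine (enorm_integral_le_lintegral_enorm _).trans (le_of_eq ?_)
    rw [hν, lintegral_withDensity_eq_lintegral_mul_non_measurable _
      hρ.measurable.ennreal_ofReal (Eventually.of_forall fun _ => ENNReal.ofReal_lt_top)]
    refine lintegral_congr fun t => ?_
    simp [enorm_mul, Real.enorm_of_nonneg (hρ0 t)]
  rw [eLpNorm_eq_lintegral_rpow_enorm_toReal hp0 hp, ← hrdef]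
  have key : ∫⁻ x, ‖(∫ t, ρ t * f (x - t)) - f x‖ₑ ^ r ≤ ε ^ r := by
    calc ∫⁻ x, ‖(∫ t, ρ t * f (x - t)) - f x‖ₑ ^ r
        ≤ ∫⁻ x, ∫⁻ t, ‖f (x - t) - f x‖ₑ ^ r ∂ν := by
          refine lintegral_mono_ae ?_
          filter_upwards [hmeas.prodMk_left] with x hx
          exact (ENNReal.rpow_le_rpow (hb x) hr0.le).trans
            (lintegral_rpow_le_of_isProbabilityMeasure ν hx hr)
      _ = ∫⁻ t, ∫⁻ x, ‖f (x - t) - f x‖ₑ ^ r ∂volume ∂ν :=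
          lintegral_lintegral_swap (hmeas.enorm.pow_const r)
      _ ≤ ∫⁻ t, ε ^ r ∂ν := by
          refine lintegral_mono_ae ?_
          have : ∀ᵐ t ∂ν, ρ t ≠ 0 := by
            rw [hν, ae_withDensity_iff hρ.measurable.ennreal_ofReal]
            exact Eventually.of_forall fun t ht h0 => ht (by simp [h0])
          filter_upwards [this] with t ht
          have := hε t ht
          rw [eLpNorm_eq_lintegral_rpow_enorm_toReal hp0 hp, ← hrdef] at this
          rwa [one_div, ENNReal.rpow_inv_le_iff hr0] at this
      _ = ε ^ r := by simp
  rw [one_div, ENNReal.rpow_inv_le_iff hr0]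
  exact key

/-- A function that lies in `L^p` on every compact subset of `U`. -/
def MemLpLoc (p : ℝ≥0∞) (U : Set E) (u : E → ℝ) : Prop :=
  ∀ K, IsCompact K → K ⊆ U → MemLp u p (volume.restrict K)

/-- Meyers-Serrin approximation in a form local to a compact set: near a compact `K ⊆ U`, a function
with a weak derivative is the limit of smooth functions whose classical derivatives converge to
it. -/
theorem HasWeakDeriv.exists_smooth_approx [Fact (1 ≤ p)] (hp : p ≠ ⊤) (hU : IsOpen U) {K : Set E}
    (hK : IsCompact K) (hKU : K ⊆ U) (h : HasWeakDeriv U e u g) (hu : MemLpLoc p U u)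
    (hg : MemLpLoc p U g) :
    ∃ w : ℕ → E → ℝ, (∀ n, ContDiff ℝ ∞ (w n)) ∧
      Tendsto (fun n => eLpNorm (fun q => w n q - u q) p (volume.restrict K)) atTop (𝓝 0) ∧
      Tendsto (fun n => eLpNorm (fun q => fderiv ℝ (w n) q e - g q) p (volume.restrict K))
        atTop (𝓝 0) := by
  obtain ⟨δ, hδ, hδU⟩ := hK.exists_cthickening_subset_open hU hKU
  set K' := Metric.cthickening δ K with hK'
  have hK'c : IsCompact K' := hK.cthickening
  have hm : ∀ {a : E → ℝ}, MemLpLoc p U a → MemLp (K'.indicator a) p volume := fun ha =>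
    (memLp_indicator_iff_restrict hK'c.measurableSet).2 (ha K' hK'c hδU)
  -- bump functions of radius tending to zero
  let φ : ℕ → ContDiffBump (0 : E) := fun n =>
    { rIn := δ / (n + 1) / 2, rOut := δ / (n + 1), rIn_pos := by positivity
      rIn_lt_rOut := by
        have : 0 < δ / (n + 1) := by positivity
        linarith }
  set ρ : ℕ → E → ℝ := fun n => (φ n).normed volume with hρ
  have hρsm : ∀ n, ContDiff ℝ ∞ (ρ n) := fun n => (φ n).contDiff_normed
  have hρc : ∀ n, HasCompactSupport (ρ n) := fun n => (φ n).hasCompactSupport_normed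
  have hrO : ∀ n, (φ n).rOut = δ / (n + 1) := fun n => rfl
  have hlim : Tendsto (fun n : ℕ => δ / ((n : ℝ) + 1)) atTop (𝓝 0) := by
    simpa [div_eq_mul_inv] using tendsto_one_div_add_atTop_nhds_zero_nat.const_mul δ
  have hconv : ∀ {a : E → ℝ}, MemLp a p volume →
      Tendsto (fun n => eLpNorm (fun x => (∫ t, ρ n t * a (x - t)) - a x) p volume)
        atTop (𝓝 0) := by
    intro a ha
    rw [ENNReal.tendsto_nhds_zero]
    intro ε hε
    have h1 := (ENNReal.tendsto_nhds_zero.1 (tendsto_eLpNorm_translate_sub hp ha)) ε hε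
    obtain ⟨r, hr, hrb⟩ := Metric.eventually_nhds_iff.1 h1
    filter_upwards [hlim.eventually (gt_mem_nhds hr)] with n hn
    refine eLpNorm_mollify_sub_le hp ha (hρsm n).continuous (hρc n) (fun t => (φ n).nonneg_normed t)
      (φ n).integral_normed fun t ht => hrb ?_
    have : t ∈ Function.support (ρ n) := ht
    rw [(φ n).support_normed_eq] at this
    exact (Metric.mem_ball.1 this).trans hn
  have hswap : ∀ (n : ℕ) (a : E → ℝ) (x : E), ∫ t, ρ n t * a (x - t) = ∫ t, a t * ρ n (x - t) :=
    fun n a x => by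
      rw [← integral_sub_left_eq_self (fun t => a t * ρ n (x - t)) volume x]
      simp [mul_comm]
  have hloc : LocallyIntegrable (K'.indicator u) volume := (hm hu).locallyIntegrable Fact.out
  refine ⟨fun n x => ∫ t, K'.indicator u t * ρ n (x - t), fun n => ?_, ?_, ?_⟩
  · exact (hρc n).contDiff_convolution_right (ContinuousLinearMap.mul ℝ ℝ) hloc (hρsm n)
  · refine tendsto_of_tendsto_of_tendsto_of_le_of_le tendsto_const_nhds (hconv (hm hu))
      (fun _ => zero_le) fun n => ?_
    refine le_trans (le_of_eq (eLpNorm_congr_ae ?_)) (eLpNorm_restrict_le _ _ _ K)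
    filter_upwards [ae_restrict_mem hK.measurableSet] with x hx
    have : x ∈ K' := Metric.self_subset_cthickening K hx
    simp [hswap, indicator_of_mem this]
  · refine tendsto_of_tendsto_of_tendsto_of_le_of_le tendsto_const_nhds (hconv (hm hg))
      (fun _ => zero_le) fun n => ?_
    refine le_trans (le_of_eq (eLpNorm_congr_ae ?_)) (eLpNorm_restrict_le _ _ _ K)
    filter_upwards [ae_restrict_mem hK.measurableSet] with x hx
    have hxK' : x ∈ K' := Metric.self_subset_cthickening K hx
    have hd := (hρc n).hasFDerivAt_convolution_right (ContinuousLinearMap.mul ℝ ℝ) hloc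
      ((hρsm n).of_le (by simp)) x
    have hd' : fderiv ℝ (fun x => ∫ t, K'.indicator u t * ρ n (x - t)) x e
        = ∫ t, K'.indicator u t * fderiv ℝ (ρ n) (x - t) e := by
      have := congrArg (fun L => L e) hd.fderiv
      rw [convolution_precompR_apply _ hloc ((hρc n).fderiv ℝ)
        ((hρsm n).continuous_fderiv (by simp))] at this
      exact this
    -- the translated reflected mollifier is a test function in `U`
    set ψ : E → ℝ := fun t => ρ n (x - t) with hψ
    have hψs : ContDiff ℝ ∞ ψ := (hρsm n).comp (contDiff_const.sub contDiff_id)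
    have hψc : HasCompactSupport ψ := (hρc n).comp_homeomorph (Homeomorph.subLeft x)
    have hψK : tsupport ψ ⊆ K' := by
      refine closure_minimal (fun t ht => ?_) hK'c.isClosed
      have h1 : x - t ∈ Function.support (ρ n) := ht
      rw [(φ n).support_normed_eq, mem_ball_zero_iff, hrO] at h1
      refine Metric.mem_cthickening_of_dist_le t x δ K hx ?_
      rw [dist_comm, dist_eq_norm]
      refine h1.le.trans (div_le_self hδ.le ?_)
      simp
    have hψd : ∀ t, fderiv ℝ ψ t e = - fderiv ℝ (ρ n) (x - t) e := fun t => by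
      have h1 : HasFDerivAt (fun t => x - t) (-(ContinuousLinearMap.id ℝ E)) t := by
        simpa using (hasFDerivAt_id t).const_sub x
      have h2 := (((hρsm n).differentiable (by simp) (x - t)).hasFDerivAt.comp t h1).fderiv
      have h3 : fderiv ℝ ψ t = _ := h2
      rw [h3]; simp
    have hweak := h.integral_eq hψs hψc (hψK.trans hδU)
    rw [hd', hswap, indicator_of_mem hxK']
    congr 1
    have e1 : ∀ t, K'.indicator u t * fderiv ℝ (ρ n) (x - t) e = - (u t * fderiv ℝ ψ t e) :=
      fun t => by
        rw [hψd]
        by_cases ht : t ∈ K'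
        · rw [indicator_of_mem ht]; ring
        · have h0 : fderiv ℝ ψ t e = 0 := fderiv_apply_eq_zero_of_eventuallyEq
            (notMem_tsupport_iff_eventuallyEq.1 fun h => ht (hψK h))
          rw [hψd] at h0
          rw [indicator_of_notMem ht, h0]; simp
    have e2 : ∀ t, K'.indicator g t * ρ n (x - t) = g t * ψ t := fun t => by
      by_cases ht : t ∈ K'
      · rw [indicator_of_mem ht]
      · have h0 : ψ t = 0 := image_eq_zero_of_notMem_tsupport fun h => ht (hψK h)
        rw [indicator_of_notMem ht, h0]; simp
    simp only [e1, e2]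
    rw [integral_neg, hweak, neg_neg]

end Mollification

/-! ### Product and chain rules -/

section ProductChain

lemma tendsto_integral_mul_of_eLpNorm {α ι : Type*} [MeasurableSpace α] {μ : Measure α}
    {p q : ℝ≥0∞} [ENNReal.HolderTriple q p 1] {a u : α → ℝ} {w : ι → α → ℝ} {l : Filter ι}
    (ha : MemLp a q μ) (hu : MemLp u p μ) (hw : ∀ n, MemLp (w n) p μ)
    (h : Tendsto (fun n => eLpNorm (fun x => w n x - u x) p μ) l (𝓝 0)) :
    Tendsto (fun n => ∫ x, a x * w n x ∂μ) l (𝓝 (∫ x, a x * u x ∂μ)) := by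
  refine tendsto_integral_of_L1' _ (ha.integrable_mul hu).1
    (Eventually.of_forall fun n => ha.integrable_mul (hw n)) ?_
  have h2 := ENNReal.Tendsto.const_mul h (a := eLpNorm a q μ) (Or.inr ha.2.ne)
  rw [mul_zero] at h2
  refine tendsto_of_tendsto_of_tendsto_of_le_of_le tendsto_const_nhds h2 (fun _ => zero_le)
    fun n => ?_
  have := eLpNorm_smul_le_mul_eLpNorm (p := q) (q := p) (r := 1) ((hw n).1.sub hu.1) ha.1
  refine le_trans (le_of_eq (congrArg (fun F => eLpNorm F 1 μ) (funext fun x => ?_))) this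
  simp [mul_sub]

variable {E : Type*} [NormedAddCommGroup E] [NormedSpace ℝ E] [FiniteDimensional ℝ E]
  [MeasureSpace E] [BorelSpace E] [(volume : Measure E).IsAddHaarMeasure]
  {U : Set E} {e : E} {u v g k : E → ℝ} {p : ℝ≥0∞}

lemma memLp_restrict_of_continuous {K : Set E} (hK : IsCompact K) {a : E → ℝ} (ha : Continuous a) :
    MemLp a p (volume.restrict K) := by
  obtain ⟨C, hC⟩ := hK.exists_bound_of_continuousOn ha.continuousOn
  have : IsFiniteMeasure (volume.restrict K) := ⟨by simpa using hK.measure_lt_top⟩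
  exact MemLp.of_bound ha.aestronglyMeasurable C
    ((ae_restrict_iff' hK.measurableSet).2 (Eventually.of_forall hC))

lemma MemLpLoc.add (h : MemLpLoc p U u) (h' : MemLpLoc p U v) :
    MemLpLoc p U (fun q => u q + v q) := fun K hK hKU => (h K hK hKU).add (h' K hK hKU)

lemma MemLpLoc.mul {r s : ℝ≥0∞} [ENNReal.HolderTriple p r s] (h : MemLpLoc p U u)
    (h' : MemLpLoc r U v) : MemLpLoc s U (fun q => u q * v q) :=
  fun K hK hKU => (h' K hK hKU).mul' (h K hK hKU)

lemma MemLpLoc.of_le {r : ℝ≥0∞} (h : MemLpLoc p U u) (hr : r ≤ p) : MemLpLoc r U u := by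
  intro K hK hKU
  have : IsFiniteMeasure (volume.restrict K) := ⟨by simpa using hK.measure_lt_top⟩
  exact (h K hK hKU).mono_exponent hr

lemma locallyIntegrableOn_iff_memLpLoc (hU : IsOpen U) :
    LocallyIntegrableOn u U volume ↔ MemLpLoc 1 U u := by
  rw [locallyIntegrableOn_iff hU.isLocallyClosed]
  exact ⟨fun h K hK hKU => memLp_one_iff_integrable.2 (h K hKU hK),
    fun h K hKU hK => memLp_one_iff_integrable.1 (h K hK hKU)⟩

/-- **Product rule** for weak derivatives, for locally integrable functions to conjugate
exponents. -/
theorem HasWeakDeriv.mul_of_holder {r : ℝ≥0∞} [Fact (1 ≤ p)] [ENNReal.HolderTriple p r 1]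
    [ENNReal.HolderTriple r p 1] (hp : p ≠ ⊤) (hU : IsOpen U) (hu : HasWeakDeriv U e u g)
    (hv : HasWeakDeriv U e v k) (u2 : MemLpLoc p U u) (g2 : MemLpLoc p U g) (v2 : MemLpLoc r U v)
    (k2 : MemLpLoc r U k) :
    HasWeakDeriv U e (fun q => u q * v q) (fun q => u q * k q + g q * v q) := by
  refine .of_integral_eq ((locallyIntegrableOn_iff_memLpLoc hU).2 (u2.mul v2))
    ((locallyIntegrableOn_iff_memLpLoc hU).2 ((u2.mul k2).add (g2.mul v2))) fun φ h1 h2 h3 => ?_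
  set K := tsupport φ with hKdef
  have hK : IsCompact K := h2
  obtain ⟨w, hw, hwu, hwg⟩ := hu.exists_smooth_approx (p := p) hp hU hK h3 u2 g2
  have hφd : Continuous fun q => fderiv ℝ φ q e :=
    (h1.continuous_fderiv (by simp)).clm_apply continuous_const
  have hwd : ∀ n, Continuous fun q => fderiv ℝ (w n) q e := fun n =>
    ((hw n).continuous_fderiv (by simp)).clm_apply continuous_const
  have hF : ∀ F : E → ℝ, (∀ q, φ =ᶠ[𝓝 q] 0 → F q = 0) → ∫ q, F q = ∫ q in K, F q := fun F hF =>
    (setIntegral_eq_of_tsupport_subset (U := K) (φ := φ) subset_rfl hF).symm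
  have vφd : MemLp (fun q => v q * fderiv ℝ φ q e) r (volume.restrict K) :=
    MemLp.mul' (p := r) (q := ⊤) (memLp_restrict_of_continuous hK hφd) (v2 K hK h3)
  have vφ : MemLp (fun q => v q * φ q) r (volume.restrict K) :=
    MemLp.mul' (p := r) (q := ⊤) (memLp_restrict_of_continuous hK h1.continuous) (v2 K hK h3)
  have kφ : MemLp (fun q => k q * φ q) r (volume.restrict K) :=
    MemLp.mul' (p := r) (q := ⊤) (memLp_restrict_of_continuous hK h1.continuous) (k2 K hK h3)
  have wm : ∀ n, MemLp (w n) p (volume.restrict K) := fun n =>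
    memLp_restrict_of_continuous hK (hw n).continuous
  have wdm : ∀ n, MemLp (fun q => fderiv ℝ (w n) q e) p (volume.restrict K) := fun n =>
    memLp_restrict_of_continuous hK (hwd n)
  have key : ∀ n, ∫ q in K, (v q * fderiv ℝ φ q e) * w n q
      = - (∫ q in K, (k q * φ q) * w n q) - ∫ q in K, (v q * φ q) * fderiv ℝ (w n) q e := by
    intro n
    have hs : ContDiff ℝ ∞ (fun q => w n q * φ q) := (hw n).mul h1
    have hts : tsupport (fun q => w n q * φ q) ⊆ K := tsupport_mul_subset_right
    have hd : ∀ q, fderiv ℝ (fun q => w n q * φ q) q e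
        = w n q * fderiv ℝ φ q e + φ q * fderiv ℝ (w n) q e := fun q => by
      rw [fderiv_fun_mul ((hw n).differentiable (by simp) q) (h1.differentiable (by simp) q)]
      simp
    have := hv.integral_eq hs h2.mul_left (hts.trans h3)
    simp only [hd] at this
    rw [hF, hF] at this
    · have i1 : IntegrableOn (fun q => (v q * fderiv ℝ φ q e) * w n q) K := vφd.integrable_mul (wm n)
      have i2 : IntegrableOn (fun q => (v q * φ q) * fderiv ℝ (w n) q e) K :=
        vφ.integrable_mul (wdm n)
      have e1 : ∫ q in K, v q * (w n q * fderiv ℝ φ q e + φ q * fderiv ℝ (w n) q e)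
          = (∫ q in K, (v q * fderiv ℝ φ q e) * w n q)
            + ∫ q in K, (v q * φ q) * fderiv ℝ (w n) q e := by
        rw [← integral_add i1 i2]
        exact integral_congr_ae (Eventually.of_forall fun q => by ring)
      have e2 : ∫ q in K, k q * (w n q * φ q) = ∫ q in K, (k q * φ q) * w n q :=
        integral_congr_ae (Eventually.of_forall fun q => by ring)
      rw [e1, e2] at this
      linarith
    · intro q hq; simp [hq.eq_of_nhds]
    · intro q hq; simp [hq.eq_of_nhds, fderiv_apply_eq_zero_of_eventuallyEq hq]
  have t1 := tendsto_integral_mul_of_eLpNorm vφd (u2 K hK h3) wm hwu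
  have t2 := tendsto_integral_mul_of_eLpNorm kφ (u2 K hK h3) wm hwu
  have t3 := tendsto_integral_mul_of_eLpNorm vφ (g2 K hK h3) wdm hwg
  simp only [key] at t1
  have := tendsto_nhds_unique t1 (t2.neg.sub t3)
  rw [hF, hF]
  · have e1 : ∫ q in K, u q * v q * fderiv ℝ φ q e = ∫ q in K, (v q * fderiv ℝ φ q e) * u q :=
      integral_congr_ae (Eventually.of_forall fun q => by ring)
    have e2 : ∫ q in K, (u q * k q + g q * v q) * φ q
        = (∫ q in K, (k q * φ q) * u q) + ∫ q in K, (v q * φ q) * g q := by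
      have i1 : IntegrableOn (fun q => (k q * φ q) * u q) K := kφ.integrable_mul (u2 K hK h3)
      have i2 : IntegrableOn (fun q => (v q * φ q) * g q) K := vφ.integrable_mul (g2 K hK h3)
      rw [← integral_add i1 i2]
      exact integral_congr_ae (Eventually.of_forall fun q => by ring)
    rw [e1, e2, this]; ring
  · intro q hq; simp [hq.eq_of_nhds]
  · intro q hq; simp [fderiv_apply_eq_zero_of_eventuallyEq hq]

/-- **Product rule** for weak derivatives of functions that are locally square integrable. -/
theorem HasWeakDeriv.mul (hU : IsOpen U) (hu : HasWeakDeriv U e u g) (hv : HasWeakDeriv U e v k)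
    (u2 : MemLpLoc 2 U u) (g2 : MemLpLoc 2 U g) (v2 : MemLpLoc 2 U v) (k2 : MemLpLoc 2 U k) :
    HasWeakDeriv U e (fun q => u q * v q) (fun q => u q * k q + g q * v q) :=
  hu.mul_of_holder (by simp) hU hv u2 g2 v2 k2

lemma MemLpLoc.comp_of_deriv_le {F : ℝ → ℝ} (hF : ContDiff ℝ 1 F) {C : ℝ}
    (hC : ∀ s, ‖deriv F s‖ ≤ C) (hu : MemLpLoc p U u) : MemLpLoc p U (fun q => F (u q)) := by
  intro K hK hKU
  have : IsFiniteMeasure (volume.restrict K) := ⟨by simpa using hK.measure_lt_top⟩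
  have h0 : ∀ s : ℝ, ‖F s - F 0‖ ≤ C * ‖s‖ := fun s => by
    simpa using Convex.norm_image_sub_le_of_norm_deriv_le (s := univ) (x := 0) (y := s)
      (fun x _ => hF.differentiable one_ne_zero x) (fun x _ => hC x) convex_univ trivial trivial
  have h1 : MemLp (fun q => F (u q) - F 0) p (volume.restrict K) :=
    MemLp.of_le_mul (hu K hK hKU)
      ((hF.continuous.comp_aestronglyMeasurable (hu K hK hKU).1).sub aestronglyMeasurable_const)
      (Eventually.of_forall fun q => h0 (u q))
  refine (h1.add (memLp_const (F 0))).ae_eq (Eventually.of_forall fun q => ?_)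
  simp

/-- **Chain rule** for the composition of a `C¹` function of bounded derivative with a weakly
differentiable function. -/
theorem HasWeakDeriv.comp_contDiff (hU : IsOpen U) {F : ℝ → ℝ} (hF : ContDiff ℝ 1 F) {C : ℝ}
    (hC : ∀ s, ‖deriv F s‖ ≤ C) (hu : HasWeakDeriv U e u g) :
    HasWeakDeriv U e (fun q => F (u q)) (fun q => deriv F (u q) * g q) := by
  have u1 := (locallyIntegrableOn_iff_memLpLoc hU).1 hu.1
  have g1 := (locallyIntegrableOn_iff_memLpLoc hU).1 hu.2.1
  have hF'c : Continuous (deriv F) := hF.continuous_deriv le_rfl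
  have hF'm : ∀ K, IsCompact K → K ⊆ U → MemLp (fun q => deriv F (u q)) ⊤ (volume.restrict K) :=
    fun K hK hKU => memLp_top_of_bound (hF'c.comp_aestronglyMeasurable (u1 K hK hKU).1) C
      (Eventually.of_forall fun q => hC (u q))
  have hF'l : MemLpLoc ⊤ U (fun q => deriv F (u q)) := hF'm
  refine .of_integral_eq ((locallyIntegrableOn_iff_memLpLoc hU).2 (u1.comp_of_deriv_le hF hC))
    ((locallyIntegrableOn_iff_memLpLoc hU).2 (hF'l.mul g1)) fun φ h1 h2 h3 => ?_
  set K := tsupport φ with hKdef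
  have hK : IsCompact K := h2
  obtain ⟨w, hw, hwu, hwg⟩ := hu.exists_smooth_approx (p := 1) (by simp) hU hK h3 u1 g1
  have hF0 : ∀ H : E → ℝ, (∀ q, φ =ᶠ[𝓝 q] 0 → H q = 0) → ∫ q, H q = ∫ q in K, H q := fun H hH =>
    (setIntegral_eq_of_tsupport_subset (U := K) (φ := φ) subset_rfl hH).symm
  have hφd : Continuous fun q => fderiv ℝ φ q e :=
    (h1.continuous_fderiv (by simp)).clm_apply continuous_const
  have hwd : ∀ n, Continuous fun q => fderiv ℝ (w n) q e := fun n =>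
    ((hw n).continuous_fderiv (by simp)).clm_apply continuous_const
  have wm : ∀ n, MemLp (w n) 1 (volume.restrict K) := fun n =>
    memLp_restrict_of_continuous hK (hw n).continuous
  have wdm : ∀ n, MemLp (fun q => fderiv ℝ (w n) q e) 1 (volume.restrict K) := fun n =>
    memLp_restrict_of_continuous hK (hwd n)
  -- along a subsequence the approximations converge almost everywhere
  obtain ⟨ns, hns, hae⟩ := (tendstoInMeasure_of_tendsto_eLpNorm (p := 1) one_ne_zero
    (fun n => (wm n).1) (u1 K hK h3).1 hwu).exists_seq_tendsto_ae
  have hwu' := hwu.comp hns.tendsto_atTop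
  have hwg' := hwg.comp hns.tendsto_atTop
  have φm : MemLp φ ⊤ (volume.restrict K) := memLp_restrict_of_continuous hK h1.continuous
  have φdm : MemLp (fun q => fderiv ℝ φ q e) ⊤ (volume.restrict K) :=
    memLp_restrict_of_continuous hK hφd
  have hlip : ∀ s t, ‖F s - F t‖ ≤ C * ‖s - t‖ := fun s t =>
    Convex.norm_image_sub_le_of_norm_deriv_le (s := univ) (x := t) (y := s)
      (fun x _ => hF.differentiable one_ne_zero x) (fun x _ => hC x) convex_univ trivial trivial
  have key : ∀ n, ∫ q in K, fderiv ℝ φ q e * F (w n q)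
      = - (∫ q in K, φ q * (deriv F (w n q) * (fderiv ℝ (w n) q e - g q)))
        - ∫ q in K, φ q * (deriv F (w n q) * g q) := by
    intro n
    have hs : ContDiff ℝ 1 (fun q => F (w n q)) := hF.comp ((hw n).of_le (by simp))
    have hd : ∀ q, fderiv ℝ (fun q => F (w n q)) q e = deriv F (w n q) * fderiv ℝ (w n) q e :=
      fun q => by
        have := ((hF.differentiable one_ne_zero (w n q)).hasDerivAt.comp_hasFDerivAt q
          ((hw n).differentiable (by simp) q).hasFDerivAt).fderiv
        have h' : fderiv ℝ (fun q => F (w n q)) q = _ := this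
        rw [h']; simp
    have := (hasWeakDeriv_of_contDiff (U := U) (e := e) hs).integral_eq h1 h2 h3
    simp only [hd] at this
    rw [hF0, hF0] at this
    · have b1 : MemLp (fun q => deriv F (w n q)) ⊤ (volume.restrict K) :=
        memLp_restrict_of_continuous hK (hF'c.comp (hw n).continuous)
      have d1 : MemLp (fun q => fderiv ℝ (w n) q e - g q) 1 (volume.restrict K) :=
        (wdm n).sub (g1 K hK h3)
      have i1 : Integrable (fun q => φ q * (deriv F (w n q) * (fderiv ℝ (w n) q e - g q)))
          (volume.restrict K) := memLp_one_iff_integrable.1 ((d1.mul' (r := 1) b1).mul' φm)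
      have i2 : Integrable (fun q => φ q * (deriv F (w n q) * g q)) (volume.restrict K) :=
        memLp_one_iff_integrable.1 (((g1 K hK h3).mul' (r := 1) b1).mul' φm)
      have e1 : ∫ q in K, fderiv ℝ φ q e * F (w n q) = ∫ q in K, F (w n q) * fderiv ℝ φ q e := by
        simp only [mul_comm]
      have e2 : ∫ q in K, deriv F (w n q) * fderiv ℝ (w n) q e * φ q
          = (∫ q in K, φ q * (deriv F (w n q) * (fderiv ℝ (w n) q e - g q)))
            + ∫ q in K, φ q * (deriv F (w n q) * g q) := by
        rw [← integral_add i1 i2]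
        exact integral_congr_ae (Eventually.of_forall fun q => by ring)
      rw [e1, this, e2]; ring
    · intro q hq; simp [hq.eq_of_nhds]
    · intro q hq; simp [fderiv_apply_eq_zero_of_eventuallyEq hq]
  have t1 : Tendsto (fun n => ∫ q in K, fderiv ℝ φ q e * F (w (ns n) q)) atTop
      (𝓝 (∫ q in K, fderiv ℝ φ q e * F (u q))) := by
    refine tendsto_integral_mul_of_eLpNorm (p := 1) φdm (u1.comp_of_deriv_le hF hC K hK h3)
      (fun n => memLp_restrict_of_continuous hK (hF.continuous.comp (hw _).continuous)) ?_
    have h0 := ENNReal.Tendsto.const_mul hwu' (a := ENNReal.ofReal C) (Or.inr (by simp))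
    rw [mul_zero] at h0
    refine tendsto_of_tendsto_of_tendsto_of_le_of_le tendsto_const_nhds h0 (fun _ => zero_le)
      fun n => ?_
    exact eLpNorm_le_mul_eLpNorm_of_ae_le_mul (Eventually.of_forall fun q => hlip _ _) 1
  have t2 : Tendsto (fun n => ∫ q in K, φ q * (deriv F (w (ns n) q)
      * (fderiv ℝ (w (ns n)) q e - g q))) atTop (𝓝 (∫ q in K, φ q * 0)) := by
    refine tendsto_integral_mul_of_eLpNorm (p := 1) φm MemLp.zero' (fun n => ?_) ?_
    · exact MemLp.mul' (p := ⊤) (q := 1) ((wdm _).sub (g1 K hK h3))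
        (memLp_restrict_of_continuous hK (hF'c.comp (hw _).continuous))
    have h0 := ENNReal.Tendsto.const_mul hwg' (a := ENNReal.ofReal C) (Or.inr (by simp))
    rw [mul_zero] at h0
    refine tendsto_of_tendsto_of_tendsto_of_le_of_le tendsto_const_nhds h0 (fun _ => zero_le)
      fun n => ?_
    refine eLpNorm_le_mul_eLpNorm_of_ae_le_mul (Eventually.of_forall fun q => ?_) 1
    rw [sub_zero, norm_mul]
    exact mul_le_mul_of_nonneg_right (hC _) (norm_nonneg _)
  have t3 : Tendsto (fun n => ∫ q in K, φ q * (deriv F (w (ns n) q) * g q)) atTop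
      (𝓝 (∫ q in K, φ q * (deriv F (u q) * g q))) := by
    obtain ⟨B, hB⟩ := hK.exists_bound_of_continuousOn h1.continuous.continuousOn
    have gi : Integrable (fun q => B * (C * ‖g q‖)) (volume.restrict K) :=
      ((memLp_one_iff_integrable.1 (g1 K hK h3)).norm.const_mul C).const_mul B
    refine tendsto_integral_of_dominated_convergence _ (fun n => ?_) gi (fun n => ?_) ?_
    · exact h1.continuous.aestronglyMeasurable.mul
        ((hF'c.comp (hw _).continuous).aestronglyMeasurable.mul (g1 K hK h3).1)
    · rw [ae_restrict_iff' hK.measurableSet]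
      refine Eventually.of_forall fun q hq => ?_
      rw [norm_mul, norm_mul]
      exact mul_le_mul (hB q hq) (mul_le_mul_of_nonneg_right (hC _) (norm_nonneg _))
        (by positivity) ((norm_nonneg _).trans (hB q hq))
    · filter_upwards [hae] with q hq
      exact ((hF'c.tendsto _).comp hq |>.mul_const _).const_mul _
  simp only [key] at t1
  have := tendsto_nhds_unique t1 (t2.neg.sub t3)
  rw [hF0, hF0]
  · have e1 : ∫ q in K, F (u q) * fderiv ℝ φ q e = ∫ q in K, fderiv ℝ φ q e * F (u q) := by
      simp only [mul_comm]
    rw [e1, this]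
    simp only [mul_zero, integral_zero, neg_zero, zero_sub]
    congr 1
    exact integral_congr_ae (Eventually.of_forall fun q => by ring)
  · intro q hq; simp [hq.eq_of_nhds]
  · intro q hq; simp [fderiv_apply_eq_zero_of_eventuallyEq hq]

end ProductChain

/-! ### Periodic functions and integration over a period cell -/

section Translation

variable {E : Type*} [NormedAddCommGroup E] [NormedSpace ℝ E] [FiniteDimensional ℝ E]
  [MeasureSpace E] [BorelSpace E] [(volume : Measure E).IsAddHaarMeasure]
  {U : Set E} {e : E} {u v g k : E → ℝ} {p : ℝ≥0∞}

lemma MemLpLoc.comp_add_right (a : E) (hUa : ∀ q, q + a ∈ U ↔ q ∈ U) (h : MemLpLoc p U u) :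
    MemLpLoc p U (fun q => u (q + a)) := by
  intro K hK hKU
  have hK' : IsCompact ((fun q => q + a) '' K) := hK.image (by fun_prop)
  have hs : (fun q => q + a) '' K ⊆ U := by
    rintro _ ⟨q, hq, rfl⟩
    exact (hUa q).2 (hKU hq)
  have := (h _ hK' hs).comp_measurePreserving
    ((measurePreserving_add_right volume a).restrict_preimage hK'.measurableSet)
  rwa [preimage_image_eq _ (add_left_injective a)] at this

theorem HasWeakDeriv.comp_add_right (hU : IsOpen U) (a : E) (hUa : ∀ q, q + a ∈ U ↔ q ∈ U)
    (h : HasWeakDeriv U e u g) :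
    HasWeakDeriv U e (fun q => u (q + a)) (fun q => g (q + a)) := by
  refine .of_integral_eq
    ((locallyIntegrableOn_iff_memLpLoc hU).2
      (((locallyIntegrableOn_iff_memLpLoc hU).1 h.1).comp_add_right a hUa))
    ((locallyIntegrableOn_iff_memLpLoc hU).2
      (((locallyIntegrableOn_iff_memLpLoc hU).1 h.2.1).comp_add_right a hUa))
    fun φ h1 h2 h3 => ?_
  have hs : tsupport (fun q => φ (q - a)) ⊆ U := by
    have : tsupport (fun q => φ (q - a)) = (fun q => q - a) ⁻¹' tsupport φ :=
      tsupport_comp_eq_preimage φ (Homeomorph.subRight a)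
    rw [this]
    intro q hq
    have := (hUa (q - a)).2 (h3 hq)
    simpa using this
  have := h.integral_eq (φ := fun q => φ (q - a)) (h1.comp (contDiff_id.sub contDiff_const))
    (h2.comp_homeomorph (Homeomorph.subRight a)) hs
  rw [← integral_add_right_eq_self _ a, ← integral_add_right_eq_self (fun q => g q * φ (q - a)) a]
    at this
  simpa [fderiv_comp_sub] using this

end Translation

section Periodic

variable {F : Type*} [NormedAddCommGroup F] [NormedSpace ℝ F] [FiniteDimensional ℝ F]
  [MeasureSpace F] [BorelSpace F] [(volume : Measure F).IsAddHaarMeasure]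
  {U : Set (ℝ × F)} {e : ℝ × F} {u v g k : ℝ × F → ℝ} {p : ℝ≥0∞}

instance isAddHaarMeasure_volume_prod : (volume : Measure (ℝ × F)).IsAddHaarMeasure :=
  inferInstanceAs ((volume : Measure ℝ).prod (volume : Measure F)).IsAddHaarMeasure

/-- `U` is invariant under translation by one period in its first coordinate. -/
def IsXPeriodic (U : Set (ℝ × F)) : Prop := ∀ q : ℝ × F, q + (1, 0) ∈ U ↔ q ∈ U

/-- `u` is periodic of period one in its first coordinate, almost everywhere on `U`. -/
def AEPeriodic (U : Set (ℝ × F)) (u : ℝ × F → ℝ) : Prop :=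
  ∀ᵐ q ∂volume.restrict U, u (q + (1, 0)) = u q

/-- The part of `U` over the open period starting at `a`. -/
def xCell (U : Set (ℝ × F)) (a : ℝ) : Set (ℝ × F) := U ∩ {q | q.1 ∈ Ioo a (a + 1)}

lemma measurableSet_xCell (hU : MeasurableSet U) (a : ℝ) : MeasurableSet (xCell U a) :=
  hU.inter (measurable_fst measurableSet_Ioo)

theorem HasWeakDeriv.aePeriodic (hU : IsOpen U) (hper : IsXPeriodic U) (h : HasWeakDeriv U e u g)
    (hu : AEPeriodic U u) : AEPeriodic U g :=
  ((h.comp_add_right hU (1, 0) hper).congr hu (Eventually.of_forall fun _ => rfl)).unique hU h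

lemma AEPeriodic.mul (hu : AEPeriodic U u) (hv : AEPeriodic U v) :
    AEPeriodic U (fun q => u q * v q) := by
  filter_upwards [hu, hv] with q h1 h2
  rw [h1, h2]

lemma AEPeriodic.add (hu : AEPeriodic U u) (hv : AEPeriodic U v) :
    AEPeriodic U (fun q => u q + v q) := by
  filter_upwards [hu, hv] with q h1 h2
  rw [h1, h2]

lemma AEPeriodic.comp (hu : AEPeriodic U u) (G : ℝ → ℝ) : AEPeriodic U (fun q => G (u q)) := by
  filter_upwards [hu] with q h1
  rw [h1]

lemma measurePreserving_xCell (hU : MeasurableSet U) (hper : IsXPeriodic U) (a : ℝ) :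
    MeasurePreserving (fun q : ℝ × F => q + (1, 0)) (volume.restrict (xCell U a))
      (volume.restrict (xCell U (a + 1))) := by
  have := (measurePreserving_add_right (volume : Measure (ℝ × F)) (1, 0)).restrict_preimage
    (measurableSet_xCell hU (a + 1))
  have he : (fun q : ℝ × F => q + (1, 0)) ⁻¹' (xCell U (a + 1)) = xCell U a := by
    ext q
    simp only [xCell, mem_preimage, mem_inter_iff, mem_ofPred_eq, hper q, Prod.fst_add, mem_Ioo,
      add_lt_add_iff_right]
  rwa [he] at this

lemma AEPeriodic.memLp_xCell_iff (hU : MeasurableSet U) (hper : IsXPeriodic U)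
    (hu : AEPeriodic U u) (a : ℝ) :
    MemLp u p (volume.restrict (xCell U (a + 1))) ↔ MemLp u p (volume.restrict (xCell U a)) := by
  have hmp := measurePreserving_xCell hU hper a
  have hemb : MeasurableEmbedding (fun q : ℝ × F => q + (1, 0)) :=
    (Homeomorph.addRight ((1, 0) : ℝ × F)).measurableEmbedding
  have h1 : MemLp u p (volume.restrict (xCell U (a + 1)))
      ↔ MemLp (fun q => u (q + (1, 0))) p (volume.restrict (xCell U a)) := by
    rw [← hmp.map_eq]
    exact hemb.memLp_map_measure_iff
  rw [h1]
  exact memLp_congr_ae (ae_mono (Measure.restrict_mono inter_subset_left le_rfl) hu)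

lemma AEPeriodic.memLp_xCell (hU : MeasurableSet U) (hper : IsXPeriodic U) (hu : AEPeriodic U u)
    (h : MemLp u p (volume.restrict (xCell U 0))) (m : ℤ) :
    MemLp u p (volume.restrict (xCell U m)) := by
  induction m using Int.induction_on with
  | zero => simpa using h
  | succ i ih => simpa using (hu.memLp_xCell_iff hU hper (i : ℝ)).2 (by simpa using ih)
  | pred i ih =>
    have := (hu.memLp_xCell_iff (p := p) hU hper (-(i : ℝ) - 1)).1
    simp only [sub_add_cancel] at this
    simpa using this (by simpa using ih)

lemma ae_fst_notMem_range_intCast :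
    ∀ᵐ q : ℝ × F ∂(volume : Measure (ℝ × F)), q.1 ∉ range ((↑) : ℤ → ℝ) :=
  (Measure.quasiMeasurePreserving_fst (μ := (volume : Measure ℝ))
    (ν := (volume : Measure F))).ae (measure_eq_zero_iff_ae_notMem.1
      ((countable_range _).measure_zero _))

/-- A periodic function that lies in `L^p` of one period cell lies in `L^p` of every compact
subset. -/
theorem AEPeriodic.memLpLoc (hU : MeasurableSet U) (hper : IsXPeriodic U) (hu : AEPeriodic U u)
    (h : MemLp u p (volume.restrict (xCell U 0))) : MemLpLoc p U u := by
  intro K hK hKU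
  obtain ⟨C, hC⟩ := (hK.image continuous_fst).isBounded.subset_closedBall 0
  set N : ℤ := ⌈C⌉ + 1 with hN
  have hsum : MemLp (fun q => ∑ m ∈ Finset.Icc (-N) N, (xCell U m).indicator u q) p volume :=
    memLp_finsetSum _ fun m _ =>
      (memLp_indicator_iff_restrict (measurableSet_xCell hU m)).2 (hu.memLp_xCell hU hper h m)
  refine (hsum.restrict K).ae_eq ?_
  filter_upwards [ae_restrict_mem hK.measurableSet, ae_restrict_of_ae ae_fst_notMem_range_intCast]
    with q hq hqZ
  have hq1 : |q.1| ≤ C := by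
    have := hC (mem_image_of_mem _ hq)
    simpa using this
  obtain ⟨hq2, hq3⟩ := abs_le.1 hq1
  have hfl : (⌊q.1⌋ : ℝ) < q.1 :=
    lt_of_le_of_ne (Int.floor_le _) fun hne => hqZ ⟨_, hne⟩
  rw [Finset.sum_eq_single ⌊q.1⌋]
  · rw [indicator_of_mem]
    exact ⟨hKU hq, hfl, Int.lt_floor_add_one _⟩
  · intro m _ hm
    refine indicator_of_notMem (fun hmem => hm ?_) _
    exact (Int.floor_eq_iff.2 ⟨hmem.2.1.le, hmem.2.2⟩).symm
  · intro hnot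
    exfalso
    refine hnot (Finset.mem_Icc.2 ⟨?_, ?_⟩)
    · rw [Int.le_floor]; push_cast [hN]; linarith [Int.le_ceil C]
    · have : (⌊q.1⌋ : ℝ) ≤ N := by push_cast [hN]; linarith [Int.le_ceil C]
      exact_mod_cast this

/-- Unfolding: integrating a periodic function against a function of the first coordinate supported
in two periods is integrating over one cell against the sum of its translates. -/
lemma integral_mul_of_support_subset (hU : MeasurableSet U) (hper : IsXPeriodic U) {H : ℝ × F → ℝ}
    (hH : AEPeriodic U H) (hHi : IntegrableOn H (xCell U 0)) {c : ℝ → ℝ} (hc : Continuous c)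
    (hc0 : ∀ x, x ∉ Ioo (0 : ℝ) 2 → c x = 0) :
    ∫ q in U, c q.1 * H q = ∫ q in xCell U 0, (c q.1 + c (q.1 + 1)) * H q := by
  have hHi1 : IntegrableOn H (xCell U 1) := by
    have := (hH.memLp_xCell_iff (p := 1) hU hper 0).2 (memLp_one_iff_integrable.2 hHi)
    simpa [IntegrableOn] using memLp_one_iff_integrable.1 this
  have hcb : ∃ C, ∀ x, ‖c x‖ ≤ C := by
    obtain ⟨C, hC⟩ := (isCompact_Icc (a := (0 : ℝ)) (b := 2)).exists_bound_of_continuousOn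
      hc.continuousOn
    refine ⟨C, fun x => ?_⟩
    by_cases hx : x ∈ Ioo (0 : ℝ) 2
    · exact hC x (Ioo_subset_Icc_self hx)
    · rw [hc0 x hx, norm_zero]; exact (norm_nonneg _).trans (hC 0 (by simp))
  obtain ⟨C, hC⟩ := hcb
  have hi : ∀ {a : ℝ → ℝ} {S : Set (ℝ × F)}, Continuous a → (∀ x, ‖a x‖ ≤ C) → IntegrableOn H S →
      IntegrableOn (fun q => a q.1 * H q) S := fun ha haC hS =>
    hS.bdd_mul (ha.comp continuous_fst).aestronglyMeasurable
      (Eventually.of_forall fun q => haC q.1)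
  have h1 : ∫ q in U, c q.1 * H q = ∫ q in xCell U 0 ∪ xCell U 1, c q.1 * H q := by
    refine setIntegral_eq_of_subset_of_ae_sdiff_eq_zero hU.nullMeasurableSet
      (union_subset inter_subset_left inter_subset_left) ?_
    filter_upwards [ae_fst_notMem_range_intCast] with q hqZ hq
    rw [hc0 q.1, zero_mul]
    intro hx
    rcases lt_trichotomy q.1 1 with h | h | h
    · exact hq.2 (Or.inl ⟨hq.1, hx.1, by simpa using h⟩)
    · exact hqZ ⟨1, by simp [h]⟩
    · exact hq.2 (Or.inr ⟨hq.1, h, by have := hx.2; norm_num; exact this⟩)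
  have hdisj : Disjoint (xCell U 0) (xCell U 1) := by
    rw [Set.disjoint_left]
    intro q hq1 hq2
    have a1 := hq1.2.2
    have a2 := hq2.2.1
    norm_num at a1
    exact lt_asymm a1 a2
  rw [h1, setIntegral_union hdisj (measurableSet_xCell hU 1) (hi hc hC hHi) (hi hc hC hHi1)]
  have h2 : ∫ q in xCell U 1, c q.1 * H q = ∫ q in xCell U 0, c (q.1 + 1) * H q := by
    have hmp := measurePreserving_xCell hU hper 0
    have hemb : MeasurableEmbedding (fun q : ℝ × F => q + (1, 0)) :=
      (Homeomorph.addRight ((1, 0) : ℝ × F)).measurableEmbedding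
    rw [zero_add] at hmp
    rw [← hmp.integral_comp hemb]
    refine integral_congr_ae ?_
    filter_upwards [ae_mono (Measure.restrict_mono inter_subset_left le_rfl) hH] with q hq
    simp [hq]
  rw [h2, ← integral_add (hi hc hC hHi)
    (hi (a := fun x => c (x + 1)) (by fun_prop) (fun x => hC _) hHi)]
  exact integral_congr_ae (Eventually.of_forall fun q => by simp only; ring)

lemma HasWeakDeriv.ae_eq_zero_of_eq_zero {V : Set (ℝ × F)} (hV : IsOpen V)
    (h : HasWeakDeriv V e u g) (hu : ∀ q ∈ V, u q = 0) : ∀ᵐ q ∂volume.restrict V, g q = 0 := by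
  have h0 : HasWeakDeriv V e u (fun _ => 0) := by
    have hz : HasWeakDeriv V e (fun _ => (0 : ℝ)) (fun _ => 0) := by
      simpa using hasWeakDeriv_of_contDiff (U := V) (e := e)
        (contDiff_const (c := (0 : ℝ)) (n := 1))
    refine hz.congr ?_ (Eventually.of_forall fun _ => rfl)
    filter_upwards [ae_restrict_mem hV.measurableSet] with q hq
    rw [hu q hq]
  exact h.unique hV h0

/-- A weak derivative of a periodic function has integral zero over a period cell, provided that
the function vanishes away from a set `L` whose part over two periods is compact in `U`. The proof
tests with a smooth partition of unity `x ↦ S(x) - S(x - 1)` subordinate to the periods. -/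
theorem HasWeakDeriv.integral_xCell_eq_zero (hU : IsOpen U) (hper : IsXPeriodic U)
    (h : HasWeakDeriv U e u g) (hu : AEPeriodic U u) {L : Set (ℝ × F)} (hL : IsClosed L)
    (hLc : IsCompact (L ∩ {q | q.1 ∈ Icc (0 : ℝ) 2})) (hLU : L ∩ {q | q.1 ∈ Icc (0 : ℝ) 2} ⊆ U)
    (hu0 : ∀ q ∈ U, q ∉ L → u q = 0) : ∫ q in xCell U 0, g q = 0 := by
  set K := L ∩ {q | q.1 ∈ Icc (0 : ℝ) 2} with hKdef
  have hg : AEPeriodic U g := h.aePeriodic hU hper hu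
  have hg0 : ∀ᵐ q ∂volume.restrict U, q ∉ L → g q = 0 := by
    have h1 := (h.mono (V := U ∩ Lᶜ) inter_subset_left).ae_eq_zero_of_eq_zero
      (hU.inter hL.isOpen_compl) fun q hq => hu0 q hq.1 hq.2
    rw [ae_restrict_iff' (hU.inter hL.isOpen_compl).measurableSet] at h1
    rw [ae_restrict_iff' hU.measurableSet]
    filter_upwards [h1] with q hq h2 h3
    exact hq ⟨h2, h3⟩
  have hxsub : ∀ {q : ℝ × F}, q ∈ xCell U 0 → q.1 ∈ Icc (0 : ℝ) 2 := fun hq => by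
    have h1 := hq.2.1
    have h2 := hq.2.2
    constructor <;> linarith
  have hKi : ∀ {a : ℝ × F → ℝ}, LocallyIntegrableOn a U volume →
      (∀ᵐ q ∂volume.restrict U, q ∉ L → a q = 0) → IntegrableOn a (xCell U 0) := by
    intro a ha ha0
    have h1 : IntegrableOn (K.indicator a) (xCell U 0) :=
      (integrable_indicator_iff hLc.measurableSet).2
        (ha.integrableOn_compact_subset hLU hLc) |>.integrableOn
    refine h1.congr ?_
    filter_upwards [ae_restrict_mem (measurableSet_xCell hU.measurableSet 0),
      ae_mono (Measure.restrict_mono inter_subset_left le_rfl) ha0] with q hq hq0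
    by_cases hqL : q ∈ L
    · exact indicator_of_mem (show q ∈ K from ⟨hqL, hxsub hq⟩) _
    · rw [hq0 hqL, indicator_of_notMem fun hk => hqL hk.1]
  have hui := hKi h.1 ((ae_restrict_mem hU.measurableSet).mono fun q hq => hu0 q hq)
  have hgi := hKi h.2.1 hg0
  -- a cutoff equal to one near `K`, and the partition of unity in `x`
  obtain ⟨δ, hδ, hδU⟩ := hLc.exists_cthickening_subset_open hU hLU
  obtain ⟨b, hb1, hb0, -⟩ := exists_contMDiffMap_one_nhds_of_subset_interior
    (n := (⊤ : ℕ∞)) (modelWithCornersSelf ℝ (ℝ × F)) hLc.isClosed (t := Metric.cthickening δ K)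
    ((Metric.self_subset_thickening hδ K).trans
      (interior_maximal (Metric.thickening_subset_cthickening δ K) Metric.isOpen_thickening))
  have hbs : ContDiff ℝ ∞ b := b.contMDiff.contDiff
  have hbt : tsupport b ⊆ Metric.cthickening δ K := by
    refine closure_minimal (fun q hq => ?_) Metric.isClosed_cthickening
    by_contra hn
    exact hq (hb0 q hn)
  have hbc : HasCompactSupport b := hLc.cthickening.of_isClosed_subset (isClosed_tsupport _) hbt
  set c : ℝ → ℝ := fun x => Real.smoothTransition x - Real.smoothTransition (x - 1) with hcdef
  have hcs : ContDiff ℝ ∞ c :=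
    (Real.smoothTransition.contDiff (n := ⊤)).sub
      ((Real.smoothTransition.contDiff (n := ⊤)).comp (contDiff_id.sub contDiff_const))
  have hcsum : ∀ x ∈ Icc (0 : ℝ) 1, c x + c (x + 1) = 1 := fun x hx => by
    simp only [hcdef, add_sub_cancel_right]
    rw [Real.smoothTransition.zero_of_nonpos (x := x - 1) (by linarith [hx.2]),
      Real.smoothTransition.one_of_one_le (x := x + 1) (by linarith [hx.1])]
    ring
  have hc0' : ∀ x, x ∉ Ioo (0 : ℝ) 2 → c x = 0 := fun x hx => by
    simp only [hcdef]
    by_cases h0 : x ≤ 0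
    · rw [Real.smoothTransition.zero_of_nonpos h0,
        Real.smoothTransition.zero_of_nonpos (by linarith)]; ring
    · have : 2 ≤ x := by
        by_contra h2
        exact hx ⟨not_le.1 h0, not_le.1 h2⟩
      rw [Real.smoothTransition.one_of_one_le (by linarith),
        Real.smoothTransition.one_of_one_le (by linarith)]; ring
  have hcd : Continuous (deriv c) := hcs.continuous_deriv (by simp)
  have hcd0 : ∀ x, x ∉ Ioo (0 : ℝ) 2 → deriv c x = 0 := by
    have hcl : ∀ x, x ∉ Icc (0 : ℝ) 2 → deriv c x = 0 := fun x hx => by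
      have : c =ᶠ[𝓝 x] fun _ => 0 := by
        filter_upwards [isClosed_Icc.isOpen_compl.mem_nhds hx] with y hy
        exact hc0' y fun h => hy (Ioo_subset_Icc_self h)
      rw [this.deriv_eq]; simp
    intro x hx
    by_cases hx' : x ∈ Icc (0 : ℝ) 2
    · -- an endpoint is a limit of points where the derivative vanishes
      have hmem : x ∈ closure (Icc (0 : ℝ) 2)ᶜ := by
        rw [closure_compl, interior_Icc]; exact hx
      exact closure_minimal (fun y hy => hcl y hy) (isClosed_singleton.preimage hcd) hmem
    · exact hcl x hx'
  have hcdsum : ∀ x ∈ Ioo (0 : ℝ) 1, deriv c x + deriv c (x + 1) = 0 := fun x hx => by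
    have h1 : (fun y => c y + c (y + 1)) =ᶠ[𝓝 x] fun _ => 1 := by
      filter_upwards [isOpen_Ioo.mem_nhds hx] with y hy
      exact hcsum y (Ioo_subset_Icc_self hy)
    have h2 := h1.deriv_eq
    rw [deriv_const, deriv_fun_add (f := c) (g := fun y => c (y + 1)) (hcs.differentiable (by simp) x)
      ((hcs.comp (contDiff_id.add contDiff_const)).differentiable (by simp) x),
      deriv_comp_add_const] at h2
    exact h2
  have hφs : ContDiff ℝ ∞ (fun q : ℝ × F => c q.1 * b q) := (hcs.comp contDiff_fst).mul hbs
  have hts : tsupport (fun q : ℝ × F => c q.1 * b q) ⊆ U :=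
    (tsupport_mul_subset_right.trans hbt).trans hδU
  have hmain := h.2.2 _ hφs hbc.mul_left hts
  have e1 : ∫ q in U, u q * fderiv ℝ (fun q : ℝ × F => c q.1 * b q) q e
      = ∫ q in U, (e.1 * deriv c q.1) * u q := by
    refine setIntegral_congr_fun hU.measurableSet fun q hq => ?_
    by_cases hqL : q ∈ L
    · have hdc : HasFDerivAt (fun q : ℝ × F => c q.1)
          (deriv c q.1 • ContinuousLinearMap.fst ℝ ℝ F) q :=
        (hcs.differentiable (by simp) q.1).hasDerivAt.comp_hasFDerivAt q hasFDerivAt_fst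
      by_cases hqx : q.1 ∈ Icc (0 : ℝ) 2
      · have hqb : (b : ℝ × F → ℝ) =ᶠ[𝓝 q] fun _ => 1 :=
          (eventually_nhdsSet_iff_forall.1 hb1) q ⟨hqL, hqx⟩
        have : (fun q : ℝ × F => c q.1 * b q) =ᶠ[𝓝 q] fun q => c q.1 := by
          filter_upwards [hqb] with y hy
          rw [hy, mul_one]
        simp only [this.fderiv_eq, hdc.fderiv]
        simp; ring
      · have hc0q : deriv c q.1 = 0 := hcd0 _ fun h => hqx (Ioo_subset_Icc_self h)
        have : (fun q : ℝ × F => c q.1 * b q) =ᶠ[𝓝 q] fun _ => 0 := by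
          filter_upwards [(isClosed_Icc.isOpen_compl.preimage continuous_fst).mem_nhds
            (show q ∈ Prod.fst ⁻¹' (Icc (0 : ℝ) 2)ᶜ from hqx)] with y hy
          rw [hc0' _ fun h => hy (Ioo_subset_Icc_self h), zero_mul]
        simp [this.fderiv_eq, hc0q]
    · simp [hu0 q hq hqL]
  have e2 : ∫ q in U, g q * (c q.1 * b q) = ∫ q in U, c q.1 * g q := by
    refine integral_congr_ae ?_
    filter_upwards [hg0, ae_restrict_mem hU.measurableSet] with q h0 hq
    by_cases hqL : q ∈ L
    · by_cases hqx : q.1 ∈ Icc (0 : ℝ) 2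
      · rw [((eventually_nhdsSet_iff_forall.1 hb1) q ⟨hqL, hqx⟩).self_of_nhds]; ring
      · rw [hc0' _ fun h => hqx (Ioo_subset_Icc_self h)]; ring
    · rw [h0 hqL]; ring
  rw [e1, e2, integral_mul_of_support_subset hU.measurableSet hper hu hui
    (c := fun x => e.1 * deriv c x) (by fun_prop) (fun x hx => by rw [hcd0 x hx, mul_zero]),
    integral_mul_of_support_subset hU.measurableSet hper hg hgi hcs.continuous hc0'] at hmain
  have e3 : ∫ q in xCell U 0, (e.1 * deriv c q.1 + e.1 * deriv c (q.1 + 1)) * u q = 0 := by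
    rw [setIntegral_congr_fun (g := fun _ => (0 : ℝ)) (measurableSet_xCell hU.measurableSet 0)
      fun q hq => ?_]
    · simp
    · have := hcdsum q.1 (by simpa using hq.2)
      simp only [← mul_add, this]; ring
  have e4 : ∫ q in xCell U 0, (c q.1 + c (q.1 + 1)) * g q = ∫ q in xCell U 0, g q := by
    refine setIntegral_congr_fun (measurableSet_xCell hU.measurableSet 0) fun q hq => ?_
    have := hcsum q.1 (Ioo_subset_Icc_self (by simpa using hq.2))
    simp only [this, one_mul]
  rw [e3, e4] at hmain
  linarith

end Periodic

/-! ### Functions of one variable -/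

section OneDim

open scoped Convolution

variable {a b : ℝ} {θ y f : ℝ → ℝ}

/-- `θ` is a smooth function with compact support in the interval `(a,b)`. -/
structure IsTest (a b : ℝ) (θ : ℝ → ℝ) : Prop where
  smooth : ContDiff ℝ ∞ θ
  compact : HasCompactSupport θ
  subset : tsupport θ ⊆ Ioo a b

lemma IsTest.exists_Icc (hab : a < b) (h : IsTest a b θ) :
    ∃ a' b', a < a' ∧ a' ≤ b' ∧ b' < b ∧ (∀ t, t ∉ Icc a' b' → θ t = 0) ∧
      ∀ t, t ∉ Icc a' b' → deriv θ t = 0 := by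
  have key : ∃ a' b', a < a' ∧ a' ≤ b' ∧ b' < b ∧ tsupport θ ⊆ Icc a' b' := by
    rcases (tsupport θ).eq_empty_or_nonempty with he | hne
    · exact ⟨(a + b) / 2, (a + b) / 2, by linarith, le_rfl, by linarith, by simp [he]⟩
    · obtain ⟨a', ha', hla⟩ := h.compact.isCompact.exists_isLeast hne
      obtain ⟨b', hb', hlb⟩ := h.compact.isCompact.exists_isGreatest hne
      exact ⟨a', b', (h.subset ha').1, hla hb', (h.subset hb').2, fun t ht => ⟨hla ht, hlb ht⟩⟩
  obtain ⟨a', b', h1, h2, h3, h4⟩ := key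
  refine ⟨a', b', h1, h2, h3, fun t ht => image_eq_zero_of_notMem_tsupport fun h => ht (h4 h),
    fun t ht => ?_⟩
  exact image_eq_zero_of_notMem_tsupport (f := deriv θ) fun h => ht (h4 (tsupport_deriv_subset h))

lemma IsTest.eq_zero (h : IsTest a b θ) {t : ℝ} (ht : t ∉ Ioo a b) : θ t = 0 :=
  image_eq_zero_of_notMem_tsupport fun h' => ht (h.subset h')

lemma IsTest.continuous (h : IsTest a b θ) : Continuous θ := h.smooth.continuous

lemma IsTest.continuous_deriv (h : IsTest a b θ) : Continuous (deriv θ) :=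
  h.smooth.continuous_deriv (by simp)

lemma IsTest.exists_bound (h : IsTest a b θ) : ∃ C, ∀ t, ‖θ t‖ ≤ C :=
  h.compact.exists_bound_of_continuous h.continuous

lemma IsTest.exists_bound_deriv (h : IsTest a b θ) : ∃ C, ∀ t, ‖deriv θ t‖ ≤ C :=
  h.compact.deriv.exists_bound_of_continuous h.continuous_deriv

/-- Integration by parts against the primitive of an integrable function. -/
lemma IsTest.integral_deriv_mul_primitive (hab : a < b) (h : IsTest a b θ)
    (hf : IntegrableOn f (Ioo a b)) :
    - ∫ t in Ioo a b, deriv θ t * (∫ τ in a..t, f τ) = ∫ t in Ioo a b, θ t * f t := by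
  have hfi : IntervalIntegrable f volume a b :=
    (intervalIntegrable_iff_integrableOn_Ioo_of_le hab.le).2 hf
  have hB := hfi.absolutelyContinuousOnInterval_intervalIntegral (c := a) (by simp)
  have hθ : AbsolutelyContinuousOnInterval θ a b :=
    (h.smooth.of_le (by simp)).contDiffOn.absolutelyContinuousOnInterval
  have hi := hB.integral_mul_deriv_eq_deriv_mul hθ
  have h0 : θ a = 0 := h.eq_zero (by simp)
  have h1 : θ b = 0 := h.eq_zero (by simp)
  simp only [h0, h1, mul_zero, sub_self, zero_sub, intervalIntegral.integral_of_le hab.le,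
    integral_Ioc_eq_integral_Ioo] at hi
  have e1 : ∫ x in Ioo a b, deriv (fun x => ∫ τ in a..x, f τ) x * θ x
      = ∫ t in Ioo a b, θ t * f t := by
    refine integral_congr_ae ?_
    filter_upwards [ae_restrict_of_ae hfi.ae_hasDerivAt_integral, ae_restrict_mem measurableSet_Ioo]
      with x hx hxm
    have := (hx (by rw [uIcc_of_le hab.le]; exact Ioo_subset_Icc_self hxm) a (by simp)).deriv
    simp only [this]; ring
  have e2 : ∫ x in Ioo a b, (∫ τ in a..x, f τ) * deriv θ x
      = ∫ t in Ioo a b, deriv θ t * (∫ τ in a..t, f τ) := by simp only [mul_comm]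
  rw [e1, e2] at hi
  rw [hi, neg_neg]

/-- An integrable function whose distributional derivative is nonpositive is nonincreasing on a
set of full measure. -/
theorem exists_antitoneOn_of_weak (hy : IntegrableOn y (Ioo a b))
    (h : ∀ θ, IsTest a b θ → (∀ t, 0 ≤ θ t) → 0 ≤ ∫ t in Ioo a b, deriv θ t * y t) :
    ∃ S ⊆ Ioo a b, (∀ᵐ t ∂volume.restrict (Ioo a b), t ∈ S) ∧ AntitoneOn y S := by
  set F : ℝ → ℝ := (Ioo a b).indicator y with hF
  have hFi : Integrable F := (integrable_indicator_iff measurableSet_Ioo).2 hy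
  have hloc : LocallyIntegrable F volume := hFi.locallyIntegrable
  let φ : ℕ → ContDiffBump (0 : ℝ) := fun n =>
    { rIn := 1 / (n + 1) / 2, rOut := 1 / (n + 1), rIn_pos := by positivity
      rIn_lt_rOut := by
        have : (0 : ℝ) < 1 / (n + 1) := by positivity
        linarith }
  have hrO : ∀ n, (φ n).rOut = 1 / (n + 1) := fun n => rfl
  have hlim : Tendsto (fun n => (φ n).rOut) atTop (𝓝 0) := by
    simp only [hrO]; exact tendsto_one_div_add_atTop_nhds_zero_nat
  have hae := ContDiffBump.ae_convolution_tendsto_right_of_locallyIntegrable (μ := volume)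
    (φ := φ) (l := atTop) (K := 2) hlim (Eventually.of_forall fun n => le_of_eq (by
      change (1 : ℝ) / (n + 1) = 2 * (1 / (n + 1) / 2); ring)) hloc
  refine ⟨{t | t ∈ Ioo a b ∧ Tendsto (fun n => ((φ n).normed volume ⋆[ContinuousLinearMap.lsmul ℝ ℝ,
    volume] F) t) atTop (𝓝 (F t))}, fun t ht => ht.1, ?_, ?_⟩
  · filter_upwards [ae_restrict_of_ae hae, ae_restrict_mem measurableSet_Ioo] with t h1 h2
    exact ⟨h2, h1⟩
  rintro s ⟨hs, hsl⟩ t ⟨ht, htl⟩ hst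
  have hFs : F s = y s := indicator_of_mem hs _
  have hFt : F t = y t := indicator_of_mem ht _
  rw [← hFs, ← hFt]
  refine le_of_tendsto_of_tendsto htl hsl ?_
  have hδ : 0 < min (s - a) (b - t) := lt_min (by linarith [hs.1]) (by linarith [ht.2])
  filter_upwards [hlim.eventually (gt_mem_nhds hδ)] with n hn
  set ρ := (φ n).normed (volume : Measure ℝ) with hρ
  have hρs : ContDiff ℝ ∞ ρ := (φ n).contDiff_normed
  have hρc : HasCompactSupport ρ := (φ n).hasCompactSupport_normed
  have hd : ∀ x, HasDerivAt (ρ ⋆[ContinuousLinearMap.lsmul ℝ ℝ, volume] F)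
      ((deriv ρ ⋆[ContinuousLinearMap.lsmul ℝ ℝ, volume] F) x) x := fun x =>
    hρc.hasDerivAt_convolution_left _ (hρs.of_le (by simp)) hloc x
  have hanti : AntitoneOn (ρ ⋆[ContinuousLinearMap.lsmul ℝ ℝ, volume] F) (Icc s t) := by
    refine antitoneOn_of_deriv_nonpos (convex_Icc s t)
      (fun x _ => (hd x).continuousAt.continuousWithinAt)
      (fun x _ => (hd x).differentiableAt.differentiableWithinAt) fun x hx => ?_
    rw [interior_Icc] at hx
    rw [(hd x).deriv, convolution_eq_swap]
    have hts : tsupport (fun τ => ρ (x - τ)) ⊆ Ioo a b := by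
      have : tsupport (fun τ => ρ (x - τ)) = (fun τ => x - τ) ⁻¹' tsupport ρ :=
        tsupport_comp_eq_preimage ρ (Homeomorph.subLeft x)
      rw [this, (φ n).tsupport_normed_eq]
      intro τ hτ
      have h1 : |x - τ| ≤ (φ n).rOut := by simpa using hτ
      obtain ⟨h2, h3⟩ := abs_le.1 h1
      have h4 := hn.trans_le (min_le_left _ _)
      have h5 := hn.trans_le (min_le_right _ _)
      constructor <;> linarith [hx.1, hx.2]
    have hT : IsTest a b (fun τ => ρ (x - τ)) :=
      ⟨hρs.comp (contDiff_const.sub contDiff_id), hρc.comp_homeomorph (Homeomorph.subLeft x), hts⟩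
    have h1 := h _ hT fun τ => (φ n).nonneg_normed _
    have hder : ∀ τ, deriv (fun τ => ρ (x - τ)) τ = - deriv ρ (x - τ) := fun τ =>
      deriv_comp_const_sub ..
    simp only [hder] at h1
    have h2 : ∫ τ, (ContinuousLinearMap.lsmul ℝ ℝ) (deriv ρ (x - τ)) (F τ)
        = ∫ τ in Ioo a b, deriv ρ (x - τ) * y τ := by
      rw [← integral_indicator measurableSet_Ioo]
      refine integral_congr_ae (Eventually.of_forall fun τ => ?_)
      by_cases hτ : τ ∈ Ioo a b <;> simp [hF, hτ]
    rw [h2]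
    simp only [neg_mul, integral_neg] at h1
    linarith
  exact hanti (left_mem_Icc.2 hst) (right_mem_Icc.2 hst) hst

/-- A differential inequality `y' ≤ f` in the sense of distributions may be integrated, between
points of a set of full measure. -/
theorem exists_le_add_integral_of_weak (hab : a < b) (hy : IntegrableOn y (Ioo a b))
    (hf : IntegrableOn f (Ioo a b))
    (h : ∀ θ, IsTest a b θ → (∀ t, 0 ≤ θ t) →
      - ∫ t in Ioo a b, deriv θ t * y t ≤ ∫ t in Ioo a b, θ t * f t) :
    ∃ S ⊆ Ioo a b, (∀ᵐ t ∂volume.restrict (Ioo a b), t ∈ S) ∧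
      ∀ s ∈ S, ∀ t ∈ S, s ≤ t → y t ≤ y s + ∫ τ in s..t, f τ := by
  have hfi : IntervalIntegrable f volume a b :=
    (intervalIntegrable_iff_integrableOn_Ioo_of_le hab.le).2 hf
  have hBc : ContinuousOn (fun t => ∫ τ in a..t, f τ) (Icc a b) := by
    have := (hfi.absolutelyContinuousOnInterval_intervalIntegral (c := a) (by simp)).continuousOn
    rwa [uIcc_of_le hab.le] at this
  have hBi : IntegrableOn (fun t => ∫ τ in a..t, f τ) (Ioo a b) :=
    (hBc.integrableOn_compact isCompact_Icc).mono_set Ioo_subset_Icc_self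
  obtain ⟨S, hS, hSa, hanti⟩ := exists_antitoneOn_of_weak (hy.sub hBi) fun θ hθ hθ0 => by
    obtain ⟨C, hC⟩ := hθ.exists_bound_deriv
    have i1 : IntegrableOn (fun t => deriv θ t * y t) (Ioo a b) :=
      hy.bdd_mul hθ.continuous_deriv.aestronglyMeasurable (Eventually.of_forall hC)
    have i2 : IntegrableOn (fun t => deriv θ t * ∫ τ in a..t, f τ) (Ioo a b) :=
      hBi.bdd_mul hθ.continuous_deriv.aestronglyMeasurable (Eventually.of_forall hC)
    have h1 := h θ hθ hθ0
    have h2 := hθ.integral_deriv_mul_primitive hab hf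
    have h3 : ∫ t in Ioo a b, deriv θ t * (y - fun t => ∫ τ in a..t, f τ) t
        = (∫ t in Ioo a b, deriv θ t * y t) - ∫ t in Ioo a b, deriv θ t * ∫ τ in a..t, f τ := by
      rw [← integral_sub i1 i2]
      exact integral_congr_ae (Eventually.of_forall fun t => by simp only [Pi.sub_apply]; ring)
    rw [h3]; linarith
  refine ⟨S, hS, hSa, fun s hs t ht hst => ?_⟩
  have h1 := hanti hs ht hst
  simp only [Pi.sub_apply] at h1
  have hsub : ∀ {x}, x ∈ S → x ∈ uIcc a b := fun hx => by
    rw [uIcc_of_le hab.le]; exact Ioo_subset_Icc_self (hS hx)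
  have h2 := intervalIntegral.integral_interval_sub_left
    (hfi.mono_set (uIcc_subset_uIcc left_mem_uIcc (hsub ht)))
    (hfi.mono_set (uIcc_subset_uIcc left_mem_uIcc (hsub hs)))
  linarith

/-- The fundamental theorem of calculus for weak derivatives of functions of one variable. -/
theorem HasWeakDeriv.exists_sub_eq_integral (hab : a < b) (h : HasWeakDeriv (Ioo a b) (1 : ℝ) y f)
    (hy : IntegrableOn y (Ioo a b)) (hf : IntegrableOn f (Ioo a b)) :
    ∃ S ⊆ Ioo a b, (∀ᵐ t ∂volume.restrict (Ioo a b), t ∈ S) ∧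
      ∀ s ∈ S, ∀ t ∈ S, s ≤ t → y t - y s = ∫ τ in s..t, f τ := by
  have h0 : ∀ θ, IsTest a b θ →
      - ∫ t in Ioo a b, deriv θ t * y t = ∫ t in Ioo a b, θ t * f t := fun θ hθ => by
    have := h.2.2 θ hθ.smooth hθ.compact hθ.subset
    simp only [mul_comm (y _), mul_comm (f _), fderiv_eq_smul_deriv, one_smul] at this
    rw [this, neg_neg]
  obtain ⟨S, hS, hSa, hle⟩ := exists_le_add_integral_of_weak hab hy hf
    fun θ hθ _ => (h0 θ hθ).le
  obtain ⟨S', hS', hSa', hle'⟩ := exists_le_add_integral_of_weak hab hy.neg hf.neg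
    fun θ hθ _ => by
      have := h0 θ hθ
      simp only [Pi.neg_apply, mul_neg, integral_neg]
      linarith
  refine ⟨S ∩ S', fun t ht => hS ht.1, hSa.and hSa', fun s hs t ht hst => le_antisymm ?_ ?_⟩
  · linarith [hle s hs.1 t ht.1 hst]
  · have := hle' s hs.2 t ht.2 hst
    simp only [Pi.neg_apply, intervalIntegral.integral_neg] at this
    linarith

/-- A one-variable form of the Poincaré inequality, for a function of mean `m`. -/
theorem HasWeakDeriv.ae_abs_sub_average_le (h : HasWeakDeriv (Ioo 0 1) (1 : ℝ) y f)
    (hy : IntegrableOn y (Ioo 0 1)) (hf : IntegrableOn f (Ioo 0 1)) :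
    ∀ᵐ x ∂volume.restrict (Ioo (0 : ℝ) 1),
      |y x - ∫ s in Ioo (0 : ℝ) 1, y s| ≤ ∫ s in Ioo (0 : ℝ) 1, |f s| := by
  obtain ⟨S, hS, hSa, heq⟩ := h.exists_sub_eq_integral one_pos hy hf
  have hle : ∀ s ∈ S, ∀ t ∈ S, |y t - y s| ≤ ∫ s in Ioo (0 : ℝ) 1, |f s| := by
    have key : ∀ s ∈ S, ∀ t ∈ S, s ≤ t → |y t - y s| ≤ ∫ s in Ioo (0 : ℝ) 1, |f s| := by
      intro s hs t ht hst
      rw [heq s hs t ht hst, intervalIntegral.integral_of_le hst]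
      refine abs_integral_le_integral_abs.trans ?_
      refine setIntegral_mono_set hf.abs (Eventually.of_forall fun _ => abs_nonneg _) ?_
      exact (Ioc_subset_Ioo_right (hS ht).2).trans (Ioo_subset_Ioo_left (hS hs).1.le)
        |>.eventuallyLE
    intro s hs t ht
    rcases le_total s t with hst | hst
    · exact key s hs t ht hst
    · rw [abs_sub_comm]; exact key t ht s hs hst
  filter_upwards [hSa] with x hx
  have h1 : y x - ∫ s in Ioo (0 : ℝ) 1, y s = ∫ s in Ioo (0 : ℝ) 1, (y x - y s) := by
    rw [integral_sub (integrable_const _) hy]; simp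
  rw [h1]
  have h2 := norm_setIntegral_le_of_norm_le_const_ae' (μ := volume) (s := Ioo (0 : ℝ) 1)
    (f := fun s => y x - y s) (C := ∫ s in Ioo (0 : ℝ) 1, |f s|) (by simp)
    (by
      rw [ae_restrict_iff' measurableSet_Ioo] at hSa
      filter_upwards [hSa] with s hs hs01
      exact hle s (hs hs01) x hx)
  simpa using h2

end OneDim

/-! ### The plate -/

section SmoothMul

variable {E : Type*} [NormedAddCommGroup E] [NormedSpace ℝ E] [FiniteDimensional ℝ E]
  [MeasureSpace E] [BorelSpace E] [(volume : Measure E).IsAddHaarMeasure]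
  {U : Set E} {e : E} {u v g k : E → ℝ} {p : ℝ≥0∞}

theorem HasWeakDeriv.smooth_mul (hU : IsOpen U) {ψ : E → ℝ} (hψ : ContDiff ℝ ∞ ψ)
    (h : HasWeakDeriv U e u g) :
    HasWeakDeriv U e (fun q => ψ q * u q) (fun q => ψ q * g q + fderiv ℝ ψ q e * u q) := by
  have hd : Continuous fun q => fderiv ℝ ψ q e :=
    (hψ.continuous_fderiv (by simp)).clm_apply continuous_const
  have u1 := h.1.continuousOn_mul hψ.continuous.continuousOn hU.isLocallyClosed
  have g1 := h.2.1.continuousOn_mul hψ.continuous.continuousOn hU.isLocallyClosed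
  have k1 := h.1.continuousOn_mul hd.continuousOn hU.isLocallyClosed
  refine .of_integral_eq u1 (g1.add k1) fun φ h1 h2 h3 => ?_
  have hs : tsupport (fun q => ψ q * φ q) ⊆ U := tsupport_mul_subset_right.trans h3
  have := h.integral_eq (hψ.mul h1) h2.mul_left hs
  have hd : ∀ q, fderiv ℝ (fun q => ψ q * φ q) q e
      = ψ q * fderiv ℝ φ q e + φ q * fderiv ℝ ψ q e := fun q => by
    rw [fderiv_fun_mul (hψ.differentiable (by simp) q) (h1.differentiable (by simp) q)]
    simp
  simp only [hd] at this
  have i1 := integrable_mul_test_fderiv (e := e) u1 (h1.of_le (by simp)) h2 h3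
  have i2 := integrable_mul_test k1 h1.continuous h2 h3
  have i3 := integrable_mul_test g1 h1.continuous h2 h3
  have e1 : ∫ q, u q * (ψ q * fderiv ℝ φ q e + φ q * fderiv ℝ ψ q e)
      = (∫ q, ψ q * u q * fderiv ℝ φ q e) + ∫ q, fderiv ℝ ψ q e * u q * φ q := by
    rw [← integral_add i1 i2]
    exact integral_congr_ae (Eventually.of_forall fun q => by ring)
  have e2 : ∫ q, (ψ q * g q + fderiv ℝ ψ q e * u q) * φ q
      = (∫ q, ψ q * g q * φ q) + ∫ q, fderiv ℝ ψ q e * u q * φ q := by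
    rw [← integral_add i3 i2]
    exact integral_congr_ae (Eventually.of_forall fun q => by ring)
  have e3 : ∫ q, g q * (ψ q * φ q) = ∫ q, ψ q * g q * φ q :=
    integral_congr_ae (Eventually.of_forall fun q => by ring)
  rw [e1, e3] at this
  rw [e2]; linarith

end SmoothMul

section CellL2

variable {F : Type*} [NormedAddCommGroup F] [NormedSpace ℝ F] [FiniteDimensional ℝ F]
  [MeasureSpace F] [BorelSpace F] [(volume : Measure F).IsAddHaarMeasure]
  {U : Set (ℝ × F)} {e : ℝ × F} {u v g k : ℝ × F → ℝ} {p : ℝ≥0∞}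

/-- Functions that are periodic in the first coordinate and square integrable over a period. -/
def CellL2 (U : Set (ℝ × F)) (u : ℝ × F → ℝ) : Prop :=
  AEPeriodic U u ∧ MemLp u 2 (volume.restrict (xCell U 0))

lemma CellL2.memLpLoc (hU : MeasurableSet U) (hper : IsXPeriodic U) (h : CellL2 U u) :
    MemLpLoc 2 U u := h.1.memLpLoc hU hper h.2

lemma CellL2.integrable_mul (h : CellL2 U u) (h' : CellL2 U v) :
    IntegrableOn (fun q => u q * v q) (xCell U 0) := h.2.integrable_mul h'.2

theorem HasWeakDeriv.mul_cellL2 (hU : IsOpen U) (hper : IsXPeriodic U)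
    (hu : HasWeakDeriv U e u g) (hv : HasWeakDeriv U e v k)
    (u2 : CellL2 U u) (g2 : CellL2 U g) (v2 : CellL2 U v) (k2 : CellL2 U k) :
    HasWeakDeriv U e (fun q => u q * v q) (fun q => u q * k q + g q * v q) :=
  hu.mul hU hv (u2.memLpLoc hU.measurableSet hper) (g2.memLpLoc hU.measurableSet hper)
    (v2.memLpLoc hU.measurableSet hper) (k2.memLpLoc hU.measurableSet hper)

lemma HasL2WeakDeriv.hasWeakDeriv {S : Set (ℝ × F)} (h : HasL2WeakDeriv U S e u) :
    HasWeakDeriv U e u (weakDeriv U e u) := hasWeakDeriv_weakDeriv h.1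

lemma HasL2WeakDeriv.cellL2 (hU : IsOpen U) (hper : IsXPeriodic U)
    (h : HasL2WeakDeriv U (xCell U 0) e u) (hu : AEPeriodic U u) : CellL2 U (weakDeriv U e u) :=
  ⟨h.hasWeakDeriv.aePeriodic hU hper hu, h.2⟩

end CellL2

section Slab

variable {a b : ℝ} {θ : ℝ → ℝ} {u g : ℝ × ℝ → ℝ} {e : ℝ × ℝ}

/-- The space-time strip `ℝ × (a,b)`. -/
def slab (a b : ℝ) : Set (ℝ × ℝ) := univ ×ˢ Ioo a b

lemma isOpen_slab : IsOpen (slab a b) := isOpen_univ.prod isOpen_Ioo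

lemma isXPeriodic_slab : IsXPeriodic (slab a b) := fun q => by simp [slab]

lemma xCell_slab : xCell (slab a b) 0 = Ioo 0 1 ×ˢ Ioo a b := by
  ext q; simp [xCell, slab, and_comm]

lemma plateDomain_eq_slab (T : ℝ) : plateDomain T = slab 0 T := rfl

lemma xCell_plateDomain (T : ℝ) : xCell (plateDomain T) 0 = plateCell T := xCell_slab

lemma hasFDerivAt_comp_snd {θ : ℝ → ℝ} (hθ : ContDiff ℝ ∞ θ) (q : ℝ × ℝ) :
    fderiv ℝ (fun q : ℝ × ℝ => θ q.2) q e = deriv θ q.2 * e.2 := by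
  have := ((hθ.differentiable (by simp) q.2).hasDerivAt.comp_hasFDerivAt q
    (hasFDerivAt_snd (𝕜 := ℝ) (E := ℝ) (F := ℝ))).fderiv
  have h' : fderiv ℝ (fun q : ℝ × ℝ => θ q.2) q = _ := this
  rw [h']; simp

/-- The divergence theorem on a strip, for functions that are periodic in `x`, against a test
function of time. -/
theorem HasWeakDeriv.integral_slab_eq_zero (hab : a < b) (h : HasWeakDeriv (slab a b) e u g)
    (hu : AEPeriodic (slab a b) u) (hθ : IsTest a b θ) :
    ∫ q in xCell (slab a b) 0, (θ q.2 * g q + deriv θ q.2 * e.2 * u q) = 0 := by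
  obtain ⟨a', b', h1, h2, h3, h4, -⟩ := hθ.exists_Icc hab
  have hw := h.smooth_mul isOpen_slab (ψ := fun q => θ q.2) (hθ.smooth.comp contDiff_snd)
  simp only [hasFDerivAt_comp_snd hθ.smooth] at hw
  have hset : {q : ℝ × ℝ | q.2 ∈ Icc a' b'} ∩ {q | q.1 ∈ Icc (0 : ℝ) 2} = Icc 0 2 ×ˢ Icc a' b' := by
    ext q
    simp only [mem_inter_iff, mem_ofPred_eq, mem_prod, and_comm]
  refine hw.integral_xCell_eq_zero isOpen_slab isXPeriodic_slab ?_
    (L := {q | q.2 ∈ Icc a' b'}) (isClosed_Icc.preimage continuous_snd) ?_ ?_ ?_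
  · filter_upwards [hu] with q hq
    simp [hq]
  · rw [hset]; exact isCompact_Icc.prod isCompact_Icc
  · rw [hset]
    exact fun q hq => ⟨trivial, h1.trans_le hq.2.1, hq.2.2.trans_lt h3⟩
  · intro q _ hq
    rw [h4 q.2 hq, zero_mul]

lemma integrableOn_test_mul {S : Set (ℝ × ℝ)} {θ : ℝ → ℝ} (hθ : Continuous θ) {C : ℝ}
    (hC : ∀ t, ‖θ t‖ ≤ C) (hu : IntegrableOn u S) : IntegrableOn (fun q => θ q.2 * u q) S :=
  hu.bdd_mul (hθ.comp continuous_snd).aestronglyMeasurable (Eventually.of_forall fun q => hC q.2)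

theorem HasWeakDeriv.integral_slab_x (hab : a < b) (h : HasWeakDeriv (slab a b) plateX u g)
    (hu : AEPeriodic (slab a b) u) (hθ : IsTest a b θ) :
    ∫ q in xCell (slab a b) 0, θ q.2 * g q = 0 := by
  simpa [plateX] using h.integral_slab_eq_zero hab hu hθ

theorem HasWeakDeriv.integral_slab_t (hab : a < b) (h : HasWeakDeriv (slab a b) plateT u g)
    (hu : AEPeriodic (slab a b) u) (hθ : IsTest a b θ)
    (ui : IntegrableOn u (xCell (slab a b) 0)) (gi : IntegrableOn g (xCell (slab a b) 0)) :
    ∫ q in xCell (slab a b) 0, θ q.2 * g q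
      = - ∫ q in xCell (slab a b) 0, deriv θ q.2 * u q := by
  obtain ⟨C, hC⟩ := hθ.exists_bound
  obtain ⟨C', hC'⟩ := hθ.exists_bound_deriv
  have := h.integral_slab_eq_zero hab hu hθ
  simp only [plateT, mul_one] at this
  rw [integral_add (integrableOn_test_mul hθ.continuous hC gi)
    (integrableOn_test_mul hθ.continuous_deriv hC' ui)] at this
  linarith

end Slab

section PlateEnergy

/-- The derivatives of a periodic plate displacement `η` that enter its energy: `ηx k` stands for
`∂_x^k η` and `sx k` for `∂_x^k ∂_t η`, while `s' = ∂_t² η`. -/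
structure PlateField (a b : ℝ) (ηx : ℕ → ℝ × ℝ → ℝ) (sx : ℕ → ℝ × ℝ → ℝ) (s' : ℝ × ℝ → ℝ) :
    Prop where
  cell_η : ∀ k ≤ 4, CellL2 (slab a b) (ηx k)
  cell_s : ∀ k ≤ 2, CellL2 (slab a b) (sx k)
  cell_s' : CellL2 (slab a b) s'
  deriv_η : ∀ k < 4, HasWeakDeriv (slab a b) plateX (ηx k) (ηx (k + 1))
  deriv_s : ∀ k < 2, HasWeakDeriv (slab a b) plateX (sx k) (sx (k + 1))
  deriv_t : HasWeakDeriv (slab a b) plateT (ηx 0) (sx 0)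
  deriv_tt : HasWeakDeriv (slab a b) plateT (sx 0) s'

variable {a b : ℝ} {ηx sx : ℕ → ℝ × ℝ → ℝ} {s' : ℝ × ℝ → ℝ} {θ : ℝ → ℝ}

lemma PlateField.deriv_t_one (h : PlateField a b ηx sx s') :
    HasWeakDeriv (slab a b) plateT (ηx 1) (sx 1) :=
  (h.deriv_η 0 (by norm_num)).comm h.deriv_t (h.deriv_s 0 (by norm_num))

lemma PlateField.deriv_t_two (h : PlateField a b ηx sx s') :
    HasWeakDeriv (slab a b) plateT (ηx 2) (sx 2) :=
  (h.deriv_η 1 (by norm_num)).comm h.deriv_t_one (h.deriv_s 1 (by norm_num))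

/-- The energy identity of the plate, obtained by testing the plate operator with the plate
velocity. -/
theorem PlateField.energy (hab : a < b) (h : PlateField a b ηx sx s') (hθ : IsTest a b θ)
    (ρ δ β : ℝ) :
    ∫ q in xCell (slab a b) 0,
        θ q.2 * (sx 0 q * (ρ * s' q - δ * sx 2 q + β * ηx 4 q))
      = - (∫ q in xCell (slab a b) 0, deriv θ q.2 * (ρ / 2 * sx 0 q ^ 2 + β / 2 * ηx 2 q ^ 2))
        + δ * ∫ q in xCell (slab a b) 0, θ q.2 * sx 1 q ^ 2 := by
  obtain ⟨C, hC⟩ := hθ.exists_bound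
  obtain ⟨C', hC'⟩ := hθ.exists_bound_deriv
  have c0 := h.cell_s 0 (by norm_num)
  have c1 := h.cell_s 1 (by norm_num)
  have c2 := h.cell_s 2 (by norm_num)
  have d2 := h.cell_η 2 (by norm_num)
  have d3 := h.cell_η 3 (by norm_num)
  have d4 := h.cell_η 4 (by norm_num)
  have hm : ∀ {u : ℝ × ℝ → ℝ}, IntegrableOn u (xCell (slab a b) 0) →
      IntegrableOn (fun q => θ q.2 * u q) (xCell (slab a b) 0) := fun hu =>
    integrableOn_test_mul hθ.continuous hC hu
  have hm' : ∀ {u : ℝ × ℝ → ℝ}, IntegrableOn u (xCell (slab a b) 0) →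
      IntegrableOn (fun q => deriv θ q.2 * u q) (xCell (slab a b) 0) := fun hu =>
    integrableOn_test_mul hθ.continuous_deriv hC' hu
  have hadd : ∀ {u v : ℝ × ℝ → ℝ}, IntegrableOn u (xCell (slab a b) 0) →
      IntegrableOn v (xCell (slab a b) 0) →
      ∫ q in xCell (slab a b) 0, θ q.2 * (u q + v q)
        = (∫ q in xCell (slab a b) 0, θ q.2 * u q) + ∫ q in xCell (slab a b) 0, θ q.2 * v q :=
    fun hu hv => by
      simp only [mul_add]; exact integral_add (hm hu) (hm hv)
  have i1 := (h.deriv_tt.mul_cellL2 isOpen_slab isXPeriodic_slab h.deriv_tt c0 h.cell_s' c0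
    h.cell_s').integral_slab_t hab (c0.1.mul c0.1) hθ (c0.integrable_mul c0)
    ((c0.integrable_mul h.cell_s').add (h.cell_s'.integrable_mul c0))
  have i2 := (h.deriv_t_two.mul_cellL2 isOpen_slab isXPeriodic_slab h.deriv_t_two d2 c2 d2
    c2).integral_slab_t hab (d2.1.mul d2.1) hθ (d2.integrable_mul d2)
    ((d2.integrable_mul c2).add (c2.integrable_mul d2))
  have i3 := ((h.deriv_s 0 (by norm_num)).mul_cellL2 isOpen_slab isXPeriodic_slab
    (h.deriv_s 1 (by norm_num)) c0 c1 c1 c2).integral_slab_x hab (c0.1.mul c1.1) hθ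
  have i4 := ((h.deriv_s 0 (by norm_num)).mul_cellL2 isOpen_slab isXPeriodic_slab
    (h.deriv_η 3 (by norm_num)) c0 c1 d3 d4).integral_slab_x hab (c0.1.mul d3.1) hθ
  have i5 := ((h.deriv_s 1 (by norm_num)).mul_cellL2 isOpen_slab isXPeriodic_slab
    (h.deriv_η 2 (by norm_num)) c1 c2 d2 d3).integral_slab_x hab (c1.1.mul d2.1) hθ
  rw [hadd (c0.integrable_mul h.cell_s') (h.cell_s'.integrable_mul c0)] at i1
  rw [hadd (d2.integrable_mul c2) (c2.integrable_mul d2)] at i2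
  rw [hadd (c0.integrable_mul c2) (c1.integrable_mul c1)] at i3
  rw [hadd (c0.integrable_mul d4) (c1.integrable_mul d3)] at i4
  rw [hadd (c1.integrable_mul d3) (c2.integrable_mul d2)] at i5
  have e0 : ∫ q in xCell (slab a b) 0, θ q.2 * (sx 0 q * (ρ * s' q - δ * sx 2 q + β * ηx 4 q))
      = ρ * (∫ q in xCell (slab a b) 0, θ q.2 * (sx 0 q * s' q))
        - δ * (∫ q in xCell (slab a b) 0, θ q.2 * (sx 0 q * sx 2 q))
        + β * ∫ q in xCell (slab a b) 0, θ q.2 * (sx 0 q * ηx 4 q) := by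
    have j : IntegrableOn (fun q => ρ * (θ q.2 * (sx 0 q * s' q)) - δ * (θ q.2 * (sx 0 q * sx 2 q)))
        (xCell (slab a b) 0) := ((hm (c0.integrable_mul h.cell_s')).const_mul ρ).sub
        ((hm (c0.integrable_mul c2)).const_mul δ)
    rw [← integral_const_mul, ← integral_const_mul, ← integral_const_mul,
      ← integral_sub ((hm (c0.integrable_mul h.cell_s')).const_mul ρ)
        ((hm (c0.integrable_mul c2)).const_mul δ),
      ← integral_add j ((hm (c0.integrable_mul d4)).const_mul β)]
    exact integral_congr_ae (Eventually.of_forall fun q => by ring)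
  have e1 : ∫ q in xCell (slab a b) 0, deriv θ q.2 * (ρ / 2 * sx 0 q ^ 2 + β / 2 * ηx 2 q ^ 2)
      = ρ / 2 * (∫ q in xCell (slab a b) 0, deriv θ q.2 * (sx 0 q * sx 0 q))
        + β / 2 * ∫ q in xCell (slab a b) 0, deriv θ q.2 * (ηx 2 q * ηx 2 q) := by
    rw [← integral_const_mul, ← integral_const_mul,
      ← integral_add ((hm' (c0.integrable_mul c0)).const_mul _)
        ((hm' (d2.integrable_mul d2)).const_mul _)]
    exact integral_congr_ae (Eventually.of_forall fun q => by ring)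
  have e2 : ∫ q in xCell (slab a b) 0, θ q.2 * (s' q * sx 0 q)
      = ∫ q in xCell (slab a b) 0, θ q.2 * (sx 0 q * s' q) := by simp only [mul_comm (s' _)]
  have e3 : ∫ q in xCell (slab a b) 0, θ q.2 * (sx 2 q * ηx 2 q)
      = ∫ q in xCell (slab a b) 0, θ q.2 * (ηx 2 q * sx 2 q) := by simp only [mul_comm (sx 2 _)]
  simp only [pow_two] at *
  rw [e0, e1]
  rw [e2] at i1
  rw [e3] at i2 i5
  linear_combination (ρ / 2) * i1 + (β / 2) * i2 - δ * i3 + β * i4 - β * i5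

end PlateEnergy

/-! ### Slices in time -/

section Slices

variable {a b : ℝ} {u g : ℝ × ℝ → ℝ}

lemma fderiv_slice {φ : ℝ × ℝ → ℝ} (hφ : Differentiable ℝ φ) (x t : ℝ) :
    fderiv ℝ (fun x => φ (x, t)) x 1 = fderiv ℝ φ (x, t) plateX := by
  have h1 : HasFDerivAt (fun x : ℝ => (x, t)) (ContinuousLinearMap.inl ℝ ℝ ℝ) x := by
    simpa using hasFDerivAt_prodMk_left x t
  have h2 : fderiv ℝ (fun x => φ (x, t)) x = _ := ((hφ (x, t)).hasFDerivAt.comp x h1).fderiv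
  rw [h2]; simp [plateX]

lemma contDiff_slice {φ : ℝ × ℝ → ℝ} {n : WithTop ℕ∞} (hφ : ContDiff ℝ n φ) (t : ℝ) :
    ContDiff ℝ n (fun x => φ (x, t)) := hφ.comp (contDiff_id.prodMk contDiff_const)

/-- If a sequence of functions converges in `L¹` of a product, fast enough, then almost all of its
slices converge in `L¹`. -/
lemma ae_tendsto_lintegral_slice {I J : Set ℝ} {T : ℕ → ℝ × ℝ → ℝ≥0∞}
    (hT : ∀ n, AEMeasurable (T n) (volume.restrict (I ×ˢ J)))
    (hsum : ∀ n, ∫⁻ q in I ×ˢ J, T n q ≤ (1 / 2 : ℝ≥0∞) ^ n) :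
    ∀ᵐ t ∂volume.restrict J, Tendsto (fun n => ∫⁻ x in I, T n (x, t)) atTop (𝓝 0) := by
  have hr : (volume : Measure (ℝ × ℝ)).restrict (I ×ˢ J)
      = (volume.restrict I).prod (volume.restrict J) := (Measure.prod_restrict I J).symm
  simp only [hr] at hT hsum
  have h1 : ∫⁻ t in J, ∑' n, ∫⁻ x in I, T n (x, t) ≠ ⊤ := by
    rw [lintegral_tsum fun n => (hT n).lintegral_prod_left']
    refine ne_top_of_le_ne_top ?_ (ENNReal.tsum_le_tsum (g := fun n => (1 / 2 : ℝ≥0∞) ^ n) fun n => ?_)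
    · simp [ENNReal.tsum_geometric]
    · rw [← lintegral_prod_symm _ (hT n)]; exact hsum n
  filter_upwards [ae_lt_top' (AEMeasurable.tsum fun n => (hT n).lintegral_prod_left') h1]
    with t ht
  exact ENNReal.tendsto_atTop_zero_of_tsum_ne_top ht.ne

/-- Almost all slices of a weak derivative satisfy the defining identity against all test functions
supported in `I` at once: approximate by smooth functions, whose slices satisfy it. -/
lemma HasWeakDeriv.ae_slice_on {I J : Set ℝ} (hI : IsCompact I) (hJ : IsCompact J)
    (hJab : J ⊆ Ioo a b) (h : HasWeakDeriv (slab a b) plateX u g) :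
    ∀ᵐ t ∂volume.restrict J, IntegrableOn (fun x => u (x, t)) I ∧
      IntegrableOn (fun x => g (x, t)) I ∧
      ∀ φ : ℝ → ℝ, ContDiff ℝ ∞ φ → HasCompactSupport φ → tsupport φ ⊆ I →
        ∫ x, u (x, t) * fderiv ℝ φ x 1 = - ∫ x, g (x, t) * φ x := by
  have hK : IsCompact (I ×ˢ J) := hI.prod hJ
  have hKU : I ×ˢ J ⊆ slab a b := fun q hq => ⟨trivial, hJab hq.2⟩
  have u1 := (locallyIntegrableOn_iff_memLpLoc isOpen_slab).1 h.1
  have g1 := (locallyIntegrableOn_iff_memLpLoc isOpen_slab).1 h.2.1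
  obtain ⟨w, hw, hwu, hwg⟩ := h.exists_smooth_approx (p := 1) (by simp) isOpen_slab hK hKU u1 g1
  have hsel : ∀ k : ℕ, ∃ n, eLpNorm (fun q => w n q - u q) 1 (volume.restrict (I ×ˢ J))
      ≤ (1 / 2 : ℝ≥0∞) ^ k ∧ eLpNorm (fun q => fderiv ℝ (w n) q plateX - g q) 1
        (volume.restrict (I ×ˢ J)) ≤ (1 / 2 : ℝ≥0∞) ^ k := fun k => by
    have hpos : (0 : ℝ≥0∞) < (1 / 2 : ℝ≥0∞) ^ k := ENNReal.pow_pos (by simp) k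
    exact ((hwu.eventually (ge_mem_nhds hpos)).and (hwg.eventually (ge_mem_nhds hpos))).exists
  choose n hn1 hn2 using hsel
  have hwd : ∀ n, Continuous fun q => fderiv ℝ (w n) q plateX := fun n =>
    ((hw n).continuous_fderiv (by simp)).clm_apply continuous_const
  have uK := u1 _ hK hKU
  have gK := g1 _ hK hKU
  have m1 : ∀ k, AEStronglyMeasurable (fun q => w (n k) q - u q) (volume.restrict (I ×ˢ J)) :=
    fun k => (hw _).continuous.aestronglyMeasurable.sub uK.1
  have m2 : ∀ k, AEStronglyMeasurable (fun q => fderiv ℝ (w (n k)) q plateX - g q)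
      (volume.restrict (I ×ˢ J)) := fun k => (hwd _).aestronglyMeasurable.sub gK.1
  have t1 := ae_tendsto_lintegral_slice (fun k => (m1 k).enorm) fun k => by
    simpa [eLpNorm_one_eq_lintegral_enorm] using hn1 k
  have t2 := ae_tendsto_lintegral_slice (fun k => (m2 k).enorm) fun k => by
    simpa [eLpNorm_one_eq_lintegral_enorm] using hn2 k
  have hr : (volume : Measure (ℝ × ℝ)).restrict (I ×ˢ J)
      = (volume.restrict I).prod (volume.restrict J) := (Measure.prod_restrict I J).symm
  rw [hr] at uK gK
  filter_upwards [t1, t2, (memLp_one_iff_integrable.1 uK).prod_left_ae,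
    (memLp_one_iff_integrable.1 gK).prod_left_ae] with t h1 h2 h3 h4
  refine ⟨h3, h4, fun φ hφ hφc hφI => ?_⟩
  have hφd : Continuous fun x => fderiv ℝ φ x 1 :=
    (hφ.continuous_fderiv (by simp)).clm_apply continuous_const
  have s1 := tendsto_integral_mul_of_eLpNorm (p := 1) (q := ⊤) (l := atTop)
    (memLp_restrict_of_continuous hI hφd) (memLp_one_iff_integrable.2 h3)
    (fun k => memLp_restrict_of_continuous hI (contDiff_slice (hw (n k)) t).continuous)
    (by simpa [eLpNorm_one_eq_lintegral_enorm] using h1)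
  have s2 := tendsto_integral_mul_of_eLpNorm (p := 1) (q := ⊤) (l := atTop)
    (memLp_restrict_of_continuous hI hφ.continuous) (memLp_one_iff_integrable.2 h4)
    (w := fun k x => fderiv ℝ (w (n k)) (x, t) plateX)
    (fun k => memLp_restrict_of_continuous hI ((hwd (n k)).comp (by fun_prop)))
    (by simpa [eLpNorm_one_eq_lintegral_enorm] using h2)
  have hF : ∀ H : ℝ → ℝ, (∀ q, φ =ᶠ[𝓝 q] 0 → H q = 0) → ∫ q, H q = ∫ q in I, H q := fun H hH =>
    (setIntegral_eq_of_tsupport_subset (U := I) (φ := φ) hφI hH).symm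
  have key : ∀ k, ∫ x in I, fderiv ℝ φ x 1 * w (n k) (x, t)
      = - ∫ x in I, φ x * fderiv ℝ (w (n k)) (x, t) plateX := fun k => by
    have := (hasWeakDeriv_of_contDiff (U := univ) (e := (1 : ℝ))
      ((contDiff_slice (hw (n k)) t).of_le (by simp))).integral_eq hφ hφc (subset_univ _)
    simp only [fderiv_slice ((hw (n k)).differentiable (by simp))] at this
    rw [hF, hF] at this
    · simpa only [mul_comm] using this
    · intro q hq; simp [hq.eq_of_nhds]
    · intro q hq; simp [fderiv_apply_eq_zero_of_eventuallyEq hq]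
  simp only [key] at s1
  have := tendsto_nhds_unique s1 s2.neg
  rw [hF, hF]
  · simpa only [mul_comm] using this
  · intro q hq; simp [hq.eq_of_nhds]
  · intro q hq; simp [fderiv_apply_eq_zero_of_eventuallyEq hq]

/-- Almost every slice of a weakly differentiable function of `(x,t)` is weakly differentiable in
`x`. -/
theorem HasWeakDeriv.ae_slice (h : HasWeakDeriv (slab a b) plateX u g) :
    ∀ᵐ t ∂volume.restrict (Ioo a b),
      HasWeakDeriv univ (1 : ℝ) (fun x => u (x, t)) (fun x => g (x, t)) := by
  have hall : ∀ m : ℕ, ∀ᵐ t, t ∈ Icc (a + 1 / (m + 1)) (b - 1 / (m + 1)) →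
      IntegrableOn (fun x => u (x, t)) (Icc (-(m : ℝ)) m) ∧
      IntegrableOn (fun x => g (x, t)) (Icc (-(m : ℝ)) m) ∧
      ∀ φ : ℝ → ℝ, ContDiff ℝ ∞ φ → HasCompactSupport φ → tsupport φ ⊆ Icc (-(m : ℝ)) m →
        ∫ x, u (x, t) * fderiv ℝ φ x 1 = - ∫ x, g (x, t) * φ x := fun m => by
    rw [← ae_restrict_iff' measurableSet_Icc]
    refine h.ae_slice_on isCompact_Icc isCompact_Icc fun t ht => ?_
    have : (0 : ℝ) < 1 / (m + 1) := by positivity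
    constructor <;> linarith [ht.1, ht.2]
  rw [← ae_all_iff] at hall
  filter_upwards [ae_restrict_of_ae hall, ae_restrict_mem measurableSet_Ioo] with t ht htab
  have hev : ∀ᶠ m : ℕ in atTop, t ∈ Icc (a + 1 / ((m : ℝ) + 1)) (b - 1 / (m + 1)) := by
    have hδ : 0 < min (t - a) (b - t) := lt_min (by linarith [htab.1]) (by linarith [htab.2])
    filter_upwards [tendsto_one_div_add_atTop_nhds_zero_nat.eventually (gt_mem_nhds hδ)] with m hm
    have h1 := hm.trans_le (min_le_left _ _)
    have h2 := hm.trans_le (min_le_right _ _)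
    constructor <;> linarith
  have hbig : ∀ K : Set ℝ, IsCompact K → ∃ m : ℕ, K ⊆ Icc (-(m : ℝ)) m ∧
      t ∈ Icc (a + 1 / ((m : ℝ) + 1)) (b - 1 / (m + 1)) := fun K hK => by
    obtain ⟨C, hC⟩ := hK.isBounded.subset_closedBall 0
    obtain ⟨m, hm1, hm2⟩ := (hev.and (eventually_ge_atTop ⌈C⌉₊)).exists
    refine ⟨m, fun x hx => ?_, hm1⟩
    have h1 : |x| ≤ C := by simpa using hC hx
    have h2 : C ≤ m := (Nat.le_ceil C).trans (by exact_mod_cast hm2)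
    exact abs_le.1 (h1.trans h2)
  refine .of_integral_eq ?_ ?_ fun φ h1 h2 _ => ?_
  · refine (locallyIntegrableOn_iff isOpen_univ.isLocallyClosed).2 fun K _ hK => ?_
    obtain ⟨m, hm1, hm2⟩ := hbig K hK
    exact (ht m hm2).1.mono_set hm1
  · refine (locallyIntegrableOn_iff isOpen_univ.isLocallyClosed).2 fun K _ hK => ?_
    obtain ⟨m, hm1, hm2⟩ := hbig K hK
    exact (ht m hm2).2.1.mono_set hm1
  · obtain ⟨m, hm1, hm2⟩ := hbig _ h2.isCompact
    exact (ht m hm2).2.2 φ h1 h2 hm1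

/-- Conversely, a function is weakly differentiable in `x` if almost all of its slices are. -/
theorem hasWeakDeriv_of_ae_slice (hu : LocallyIntegrableOn u (slab a b) volume)
    (hg : LocallyIntegrableOn g (slab a b) volume)
    (h : ∀ᵐ t ∂volume.restrict (Ioo a b),
      HasWeakDeriv univ (1 : ℝ) (fun x => u (x, t)) (fun x => g (x, t))) :
    HasWeakDeriv (slab a b) plateX u g := by
  refine .of_integral_eq hu hg fun φ h1 h2 h3 => ?_
  have i1 := integrable_mul_test_fderiv (e := plateX) hu (h1.of_le (by simp)) h2 h3
  have i2 := integrable_mul_test hg h1.continuous h2 h3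
  have e1 : ∫ q, u q * fderiv ℝ φ q plateX = ∫ t, ∫ x, u (x, t) * fderiv ℝ φ (x, t) plateX :=
    integral_prod_symm _ i1
  have e2 : ∫ q, g q * φ q = ∫ t, ∫ x, g (x, t) * φ (x, t) := integral_prod_symm _ i2
  rw [e1, e2, ← integral_neg]
  refine integral_congr_ae ?_
  rw [ae_restrict_iff' measurableSet_Ioo] at h
  filter_upwards [h] with t ht
  by_cases htab : t ∈ Ioo a b
  · have hc : HasCompactSupport (fun x => φ (x, t)) :=
      HasCompactSupport.intro (h2.isCompact.image continuous_fst) fun x hx =>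
        image_eq_zero_of_notMem_tsupport fun hxt => hx ⟨_, hxt, rfl⟩
    have := (ht htab).integral_eq (contDiff_slice h1 t) hc (subset_univ _)
    simpa only [fderiv_slice (h1.differentiable (by simp))] using this
  · have h0 : ∀ x, φ =ᶠ[𝓝 (x, t)] 0 := fun x =>
      notMem_tsupport_iff_eventuallyEq.1 fun hx => htab (h3 hx).2
    have z1 : ∀ x, φ (x, t) = 0 := fun x => (h0 x).eq_of_nhds
    have z2 : ∀ x, fderiv ℝ φ (x, t) plateX = 0 := fun x =>
      fderiv_apply_eq_zero_of_eventuallyEq (h0 x)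
    simp [z1, z2]

end Slices

/-! ### Extension of the displacement to negative times -/

section Invariant

variable {E : Type*} [NormedAddCommGroup E] [NormedSpace ℝ E] [FiniteDimensional ℝ E]
  [MeasureSpace E] [BorelSpace E] [(volume : Measure E).IsAddHaarMeasure]
  {U : Set E} {e : E} {u v g k : E → ℝ}

/-- A function that is invariant in the direction `e` has weak derivative zero in it. -/
theorem hasWeakDeriv_zero_of_invariant (hu : LocallyIntegrableOn u U volume)
    (hinv : ∀ q (s : ℝ), u (q + s • e) = u q) : HasWeakDeriv U e u (fun _ => 0) := by
  refine .of_integral_eq hu (locallyIntegrableOn_zero) fun φ h1 h2 h3 => ?_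
  have := integral_bilinear_hasLineDerivAt_right_eq_neg_left_of_integrable (μ := volume)
    (f := u) (f' := fun _ => 0) (g := φ) (g' := fun q => fderiv ℝ φ q e) (v := e)
    (B := ContinuousLinearMap.mul ℝ ℝ) (by simp)
    (integrable_mul_test_fderiv hu (h1.of_le (by simp)) h2 h3)
    (integrable_mul_test hu h1.continuous h2 h3)
    (fun q _ => by
      have : (fun s : ℝ => u (q + s • e)) = fun _ => u q := funext fun s => hinv q s
      rw [HasLineDerivAt, this]
      exact hasDerivAt_const _ _)
    (fun q _ => (h1.differentiable (by simp) q).hasFDerivAt.hasLineDerivAt e)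
  simpa using this

end Invariant

/-- A smooth step: `0` on `(-∞, 1/2]` and `1` on `[1, ∞)`. -/
def step (s : ℝ) : ℝ := Real.smoothTransition (2 * s - 1)

lemma step_contDiff : ContDiff ℝ ∞ step :=
  (Real.smoothTransition.contDiff (n := ⊤)).comp
    ((contDiff_const.mul contDiff_id).sub contDiff_const)

lemma step_of_le {s : ℝ} (h : s ≤ 1 / 2) : step s = 0 :=
  Real.smoothTransition.zero_of_nonpos (by linarith)

lemma step_of_ge {s : ℝ} (h : 1 ≤ s) : step s = 1 :=
  Real.smoothTransition.one_of_one_le (by linarith)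

lemma step_nonneg (s : ℝ) : 0 ≤ step s := Real.smoothTransition.nonneg _

lemma step_le_one (s : ℝ) : step s ≤ 1 := Real.smoothTransition.le_one _

lemma step_monotone : Monotone step := fun s t h => Real.smoothTransition.monotone (by linarith)

lemma continuous_deriv_step : Continuous (deriv step) := step_contDiff.continuous_deriv (by simp)

lemma deriv_step_nonneg (s : ℝ) : 0 ≤ deriv step s := step_monotone.deriv_nonneg

lemma deriv_step_of_lt {s : ℝ} (h : s < 1 / 2) : deriv step s = 0 := by
  have : step =ᶠ[𝓝 s] fun _ => 0 := by
    filter_upwards [gt_mem_nhds h] with t ht using step_of_le ht.le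
  rw [this.deriv_eq]; simp

lemma deriv_step_of_gt {s : ℝ} (h : 1 < s) : deriv step s = 0 := by
  have : step =ᶠ[𝓝 s] fun _ => 1 := by
    filter_upwards [lt_mem_nhds h] with t ht using step_of_ge ht.le
  rw [this.deriv_eq]; simp

lemma exists_bound_deriv_step : ∃ C, 0 < C ∧ ∀ s, deriv step s ≤ C := by
  obtain ⟨C, hC⟩ := (isCompact_Icc (a := (0 : ℝ)) (b := 2)).exists_bound_of_continuousOn
    continuous_deriv_step.continuousOn
  refine ⟨max C 1, by positivity, fun s => ?_⟩
  by_cases hs : s ∈ Icc (0 : ℝ) 2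
  · exact (le_abs_self _).trans ((hC s hs).trans (le_max_left _ _))
  · have : deriv step s = 0 := by
      by_cases h : s < 1 / 2
      · exact deriv_step_of_lt h
      · exact deriv_step_of_gt (by
          by_contra h1
          exact hs ⟨by linarith [not_lt.1 h], by linarith [not_lt.1 h1]⟩)
    rw [this]; positivity

section Glue

variable {a b : ℝ} {u g : ℝ × ℝ → ℝ}

/-- One side of the gluing argument: a test function may be cut off near `t = 0`. -/
lemma HasWeakDeriv.integral_step_mul {V : Set (ℝ × ℝ)} {c : ℝ} (h : HasWeakDeriv V plateT u g)
    {φ : ℝ × ℝ → ℝ} (h1 : ContDiff ℝ ∞ φ) (h2 : HasCompactSupport φ)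
    (hV : ∀ q ∈ tsupport φ, 1 / 2 ≤ c * q.2 → q ∈ V) :
    ∫ q, u q * (step (c * q.2) * fderiv ℝ φ q plateT + φ q * (c * deriv step (c * q.2)))
      = - ∫ q, g q * (step (c * q.2) * φ q) := by
  have hs : ContDiff ℝ ∞ (fun t => step (c * t)) := step_contDiff.comp (contDiff_const.mul contDiff_id)
  have hs2 : ContDiff ℝ ∞ (fun q : ℝ × ℝ => step (c * q.2)) := hs.comp contDiff_snd
  have hts : tsupport (fun q : ℝ × ℝ => step (c * q.2) * φ q) ⊆ V := by
    intro q hq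
    refine hV q (tsupport_mul_subset_right hq) ?_
    have : q ∈ closure {q : ℝ × ℝ | 1 / 2 ≤ c * q.2} := by
      refine closure_mono (fun q' hq' => ?_) hq
      by_contra hlt
      exact hq' (by simp [step_of_le (not_le.1 hlt).le])
    rwa [(isClosed_le continuous_const (by fun_prop)).closure_eq] at this
  have := h.integral_eq (hs2.mul h1) h2.mul_left hts
  rw [← this]
  refine integral_congr_ae (Eventually.of_forall fun q => ?_)
  simp only
  rw [fderiv_fun_mul (hs2.differentiable (by simp) q) (h1.differentiable (by simp) q)]
  have hd : deriv (fun t => step (c * t)) q.2 = c * deriv step (c * q.2) := by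
    have := ((step_contDiff.differentiable (by simp) (c * q.2)).hasDerivAt.comp q.2
      ((hasDerivAt_id q.2).const_mul c)).deriv
    have h' : deriv (fun t => step (c * t)) q.2 = _ := this
    rw [h']; simp; ring
  have hq := hasFDerivAt_comp_snd (e := plateT) hs q
  rw [hd] at hq
  rw [add_apply, smul_apply, smul_apply, hq]
  simp [plateT]

/-- A weak time derivative extends across `t = 0` if the function is continuous and vanishes
there. -/
lemma hasWeakDeriv_glue_of_zero (ha : a < 0) (hb : 0 < b) (hc : ContinuousOn u (slab a b))
    (h0 : ∀ x, u (x, 0) = 0) (hm : HasWeakDeriv (slab a 0) plateT u g)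
    (hp : HasWeakDeriv (slab 0 b) plateT u g) (hg : LocallyIntegrableOn g (slab a b) volume) :
    HasWeakDeriv (slab a b) plateT u g := by
  have hu : LocallyIntegrableOn u (slab a b) volume :=
    hc.locallyIntegrableOn isOpen_slab.measurableSet
  refine .of_integral_eq hu hg fun φ h1 h2 h3 => ?_
  have i1 := integrable_mul_test_fderiv (e := plateT) hu (h1.of_le (by simp)) h2 h3
  have i2 := integrable_mul_test hg h1.continuous h2 h3
  have i3 := integrable_mul_test hu h1.continuous h2 h3
  obtain ⟨C, hC0, hC⟩ := exists_bound_deriv_step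
  obtain ⟨B, hB⟩ := h2.exists_bound_of_continuous h1.continuous
  have hB0 : 0 ≤ B := (norm_nonneg _).trans (hB 0)
  obtain ⟨R, hR0, hR⟩ := h2.isCompact.isBounded.subset_closedBall_lt 0 0
  have hRx : ∀ q, φ q ≠ 0 → q.1 ∈ Icc (-R) R := fun q hq => by
    have : q ∈ Metric.closedBall (0 : ℝ × ℝ) R := hR (subset_tsupport φ hq)
    rw [mem_closedBall_zero_iff] at this
    exact abs_le.1 ((norm_fst_le q).trans this)
  set c : ℕ → ℝ := fun n => (n : ℝ) + 1 with hcdef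
  have hcpos : ∀ n, 0 < c n := fun n => by positivity
  have hct : Tendsto c atTop atTop :=
    tendsto_atTop_add_const_right _ _ tendsto_natCast_atTop_atTop
  -- `ζ n` vanishes near `t = 0` and is one for `|t| ≥ 1 / c n`; its derivative is of order `c n`, but
  -- on an interval of length `2 / c n` on which `u` is small
  set ζ : ℕ → ℝ → ℝ := fun n t => step (c n * t) + step (-c n * t) with hζ
  set ζ' : ℕ → ℝ → ℝ := fun n t => c n * deriv step (c n * t) + -c n * deriv step (-c n * t) with hζ'
  have hζc : ∀ n, Continuous (ζ n) := fun n =>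
    (step_contDiff.continuous.comp (by fun_prop)).add (step_contDiff.continuous.comp (by fun_prop))
  have hζ'c : ∀ n, Continuous (ζ' n) := fun n =>
    (continuous_const.mul (continuous_deriv_step.comp (by fun_prop))).add
      (continuous_const.mul (continuous_deriv_step.comp (by fun_prop)))
  have hζb : ∀ n t, ‖ζ n t‖ ≤ 2 := fun n t => by
    rw [Real.norm_of_nonneg (add_nonneg (step_nonneg _) (step_nonneg _))]
    linarith [step_le_one (c n * t), step_le_one (-c n * t)]
  have hζ1 : ∀ t, t ≠ 0 → ∀ᶠ n in atTop, ζ n t = 1 := fun t ht => by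
    rcases lt_or_gt_of_ne ht with h | h
    · filter_upwards [(hct.atTop_mul_const (neg_pos.2 h)).eventually_ge_atTop 1] with n hn
      simp only [hζ]
      rw [step_of_le (by nlinarith [hcpos n]), step_of_ge (by linarith), zero_add]
    · filter_upwards [(hct.atTop_mul_const h).eventually_ge_atTop 1] with n hn
      simp only [hζ]
      rw [step_of_ge hn, step_of_le (by nlinarith [hcpos n]), add_zero]
  have key : ∀ n, (∫ q, ζ n q.2 * (u q * fderiv ℝ φ q plateT)) + ∫ q, ζ' n q.2 * (u q * φ q)
      = - ∫ q, ζ n q.2 * (g q * φ q) := fun n => by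
    have k1 := hp.integral_step_mul (c := c n) h1 h2 fun q hq hq2 => by
      refine ⟨trivial, ?_, (h3 hq).2.2⟩
      by_contra hn
      nlinarith [hcpos n, not_lt.1 hn]
    have k2 := hm.integral_step_mul (c := -c n) h1 h2 fun q hq hq2 => by
      refine ⟨trivial, (h3 hq).2.1, ?_⟩
      by_contra hn
      nlinarith [hcpos n, not_lt.1 hn]
    have sb : ∀ c : ℝ, ∀ {w : ℝ × ℝ → ℝ}, Integrable w → Integrable fun q => step (c * q.2) * w q :=
      fun c w hw => hw.bdd_mul (c := 1)
        (step_contDiff.continuous.comp (by fun_prop)).aestronglyMeasurable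
        (Eventually.of_forall fun q => by
          rw [Real.norm_of_nonneg (step_nonneg _)]; exact step_le_one _)
    have sd : ∀ c : ℝ, ∀ {w : ℝ × ℝ → ℝ}, Integrable w →
        Integrable fun q => (c * deriv step (c * q.2)) * w q :=
      fun c w hw => hw.bdd_mul (c := |c| * C)
        (continuous_const.mul (continuous_deriv_step.comp (by fun_prop))).aestronglyMeasurable
        (Eventually.of_forall fun q => by
          rw [norm_mul, Real.norm_of_nonneg (deriv_step_nonneg _), Real.norm_eq_abs]
          exact mul_le_mul_of_nonneg_left (hC _) (abs_nonneg _))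
    have m1 : ∀ c : ℝ,
        ∫ q, u q * (step (c * q.2) * fderiv ℝ φ q plateT + φ q * (c * deriv step (c * q.2)))
        = (∫ q, step (c * q.2) * (u q * fderiv ℝ φ q plateT))
          + ∫ q, (c * deriv step (c * q.2)) * (u q * φ q) := fun c => by
      rw [← integral_add (sb c i1) (sd c i3)]
      exact integral_congr_ae (Eventually.of_forall fun q => by ring)
    have m2 : ∀ c : ℝ, ∫ q, g q * (step (c * q.2) * φ q) = ∫ q, step (c * q.2) * (g q * φ q) :=
      fun c => integral_congr_ae (Eventually.of_forall fun q => by ring)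
    rw [m1, m2] at k1 k2
    simp only [hζ, hζ', add_mul]
    rw [integral_add (sb _ i1) (sb _ i1), integral_add (sd _ i3) (sd _ i3),
      integral_add (sb _ i2) (sb _ i2)]
    linarith
  have hne : ∀ᵐ q : ℝ × ℝ, q.2 ≠ 0 :=
    (Measure.quasiMeasurePreserving_snd (μ := (volume : Measure ℝ))
      (ν := (volume : Measure ℝ))).ae (p := fun t : ℝ => t ≠ 0) (by simp [ae_iff])
  have lim : ∀ {w : ℝ × ℝ → ℝ}, Integrable w →
      Tendsto (fun n => ∫ q, ζ n q.2 * w q) atTop (𝓝 (∫ q, w q)) := fun {w} hw => by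
    refine tendsto_integral_of_dominated_convergence (fun q => 2 * ‖w q‖) (fun n => ?_)
      (hw.norm.const_mul 2) (fun n => ?_) ?_
    · exact ((hζc n).comp continuous_snd).aestronglyMeasurable.mul hw.1
    · exact Eventually.of_forall fun q => by
        rw [norm_mul]; exact mul_le_mul_of_nonneg_right (hζb _ _) (norm_nonneg _)
    · filter_upwards [hne] with q hq
      refine tendsto_const_nhds.congr' ?_
      filter_upwards [hζ1 _ hq] with n hn
      rw [hn, one_mul]
  have lim0 : Tendsto (fun n => ∫ q, ζ' n q.2 * (u q * φ q)) atTop (𝓝 0) := by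
    -- `u` is uniformly small near `t = 0` on the support of the test function
    set r := min (-a) b / 2 with hr
    have hr0 : 0 < r := by
      have : 0 < min (-a) b := lt_min (by linarith) hb
      positivity
    have hra : r < -a := by
      have := min_le_left (-a) b
      have : 0 < min (-a) b := lt_min (by linarith) hb
      linarith
    have hrb : r < b := by
      have := min_le_right (-a) b
      have : 0 < min (-a) b := lt_min (by linarith) hb
      linarith
    have hK : IsCompact (Icc (-R) R ×ˢ Icc (-r) r) := isCompact_Icc.prod isCompact_Icc
    have hKs : Icc (-R) R ×ˢ Icc (-r) r ⊆ slab a b := fun q hq =>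
      ⟨trivial, by linarith [hq.2.1], by linarith [hq.2.2]⟩
    have huc := hK.uniformContinuousOn_of_continuous (hc.mono hKs)
    rw [Metric.tendsto_atTop]
    intro ε hε
    set ε' := ε / (8 * R * C * (B + 1)) with hε'
    have hε'0 : 0 < ε' := by positivity
    obtain ⟨δ, hδ, hδu⟩ := Metric.uniformContinuousOn_iff.1 huc ε' hε'0
    obtain ⟨N, hN⟩ := (hct.eventually_gt_atTop (1 / min δ r)).exists_forall_of_atTop
    refine ⟨N, fun n hn => ?_⟩
    have hmin : 0 < min δ r := lt_min hδ hr0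
    have hn1 : 1 / c n < min δ r := (one_div_lt (hcpos n) hmin).2 (hN n hn)
    have hsupp : ∀ q : ℝ × ℝ, q ∉ Icc (-R) R ×ˢ Icc (-(1 / c n)) (1 / c n) →
        ζ' n q.2 * (u q * φ q) = 0 := fun q hq => by
      by_cases hφ : φ q = 0
      · rw [hφ]; ring
      have hq2 : q.2 ∉ Icc (-(1 / c n)) (1 / c n) := fun h => hq ⟨hRx q hφ, h⟩
      have hz : ζ' n q.2 = 0 := by
        simp only [hζ']
        by_cases h : q.2 < -(1 / c n)
        · have h2 : c n * q.2 < -1 := by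
            have := mul_lt_mul_of_pos_left h (hcpos n)
            rwa [mul_neg, mul_one_div_cancel (hcpos n).ne'] at this
          rw [deriv_step_of_lt (by linarith), deriv_step_of_gt (by linarith)]; ring
        · have h1 : 1 / c n < q.2 := by
            by_contra h1
            exact hq2 ⟨not_lt.1 h, not_lt.1 h1⟩
          have h2 : 1 < c n * q.2 := by
            have := mul_lt_mul_of_pos_left h1 (hcpos n)
            rwa [mul_one_div_cancel (hcpos n).ne'] at this
          rw [deriv_step_of_gt h2, deriv_step_of_lt (by linarith)]; ring
      rw [hz, zero_mul]
    rw [dist_zero_right, ← setIntegral_eq_integral_of_forall_compl_eq_zero hsupp]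
    have hbound : ∀ q ∈ Icc (-R) R ×ˢ Icc (-(1 / c n)) (1 / c n),
        ‖ζ' n q.2 * (u q * φ q)‖ ≤ 2 * c n * C * (ε' * B) := fun q hq => by
      have hz : ‖ζ' n q.2‖ ≤ 2 * c n * C := by
        refine (norm_add_le _ _).trans ?_
        rw [norm_mul, norm_mul, norm_neg, Real.norm_of_nonneg (hcpos n).le,
          Real.norm_of_nonneg (deriv_step_nonneg _), Real.norm_of_nonneg (deriv_step_nonneg _)]
        nlinarith [hC (c n * q.2), hC (-c n * q.2), hcpos n,
          mul_le_mul_of_nonneg_left (hC (c n * q.2)) (hcpos n).le,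
          mul_le_mul_of_nonneg_left (hC (-c n * q.2)) (hcpos n).le]
      have hq2 : |q.2| < min δ r := (abs_le.2 hq.2).trans_lt hn1
      have hq2r : q.2 ∈ Icc (-r) r := abs_le.1 (hq2.le.trans (min_le_right _ _))
      have hu : ‖u q‖ ≤ ε' := by
        have := hδu q ⟨hq.1, hq2r⟩ (q.1, 0) ⟨hq.1, by constructor <;> linarith⟩ (by
          rw [Prod.dist_eq]
          simp only [dist_self]
          rw [Real.dist_eq, sub_zero]
          exact max_lt hδ (hq2.trans_le (min_le_left _ _)))
        rw [h0, dist_zero_right] at this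
        exact this.le
      rw [norm_mul, norm_mul]
      exact mul_le_mul hz (mul_le_mul hu (hB q) (norm_nonneg _) hε'0.le) (by positivity)
        (by have := hcpos n; positivity)
    have hvol : (volume : Measure (ℝ × ℝ)).real (Icc (-R) R ×ˢ Icc (-(1 / c n)) (1 / c n))
        = 2 * R * (2 / c n) := by
      rw [Measure.volume_eq_prod, measureReal_prod_prod, Real.volume_real_Icc_of_le (by linarith),
        Real.volume_real_Icc_of_le (by have := hcpos n; have : 0 < 1 / c n := by positivity
                                       linarith)]
      ring
    have hfin : (volume : Measure (ℝ × ℝ)) (Icc (-R) R ×ˢ Icc (-(1 / c n)) (1 / c n)) < ⊤ :=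
      (isCompact_Icc.prod isCompact_Icc).measure_lt_top
    refine (norm_setIntegral_le_of_norm_le_const hfin hbound).trans_lt ?_
    rw [hvol]
    have hcn := (hcpos n).ne'
    have : 2 * c n * C * (ε' * B) * (2 * R * (2 / c n)) = ε * (B / (B + 1)) := by
      rw [hε']; field_simp; ring
    rw [this]
    have : B / (B + 1) < 1 := by rw [div_lt_one (by positivity)]; linarith
    nlinarith
  have l1 := (lim i1).add lim0
  have l2 := (lim i2).neg
  simp only [key] at l1
  have := tendsto_nhds_unique l1 l2
  rw [add_zero] at this
  exact this

/-- A weak time derivative extends across `t = 0` if the function is continuous. -/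
theorem hasWeakDeriv_glue (ha : a < 0) (hb : 0 < b) (hc : ContinuousOn u (slab a b))
    (hm : HasWeakDeriv (slab a 0) plateT u g)
    (hp : HasWeakDeriv (slab 0 b) plateT u g) (hg : LocallyIntegrableOn g (slab a b) volume) :
    HasWeakDeriv (slab a b) plateT u g := by
  have hc0 : Continuous fun x : ℝ => u (x, 0) := by
    rw [← continuousOn_univ]
    exact hc.comp (by fun_prop) fun x _ => ⟨trivial, ha, hb⟩
  have hc1 : Continuous fun q : ℝ × ℝ => u (q.1, 0) := hc0.comp continuous_fst
  have h0 : ∀ V : Set (ℝ × ℝ),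
      HasWeakDeriv V plateT (fun q : ℝ × ℝ => u (q.1, 0)) (fun _ => 0) := fun V =>
    hasWeakDeriv_zero_of_invariant (hc1.locallyIntegrable.locallyIntegrableOn V)
      fun q s => by simp [plateT]
  have h1 : HasWeakDeriv (slab a b) plateT (fun q => u q - u (q.1, 0)) g := by
    refine hasWeakDeriv_glue_of_zero ha hb (hc.sub hc1.continuousOn) (fun x => by simp) ?_ ?_ hg
    · simpa using hm.sub (h0 _)
    · simpa using hp.sub (h0 _)
  simpa using h1.add (h0 _)

end Glue

section TimeExt

variable {a b : ℝ} {u g : ℝ × ℝ → ℝ} {φ ψ : ℝ → ℝ}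

/-- The extension of a function of `(x,t)`, `t > 0`, by a function of `x` to times `t ≤ 0`. -/
def timeExt (u : ℝ × ℝ → ℝ) (φ : ℝ → ℝ) (q : ℝ × ℝ) : ℝ := if 0 < q.2 then u q else φ q.1

lemma timeExt_of_pos {q : ℝ × ℝ} (h : 0 < q.2) : timeExt u φ q = u q := if_pos h

lemma timeExt_of_nonpos {q : ℝ × ℝ} (h : q.2 ≤ 0) : timeExt u φ q = φ q.1 := if_neg h.not_gt

lemma CellL2.timeExt (hu : CellL2 (slab 0 b) u)
    (hφ : ∀ᵐ x, φ (x + 1) = φ x) (hφ2 : MemLp φ 2 (volume.restrict (Ioo 0 1))) :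
    CellL2 (slab a b) (timeExt u φ) := by
  constructor
  · have h1 := hu.1
    rw [AEPeriodic, ae_restrict_iff' isOpen_slab.measurableSet] at h1 ⊢
    have h2 : ∀ᵐ q : ℝ × ℝ, φ (q.1 + 1) = φ q.1 :=
      (Measure.quasiMeasurePreserving_fst (μ := (volume : Measure ℝ))
        (ν := (volume : Measure ℝ))).ae (p := fun x : ℝ => φ (x + 1) = φ x) hφ
    filter_upwards [h1, h2] with q h1 h2 hq
    by_cases h : 0 < q.2
    · rw [timeExt_of_pos (by simpa using h), timeExt_of_pos h]
      exact h1 ⟨trivial, h, hq.2.2⟩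
    · rw [timeExt_of_nonpos (by simpa using h), timeExt_of_nonpos (not_lt.1 h)]
      exact h2
  · rw [xCell_slab]
    have hs : MeasurableSet {q : ℝ × ℝ | 0 < q.2} := measurableSet_lt (by fun_prop) (by fun_prop)
    classical
    have hpw : ThinFSI.timeExt u φ = {q : ℝ × ℝ | 0 < q.2}.piecewise u (fun q => φ q.1) := by
      ext q
      by_cases h : 0 < q.2
      · rw [timeExt_of_pos h, piecewise_eq_of_mem {q : ℝ × ℝ | 0 < q.2} _ _ h]
      · rw [timeExt_of_nonpos (not_lt.1 h), piecewise_eq_of_notMem {q : ℝ × ℝ | 0 < q.2} _ _ h]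
    rw [hpw]
    have h2 := hu.2
    rw [xCell_slab] at h2
    refine MemLp.piecewise hs ?_ ?_
    · rw [Measure.restrict_restrict hs]
      have hsub : {q : ℝ × ℝ | 0 < q.2} ∩ Ioo 0 1 ×ˢ Ioo a b ⊆ Ioo 0 1 ×ˢ Ioo 0 b :=
        fun q hq => ⟨hq.2.1, hq.1, hq.2.2.2⟩
      exact h2.mono_measure (Measure.restrict_mono hsub le_rfl)
    · have : MemLp (fun q : ℝ × ℝ => φ q.1) 2
          ((volume.restrict (Ioo 0 1)).prod (volume.restrict (Ioo a b))) := hφ2.comp_fst _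
      rw [Measure.prod_restrict] at this
      exact this.mono_measure (Measure.restrict_le_self)

lemma timeExt_hasWeakDeriv_x (h : HasWeakDeriv (slab 0 b) plateX u g)
    (hφ : HasWeakDeriv univ (1 : ℝ) φ ψ)
    (u2 : CellL2 (slab a b) (timeExt u φ)) (g2 : CellL2 (slab a b) (timeExt g ψ)) :
    HasWeakDeriv (slab a b) plateX (timeExt u φ) (timeExt g ψ) := by
  have hm := (isOpen_slab (a := a) (b := b)).measurableSet
  refine hasWeakDeriv_of_ae_slice
    ((locallyIntegrableOn_iff_memLpLoc isOpen_slab).2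
      ((u2.memLpLoc hm isXPeriodic_slab).of_le (by norm_num)))
    ((locallyIntegrableOn_iff_memLpLoc isOpen_slab).2
      ((g2.memLpLoc hm isXPeriodic_slab).of_le (by norm_num))) ?_
  have h1 := h.ae_slice
  rw [ae_restrict_iff' measurableSet_Ioo] at h1 ⊢
  filter_upwards [h1] with t h1 ht
  by_cases h : 0 < t
  · simpa only [timeExt_of_pos (q := (_, t)) h] using h1 ⟨h, ht.2⟩
  · simpa only [timeExt_of_nonpos (q := (_, t)) (not_lt.1 h)] using hφ

lemma timeExt_hasWeakDeriv_t (ha : a < 0) (hb : 0 < b) (h : HasWeakDeriv (slab 0 b) plateT u g)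
    (hc : ContinuousOn u (univ ×ˢ Icc 0 b)) (h0 : ∀ x, u (x, 0) = φ x)
    (g2 : CellL2 (slab a b) (timeExt g 0)) :
    HasWeakDeriv (slab a b) plateT (timeExt u φ) (timeExt g 0) := by
  have hm := (isOpen_slab (a := a) (b := b)).measurableSet
  have hφc : Continuous φ := by
    have : φ = fun x => u (x, 0) := funext fun x => (h0 x).symm
    rw [this, ← continuousOn_univ]
    exact hc.comp (by fun_prop) fun x _ => ⟨trivial, le_rfl, hb.le⟩
  refine hasWeakDeriv_glue ha hb ?_ ?_ ?_
    ((locallyIntegrableOn_iff_memLpLoc isOpen_slab).2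
      ((g2.memLpLoc hm isXPeriodic_slab).of_le (by norm_num)))
  · have : ContinuousOn (fun q : ℝ × ℝ => u (q.1, max q.2 0)) (slab a b) :=
      hc.comp (by fun_prop) fun q hq => ⟨trivial, le_max_right _ _, max_le hq.2.2.le hb.le⟩
    refine this.congr fun q hq => ?_
    beta_reduce
    by_cases h : 0 < q.2
    · rw [timeExt_of_pos h, max_eq_left h.le]
    · rw [timeExt_of_nonpos (not_lt.1 h), max_eq_right (not_lt.1 h), h0]
  · refine (hasWeakDeriv_zero_of_invariant (u := fun q : ℝ × ℝ => φ q.1) (e := plateT)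
      ((hφc.comp continuous_fst).locallyIntegrable.locallyIntegrableOn _)
      fun q s => by simp [plateT]).congr ?_ ?_ <;>
    · filter_upwards [ae_restrict_mem isOpen_slab.measurableSet] with q hq
      rw [timeExt_of_nonpos hq.2.2.le]
      try rfl
  · refine h.congr ?_ ?_ <;>
    · filter_upwards [ae_restrict_mem isOpen_slab.measurableSet] with q hq
      rw [timeExt_of_pos hq.2.1]

end TimeExt

section Bending

variable {a b : ℝ}

/-- Integration over a space-time cell of a function weighted by a function of time. -/
lemma integral_cell_mul_time {I J : Set ℝ} {θ : ℝ → ℝ} {H : ℝ × ℝ → ℝ}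
    (h : IntegrableOn (fun q => θ q.2 * H q) (I ×ˢ J)) :
    ∫ q in I ×ˢ J, θ q.2 * H q = ∫ t in J, θ t * ∫ x in I, H (x, t) := by
  rw [IntegrableOn, Measure.volume_eq_prod, ← Measure.prod_restrict] at h
  rw [Measure.volume_eq_prod, ← Measure.prod_restrict, integral_prod_symm _ h]
  simp only [integral_const_mul]

lemma integrableOn_integral_slice {I J : Set ℝ} {H : ℝ × ℝ → ℝ} (h : IntegrableOn H (I ×ˢ J)) :
    IntegrableOn (fun t => ∫ x in I, H (x, t)) J := by
  rw [IntegrableOn, Measure.volume_eq_prod, ← Measure.prod_restrict] at h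
  exact h.integral_prod_right

/-- The bending energy is bounded by its initial value and the integral of a function of time. Extended
by the initial displacement to negative times, the displacement keeps its weak time derivatives, so
the bending energy may be compared with its value at a negative time. -/
theorem PlateField.exists_bending_le {T : ℝ} (hT : 0 < T) {ηx sx : ℕ → ℝ × ℝ → ℝ}
    {s' : ℝ × ℝ → ℝ} (h : PlateField 0 T ηx sx s') (hc : ContinuousOn (ηx 0) (univ ×ˢ Icc 0 T))
    {φ : ℕ → ℝ → ℝ} (h0 : ∀ x, ηx 0 (x, 0) = φ 0 x)
    (hφ : ∀ k < 2, HasWeakDeriv univ (1 : ℝ) (φ k) (φ (k + 1)))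
    (hφp : ∀ k ≤ 2, ∀ᵐ x, φ k (x + 1) = φ k x)
    (hφ2 : ∀ k ≤ 2, MemLp (φ k) 2 (volume.restrict (Ioo 0 1))) :
    ∃ f : ℝ → ℝ, IntegrableOn f (Ioo 0 T) ∧ ∀ᵐ t ∂volume.restrict (Ioo 0 T),
      ∫ x in Ioo (0 : ℝ) 1, ηx 2 (x, t) ^ 2
        ≤ (∫ x in Ioo (0 : ℝ) 1, φ 2 x ^ 2) + ∫ τ in 0..t, f τ := by
  have h1 : (-1 : ℝ) < 0 := by norm_num
  have hT1 : -1 < T := by linarith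
  have cη : ∀ k ≤ 2, CellL2 (slab (-1) T) (timeExt (ηx k) (φ k)) := fun k hk =>
    (h.cell_η k (by omega)).timeExt (hφp k hk) (hφ2 k hk)
  have cs : ∀ k ≤ 2, CellL2 (slab (-1) T) (timeExt (sx k) 0) := fun k hk =>
    (h.cell_s k hk).timeExt (by simp) (by simp)
  have z : HasWeakDeriv univ (1 : ℝ) 0 0 := by
    have := hasWeakDeriv_of_contDiff (U := (univ : Set ℝ)) (e := (1 : ℝ))
      (contDiff_const (c := (0 : ℝ)) (n := 1))
    simpa [Pi.zero_def] using this
  have dη : ∀ k < 2, HasWeakDeriv (slab (-1) T) plateX (timeExt (ηx k) (φ k))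
      (timeExt (ηx (k + 1)) (φ (k + 1))) := fun k hk =>
    timeExt_hasWeakDeriv_x (h.deriv_η k (by omega)) (hφ k hk) (cη k (by omega))
      (cη (k + 1) (by omega))
  have ds : ∀ k < 2, HasWeakDeriv (slab (-1) T) plateX (timeExt (sx k) 0)
      (timeExt (sx (k + 1)) 0) := fun k hk =>
    timeExt_hasWeakDeriv_x (h.deriv_s k hk) z (cs k (by omega)) (cs (k + 1) (by omega))
  have t0 := timeExt_hasWeakDeriv_t h1 hT h.deriv_t hc h0 (cs 0 (by norm_num))
  have t1 := (dη 0 (by norm_num)).comm t0 (ds 0 (by norm_num))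
  have t2 := (dη 1 (by norm_num)).comm t1 (ds 1 (by norm_num))
  have c2 := cη 2 le_rfl
  have c2' := cs 2 le_rfl
  have hsq := t2.mul_cellL2 isOpen_slab isXPeriodic_slab t2 c2 c2' c2 c2'
  have i1 := c2.integrable_mul c2
  have i2 := (c2.integrable_mul c2').add (c2'.integrable_mul c2)
  set y : ℝ → ℝ := fun t => ∫ x in Ioo (0 : ℝ) 1,
    timeExt (ηx 2) (φ 2) (x, t) * timeExt (ηx 2) (φ 2) (x, t) with hy
  set f : ℝ → ℝ := fun t => ∫ x in Ioo (0 : ℝ) 1,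
    (timeExt (ηx 2) (φ 2) (x, t) * timeExt (sx 2) 0 (x, t)
      + timeExt (sx 2) 0 (x, t) * timeExt (ηx 2) (φ 2) (x, t)) with hf
  have iy : IntegrableOn y (Ioo (-1) T) := by
    rw [xCell_slab] at i1; exact integrableOn_integral_slice i1
  have if' : IntegrableOn f (Ioo (-1) T) := by
    rw [xCell_slab] at i2; exact integrableOn_integral_slice i2
  obtain ⟨S, hS, hSa, hle⟩ := exists_le_add_integral_of_weak hT1 iy if' fun θ hθ _ => by
    have := hsq.integral_slab_t hT1 (c2.1.mul c2.1) hθ i1 i2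
    obtain ⟨C, hC⟩ := hθ.exists_bound
    obtain ⟨C', hC'⟩ := hθ.exists_bound_deriv
    have j1 := integrableOn_test_mul hθ.continuous_deriv hC' i1
    have j2 := integrableOn_test_mul hθ.continuous hC i2
    rw [xCell_slab] at this j1 j2
    have j3 := integral_cell_mul_time j1
    have j4 := integral_cell_mul_time j2
    simp only [Pi.add_apply] at j4
    rw [j3, j4] at this
    exact this.ge
  refine ⟨f, if'.mono_set (Ioo_subset_Ioo_left h1.le), ?_⟩
  have hneg : ∃ s ∈ S, s < 0 := by
    have : ∀ᵐ t ∂volume.restrict (Ioo (-1 : ℝ) 0), t ∈ S :=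
      ae_mono (Measure.restrict_mono (Ioo_subset_Ioo_right hT.le) le_rfl) hSa
    have hne : (volume.restrict (Ioo (-1 : ℝ) 0)) ≠ 0 := by
      simp [Measure.restrict_eq_zero]
    have : NeBot (ae (volume.restrict (Ioo (-1 : ℝ) 0))) := ae_neBot.2 hne
    obtain ⟨s, hs, hs'⟩ := (‹∀ᵐ t ∂volume.restrict (Ioo (-1 : ℝ) 0), t ∈ S›.and
      (ae_restrict_mem measurableSet_Ioo)).exists
    exact ⟨s, hs, hs'.2⟩
  -- compare the times `s < 0 < t`; the extended displacement is constant in time on `(s,0)`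
  obtain ⟨s, hs, hs0⟩ := hneg
  have hS' : ∀ᵐ t ∂volume.restrict (Ioo 0 T), t ∈ S :=
    ae_mono (Measure.restrict_mono (Ioo_subset_Ioo_left h1.le) le_rfl) hSa
  filter_upwards [hS', ae_restrict_mem measurableSet_Ioo] with t ht ht'
  have := hle s hs t ht (by linarith [ht'.1])
  have hyt : y t = ∫ x in Ioo (0 : ℝ) 1, ηx 2 (x, t) ^ 2 := by
    simp only [hy, timeExt_of_pos (q := (_, t)) ht'.1, sq]
  have hys : y s = ∫ x in Ioo (0 : ℝ) 1, φ 2 x ^ 2 := by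
    simp only [hy, timeExt_of_nonpos (q := (_, s)) hs0.le, sq]
  have hfi : ∀ c d, c ∈ Ioo (-1) T → d ∈ Ioo (-1) T → IntervalIntegrable f volume c d :=
    fun c d hc hd => intervalIntegrable_iff.2
      (if'.mono_set (uIoc_subset_uIcc.trans (ordConnected_Ioo.uIcc_subset hc hd)))
  have hsplit := intervalIntegral.integral_add_adjacent_intervals
    (hfi s 0 (hS hs) ⟨h1, hT⟩) (hfi 0 t ⟨h1, hT⟩ (hS ht))
  have hz : ∫ τ in s..0, f τ = 0 := by
    rw [intervalIntegral.integral_of_le hs0.le]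
    refine setIntegral_eq_zero_of_forall_eq_zero fun τ hτ => ?_
    simp only [hf, timeExt_of_nonpos (q := (_, τ)) hτ.2, Pi.zero_apply, mul_zero, zero_mul, add_zero,
      integral_zero]
  rw [hyt, hys, ← hsplit, hz, zero_add] at this
  exact this

end Bending

/-! ### Bounds for the displacement by the bending energy -/

section Bounds

variable {a b : ℝ} {u g : ℝ × ℝ → ℝ}

/-- The `L²` form of the Poincaré inequality on the unit interval, with a pointwise left side. -/
lemma HasWeakDeriv.ae_abs_sub_average_le_sqrt {y f : ℝ → ℝ}
    (h : HasWeakDeriv (Ioo 0 1) (1 : ℝ) y f) (hy : MemLp y 2 (volume.restrict (Ioo 0 1)))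
    (hf : MemLp f 2 (volume.restrict (Ioo 0 1))) :
    ∀ᵐ x ∂volume.restrict (Ioo (0 : ℝ) 1),
      |y x - ∫ s in Ioo (0 : ℝ) 1, y s| ≤ √(∫ s in Ioo (0 : ℝ) 1, f s ^ 2) := by
  have hf1 : IntegrableOn f (Ioo 0 1) := hf.integrable (by norm_num)
  have hy1 : IntegrableOn y (Ioo 0 1) := hy.integrable (by norm_num)
  have hf2 : IntegrableOn (fun x => f x ^ 2) (Ioo 0 1) := hf.integrable_sq
  filter_upwards [h.ae_abs_sub_average_le hy1 hf1] with x hx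
  refine hx.trans (Real.le_sqrt_of_sq_le ?_)
  set m := ∫ s in Ioo (0 : ℝ) 1, |f s| with hm
  have h0 : 0 ≤ ∫ s in Ioo (0 : ℝ) 1, (|f s| - m) ^ 2 := integral_nonneg fun s => sq_nonneg _
  have h1 : ∫ s in Ioo (0 : ℝ) 1, (|f s| - m) ^ 2
      = (∫ s in Ioo (0 : ℝ) 1, f s ^ 2) - 2 * m * m + m ^ 2 := by
    have e : ∀ s, (|f s| - m) ^ 2 = f s ^ 2 - 2 * m * |f s| + m ^ 2 := fun s => by
      rw [sub_sq, sq_abs]; ring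
    simp only [e]
    have i1 : IntegrableOn (fun s => 2 * m * |f s|) (Ioo 0 1) := hf1.abs.const_mul _
    have i2 : IntegrableOn (fun s => f s ^ 2 - 2 * m * |f s|) (Ioo 0 1) := hf2.sub i1
    rw [integral_add i2 (integrable_const _), integral_sub hf2 i1, integral_const_mul, ← hm]
    simp
  nlinarith

lemma CellL2.ae_memLp_slice (h : CellL2 (slab a b) u) :
    ∀ᵐ t ∂volume.restrict (Ioo a b), MemLp (fun x => u (x, t)) 2 (volume.restrict (Ioo 0 1)) := by
  have h2 := h.2
  rw [xCell_slab, Measure.volume_eq_prod, ← Measure.prod_restrict] at h2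
  have i1 := h2.integrable (by norm_num)
  have i2 := h2.integrable_sq
  filter_upwards [i1.prod_left_ae, i2.prod_left_ae] with t h1 h2
  exact (memLp_two_iff_integrable_sq h1.1).2 h2

/-- The `x`-derivative of a periodic function has mean zero at almost all times. -/
lemma HasWeakDeriv.ae_integral_slice_eq_zero (hab : a < b) (h : HasWeakDeriv (slab a b) plateX u g)
    (hu : AEPeriodic (slab a b) u) (hg : IntegrableOn g (xCell (slab a b) 0)) :
    ∀ᵐ t ∂volume.restrict (Ioo a b), ∫ x in Ioo (0 : ℝ) 1, g (x, t) = 0 := by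
  have hg' := hg
  rw [xCell_slab] at hg'
  have hi := integrableOn_integral_slice hg'
  rw [ae_restrict_iff' measurableSet_Ioo]
  refine isOpen_Ioo.ae_eq_zero_of_integral_contDiff_smul_eq_zero hi.locallyIntegrableOn
    fun θ h1 h2 h3 => ?_
  have hθ : IsTest a b θ := ⟨h1, h2, h3⟩
  have h0 := h.integral_slab_x hab hu hθ
  obtain ⟨C, hC⟩ := hθ.exists_bound
  have i := integrableOn_test_mul hθ.continuous hC hg
  rw [xCell_slab] at h0 i
  rw [integral_cell_mul_time i] at h0
  rw [← setIntegral_eq_integral_of_forall_compl_eq_zero (s := Ioo a b) fun t ht => by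
    rw [hθ.eq_zero ht, zero_smul]]
  exact h0

variable {ηx sx : ℕ → ℝ × ℝ → ℝ} {s' : ℝ × ℝ → ℝ}

/-- The slope, and the deviation of the displacement from its mean, are bounded by the square root
of the bending energy: the slope has mean zero. -/
theorem PlateField.ae_bounds (hab : a < b) (h : PlateField a b ηx sx s') :
    ∀ᵐ t ∂volume.restrict (Ioo a b),
      (∀ᵐ x ∂volume.restrict (Ioo (0 : ℝ) 1),
        |ηx 1 (x, t)| ≤ √(∫ s in Ioo (0 : ℝ) 1, ηx 2 (s, t) ^ 2)) ∧
      ∀ᵐ x ∂volume.restrict (Ioo (0 : ℝ) 1), |ηx 0 (x, t) - ∫ s in Ioo (0 : ℝ) 1, ηx 0 (s, t)|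
        ≤ √(∫ s in Ioo (0 : ℝ) 1, ηx 2 (s, t) ^ 2) := by
  have c0 := h.cell_η 0 (by norm_num)
  have c1 := h.cell_η 1 (by norm_num)
  have c2 := h.cell_η 2 (by norm_num)
  have d0 := h.deriv_η 0 (by norm_num)
  have d1 := h.deriv_η 1 (by norm_num)
  have i1 : IntegrableOn (ηx 1) (xCell (slab a b) 0) := by
    have : IsFiniteMeasure (volume.restrict (xCell (slab a b) 0)) := by
      rw [xCell_slab, Measure.volume_eq_prod, ← Measure.prod_restrict]; infer_instance
    exact c1.2.integrable (by norm_num)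
  filter_upwards [d0.ae_slice, d1.ae_slice, c0.ae_memLp_slice, c1.ae_memLp_slice,
    c2.ae_memLp_slice, d0.ae_integral_slice_eq_zero hab c0.1 i1] with t h0 h1 m0 m1 m2 hz
  have b1 := (h1.mono (subset_univ (Ioo 0 1))).ae_abs_sub_average_le_sqrt m1 m2
  have b0 := (h0.mono (subset_univ (Ioo 0 1))).ae_abs_sub_average_le_sqrt m0 m1
  simp only [hz, sub_zero] at b1
  refine ⟨b1, ?_⟩
  filter_upwards [b0] with x hx
  refine hx.trans (Real.sqrt_le_sqrt ?_)
  have hY : 0 ≤ ∫ s in Ioo (0 : ℝ) 1, ηx 2 (s, t) ^ 2 := integral_nonneg fun s => sq_nonneg _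
  calc ∫ s in Ioo (0 : ℝ) 1, ηx 1 (s, t) ^ 2
      ≤ ∫ _ in Ioo (0 : ℝ) 1, ∫ s in Ioo (0 : ℝ) 1, ηx 2 (s, t) ^ 2 := by
        refine integral_mono_ae m1.integrable_sq (integrable_const _) ?_
        filter_upwards [b1] with s hs
        rw [← sq_abs, ← Real.sq_sqrt hY]
        exact pow_le_pow_left₀ (abs_nonneg _) hs 2
    _ = _ := by simp

/-- A function that is bounded on almost all time slices is bounded on the space-time cell. -/
lemma ae_cell_of_ae_slice {I J : Set ℝ} {K : ℝ} (hu : AEStronglyMeasurable u (volume.restrict (I ×ˢ J)))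
    (h : ∀ᵐ t ∂volume.restrict J, ∀ᵐ x ∂volume.restrict I, |u (x, t)| ≤ K) :
    ∀ᵐ q ∂volume.restrict (I ×ˢ J), |u q| ≤ K := by
  rw [Measure.volume_eq_prod, ← Measure.prod_restrict] at hu ⊢
  have hm : AEMeasurable (fun q => ENNReal.ofReal (|u q| - K))
      ((volume.restrict I).prod (volume.restrict J)) :=
    (((continuous_abs.comp_aestronglyMeasurable hu).aemeasurable).sub_const K).ennreal_ofReal
  have h0 : ∫⁻ q, ENNReal.ofReal (|u q| - K) ∂((volume.restrict I).prod (volume.restrict J)) = 0 := by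
    rw [lintegral_prod_symm _ hm]
    refine (lintegral_congr_ae ?_).trans lintegral_zero
    filter_upwards [h] with t ht
    refine (lintegral_congr_ae ?_).trans lintegral_zero
    filter_upwards [ht] with x hx
    exact ENNReal.ofReal_eq_zero.2 (by linarith)
  rw [lintegral_eq_zero_iff' hm] at h0
  filter_upwards [h0] with q hq
  have := ENNReal.ofReal_eq_zero.1 hq
  linarith

/-- The slope is bounded if the bending energy is. -/
theorem PlateField.exists_slope_le (hab : a < b) (h : PlateField a b ηx sx s') {L : ℝ}
    (hL : ∀ᵐ t ∂volume.restrict (Ioo a b), ∫ s in Ioo (0 : ℝ) 1, ηx 2 (s, t) ^ 2 ≤ L) :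
    MemLp (ηx 1) ⊤ (volume.restrict (xCell (slab a b) 0)) := by
  have c1 := h.cell_η 1 (by norm_num)
  refine memLp_top_of_bound c1.2.1 (√L) ?_
  have hm := c1.2.1
  rw [xCell_slab] at hm ⊢
  refine ae_cell_of_ae_slice hm ?_
  filter_upwards [h.ae_bounds hab, hL] with t ht hl
  filter_upwards [ht.1] with x hx using hx.trans (Real.sqrt_le_sqrt hl)

end Bounds

/-! ### Functions of `(x,t)` as functions on the fluid domain -/

section Lift

variable {U : Set (ℝ × ℝ × ℝ)} {V : Set (ℝ × ℝ)} {e : ℝ × ℝ} {u g : ℝ × ℝ → ℝ} {p : ℝ≥0∞}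

/-- The projection `(x,z,t) ↦ (x,t)`. -/
def plateProj (q : ℝ × ℝ × ℝ) : ℝ × ℝ := (q.1, q.2.2)

lemma continuous_plateProj : Continuous plateProj := by unfold plateProj; fun_prop

/-- The rearrangement `((x,t),z) ↦ (x,z,t)`. -/
def fluidEquiv : (ℝ × ℝ) × ℝ ≃ᵐ ℝ × ℝ × ℝ :=
  MeasurableEquiv.prodAssoc.trans ((MeasurableEquiv.refl ℝ).prodCongr MeasurableEquiv.prodComm)

lemma measurePreserving_fluidEquiv : MeasurePreserving fluidEquiv :=
  ((MeasurePreserving.id (volume : Measure ℝ)).prod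
    (Measure.measurePreserving_swap (μ := (volume : Measure ℝ)) (ν := (volume : Measure ℝ)))).comp
    volume_preserving_prodAssoc

lemma integral_fluidEquiv {H : ℝ × ℝ × ℝ → ℝ} (hH : Integrable H) :
    ∫ q, H q = ∫ z, ∫ y : ℝ × ℝ, H (y.1, z, y.2) := by
  rw [← measurePreserving_fluidEquiv.integral_comp' H, Measure.volume_eq_prod,
    integral_prod_symm]
  · rfl
  · exact (measurePreserving_fluidEquiv.integrable_comp_emb
      fluidEquiv.measurableEmbedding).2 hH

lemma MemLpLoc.comp_plateProj (hUV : ∀ q ∈ U, plateProj q ∈ V) (hu : MemLpLoc p V u) :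
    MemLpLoc p U (fun q => u (plateProj q)) := by
  intro K hK hKU
  have h1 := hu (plateProj '' K) (hK.image continuous_plateProj) (by
    rintro _ ⟨q, hq, rfl⟩; exact hUV q (hKU hq))
  obtain ⟨R, hR⟩ := (hK.image (continuous_fst.comp continuous_snd)).isBounded.subset_closedBall 0
  have h2 : MemLp (fun w : (ℝ × ℝ) × ℝ => u w.1) p
      (((volume : Measure (ℝ × ℝ)).restrict (plateProj '' K)).prod
        ((volume : Measure ℝ).restrict (Metric.closedBall 0 R))) := by
    have : IsFiniteMeasure ((volume : Measure ℝ).restrict (Metric.closedBall 0 R)) :=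
      ⟨by simp [ENNReal.mul_lt_top]⟩
    exact h1.comp_fst _
  rw [Measure.prod_restrict, ← Measure.volume_eq_prod] at h2
  have hmp : MeasurePreserving fluidEquiv.symm
      ((volume : Measure (ℝ × ℝ × ℝ)).restrict
        (fluidEquiv.symm ⁻¹' ((plateProj '' K) ×ˢ Metric.closedBall 0 R)))
      ((volume : Measure ((ℝ × ℝ) × ℝ)).restrict ((plateProj '' K) ×ˢ Metric.closedBall 0 R)) :=
    (measurePreserving_fluidEquiv.symm fluidEquiv).restrict_preimage
      ((hK.image continuous_plateProj).measurableSet.prod measurableSet_closedBall)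
  refine (h2.comp_measurePreserving hmp).mono_measure (Measure.restrict_mono ?_ le_rfl)
  exact fun q hq => ⟨mem_image_of_mem _ hq, hR (mem_image_of_mem _ hq)⟩

lemma fderiv_fluid_slice {φ : ℝ × ℝ × ℝ → ℝ} (hφ : Differentiable ℝ φ) (z : ℝ) (y e : ℝ × ℝ) :
    fderiv ℝ (fun y : ℝ × ℝ => φ (y.1, z, y.2)) y e = fderiv ℝ φ (y.1, z, y.2) (e.1, 0, e.2) := by
  have h1 : HasFDerivAt (fun y : ℝ × ℝ => (y.1, z, y.2))
      ((ContinuousLinearMap.fst ℝ ℝ ℝ).prod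
        ((0 : ℝ × ℝ →L[ℝ] ℝ).prod (ContinuousLinearMap.snd ℝ ℝ ℝ))) y :=
    hasFDerivAt_fst.prodMk ((hasFDerivAt_const z y).prodMk hasFDerivAt_snd)
  have h2 : fderiv ℝ (fun y : ℝ × ℝ => φ (y.1, z, y.2)) y = _ :=
    ((hφ (y.1, z, y.2)).hasFDerivAt.comp y h1).fderiv
  rw [h2]; simp

/-- A weakly differentiable function of `(x,t)` remains so when it is regarded as a function of
`(x,z,t)`. -/
theorem HasWeakDeriv.comp_plateProj (hU : IsOpen U) (hV : IsOpen V)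
    (hUV : ∀ q ∈ U, plateProj q ∈ V) (h : HasWeakDeriv V e u g) :
    HasWeakDeriv U (e.1, 0, e.2) (fun q => u (plateProj q)) (fun q => g (plateProj q)) := by
  have hu := (locallyIntegrableOn_iff_memLpLoc hU).2
    (((locallyIntegrableOn_iff_memLpLoc hV).1 h.1).comp_plateProj hUV)
  have hg := (locallyIntegrableOn_iff_memLpLoc hU).2
    (((locallyIntegrableOn_iff_memLpLoc hV).1 h.2.1).comp_plateProj hUV)
  refine .of_integral_eq hu hg fun φ h1 h2 h3 => ?_
  rw [integral_fluidEquiv (integrable_mul_test_fderiv hu (h1.of_le (by simp)) h2 h3),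
    integral_fluidEquiv (integrable_mul_test hg h1.continuous h2 h3), ← integral_neg]
  congr 1
  funext z
  have hc : HasCompactSupport (fun y : ℝ × ℝ => φ (y.1, z, y.2)) :=
    HasCompactSupport.intro (h2.isCompact.image continuous_plateProj) fun y hy =>
      image_eq_zero_of_notMem_tsupport fun hyt => hy ⟨_, hyt, rfl⟩
  have hs : tsupport (fun y : ℝ × ℝ => φ (y.1, z, y.2)) ⊆ V := fun y hy =>
    hUV _ (h3 (tsupport_comp_subset_preimage φ
      (f := fun y : ℝ × ℝ => (y.1, z, y.2)) (by fun_prop) hy))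
  have := h.integral_eq (h1.comp (by fun_prop : ContDiff ℝ ∞ fun y : ℝ × ℝ => (y.1, z, y.2))) hc hs
  simp only [Function.comp_def] at this
  simpa only [fderiv_fluid_slice (h1.differentiable (by simp)), plateProj] using this

end Lift

section Geometry

/-- The displacement data of a fluid domain: the displacement `η`, its derivatives `ηx` and `ηt`,
and a lower bound `c`. -/
structure FluidGeometry (T c : ℝ) (η ηx ηt : ℝ × ℝ → ℝ) : Prop where
  time_pos : 0 < T
  cont : ContinuousOn η (univ ×ˢ Icc 0 T)
  per : ∀ x t, η (x + 1, t) = η (x, t)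
  pos : 0 < c
  lower : ∀ y ∈ plateDomain T, c ≤ η y
  deriv_x : HasWeakDeriv (slab 0 T) plateX η ηx
  deriv_t : HasWeakDeriv (slab 0 T) plateT η ηt
  bdd_x : MemLp ηx ⊤ (volume.restrict (xCell (slab 0 T) 0))
  memLp_t : MemLp ηt 2 (volume.restrict (xCell (slab 0 T) 0))

variable {T c : ℝ} {η ηx ηt : ℝ × ℝ → ℝ}

/-- The displacement, extended continuously to all times. -/
def clampTime (T : ℝ) (η : ℝ × ℝ → ℝ) (y : ℝ × ℝ) : ℝ := η (y.1, max 0 (min y.2 T))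

lemma clampTime_of_mem {y : ℝ × ℝ} (hy : y.2 ∈ Icc 0 T) : clampTime T η y = η y := by
  rw [clampTime, min_eq_left hy.2, max_eq_right hy.1]

namespace FluidGeometry

lemma continuous_clampTime (h : FluidGeometry T c η ηx ηt) : Continuous (clampTime T η) := by
  rw [← continuousOn_univ]
  exact h.cont.comp (by fun_prop) fun y _ =>
    ⟨trivial, le_max_left _ _, max_le h.time_pos.le (min_le_right _ _)⟩

lemma fluidDomain_eq : fluidDomain T η
    = {q | q.2.2 ∈ Ioo 0 T ∧ q.2.1 ∈ Ioo 0 (clampTime T η (plateProj q))} := by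
  ext q
  refine and_congr_right fun hq => ?_
  rw [clampTime_of_mem (y := plateProj q) ⟨hq.1.le, hq.2.le⟩]; rfl

lemma isOpen (h : FluidGeometry T c η ηx ηt) : IsOpen (fluidDomain T η) := by
  rw [fluidDomain_eq]
  have h1 : Continuous fun q : ℝ × ℝ × ℝ => clampTime T η (plateProj q) :=
    h.continuous_clampTime.comp continuous_plateProj
  have h2 : Continuous fun q : ℝ × ℝ × ℝ => q.2.1 := by fun_prop
  have h3 : Continuous fun q : ℝ × ℝ × ℝ => q.2.2 := by fun_prop
  exact (isOpen_Ioo.preimage h3).inter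
    ((isOpen_lt continuous_const h2).inter (isOpen_lt h2 h1))

lemma isXPeriodic (h : FluidGeometry T c η ηx ηt) : IsXPeriodic (fluidDomain T η) := fun q => by
  simp only [fluidDomain, mem_ofPred_eq, Prod.snd_add, Prod.fst_add, 
    add_zero, h.per]

lemma xCell_eq : xCell (fluidDomain T η) 0 = fluidCell T η := by
  simp [xCell, fluidCell]

lemma plateProj_mem {q : ℝ × ℝ × ℝ} (hq : q ∈ fluidDomain T η) : plateProj q ∈ slab 0 T :=
  ⟨trivial, hq.1⟩

lemma exists_upper (h : FluidGeometry T c η ηx ηt) :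
    ∃ H, 0 < H ∧ ∀ x ∈ Icc (0 : ℝ) 2, ∀ t ∈ Icc 0 T, η (x, t) ≤ H := by
  obtain ⟨H, hH⟩ := ((isCompact_Icc (a := (0 : ℝ)) (b := 2)).prod
    (isCompact_Icc (a := (0 : ℝ)) (b := T))).exists_bound_of_continuousOn
    (h.cont.mono (prod_mono (subset_univ _) subset_rfl))
  refine ⟨max H 1, by positivity, fun x hx t ht => ?_⟩
  exact (le_abs_self _).trans ((hH (x, t) ⟨hx, ht⟩).trans (le_max_left _ _))

lemma volume_cell_lt_top (h : FluidGeometry T c η ηx ηt) :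
    volume (xCell (fluidDomain T η) 0) < ⊤ := by
  obtain ⟨H, hH0, hH⟩ := h.exists_upper
  have : xCell (fluidDomain T η) 0 ⊆ Icc 0 2 ×ˢ Icc 0 H ×ˢ Icc 0 T := by
    rintro q ⟨hq, hx⟩
    have hx' : q.1 ∈ Icc (0 : ℝ) 2 := ⟨hx.1.le, by have := hx.2; linarith⟩
    have ht : q.2.2 ∈ Icc 0 T := Ioo_subset_Icc_self hq.1
    exact ⟨hx', ⟨hq.2.1.le, hq.2.2.le.trans (hH _ hx' _ ht)⟩, ht⟩
  exact (measure_mono this).trans_lt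
    (isCompact_Icc.prod (isCompact_Icc.prod isCompact_Icc)).measure_lt_top

lemma isFiniteMeasure (h : FluidGeometry T c η ηx ηt) :
    IsFiniteMeasure (volume.restrict (xCell (fluidDomain T η) 0)) :=
  ⟨by simpa using h.volume_cell_lt_top⟩

lemma isClosed_layer (h : FluidGeometry T c η ηx ηt) (a' b' c₁ c₂ : ℝ) :
    IsClosed {q : ℝ × ℝ × ℝ | q.2.2 ∈ Icc a' b' ∧ c₁ ≤ q.2.1 ∧
      q.2.1 ≤ clampTime T η (plateProj q) - c₂} := by
  have h1 : Continuous fun q : ℝ × ℝ × ℝ => clampTime T η (plateProj q) :=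
    h.continuous_clampTime.comp continuous_plateProj
  have h2 : Continuous fun q : ℝ × ℝ × ℝ => q.2.1 := by fun_prop
  have h3 : Continuous fun q : ℝ × ℝ × ℝ => q.2.2 := by fun_prop
  exact (isClosed_Icc.preimage h3).inter
    ((isClosed_le continuous_const h2).inter (isClosed_le h2 (h1.sub continuous_const)))

/-- The divergence theorem in one direction for a function that vanishes near the boundary of the
fluid domain. -/
theorem integral_eq_zero (h : FluidGeometry T c η ηx ηt) {e : ℝ × ℝ × ℝ} {F g : ℝ × ℝ × ℝ → ℝ}
    (hF : HasWeakDeriv (fluidDomain T η) e F g) (hper : AEPeriodic (fluidDomain T η) F)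
    {a' b' h₀ : ℝ} (ha : 0 < a') (hb : b' < T) (h₀p : 0 < h₀)
    (h0 : ∀ q ∈ fluidDomain T η,
      (q.2.2 ∉ Icc a' b' ∨ q.2.1 < h₀ ∨ η (plateProj q) - q.2.1 < h₀) → F q = 0) :
    ∫ q in xCell (fluidDomain T η) 0, g q = 0 := by
  obtain ⟨H, hH0, hH⟩ := h.exists_upper
  refine hF.integral_xCell_eq_zero h.isOpen h.isXPeriodic hper (h.isClosed_layer a' b' h₀ h₀)
    ?_ ?_ ?_
  · refine ((isCompact_Icc (a := (0 : ℝ)) (b := 2)).prod ((isCompact_Icc (a := (0 : ℝ)) (b := H)).prod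
      (isCompact_Icc (a := a') (b := b')))).of_isClosed_subset
      ((h.isClosed_layer a' b' h₀ h₀).inter (isClosed_Icc.preimage continuous_fst)) ?_
    rintro q ⟨⟨h1, h2, h3⟩, hx⟩
    refine ⟨hx, ⟨by linarith, ?_⟩, h1⟩
    have ht : q.2.2 ∈ Icc 0 T := ⟨by linarith [h1.1], by linarith [h1.2]⟩
    rw [clampTime_of_mem (y := plateProj q) ht] at h3
    have := hH _ hx _ ht
    have h3' : q.2.1 ≤ η (q.1, q.2.2) - h₀ := h3
    linarith
  · rintro q ⟨⟨h1, h2, h3⟩, hx⟩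
    have ht : q.2.2 ∈ Icc 0 T := ⟨by linarith [h1.1], by linarith [h1.2]⟩
    rw [clampTime_of_mem (y := plateProj q) ht] at h3
    have h3' : q.2.1 ≤ η (q.1, q.2.2) - h₀ := h3
    exact ⟨⟨by linarith [h1.1], by linarith [h1.2]⟩, by linarith, by linarith⟩
  · intro q hq hqL
    refine h0 q hq ?_
    by_contra hcon
    push Not at hcon
    refine hqL ⟨hcon.1, hcon.2.1, ?_⟩
    rw [clampTime_of_mem (y := plateProj q) (Ioo_subset_Icc_self hq.1)]
    linarith [hcon.2.2]

lemma deriv_plate (h : FluidGeometry T c η ηx ηt) {e : ℝ × ℝ} {u g : ℝ × ℝ → ℝ}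
    (hu : HasWeakDeriv (slab 0 T) e u g) :
    HasWeakDeriv (fluidDomain T η) (e.1, 0, e.2) (fun q => u (plateProj q))
      (fun q => g (plateProj q)) :=
  hu.comp_plateProj h.isOpen isOpen_slab fun _ hq => plateProj_mem hq

end FluidGeometry

end Geometry

/-! ### The divergence theorem on the moving domain -/

lemma integrable_top_mul {α : Type*} [MeasurableSpace α] {μ : Measure α} {a f : α → ℝ}
    (ha : MemLp a ⊤ μ) (hf : Integrable f μ) : Integrable (fun x => a x * f x) μ :=
  memLp_one_iff_integrable.1 ((memLp_one_iff_integrable.2 hf).mul' ha)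

lemma Integrable.fun_add {α : Type*} [MeasurableSpace α] {μ : Measure α} {f g : α → ℝ}
    (hf : Integrable f μ) (hg : Integrable g μ) : Integrable (fun x => f x + g x) μ := hf.add hg

lemma Integrable.fun_sub {α : Type*} [MeasurableSpace α] {μ : Measure α} {f g : α → ℝ}
    (hf : Integrable f μ) (hg : Integrable g μ) : Integrable (fun x => f x - g x) μ := hf.sub hg

lemma memLp_top_mul {α : Type*} [MeasurableSpace α] {μ : Measure α} {a f : α → ℝ} {p : ℝ≥0∞}
    (ha : MemLp a ⊤ μ) (hf : MemLp f p μ) : MemLp (fun x => a x * f x) p μ := hf.mul' ha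

/-- The derivative of `s ↦ step (s / h)`: a bump of integral one carried by `[h/2, h]`. -/
def layer (h s : ℝ) : ℝ := deriv step (s / h) / h

section LayerFunction

variable {h : ℝ}

lemma layer_nonneg (hh : 0 < h) (s : ℝ) : 0 ≤ layer h s := div_nonneg (deriv_step_nonneg _) hh.le

lemma exists_layer_le : ∃ C, 0 < C ∧ ∀ h, 0 < h → ∀ s, layer h s ≤ C / h := by
  obtain ⟨C, hC0, hC⟩ := exists_bound_deriv_step
  exact ⟨C, hC0, fun h hh s => div_le_div_of_nonneg_right (hC _) hh.le⟩

lemma layer_eq_zero_of_gt (hh : 0 < h) {s : ℝ} (hs : h < s) : layer h s = 0 := by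
  rw [layer, deriv_step_of_gt ((one_lt_div hh).2 hs), zero_div]

lemma continuous_layer (h : ℝ) : Continuous (layer h) := by
  unfold layer
  exact (continuous_deriv_step.comp (by fun_prop)).div_const h

lemma contDiff_step_div (h : ℝ) : ContDiff ℝ ∞ fun s => step (s / h) :=
  step_contDiff.comp (contDiff_id.div_const h)

lemma deriv_step_div (h s : ℝ) : deriv (fun s => step (s / h)) s = layer h s := by
  have := ((step_contDiff.differentiable (by simp) (s / h)).hasDerivAt.comp s
    ((hasDerivAt_id s).div_const h)).deriv
  have h' : deriv (fun s => step (s / h)) s = _ := this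
  rw [h', layer]; simp; ring

end LayerFunction

section StepDiv

variable {E : Type*} [NormedAddCommGroup E] [NormedSpace ℝ E] [FiniteDimensional ℝ E]
  [MeasureSpace E] [BorelSpace E] [(volume : Measure E).IsAddHaarMeasure]
  {U : Set E} {e : E} {d g : E → ℝ}

lemma HasWeakDeriv.step_div (hU : IsOpen U) {h : ℝ} (hh : 0 < h) (hd : HasWeakDeriv U e d g) :
    HasWeakDeriv U e (fun q => step (d q / h)) (fun q => layer h (d q) * g q) := by
  obtain ⟨C, hC0, hC⟩ := exists_layer_le
  have := hd.comp_contDiff hU (F := fun s => step (s / h)) (C := C / h)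
    ((contDiff_step_div h).of_le (by simp)) fun s => by
      rw [deriv_step_div, Real.norm_of_nonneg (layer_nonneg hh s)]; exact hC h hh s
  simpa only [deriv_step_div] using this

end StepDiv

namespace FluidGeometry

variable {T c : ℝ} {η ηx ηt : ℝ × ℝ → ℝ}

/-- The vertical distance to the plate. -/
def depth (η : ℝ × ℝ → ℝ) (q : ℝ × ℝ × ℝ) : ℝ := η (plateProj q) - q.2.1

/-- A function that vanishes near the horizontal boundaries and is one at a distance `h`. -/
def cutoff (η : ℝ × ℝ → ℝ) (h : ℝ) (q : ℝ × ℝ × ℝ) : ℝ :=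
  step (q.2.1 / h) + step (depth η q / h) - 1

lemma depth_pos {q : ℝ × ℝ × ℝ} (hq : q ∈ fluidDomain T η) : 0 < depth η q :=
  sub_pos.2 hq.2.2

lemma height_add_depth (h : FluidGeometry T c η ηx ηt) {q : ℝ × ℝ × ℝ} (hq : q ∈ fluidDomain T η) :
    c ≤ q.2.1 + depth η q := by
  have := h.lower (plateProj q) (plateProj_mem hq)
  rw [depth]; linarith

lemma continuousOn_depth (h : FluidGeometry T c η ηx ηt) :
    ContinuousOn (depth η) (fluidDomain T η) := by
  refine ContinuousOn.sub ?_ (by fun_prop)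
  exact h.cont.comp continuous_plateProj.continuousOn fun q hq =>
    ⟨trivial, Ioo_subset_Icc_self hq.1⟩

lemma hasWeakDeriv_height (e : ℝ × ℝ × ℝ) {U : Set (ℝ × ℝ × ℝ)} :
    HasWeakDeriv U e (fun q => q.2.1) (fun _ => e.2.1) := by
  have h1 : ContDiff ℝ 1 fun q : ℝ × ℝ × ℝ => q.2.1 := by fun_prop
  have h2 : ∀ q : ℝ × ℝ × ℝ, fderiv ℝ (fun q : ℝ × ℝ × ℝ => q.2.1) q e = e.2.1 := fun q => by
    have : HasFDerivAt (fun q : ℝ × ℝ × ℝ => q.2.1)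
        ((ContinuousLinearMap.fst ℝ ℝ ℝ).comp (ContinuousLinearMap.snd ℝ ℝ (ℝ × ℝ))) q :=
      (hasFDerivAt_fst (𝕜 := ℝ) (E := ℝ) (F := ℝ)).comp q hasFDerivAt_snd
    rw [this.fderiv]; simp
  simpa only [h2] using hasWeakDeriv_of_contDiff (U := U) (e := e) h1

lemma depth_x (h : FluidGeometry T c η ηx ηt) :
    HasWeakDeriv (fluidDomain T η) (fluidDir 0) (depth η) (fun q => ηx (plateProj q)) := by
  change HasWeakDeriv _ _ (fun q => η (plateProj q) - q.2.1) _
  simpa [plateX, fluidDir] using (h.deriv_plate h.deriv_x).sub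
    (hasWeakDeriv_height (plateX.1, 0, plateX.2))

lemma depth_t (h : FluidGeometry T c η ηx ηt) :
    HasWeakDeriv (fluidDomain T η) fluidT (depth η) (fun q => ηt (plateProj q)) := by
  change HasWeakDeriv _ _ (fun q => η (plateProj q) - q.2.1) _
  simpa [plateT, fluidT] using (h.deriv_plate h.deriv_t).sub
    (hasWeakDeriv_height (plateT.1, 0, plateT.2))

/-- Functions of `(x,t)` have no derivative in `z`. -/
lemma hasWeakDeriv_z_plate (h : FluidGeometry T c η ηx ηt) {u : ℝ × ℝ → ℝ}
    (hu : LocallyIntegrableOn u (slab 0 T) volume) :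
    HasWeakDeriv (fluidDomain T η) (fluidDir 1) (fun q => u (plateProj q)) (fun _ => 0) :=
  hasWeakDeriv_zero_of_invariant ((locallyIntegrableOn_iff_memLpLoc h.isOpen).2
    (((locallyIntegrableOn_iff_memLpLoc isOpen_slab).1 hu).comp_plateProj
      fun _ hq => plateProj_mem hq)) fun q s => by simp [plateProj, fluidDir]

lemma depth_z (h : FluidGeometry T c η ηx ηt) :
    HasWeakDeriv (fluidDomain T η) (fluidDir 1) (depth η) (fun _ => -1) := by
  change HasWeakDeriv _ _ (fun q => η (plateProj q) - q.2.1) _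
  simpa [fluidDir] using (h.hasWeakDeriv_z_plate h.deriv_x.1).sub (hasWeakDeriv_height (fluidDir 1))

lemma hasWeakDeriv_one {U : Set (ℝ × ℝ × ℝ)} (e : ℝ × ℝ × ℝ) (a : ℝ) :
    HasWeakDeriv U e (fun _ => a) (fun _ => 0) := by
  simpa using hasWeakDeriv_of_contDiff (U := U) (e := e) (contDiff_const (c := a) (n := 1))

lemma cutoff_deriv (h : FluidGeometry T c η ηx ηt) {e : ℝ × ℝ × ℝ} {g : ℝ × ℝ × ℝ → ℝ}
    (hd : HasWeakDeriv (fluidDomain T η) e (depth η) g) {k : ℝ} (hk : 0 < k) :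
    HasWeakDeriv (fluidDomain T η) e (cutoff η k)
      (fun q => layer k q.2.1 * e.2.1 + layer k (depth η q) * g q) := by
  change HasWeakDeriv _ _ (fun q => step (q.2.1 / k) + step (depth η q / k) - 1) _
  simpa using
    (((hasWeakDeriv_height e).step_div h.isOpen hk).add (hd.step_div h.isOpen hk)).sub
      (hasWeakDeriv_one e 1)

lemma aePeriodic_depth (h : FluidGeometry T c η ηx ηt) :
    AEPeriodic (fluidDomain T η) (depth η) :=
  Eventually.of_forall fun q => by
    simp [depth, plateProj, h.per]

lemma aePeriodic_height {U : Set (ℝ × ℝ × ℝ)} : AEPeriodic U (fun q => q.2.1) :=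
  Eventually.of_forall fun q => by simp

lemma aePeriodic_cutoff (h : FluidGeometry T c η ηx ηt) (k : ℝ) :
    AEPeriodic (fluidDomain T η) (cutoff η k) := by
  filter_upwards [h.aePeriodic_depth] with q hq
  simp [cutoff, hq]

lemma abs_cutoff_le (k : ℝ) (q : ℝ × ℝ × ℝ) : |cutoff η k q| ≤ 1 := by
  rw [abs_le, cutoff]
  have h1 := step_nonneg (q.2.1 / k)
  have h2 := step_nonneg (depth η q / k)
  have h3 := step_le_one (q.2.1 / k)
  have h4 := step_le_one (depth η q / k)
  constructor <;> linarith

lemma memLp_top_of_continuousOn (h : FluidGeometry T c η ηx ηt) {f : ℝ × ℝ × ℝ → ℝ} {C : ℝ}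
    (hf : ContinuousOn f (fluidDomain T η)) (hC : ∀ q ∈ fluidDomain T η, |f q| ≤ C) :
    MemLp f ⊤ (volume.restrict (xCell (fluidDomain T η) 0)) := by
  have hs := measurableSet_xCell h.isOpen.measurableSet 0
  refine memLp_top_of_bound ((hf.mono inter_subset_left).aestronglyMeasurable hs) C ?_
  filter_upwards [ae_restrict_mem hs] with q hq using hC q hq.1

lemma memLp_cutoff (h : FluidGeometry T c η ηx ηt) (k : ℝ) :
    MemLp (cutoff η k) ⊤ (volume.restrict (xCell (fluidDomain T η) 0)) := by
  refine h.memLp_top_of_continuousOn (C := 1) ?_ fun q _ => abs_cutoff_le k q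
  have h1 : ContinuousOn (fun q => depth η q / k) (fluidDomain T η) :=
    h.continuousOn_depth.div_const k
  have h2 : ContinuousOn (fun q : ℝ × ℝ × ℝ => q.2.1 / k) (fluidDomain T η) := by fun_prop
  exact ((step_contDiff.continuous.comp_continuousOn h2).add
    (step_contDiff.continuous.comp_continuousOn h1)).sub continuousOn_const

lemma memLp_layer (h : FluidGeometry T c η ηx ηt) {k : ℝ} (hk : 0 < k) {d : ℝ × ℝ × ℝ → ℝ}
    (hd : ContinuousOn d (fluidDomain T η)) :
    MemLp (fun q => layer k (d q)) ⊤ (volume.restrict (xCell (fluidDomain T η) 0)) := by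
  obtain ⟨C, hC0, hC⟩ := exists_layer_le
  refine h.memLp_top_of_continuousOn (C := C / k)
    ((continuous_layer k).comp_continuousOn hd) fun q _ => ?_
  rw [abs_of_nonneg (layer_nonneg hk _)]; exact hC k hk _

lemma memLp_time (h : FluidGeometry T c η ηx ηt) {θ : ℝ → ℝ} (hθ : Continuous θ) {C : ℝ}
    (hC : ∀ t, ‖θ t‖ ≤ C) :
    MemLp (fun q : ℝ × ℝ × ℝ => θ q.2.2) ⊤ (volume.restrict (xCell (fluidDomain T η) 0)) :=
  h.memLp_top_of_continuousOn (by fun_prop) fun q _ => hC _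

/-- A function in `L^p` of the plate cell is in `L^p` of the fluid cell. -/
lemma memLp_comp_plateProj (h : FluidGeometry T c η ηx ηt) {u : ℝ × ℝ → ℝ} {p : ℝ≥0∞}
    (hu : MemLp u p (volume.restrict (xCell (slab 0 T) 0))) :
    MemLp (fun q => u (plateProj q)) p (volume.restrict (xCell (fluidDomain T η) 0)) := by
  obtain ⟨H, hH0, hH⟩ := h.exists_upper
  have hm := measurableSet_xCell (isOpen_slab (a := 0) (b := T)).measurableSet 0
  have h2 : MemLp (fun w : (ℝ × ℝ) × ℝ => u w.1) p
      (((volume : Measure (ℝ × ℝ)).restrict (xCell (slab 0 T) 0)).prod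
        ((volume : Measure ℝ).restrict (Icc 0 H))) := hu.comp_fst _
  rw [Measure.prod_restrict, ← Measure.volume_eq_prod] at h2
  have hmp : MeasurePreserving fluidEquiv.symm
      ((volume : Measure (ℝ × ℝ × ℝ)).restrict
        (fluidEquiv.symm ⁻¹' ((xCell (slab 0 T) 0) ×ˢ Icc 0 H)))
      ((volume : Measure ((ℝ × ℝ) × ℝ)).restrict ((xCell (slab 0 T) 0) ×ˢ Icc 0 H)) :=
    (measurePreserving_fluidEquiv.symm fluidEquiv).restrict_preimage (hm.prod measurableSet_Icc)
  refine (h2.comp_measurePreserving hmp).mono_measure (Measure.restrict_mono ?_ le_rfl)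
  rintro q ⟨hq, hx⟩
  refine ⟨⟨plateProj_mem hq, hx⟩, hq.2.1.le, hq.2.2.le.trans (hH _ ?_ _ (Ioo_subset_Icc_self hq.1))⟩
  exact ⟨hx.1.le, by have := hx.2; linarith⟩

lemma memLp_slope (h : FluidGeometry T c η ηx ηt) :
    MemLp (fun q => ηx (plateProj q)) ⊤ (volume.restrict (xCell (fluidDomain T η) 0)) :=
  h.memLp_comp_plateProj h.bdd_x

lemma memLp_speed (h : FluidGeometry T c η ηx ηt) :
    MemLp (fun q => ηt (plateProj q)) 2 (volume.restrict (xCell (fluidDomain T η) 0)) :=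
  h.memLp_comp_plateProj h.memLp_t

lemma fderiv_time {θ : ℝ → ℝ} (hθ : ContDiff ℝ ∞ θ) (q e : ℝ × ℝ × ℝ) :
    fderiv ℝ (fun q : ℝ × ℝ × ℝ => θ q.2.2) q e = deriv θ q.2.2 * e.2.2 := by
  have h1 : HasFDerivAt (fun q : ℝ × ℝ × ℝ => q.2.2)
      ((ContinuousLinearMap.snd ℝ ℝ ℝ).comp (ContinuousLinearMap.snd ℝ ℝ (ℝ × ℝ))) q :=
    (hasFDerivAt_snd (𝕜 := ℝ) (E := ℝ) (F := ℝ)).comp q hasFDerivAt_snd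
  have := ((hθ.differentiable (by simp) q.2.2).hasDerivAt.comp_hasFDerivAt q h1).fderiv
  have h' : fderiv ℝ (fun q : ℝ × ℝ × ℝ => θ q.2.2) q = _ := this
  rw [h']; simp

/-- The divergence theorem in one direction, with the cutoff function in place. The exponents `p` and
`r` are conjugate: the slope is bounded, but the speed of the plate is only square integrable. -/
lemma integral_cutoff (h : FluidGeometry T c η ηx ηt) {p r : ℝ≥0∞} [Fact (1 ≤ p)]
    [ENNReal.HolderTriple p r 1] [ENNReal.HolderTriple r p 1] (hp : p ≠ ⊤)
    {e : ℝ × ℝ × ℝ} {d' F g : ℝ × ℝ × ℝ → ℝ} {θ : ℝ → ℝ} {k : ℝ}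
    (hd : HasWeakDeriv (fluidDomain T η) e (depth η) d')
    (hd' : MemLp d' r (volume.restrict (xCell (fluidDomain T η) 0)))
    (hF : HasWeakDeriv (fluidDomain T η) e F g) (hper : AEPeriodic (fluidDomain T η) F)
    (F1 : MemLp F p (volume.restrict (xCell (fluidDomain T η) 0)))
    (g1 : MemLp g p (volume.restrict (xCell (fluidDomain T η) 0)))
    (hθ : IsTest 0 T θ) (hk : 0 < k) (hkc : 2 * k < c) :
    ∫ q in xCell (fluidDomain T η) 0,
      (θ q.2.2 * (F q * (layer k q.2.1 * e.2.1 + layer k (depth η q) * d' q) + g q * cutoff η k q)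
        + deriv θ q.2.2 * e.2.2 * (F q * cutoff η k q)) = 0 := by
  have hm := h.isOpen.measurableSet
  have hfin := h.isFiniteMeasure
  have hζ := h.cutoff_deriv hd hk
  have pζ := h.aePeriodic_cutoff k
  have pζ' := hζ.aePeriodic h.isOpen h.isXPeriodic pζ
  have pg := hF.aePeriodic h.isOpen h.isXPeriodic hper
  have l1 : MemLp (fun q : ℝ × ℝ × ℝ => layer k q.2.1 * e.2.1) r
      (volume.restrict (xCell (fluidDomain T η) 0)) :=
    ((h.memLp_layer hk (d := fun q => q.2.1) (by fun_prop)).mono_exponent le_top).mul_const e.2.1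
  have l2 : MemLp (fun q : ℝ × ℝ × ℝ => layer k (depth η q) * d' q) r
      (volume.restrict (xCell (fluidDomain T η) 0)) :=
    memLp_top_mul (h.memLp_layer hk h.continuousOn_depth) hd'
  have hprod := hF.mul_of_holder hp h.isOpen hζ (hper.memLpLoc hm h.isXPeriodic F1)
    (pg.memLpLoc hm h.isXPeriodic g1)
    (pζ.memLpLoc hm h.isXPeriodic ((h.memLp_cutoff k).mono_exponent le_top))
    (pζ'.memLpLoc hm h.isXPeriodic (l1.add l2))
  have hw := hprod.smooth_mul h.isOpen (ψ := fun q => θ q.2.2)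
    (hθ.smooth.comp (contDiff_snd.comp contDiff_snd))
  simp only [fderiv_time hθ.smooth] at hw
  obtain ⟨a', b', ha, -, hb, hz, -⟩ := hθ.exists_Icc h.time_pos
  refine h.integral_eq_zero hw ?_ ha hb (h₀ := k / 2) (by positivity) ?_
  · filter_upwards [hper.mul pζ] with q hq
    simpa using Or.inl hq
  · rintro q hq (ht | hz | hd)
    · simp [hz _ ht]
    · have h1 : step (q.2.1 / k) = 0 := step_of_le (by rw [div_le_iff₀ hk]; linarith)
      have h2 : step (depth η q / k) = 1 := step_of_ge (by
        rw [one_le_div hk]; linarith [h.height_add_depth hq])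
      simp [cutoff, h1, h2]
    · have h1 : step (depth η q / k) = 0 := step_of_le (by
        rw [div_le_iff₀ hk]; change η (plateProj q) - q.2.1 ≤ _; linarith)
      have h2 : step (q.2.1 / k) = 1 := step_of_ge (by
        rw [one_le_div hk]
        have : depth η q < k / 2 := hd
        linarith [h.height_add_depth hq])
      simp [cutoff, h1, h2]

/-- A vector field `(F₀, F₁, Fₜ)` on the fluid domain, with a weak space-time divergence. -/
structure Flux (T : ℝ) (η : ℝ × ℝ → ℝ) (F0 F1 Ft g0 g1 gt : ℝ × ℝ × ℝ → ℝ) : Prop where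
  deriv_x : HasWeakDeriv (fluidDomain T η) (fluidDir 0) F0 g0
  deriv_z : HasWeakDeriv (fluidDomain T η) (fluidDir 1) F1 g1
  deriv_t : HasWeakDeriv (fluidDomain T η) fluidT Ft gt
  per_x : AEPeriodic (fluidDomain T η) F0
  per_z : AEPeriodic (fluidDomain T η) F1
  per_t : AEPeriodic (fluidDomain T η) Ft
  int_x : IntegrableOn F0 (xCell (fluidDomain T η) 0)
  int_z : IntegrableOn F1 (xCell (fluidDomain T η) 0)
  memLp_t : MemLp Ft 2 (volume.restrict (xCell (fluidDomain T η) 0))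
  int_x' : IntegrableOn g0 (xCell (fluidDomain T η) 0)
  int_z' : IntegrableOn g1 (xCell (fluidDomain T η) 0)
  memLp_t' : MemLp gt 2 (volume.restrict (xCell (fluidDomain T η) 0))

/-- The flux of a vector field into the fluid through the moving boundary, per unit of `(x,t)`, with
the normal `(ηx, -1, ηt)`. -/
def topFlux (ηx ηt : ℝ × ℝ → ℝ) (F0 F1 Ft : ℝ × ℝ × ℝ → ℝ) (q : ℝ × ℝ × ℝ) : ℝ :=
  F0 q * ηx (plateProj q) - F1 q + Ft q * ηt (plateProj q)

lemma Flux.integrable_topFlux {F0 F1 Ft g0 g1 gt : ℝ × ℝ × ℝ → ℝ} (hF : Flux T η F0 F1 Ft g0 g1 gt)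
    (h : FluidGeometry T c η ηx ηt) :
    IntegrableOn (topFlux ηx ηt F0 F1 Ft) (xCell (fluidDomain T η) 0) := by
  have h1 := integrable_top_mul h.memLp_slope hF.int_x
  have h2 : IntegrableOn (fun q => Ft q * ηt (plateProj q)) (xCell (fluidDomain T η) 0) :=
    hF.memLp_t.integrable_mul h.memLp_speed
  refine ((h1.sub hF.int_z).add h2).congr (Eventually.of_forall fun q => ?_)
  simp [topFlux, mul_comm]

/-- The divergence theorem with the cutoff function in place. -/
theorem Flux.divergence_cutoff {F0 F1 Ft g0 g1 gt : ℝ × ℝ × ℝ → ℝ} {θ : ℝ → ℝ} {k : ℝ}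
    (hF : Flux T η F0 F1 Ft g0 g1 gt) (h : FluidGeometry T c η ηx ηt) (hθ : IsTest 0 T θ)
    (hk : 0 < k) (hkc : 2 * k < c) :
    (∫ q in xCell (fluidDomain T η) 0, cutoff η k q * (θ q.2.2 * (g0 q + g1 q + gt q)
        + deriv θ q.2.2 * Ft q))
      + (∫ q in xCell (fluidDomain T η) 0, θ q.2.2 * layer k q.2.1 * F1 q)
      + (∫ q in xCell (fluidDomain T η) 0,
          θ q.2.2 * layer k (depth η q) * topFlux ηx ηt F0 F1 Ft q) = 0 := by
  have hfin := h.isFiniteMeasure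
  obtain ⟨C, hC⟩ := hθ.exists_bound
  obtain ⟨C', hC'⟩ := hθ.exists_bound_deriv
  have bθ := h.memLp_time hθ.continuous hC
  have bθ' := h.memLp_time hθ.continuous_deriv hC'
  have bζ := h.memLp_cutoff k
  have bz := h.memLp_layer hk (d := fun q => q.2.1) (by fun_prop)
  have bd := h.memLp_layer hk h.continuousOn_depth
  have it := hF.memLp_t.integrable (by norm_num : (1 : ℝ≥0∞) ≤ 2)
  have it' := hF.memLp_t'.integrable (by norm_num : (1 : ℝ≥0∞) ≤ 2)
  have i1 := h.integral_cutoff (p := 1) (r := ⊤) (by simp) h.depth_x h.memLp_slope hF.deriv_x hF.per_x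
    (memLp_one_iff_integrable.2 hF.int_x) (memLp_one_iff_integrable.2 hF.int_x') hθ hk hkc
  have i2 := h.integral_cutoff (p := 1) (r := ⊤) (by simp) h.depth_z (memLp_const _) hF.deriv_z
    hF.per_z (memLp_one_iff_integrable.2 hF.int_z) (memLp_one_iff_integrable.2 hF.int_z') hθ hk hkc
  have i3 := h.integral_cutoff (p := 2) (r := 2) (by simp) h.depth_t h.memLp_speed hF.deriv_t
    hF.per_t hF.memLp_t hF.memLp_t' hθ hk hkc
  have sx : IntegrableOn (fun q => F0 q * ηx (plateProj q)) (xCell (fluidDomain T η) 0) :=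
    (integrable_top_mul h.memLp_slope hF.int_x).congr (Eventually.of_forall fun q => mul_comm _ _)
  have st : IntegrableOn (fun q => Ft q * ηt (plateProj q)) (xCell (fluidDomain T η) 0) :=
    hF.memLp_t.integrable_mul h.memLp_speed
  have j0 : ∀ {w : ℝ × ℝ × ℝ → ℝ}, IntegrableOn w (xCell (fluidDomain T η) 0) →
      IntegrableOn (fun q => θ q.2.2 * (cutoff η k q * w q)) (xCell (fluidDomain T η) 0) :=
    fun hw => integrable_top_mul bθ (integrable_top_mul bζ hw)
  have jz : ∀ {w : ℝ × ℝ × ℝ → ℝ}, IntegrableOn w (xCell (fluidDomain T η) 0) →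
      IntegrableOn (fun q => θ q.2.2 * (layer k q.2.1 * w q)) (xCell (fluidDomain T η) 0) :=
    fun hw => integrable_top_mul bθ (integrable_top_mul bz hw)
  have jd : ∀ {w : ℝ × ℝ × ℝ → ℝ}, IntegrableOn w (xCell (fluidDomain T η) 0) →
      IntegrableOn (fun q => θ q.2.2 * (layer k (depth η q) * w q)) (xCell (fluidDomain T η) 0) :=
    fun hw => integrable_top_mul bθ (integrable_top_mul bd hw)
  have jt : IntegrableOn (fun q => deriv θ q.2.2 * (cutoff η k q * Ft q))
      (xCell (fluidDomain T η) 0) := integrable_top_mul bθ' (integrable_top_mul bζ it)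
  have e1 : ∀ q, θ q.2.2 * (F0 q * (layer k q.2.1 * (fluidDir 0).2.1
        + layer k (depth η q) * ηx (plateProj q)) + g0 q * cutoff η k q)
        + deriv θ q.2.2 * (fluidDir 0).2.2 * (F0 q * cutoff η k q)
      = θ q.2.2 * (layer k (depth η q) * (F0 q * ηx (plateProj q)))
        + θ q.2.2 * (cutoff η k q * g0 q) := fun q => by simp [fluidDir]; ring
  have e2 : ∀ q, θ q.2.2 * (F1 q * (layer k q.2.1 * (fluidDir 1).2.1
        + layer k (depth η q) * -1) + g1 q * cutoff η k q)
        + deriv θ q.2.2 * (fluidDir 1).2.2 * (F1 q * cutoff η k q)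
      = (θ q.2.2 * (layer k q.2.1 * F1 q) - θ q.2.2 * (layer k (depth η q) * F1 q))
        + θ q.2.2 * (cutoff η k q * g1 q) := fun q => by simp [fluidDir]; ring
  have e3 : ∀ q, θ q.2.2 * (Ft q * (layer k q.2.1 * fluidT.2.1
        + layer k (depth η q) * ηt (plateProj q)) + gt q * cutoff η k q)
        + deriv θ q.2.2 * fluidT.2.2 * (Ft q * cutoff η k q)
      = (θ q.2.2 * (layer k (depth η q) * (Ft q * ηt (plateProj q)))
        + θ q.2.2 * (cutoff η k q * gt q)) + deriv θ q.2.2 * (cutoff η k q * Ft q) := fun q => by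
    simp [fluidT]; ring
  have e4 : ∀ q, cutoff η k q * (θ q.2.2 * (g0 q + g1 q + gt q) + deriv θ q.2.2 * Ft q)
      = ((θ q.2.2 * (cutoff η k q * g0 q) + θ q.2.2 * (cutoff η k q * g1 q))
        + θ q.2.2 * (cutoff η k q * gt q)) + deriv θ q.2.2 * (cutoff η k q * Ft q) := fun q => by
    ring
  have e5 : ∀ q, θ q.2.2 * layer k (depth η q) * topFlux ηx ηt F0 F1 Ft q
      = (θ q.2.2 * (layer k (depth η q) * (F0 q * ηx (plateProj q)))
        - θ q.2.2 * (layer k (depth η q) * F1 q))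
        + θ q.2.2 * (layer k (depth η q) * (Ft q * ηt (plateProj q))) := fun q => by
    rw [topFlux]; ring
  simp only [e1] at i1
  simp only [e2] at i2
  simp only [e3] at i3
  simp only [e4, e5, mul_assoc (θ _) (layer k _) (F1 _)]
  have kz := Integrable.fun_sub (jz hF.int_z) (jd hF.int_z)
  have kd := Integrable.fun_sub (jd sx) (jd hF.int_z)
  have kt := Integrable.fun_add (jd st) (j0 it')
  have k0 := Integrable.fun_add (j0 hF.int_x') (j0 hF.int_z')
  rw [integral_add (jd sx) (j0 hF.int_x')] at i1
  rw [integral_add kz (j0 hF.int_z'), integral_sub (jz hF.int_z) (jd hF.int_z)] at i2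
  rw [integral_add kt jt, integral_add (jd st) (j0 it')] at i3
  rw [integral_add (Integrable.fun_add k0 (j0 it')) jt, integral_add k0 (j0 it'),
    integral_add (j0 hF.int_x') (j0 hF.int_z'), integral_add kd (jd st),
    integral_sub (jd sx) (jd hF.int_z)]
  linarith

end FluidGeometry

/-! ### Boundary layers -/

lemma layer_eq_zero_of_ge {h : ℝ} (hh : 0 < h) {s : ℝ} (hs : h ≤ s) : layer h s = 0 := by
  have hcl : IsClosed {s | layer h s = 0} := isClosed_eq (continuous_layer h) continuous_const
  have : closure (Ioi h) ⊆ {s | layer h s = 0} :=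
    hcl.closure_subset_iff.2 fun s hs => layer_eq_zero_of_gt hh hs
  rw [closure_Ioi] at this
  exact this hs

lemma integral_layer {h : ℝ} (hh : 0 < h) : ∫ s in Ioo 0 h, layer h s = 1 := by
  rw [← integral_Ioc_eq_integral_Ioo, ← intervalIntegral.integral_of_le hh.le]
  have : ∀ s ∈ uIcc 0 h, HasDerivAt (fun s => step (s / h)) (layer h s) s := fun s _ => by
    rw [← deriv_step_div]
    exact ((contDiff_step_div h).differentiable (by simp) s).hasDerivAt
  rw [intervalIntegral.integral_eq_sub_of_hasDerivAt this
    ((continuous_layer h).intervalIntegrable _ _), zero_div, div_self hh.ne',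
    step_of_ge le_rfl, step_of_le (by norm_num), sub_zero]

section Family

variable {α : Type*} [MeasurableSpace α] {ν : ℝ → Measure α} {F G : α → ℝ}

/-- `F` becomes small in `L^p` of the measures `ν h` as `h → 0`. -/
def LayerSmall (ν : ℝ → Measure α) (p : ℕ) (F : α → ℝ) : Prop :=
  Tendsto (fun h => ∫⁻ q, ‖F q‖ₑ ^ p ∂ν h) (𝓝[>] 0) (𝓝 0)

/-- `F` stays bounded in `L²` of the measures `ν h` as `h → 0`. -/
def LayerBounded (ν : ℝ → Measure α) (F : α → ℝ) : Prop :=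
  ∃ C : ℝ≥0∞, C ≠ ⊤ ∧ ∀ᶠ h in 𝓝[>] 0, ∫⁻ q, ‖F q‖ₑ ^ 2 ∂ν h ≤ C

lemma LayerSmall.of_le {p : ℕ} (hG : LayerSmall ν p G) {C : ℝ≥0∞} (hC : C ≠ ⊤)
    (h : ∀ᶠ h in 𝓝[>] 0, ∀ᵐ q ∂ν h, ‖F q‖ₑ ^ p ≤ C * ‖G q‖ₑ ^ p) : LayerSmall ν p F := by
  have h0 : Tendsto (fun h => C * ∫⁻ q, ‖G q‖ₑ ^ p ∂ν h) (𝓝[>] 0) (𝓝 0) := by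
    simpa using ENNReal.Tendsto.const_mul hG (Or.inr hC)
  refine tendsto_of_tendsto_of_tendsto_of_le_of_le' tendsto_const_nhds h0
    (Eventually.of_forall fun _ => zero_le) ?_
  filter_upwards [h] with k hk
  rw [← lintegral_const_mul' _ _ hC]
  exact lintegral_mono_ae hk

lemma LayerSmall.add (hF : LayerSmall ν 1 F) (hG : LayerSmall ν 1 G)
    (hm : ∀ h, AEMeasurable F (ν h)) : LayerSmall ν 1 (fun q => F q + G q) := by
  have h0 := Tendsto.add hF hG
  rw [add_zero] at h0
  refine tendsto_of_tendsto_of_tendsto_of_le_of_le tendsto_const_nhds h0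
    (fun _ => zero_le) fun k => ?_
  simp only [pow_one]
  rw [← lintegral_add_left' (hm k).enorm]
  exact lintegral_mono fun q => enorm_add_le _ _

/-- The Cauchy-Schwarz inequality in the boundary layer. -/
lemma LayerSmall.mul (hF : LayerSmall ν 2 F) (hG : LayerBounded ν G)
    (hFm : ∀ h, AEMeasurable F (ν h)) (hGm : ∀ h, AEMeasurable G (ν h)) :
    LayerSmall ν 1 (fun q => F q * G q) := by
  obtain ⟨C, hC, hb⟩ := hG
  have h0 : Tendsto (fun h => (∫⁻ q, ‖F q‖ₑ ^ 2 ∂ν h) ^ (1 / 2 : ℝ) * C ^ (1 / 2 : ℝ)) (𝓝[>] 0)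
      (𝓝 0) := by
    have h1 := ENNReal.Tendsto.mul_const (b := C ^ (1 / 2 : ℝ))
      ((ENNReal.continuous_rpow_const (y := (1 / 2 : ℝ))).continuousAt.tendsto.comp hF)
      (Or.inr (ENNReal.rpow_ne_top_of_nonneg (by norm_num) hC))
    simpa using h1
  refine tendsto_of_tendsto_of_tendsto_of_le_of_le' tendsto_const_nhds h0
    (Eventually.of_forall fun _ => zero_le) ?_
  filter_upwards [hb] with k hk
  have := ENNReal.lintegral_mul_le_Lp_mul_Lq (ν k) Real.HolderConjugate.two_two (hFm k).enorm
    (hGm k).enorm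
  simp only [ENNReal.rpow_two, Pi.mul_apply] at this
  simp only [pow_one, enorm_mul]
  exact this.trans (mul_le_mul_right (ENNReal.rpow_le_rpow hk (by norm_num)) _)

lemma LayerSmall.layerBounded (hF : LayerSmall ν 2 F) : LayerBounded ν F :=
  ⟨1, by simp, (hF.eventually_lt_const (by simp : (0 : ℝ≥0∞) < 1)).mono fun _ h => h.le⟩

lemma LayerBounded.add (hF : LayerBounded ν F) (hG : LayerBounded ν G)
    (hFm : ∀ h, AEMeasurable F (ν h)) : LayerBounded ν (fun q => F q + G q) := by
  obtain ⟨C, hC, hb⟩ := hF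
  obtain ⟨D, hD, hb'⟩ := hG
  refine ⟨2 * C + 2 * D, by finiteness, ?_⟩
  filter_upwards [hb, hb'] with k h1 h2
  calc ∫⁻ q, ‖F q + G q‖ₑ ^ 2 ∂ν k ≤ ∫⁻ q, (2 * ‖F q‖ₑ ^ 2 + 2 * ‖G q‖ₑ ^ 2) ∂ν k := by
        refine lintegral_mono fun q => ?_
        refine (pow_le_pow_left₀ zero_le (enorm_add_le _ _) 2).trans ?_
        have := ENNReal.rpow_add_le_mul_rpow_add_rpow (‖F q‖ₑ) (‖G q‖ₑ) (p := 2) (by norm_num)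
        norm_num at this
        rw [← mul_add]; exact this
    _ = 2 * ∫⁻ q, ‖F q‖ₑ ^ 2 ∂ν k + 2 * ∫⁻ q, ‖G q‖ₑ ^ 2 ∂ν k := by
        rw [lintegral_add_left' (((hFm k).enorm.pow_const 2).const_mul 2),
          lintegral_const_mul' _ _ (by simp), lintegral_const_mul' _ _ (by simp)]
    _ ≤ _ := by gcongr

end Family

namespace FluidGeometry

variable {T c : ℝ} {η ηx ηt : ℝ × ℝ → ℝ}

/-- Coordinates `((x,t),s)` of the fluid domain near a part of its boundary, where `s` is the value
of the function `d`. -/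
structure BoundaryChart (T c : ℝ) (η : ℝ × ℝ → ℝ) (d : ℝ × ℝ × ℝ → ℝ)
    (S : (ℝ × ℝ) × ℝ ≃ᵐ ℝ × ℝ × ℝ) : Prop where
  measurePreserving : MeasurePreserving S
  proj : ∀ w, plateProj (S w) = w.1
  dist : ∀ w ∈ plateCell T ×ˢ (univ : Set ℝ), d (S w) = w.2
  mem : ∀ k, k ≤ c → ∀ w, S w ∈ xCell (fluidDomain T η) 0 ∩ {q | d q < k}
    ↔ w ∈ plateCell T ×ˢ Ioo 0 k
  cont : ContinuousOn d (fluidDomain T η)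

/-- Coordinates near the plate. -/
def topEquiv (h : FluidGeometry T c η ηx ηt) : (ℝ × ℝ) × ℝ ≃ᵐ ℝ × ℝ × ℝ where
  toFun w := (w.1.1, clampTime T η w.1 - w.2, w.1.2)
  invFun q := (plateProj q, clampTime T η (plateProj q) - q.2.1)
  left_inv w := by simp [plateProj]
  right_inv q := by simp [plateProj]
  measurable_toFun := by
    have := h.continuous_clampTime
    exact Continuous.measurable (by dsimp; fun_prop)
  measurable_invFun := by
    have := h.continuous_clampTime.comp continuous_plateProj
    exact (continuous_plateProj.prodMk (this.sub (by fun_prop))).measurable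

lemma mem_cell_iff {q : ℝ × ℝ × ℝ} : q ∈ xCell (fluidDomain T η) 0
    ↔ plateProj q ∈ plateCell T ∧ 0 < q.2.1 ∧ 0 < depth η q := by
  simp only [xCell, fluidDomain, plateCell, plateProj, depth, mem_inter_iff, mem_ofPred_eq, mem_prod,
    mem_Ioo, sub_pos, zero_add]
  tauto

lemma topEquiv_apply (h : FluidGeometry T c η ηx ηt) (w : (ℝ × ℝ) × ℝ) :
    h.topEquiv w = (w.1.1, clampTime T η w.1 - w.2, w.1.2) := rfl

lemma lower_cell (h : FluidGeometry T c η ηx ηt) {y : ℝ × ℝ} (hy : y ∈ plateCell T) : c ≤ η y :=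
  h.lower y ⟨trivial, hy.2⟩

lemma topChart (h : FluidGeometry T c η ηx ηt) :
    BoundaryChart T c η (depth η) h.topEquiv where
  measurePreserving := by
    have hm : Measurable (clampTime T η) := h.continuous_clampTime.measurable
    have h1 : MeasurePreserving (fun p : (ℝ × ℝ) × ℝ => (p.1, clampTime T η p.1 - p.2)) :=
      (MeasurePreserving.id (volume : Measure (ℝ × ℝ))).skew_product
        (g := fun y s => clampTime T η y - s)
        ((hm.comp measurable_fst).sub measurable_snd)
        (Eventually.of_forall fun y => (Measure.measurePreserving_sub_left volume _).map_eq)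
    exact measurePreserving_fluidEquiv.comp h1
  proj w := rfl
  dist w hw := by
    rw [topEquiv_apply, clampTime_of_mem (Ioo_subset_Icc_self hw.1.2)]
    simp [depth, plateProj]
  mem k hk w := by
    rw [mem_inter_iff, mem_cell_iff, mem_prod, topEquiv_apply]
    change (w.1 ∈ plateCell T ∧ _) ∧ _ ↔ _
    by_cases hw : w.1 ∈ plateCell T
    · have := h.lower_cell hw
      rw [clampTime_of_mem (Ioo_subset_Icc_self hw.2)]
      simp only [hw, true_and, depth, plateProj, mem_ofPred_eq, Prod.mk.eta, mem_Ioo]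
      constructor
      · rintro ⟨⟨h1, h2⟩, h3⟩; constructor <;> linarith
      · rintro ⟨h1, h2⟩; refine ⟨⟨?_, ?_⟩, ?_⟩ <;> linarith
    · simp [hw]
  cont := h.continuousOn_depth

lemma bottomChart (h : FluidGeometry T c η ηx ηt) :
    BoundaryChart T c η (fun q => q.2.1) fluidEquiv where
  measurePreserving := measurePreserving_fluidEquiv
  proj w := rfl
  dist w hw := rfl
  mem k hk w := by
    rw [mem_inter_iff, mem_cell_iff, mem_prod]
    change (w.1 ∈ plateCell T ∧ _) ∧ _ ↔ _
    by_cases hw : w.1 ∈ plateCell T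
    · have := h.lower_cell hw
      change (_ ∧ 0 < w.2 ∧ 0 < η w.1 - w.2) ∧ w.2 < k ↔ _
      simp only [hw, true_and, mem_Ioo]
      constructor
      · rintro ⟨⟨h1, h2⟩, h3⟩; constructor <;> linarith
      · rintro ⟨h1, h2⟩; refine ⟨⟨?_, ?_⟩, ?_⟩ <;> linarith
    · simp [hw]
  cont := by fun_prop

/-- The measure with density `θ(t) layer(d)` on the fluid cell. -/
def layerMeasure (T : ℝ) (η : ℝ × ℝ → ℝ) (θ : ℝ → ℝ) (d : ℝ × ℝ × ℝ → ℝ) (k : ℝ) :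
    Measure (ℝ × ℝ × ℝ) :=
  (volume.restrict (xCell (fluidDomain T η) 0)).withDensity
    fun q => ENNReal.ofReal (θ q.2.2 * layer k (d q))

section Chart

variable {d : ℝ × ℝ × ℝ → ℝ} {S : (ℝ × ℝ) × ℝ ≃ᵐ ℝ × ℝ × ℝ} {θ : ℝ → ℝ} {k : ℝ}
  {F : ℝ × ℝ × ℝ → ℝ} {γ : ℝ × ℝ → ℝ}

lemma layerMeasure_ac : layerMeasure T η θ d k ≪ volume.restrict (xCell (fluidDomain T η) 0) :=
  withDensity_absolutelyContinuous _ _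

lemma aemeasurable_layer (hF : AEStronglyMeasurable F
    (volume.restrict (xCell (fluidDomain T η) 0))) (k : ℝ) :
    AEMeasurable F (layerMeasure T η θ d k) := hF.aemeasurable.mono_ac layerMeasure_ac

lemma BoundaryChart.aemeasurable_density (hS : BoundaryChart T c η d S)
    (h : FluidGeometry T c η ηx ηt) (hθ : Continuous θ) (k : ℝ) :
    AEMeasurable (fun q => ENNReal.ofReal (θ q.2.2 * layer k (d q)))
      (volume.restrict (xCell (fluidDomain T η) 0)) := by
  have hm := measurableSet_xCell h.isOpen.measurableSet 0
  have hc : ContinuousOn (fun q : ℝ × ℝ × ℝ => θ q.2.2 * layer k (d q))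
      (xCell (fluidDomain T η) 0) :=
    (by fun_prop : ContinuousOn (fun q : ℝ × ℝ × ℝ => θ q.2.2) _).mul
      ((continuous_layer k).comp_continuousOn (hS.cont.mono inter_subset_left))
  exact (hc.aemeasurable hm).ennreal_ofReal

lemma BoundaryChart.lintegral_layerMeasure (hS : BoundaryChart T c η d S)
    (h : FluidGeometry T c η ηx ηt) (hθ : Continuous θ) {G : ℝ × ℝ × ℝ → ℝ≥0∞}
    (hG : AEMeasurable G (volume.restrict (xCell (fluidDomain T η) 0))) :
    ∫⁻ q, G q ∂layerMeasure T η θ d k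
      = ∫⁻ q in xCell (fluidDomain T η) 0, ENNReal.ofReal (θ q.2.2 * layer k (d q)) * G q :=
  lintegral_withDensity_eq_lintegral_mul₀ (hS.aemeasurable_density h hθ k) hG

lemma BoundaryChart.measurableSet_inter (hS : BoundaryChart T c η d S)
    (h : FluidGeometry T c η ηx ηt) (k : ℝ) :
    MeasurableSet (xCell (fluidDomain T η) 0 ∩ {q | d q < k}) := by
  have h1 : IsOpen (fluidDomain T η ∩ d ⁻¹' Iio k) := hS.cont.isOpen_inter_preimage h.isOpen isOpen_Iio
  have : xCell (fluidDomain T η) 0 ∩ {q | d q < k}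
      = (fluidDomain T η ∩ d ⁻¹' Iio k) ∩ {q | q.1 ∈ Ioo 0 (0 + 1)} := by
    ext q; simp only [xCell, mem_inter_iff, mem_ofPred_eq, mem_preimage, mem_Iio]; tauto
  rw [this]
  exact h1.measurableSet.inter (measurable_fst measurableSet_Ioo)

lemma BoundaryChart.preimage (hS : BoundaryChart T c η d S) (hk : k ≤ c) :
    S ⁻¹' (xCell (fluidDomain T η) 0 ∩ {q | d q < k}) = plateCell T ×ˢ Ioo 0 k := by
  ext w; exact hS.mem k hk w

lemma BoundaryChart.lintegral_eq (hS : BoundaryChart T c η d S) (h : FluidGeometry T c η ηx ηt)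
    (hk : k ≤ c) {G : ℝ × ℝ × ℝ → ℝ≥0∞}
    (hG : AEMeasurable G (volume.restrict (xCell (fluidDomain T η) 0))) :
    ∫⁻ q in xCell (fluidDomain T η) 0 ∩ {q | d q < k}, G q
      = ∫⁻ s in Ioo 0 k, ∫⁻ y in plateCell T, G (S (y, s)) := by
  have hr := hS.measurePreserving.restrict_preimage (hS.measurableSet_inter h k)
  rw [hS.preimage hk, Measure.volume_eq_prod (ℝ × ℝ) ℝ, ← Measure.prod_restrict] at hr
  have hG' : AEMeasurable (G ∘ S) ((volume.restrict (plateCell T)).prod (volume.restrict (Ioo 0 k))) :=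
    (hG.mono_measure (Measure.restrict_mono inter_subset_left le_rfl)).comp_quasiMeasurePreserving
      hr.quasiMeasurePreserving
  rw [← hS.measurePreserving.setLIntegral_comp_preimage_emb S.measurableEmbedding, hS.preimage hk,
    Measure.volume_eq_prod (ℝ × ℝ) ℝ, ← Measure.prod_restrict]
  exact lintegral_prod_symm _ hG'

/-- An integral over the boundary layer is bounded by an average over the distance to the boundary,
which is the quantity that occurs in the definition of a trace. -/
lemma BoundaryChart.layerMeasure_le (hS : BoundaryChart T c η d S) (h : FluidGeometry T c η ηx ηt)
    (hθ : IsTest 0 T θ) :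
    ∃ C : ℝ≥0∞, C ≠ ⊤ ∧ ∀ k, 0 < k → k ≤ c → ∀ G : ℝ × ℝ × ℝ → ℝ≥0∞,
      AEMeasurable G (volume.restrict (xCell (fluidDomain T η) 0)) →
      ∫⁻ q, G q ∂layerMeasure T η θ d k
        ≤ C * ((∫⁻ s in Ioo 0 k, ∫⁻ y in plateCell T, G (S (y, s))) / ENNReal.ofReal k) := by
  obtain ⟨B, hB⟩ := hθ.exists_bound
  have hB0 : 0 ≤ B := (norm_nonneg _).trans (hB 0)
  obtain ⟨C, hC0, hC⟩ := exists_layer_le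
  refine ⟨ENNReal.ofReal (B * C), by simp, fun k hk hkc G hG => ?_⟩
  rw [hS.lintegral_layerMeasure h hθ.continuous hG, ← hS.lintegral_eq h hkc hG]
  have hm := measurableSet_xCell h.isOpen.measurableSet 0
  have hpt : ∀ q ∈ xCell (fluidDomain T η) 0, ENNReal.ofReal (θ q.2.2 * layer k (d q)) * G q
      ≤ (xCell (fluidDomain T η) 0 ∩ {q | d q < k}).indicator
        (fun q => ENNReal.ofReal (B * C / k) * G q) q := fun q hq => by
    by_cases hd : d q < k
    · have hq' : q ∈ xCell (fluidDomain T η) 0 ∩ {q | d q < k} := ⟨hq, hd⟩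
      rw [indicator_of_mem hq']
      gcongr
      rw [mul_div_assoc]
      exact mul_le_mul ((le_abs_self _).trans (hB _)) (hC k hk _) (layer_nonneg hk _) hB0
    · rw [layer_eq_zero_of_ge hk (not_lt.1 hd)]; simp
  refine (setLIntegral_mono' hm hpt).trans ?_
  refine (setLIntegral_le_lintegral _ _).trans ?_
  rw [lintegral_indicator (hS.measurableSet_inter h k), lintegral_const_mul' _ _ (by simp),
    ENNReal.ofReal_div_of_pos hk, div_eq_mul_inv, div_eq_mul_inv, mul_assoc, mul_comm _⁻¹]

/-- A trace on the boundary gives smallness in the boundary layer. -/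
lemma BoundaryChart.layerSmall (hS : BoundaryChart T c η d S) (h : FluidGeometry T c η ηx ηt)
    (hθ : IsTest 0 T θ) {g : ℝ × ℝ × ℝ → ℝ}
    (hg : AEStronglyMeasurable g (volume.restrict (xCell (fluidDomain T η) 0)))
    (hγ : AEStronglyMeasurable (fun q => γ (plateProj q))
      (volume.restrict (xCell (fluidDomain T η) 0)))
    (htr : Tendsto (fun k : ℝ => (∫⁻ s in Ioo 0 k, ∫⁻ y in plateCell T,
      ‖g (S (y, s)) - γ y‖ₑ ^ 2) / ENNReal.ofReal k) (𝓝[>] 0) (𝓝 0)) :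
    LayerSmall (layerMeasure T η θ d) 2 (fun q => g q - γ (plateProj q)) := by
  obtain ⟨C, hC, hle⟩ := hS.layerMeasure_le h hθ
  have h0 := ENNReal.Tendsto.const_mul htr (Or.inr hC)
  rw [mul_zero] at h0
  refine tendsto_of_tendsto_of_tendsto_of_le_of_le' tendsto_const_nhds h0
    (Eventually.of_forall fun _ => zero_le) ?_
  filter_upwards [Ioc_mem_nhdsGT h.pos] with k hk
  have := hle k hk.1 hk.2 _ ((hg.sub hγ).aemeasurable.enorm.pow_const 2)
  simpa only [Pi.sub_apply, hS.proj] using this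

lemma BoundaryChart.layerBounded_plate (hS : BoundaryChart T c η d S)
    (h : FluidGeometry T c η ηx ηt) (hθ : IsTest 0 T θ) (hγ : MemLp γ 2 (volume.restrict (plateCell T))) :
    LayerBounded (layerMeasure T η θ d) (fun q => γ (plateProj q)) := by
  obtain ⟨C, hC, hle⟩ := hS.layerMeasure_le h hθ
  have hγ' : AEStronglyMeasurable (fun q => γ (plateProj q))
      (volume.restrict (xCell (fluidDomain T η) 0)) :=
    (h.memLp_comp_plateProj (by rw [← plateDomain_eq_slab, xCell_plateDomain]; exact hγ)).1
  have hfin : ∫⁻ y in plateCell T, ‖γ y‖ₑ ^ 2 ≠ ⊤ := by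
    have h1 := hγ.eLpNorm_lt_top
    rw [eLpNorm_lt_top_iff_lintegral_rpow_enorm_lt_top (by simp) (by simp)] at h1
    simpa using h1.ne
  refine ⟨C * ∫⁻ y in plateCell T, ‖γ y‖ₑ ^ 2, ENNReal.mul_ne_top hC hfin, ?_⟩
  filter_upwards [Ioc_mem_nhdsGT h.pos] with k hk
  refine (hle k hk.1 hk.2 _ (hγ'.aemeasurable.enorm.pow_const 2)).trans ?_
  simp only [hS.proj, lintegral_const, Measure.restrict_apply_univ, Real.volume_Ioo, sub_zero]
  gcongr
  rw [ENNReal.mul_div_cancel_right (by simpa using hk.1) (by simp)]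

/-- The integral over a boundary layer of a function of `(x,t)`. -/
lemma BoundaryChart.integral_plate (hS : BoundaryChart T c η d S) (h : FluidGeometry T c η ηx ηt)
    (hk : 0 < k) (hkc : k ≤ c) (γ : ℝ × ℝ → ℝ) :
    ∫ q in xCell (fluidDomain T η) 0, θ q.2.2 * layer k (d q) * γ (plateProj q)
      = ∫ y in plateCell T, θ y.2 * γ y := by
  have hm := measurableSet_xCell h.isOpen.measurableSet 0
  have e1 : ∫ q in xCell (fluidDomain T η) 0, θ q.2.2 * layer k (d q) * γ (plateProj q)
      = ∫ q in xCell (fluidDomain T η) 0 ∩ {q | d q < k},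
        θ q.2.2 * layer k (d q) * γ (plateProj q) := by
    refine setIntegral_eq_of_subset_of_forall_sdiff_eq_zero hm inter_subset_left fun q hq => ?_
    have hd : k ≤ d q := not_lt.1 fun hd => hq.2 ⟨hq.1, hd⟩
    rw [layer_eq_zero_of_ge hk hd]; simp
  rw [e1, ← hS.measurePreserving.setIntegral_preimage_emb S.measurableEmbedding, hS.preimage hkc]
  have e2 : ∫ w in plateCell T ×ˢ Ioo 0 k,
        θ (S w).2.2 * layer k (d (S w)) * γ (plateProj (S w))
      = ∫ w in plateCell T ×ˢ Ioo 0 k, (θ w.1.2 * γ w.1) * layer k w.2 := by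
    refine setIntegral_congr_fun
      ((measurableSet_Ioo.prod measurableSet_Ioo).prod measurableSet_Ioo) fun w hw => ?_
    have hp := hS.proj w
    have ht : (S w).2.2 = w.1.2 := (congrArg (fun y : ℝ × ℝ => y.2) hp :)
    simp only [hS.dist w ⟨hw.1, trivial⟩, hp, ht]
    ring
  rw [e2, Measure.volume_eq_prod (ℝ × ℝ) ℝ, setIntegral_prod_mul (fun y : ℝ × ℝ => θ y.2 * γ y) (layer k),
    integral_layer hk, mul_one]

/-- The integral over a boundary layer is small for functions that are small there. -/
lemma BoundaryChart.tendsto_integral (hS : BoundaryChart T c η d S) (h : FluidGeometry T c η ηx ηt)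
    (hθ : IsTest 0 T θ) (hθ0 : ∀ t, 0 ≤ θ t)
    (hF : AEStronglyMeasurable F (volume.restrict (xCell (fluidDomain T η) 0)))
    (hs : LayerSmall (layerMeasure T η θ d) 1 F) :
    Tendsto (fun k => ∫ q in xCell (fluidDomain T η) 0, θ q.2.2 * layer k (d q) * F q)
      (𝓝[>] 0) (𝓝 0) := by
  rw [tendsto_zero_iff_enorm_tendsto_zero]
  refine tendsto_of_tendsto_of_tendsto_of_le_of_le' tendsto_const_nhds hs
    (Eventually.of_forall fun _ => zero_le) ?_
  filter_upwards [self_mem_nhdsWithin] with k hk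
  refine (enorm_integral_le_lintegral_enorm _).trans ?_
  simp only [pow_one]
  rw [hS.lintegral_layerMeasure h hθ.continuous hF.aemeasurable.enorm]
  refine lintegral_mono fun q => ?_
  rw [enorm_mul, Real.enorm_of_nonneg (mul_nonneg (hθ0 _) (layer_nonneg hk _))]

end Chart

end FluidGeometry

namespace FluidGeometry

variable {T c : ℝ} {η ηx ηt : ℝ × ℝ → ℝ} {F0 F1 Ft g0 g1 gt : ℝ × ℝ × ℝ → ℝ} {θ : ℝ → ℝ}

lemma tendsto_cutoff {q : ℝ × ℝ × ℝ} (hq : q ∈ fluidDomain T η) :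
    Tendsto (fun k => cutoff η k q) (𝓝[>] 0) (𝓝 1) := by
  have h1 : 0 < q.2.1 := hq.2.1
  have h2 := depth_pos hq
  refine tendsto_const_nhds.congr' ?_
  filter_upwards [Ioc_mem_nhdsGT h1, Ioc_mem_nhdsGT h2] with k hk1 hk2
  rw [cutoff, step_of_ge ((one_le_div hk1.1).2 hk1.2), step_of_ge ((one_le_div hk1.1).2 hk2.2)]
  norm_num

lemma Flux.integrable_interior (hF : Flux T η F0 F1 Ft g0 g1 gt) (h : FluidGeometry T c η ηx ηt)
    (hθ : IsTest 0 T θ) :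
    IntegrableOn (fun q => θ q.2.2 * (g0 q + g1 q + gt q) + deriv θ q.2.2 * Ft q)
      (xCell (fluidDomain T η) 0) := by
  have hfin := h.isFiniteMeasure
  obtain ⟨C, hC⟩ := hθ.exists_bound
  obtain ⟨C', hC'⟩ := hθ.exists_bound_deriv
  have it := hF.memLp_t.integrable (by norm_num : (1 : ℝ≥0∞) ≤ 2)
  have it' := hF.memLp_t'.integrable (by norm_num : (1 : ℝ≥0∞) ≤ 2)
  exact (integrable_top_mul (h.memLp_time hθ.continuous hC)
    ((hF.int_x'.add hF.int_z').add it')).add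
    (integrable_top_mul (h.memLp_time hθ.continuous_deriv hC') it)

/-- The divergence theorem on the moving domain, for a vector field whose flux through the bottom
vanishes, and whose flux through the moving boundary is `R`, in the sense of traces. -/
theorem Flux.divergence (hF : Flux T η F0 F1 Ft g0 g1 gt) (h : FluidGeometry T c η ηx ηt)
    (hθ : IsTest 0 T θ) (hθ0 : ∀ t, 0 ≤ θ t) {R : ℝ × ℝ → ℝ} (hR : IntegrableOn R (plateCell T))
    (hb : LayerSmall (layerMeasure T η θ fun q => q.2.1) 1 F1)
    (ht : LayerSmall (layerMeasure T η θ (depth η)) 1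
      fun q => topFlux ηx ηt F0 F1 Ft q - R (plateProj q)) :
    (∫ q in xCell (fluidDomain T η) 0, (θ q.2.2 * (g0 q + g1 q + gt q) + deriv θ q.2.2 * Ft q))
      + ∫ y in plateCell T, θ y.2 * R y = 0 := by
  have hm := measurableSet_xCell h.isOpen.measurableSet 0
  have hi := hF.integrable_interior h hθ
  obtain ⟨C, hC⟩ := hθ.exists_bound
  have bθ := h.memLp_time hθ.continuous hC
  have hRi : IntegrableOn (fun q => R (plateProj q)) (xCell (fluidDomain T η) 0) :=
    memLp_one_iff_integrable.1 (h.memLp_comp_plateProj (memLp_one_iff_integrable.2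
      (by rw [← plateDomain_eq_slab, xCell_plateDomain]; exact hR)))
  have hti := hF.integrable_topFlux h
  have l1 : Tendsto (fun k => ∫ q in xCell (fluidDomain T η) 0,
      cutoff η k q * (θ q.2.2 * (g0 q + g1 q + gt q) + deriv θ q.2.2 * Ft q)) (𝓝[>] 0)
      (𝓝 (∫ q in xCell (fluidDomain T η) 0,
        (θ q.2.2 * (g0 q + g1 q + gt q) + deriv θ q.2.2 * Ft q))) := by
    refine tendsto_integral_filter_of_dominated_convergence
      (fun q => ‖θ q.2.2 * (g0 q + g1 q + gt q) + deriv θ q.2.2 * Ft q‖) ?_ ?_ hi.norm ?_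
    · exact Eventually.of_forall fun k => (integrable_top_mul (h.memLp_cutoff k) hi).1
    · refine Eventually.of_forall fun k => Eventually.of_forall fun q => ?_
      rw [norm_mul]
      exact mul_le_of_le_one_left (norm_nonneg _) (abs_cutoff_le k q)
    · filter_upwards [ae_restrict_mem hm] with q hq
      simpa using (tendsto_cutoff hq.1).mul_const _
  have l2 := h.bottomChart.tendsto_integral h hθ hθ0 hF.int_z.1 hb
  have l3 := h.topChart.tendsto_integral h hθ hθ0 (hti.sub hRi).1 ht
  have l4 := (l1.add l2).add l3
  rw [add_zero, add_zero] at l4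
  refine eq_neg_iff_add_eq_zero.1 (tendsto_nhds_unique l4 (tendsto_const_nhds.congr' ?_))
  filter_upwards [Ioo_mem_nhdsGT (by have := h.pos; linarith : 0 < c / 2)] with k hk
  have e := hF.divergence_cutoff h hθ hk.1 (by linarith [hk.2] : 2 * k < c)
  have e2 := h.topChart.integral_plate (θ := θ) h hk.1 (by linarith [hk.1, hk.2]) R
  have bd := h.memLp_layer hk.1 h.continuousOn_depth
  have j : ∀ {w : ℝ × ℝ × ℝ → ℝ}, IntegrableOn w (xCell (fluidDomain T η) 0) →
      IntegrableOn (fun q => θ q.2.2 * layer k (depth η q) * w q) (xCell (fluidDomain T η) 0) :=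
    fun hw => integrable_top_mul (memLp_top_mul bθ bd) hw
  simp only [Pi.sub_apply, mul_sub]
  rw [integral_sub (j hti) (j hRi), e2]
  linarith

/-- A vector field in the `z` direction. -/
lemma Flux.vertical (hd : HasWeakDeriv (fluidDomain T η) (fluidDir 1) F1 g1)
    (hper : AEPeriodic (fluidDomain T η) F1) (hi : IntegrableOn F1 (xCell (fluidDomain T η) 0))
    (hi' : IntegrableOn g1 (xCell (fluidDomain T η) 0)) :
    Flux T η (fun _ => 0) F1 (fun _ => 0) (fun _ => 0) g1 (fun _ => 0) where
  deriv_x := hasWeakDeriv_one _ _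
  deriv_z := hd
  deriv_t := hasWeakDeriv_one _ _
  per_x := Eventually.of_forall fun _ => rfl
  per_z := hper
  per_t := Eventually.of_forall fun _ => rfl
  int_x := integrable_zero _ _ _
  int_z := hi
  memLp_t := MemLp.zero'
  int_x' := integrable_zero _ _ _
  int_z' := hi'
  memLp_t' := MemLp.zero'

/-- The square of a function, cut off near one of the two horizontal boundaries, as a vertical
vector field. -/
lemma flux_cutoff_sq (h : FluidGeometry T c η ηx ηt) {w wz d : ℝ × ℝ × ℝ → ℝ} {a k : ℝ}
    (hk : 0 < k) (hw : HasWeakDeriv (fluidDomain T η) (fluidDir 1) w wz)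
    (w2 : CellL2 (fluidDomain T η) w) (wz2 : CellL2 (fluidDomain T η) wz)
    (hd : HasWeakDeriv (fluidDomain T η) (fluidDir 1) d (fun _ => a))
    (hdc : ContinuousOn d (fluidDomain T η)) (hdp : AEPeriodic (fluidDomain T η) d) :
    Flux T η (fun _ => 0) (fun q => w q * w q * step (d q / k)) (fun _ => 0) (fun _ => 0)
      (fun q => w q * w q * (layer k (d q) * a) + (w q * wz q + wz q * w q) * step (d q / k))
      (fun _ => 0) := by
  have hm := h.isOpen.measurableSet
  have i1 := w2.integrable_mul w2
  have i2 : IntegrableOn (fun q => w q * wz q + wz q * w q) (xCell (fluidDomain T η) 0) :=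
    (w2.integrable_mul wz2).add (wz2.integrable_mul w2)
  have p1 := w2.1.mul w2.1
  have hsq := hw.mul_cellL2 h.isOpen h.isXPeriodic hw w2 wz2 w2 wz2
  have hst := hd.step_div h.isOpen hk
  have b1 : MemLp (fun q => step (d q / k)) ⊤ (volume.restrict (xCell (fluidDomain T η) 0)) :=
    h.memLp_top_of_continuousOn (C := 1)
      (step_contDiff.continuous.comp_continuousOn (hdc.div_const k)) fun q _ => by
        rw [abs_of_nonneg (step_nonneg _)]; exact step_le_one _
  have b2 : MemLp (fun q => layer k (d q) * a) ⊤ (volume.restrict (xCell (fluidDomain T η) 0)) :=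
    (h.memLp_layer hk hdc).mul_const a
  have p2 : AEPeriodic (fluidDomain T η) (fun q => step (d q / k)) :=
    hdp.comp fun s => step (s / k)
  have p3 : AEPeriodic (fluidDomain T η) (fun q => layer k (d q) * a) :=
    hdp.comp fun s => layer k s * a
  have p4 := hsq.aePeriodic h.isOpen h.isXPeriodic p1
  refine Flux.vertical (hsq.mul_of_holder (p := 1) (r := ⊤) (by simp) h.isOpen hst
    (p1.memLpLoc hm h.isXPeriodic (memLp_one_iff_integrable.2 i1))
    (p4.memLpLoc hm h.isXPeriodic (memLp_one_iff_integrable.2 i2))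
    (p2.memLpLoc hm h.isXPeriodic b1) (p3.memLpLoc hm h.isXPeriodic b2)) (p1.mul p2) ?_ ?_
  · exact (integrable_top_mul b1 i1).congr (Eventually.of_forall fun q => mul_comm _ _)
  · exact ((integrable_top_mul b2 i1).add (integrable_top_mul b1 i2)).congr
      (Eventually.of_forall fun q => by simp only [Pi.add_apply]; ring)

/-- The boundary terms of the divergence theorem are bounded uniformly in the thickness of the
layer. -/
lemma Flux.exists_bound (hF : Flux T η F0 F1 Ft g0 g1 gt) (h : FluidGeometry T c η ηx ηt)
    (hθ : IsTest 0 T θ) : ∃ B, ∀ k, 0 < k → 2 * k < c →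
      |(∫ q in xCell (fluidDomain T η) 0, θ q.2.2 * layer k q.2.1 * F1 q)
      + (∫ q in xCell (fluidDomain T η) 0,
          θ q.2.2 * layer k (depth η q) * topFlux ηx ηt F0 F1 Ft q)| ≤ B := by
  have hi := hF.integrable_interior h hθ
  refine ⟨∫ q in xCell (fluidDomain T η) 0,
    |θ q.2.2 * (g0 q + g1 q + gt q) + deriv θ q.2.2 * Ft q|, fun k hk hkc => ?_⟩
  have e := hF.divergence_cutoff h hθ hk hkc
  rw [add_assoc] at e
  rw [← neg_eq_of_add_eq_zero_right e, abs_neg]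
  refine abs_integral_le_integral_abs.trans (integral_mono_of_nonneg
    (Eventually.of_forall fun _ => abs_nonneg _) hi.abs (Eventually.of_forall fun q => ?_))
  simp only [abs_mul]
  exact mul_le_of_le_one_left (abs_nonneg _) (abs_cutoff_le k q)

lemma BoundaryChart.layerBounded_of_integral {d : ℝ × ℝ × ℝ → ℝ} {S : (ℝ × ℝ) × ℝ ≃ᵐ ℝ × ℝ × ℝ}
    (hS : BoundaryChart T c η d S) (h : FluidGeometry T c η ηx ηt) (hθ : IsTest 0 T θ)
    (hθ0 : ∀ t, 0 ≤ θ t) {w : ℝ × ℝ × ℝ → ℝ}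
    (hw : MemLp w 2 (volume.restrict (xCell (fluidDomain T η) 0))) {B : ℝ}
    (hB : ∀ᶠ k in 𝓝[>] 0,
      ∫ q in xCell (fluidDomain T η) 0, θ q.2.2 * layer k (d q) * (w q * w q) ≤ B) :
    LayerBounded (layerMeasure T η θ d) w := by
  obtain ⟨C, hC⟩ := hθ.exists_bound
  refine ⟨ENNReal.ofReal B, by simp, ?_⟩
  filter_upwards [hB, self_mem_nhdsWithin] with k hk hk0
  rw [hS.lintegral_layerMeasure h hθ.continuous (hw.1.aemeasurable.enorm.pow_const 2)]
  refine le_trans (le_of_eq ?_) (ENNReal.ofReal_le_ofReal hk)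
  have i : IntegrableOn (fun q => θ q.2.2 * layer k (d q) * (w q * w q))
      (xCell (fluidDomain T η) 0) :=
    integrable_top_mul (memLp_top_mul (h.memLp_time hθ.continuous hC) (h.memLp_layer hk0 hS.cont))
      (hw.integrable_mul hw)
  have hn : ∀ q, 0 ≤ θ q.2.2 * layer k (d q) := fun q => mul_nonneg (hθ0 _) (layer_nonneg hk0 _)
  rw [ofReal_integral_eq_lintegral_ofReal i
    (Eventually.of_forall fun q => mul_nonneg (hn q) (mul_self_nonneg _))]
  refine lintegral_congr fun q => ?_
  rw [ENNReal.ofReal_mul (hn q), ← abs_mul_abs_self, ENNReal.ofReal_mul (abs_nonneg _),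
    Real.enorm_eq_ofReal_abs, sq]

/-- A function with a square integrable vertical derivative stays bounded in the boundary layer at
the bottom: apply the divergence theorem to its square, cut off near the plate. -/
theorem layerBounded_bottom (h : FluidGeometry T c η ηx ηt) (hθ : IsTest 0 T θ)
    (hθ0 : ∀ t, 0 ≤ θ t) {w wz : ℝ × ℝ × ℝ → ℝ}
    (hw : HasWeakDeriv (fluidDomain T η) (fluidDir 1) w wz)
    (w2 : CellL2 (fluidDomain T η) w) (wz2 : CellL2 (fluidDomain T η) wz) :
    LayerBounded (layerMeasure T η θ fun q => q.2.1) w := by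
  have hc := h.pos
  have hF := h.flux_cutoff_sq (k := c / 2) (by positivity) hw w2 wz2 h.depth_z h.continuousOn_depth
    h.aePeriodic_depth
  obtain ⟨B, hB⟩ := hF.exists_bound h hθ
  refine h.bottomChart.layerBounded_of_integral h hθ hθ0 w2.2 (B := B) ?_
  have hm := measurableSet_xCell h.isOpen.measurableSet 0
  filter_upwards [Ioo_mem_nhdsGT (by positivity : 0 < c / 4)] with k hk
  have := hB k hk.1 (by linarith [hk.2])
  -- the cutoff function is one in the layer at the bottom and zero in the layer at the top
  have e1 : ∫ q in xCell (fluidDomain T η) 0,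
      θ q.2.2 * layer k q.2.1 * (w q * w q * step (depth η q / (c / 2)))
      = ∫ q in xCell (fluidDomain T η) 0, θ q.2.2 * layer k q.2.1 * (w q * w q) := by
    refine setIntegral_congr_fun hm fun q hq => ?_
    by_cases hz : q.2.1 < k
    · have h1 := h.height_add_depth hq.1
      rw [step_of_ge, mul_one]
      rw [one_le_div (by positivity)]
      linarith [hk.2]
    · simp [layer_eq_zero_of_ge hk.1 (not_lt.1 hz)]
  have e2 : ∫ q in xCell (fluidDomain T η) 0, θ q.2.2 * layer k (depth η q) *
      topFlux ηx ηt (fun _ => 0) (fun q => w q * w q * step (depth η q / (c / 2))) (fun _ => 0) q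
      = 0 := by
    refine setIntegral_eq_zero_of_forall_eq_zero fun q hq => ?_
    by_cases hz : depth η q < k
    · have : step (depth η q / (c / 2)) = 0 :=
        step_of_le (by rw [div_le_iff₀ (by positivity)]; linarith [hk.2])
      simp [topFlux, this]
    · simp [layer_eq_zero_of_ge hk.1 (not_lt.1 hz)]
  rw [e1, e2, add_zero] at this
  exact (le_abs_self _).trans this

/-- A function with a square integrable vertical derivative stays bounded in the boundary layer at
the plate: apply the divergence theorem to its square, cut off near the bottom. -/
theorem layerBounded_top (h : FluidGeometry T c η ηx ηt) (hθ : IsTest 0 T θ)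
    (hθ0 : ∀ t, 0 ≤ θ t) {w wz : ℝ × ℝ × ℝ → ℝ}
    (hw : HasWeakDeriv (fluidDomain T η) (fluidDir 1) w wz)
    (w2 : CellL2 (fluidDomain T η) w) (wz2 : CellL2 (fluidDomain T η) wz) :
    LayerBounded (layerMeasure T η θ (depth η)) w := by
  have hc := h.pos
  have hF := h.flux_cutoff_sq (k := c / 2) (by positivity) hw w2 wz2
    (hasWeakDeriv_height (fluidDir 1)) (by fun_prop) aePeriodic_height
  obtain ⟨B, hB⟩ := hF.exists_bound h hθ
  refine h.topChart.layerBounded_of_integral h hθ hθ0 w2.2 (B := B) ?_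
  have hm := measurableSet_xCell h.isOpen.measurableSet 0
  filter_upwards [Ioo_mem_nhdsGT (by positivity : 0 < c / 4)] with k hk
  have := hB k hk.1 (by linarith [hk.2])
  -- the cutoff function is one in the layer at the top and zero in the layer at the bottom
  have e1 : ∫ q in xCell (fluidDomain T η) 0, θ q.2.2 * layer k (depth η q) *
      topFlux ηx ηt (fun _ => 0) (fun q => w q * w q * step (q.2.1 / (c / 2))) (fun _ => 0) q
      = - ∫ q in xCell (fluidDomain T η) 0, θ q.2.2 * layer k (depth η q) * (w q * w q) := by
    rw [← integral_neg]
    refine setIntegral_congr_fun hm fun q hq => ?_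
    by_cases hz : depth η q < k
    · have h1 := h.height_add_depth hq.1
      simp only [topFlux]
      rw [step_of_ge]
      · ring
      rw [one_le_div (by positivity)]
      linarith [hk.2]
    · simp [layer_eq_zero_of_ge hk.1 (not_lt.1 hz)]
  have e2 : ∫ q in xCell (fluidDomain T η) 0, θ q.2.2 * layer k q.2.1 *
      (w q * w q * step (q.2.1 / (c / 2))) = 0 := by
    refine setIntegral_eq_zero_of_forall_eq_zero fun q hq => ?_
    by_cases hz : q.2.1 < k
    · have : step (q.2.1 / (c / 2)) = 0 :=
        step_of_le (by rw [div_le_iff₀ (by positivity)]; linarith [hk.2])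
      simp [this]
    · simp [layer_eq_zero_of_ge hk.1 (not_lt.1 hz)]
  rw [e1, e2, zero_add, abs_neg] at this
  exact (le_abs_self _).trans this

end FluidGeometry

/-! ### Transport by the flow -/

lemma memLp_xCell_slab {T : ℝ} {γ : ℝ × ℝ → ℝ} {p : ℝ≥0∞}
    (h : MemLp γ p (volume.restrict (plateCell T))) :
    MemLp γ p (volume.restrict (xCell (slab 0 T) 0)) := by
  rwa [← plateDomain_eq_slab, xCell_plateDomain]

section Trace

open FluidGeometry

variable {T c : ℝ} {η ηx ηt : ℝ × ℝ → ℝ} {θ : ℝ → ℝ}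

lemma IsTopTrace.layerSmall {g : ℝ × ℝ × ℝ → ℝ} {γ : ℝ × ℝ → ℝ}
    (h : FluidGeometry T c η ηx ηt) (hθ : IsTest 0 T θ)
    (hg : MemLp g 2 (volume.restrict (xCell (fluidDomain T η) 0))) (htr : IsTopTrace T η g γ) :
    LayerSmall (layerMeasure T η θ (depth η)) 2 (fun q => g q - γ (plateProj q)) := by
  refine h.topChart.layerSmall h hθ hg.1 (h.memLp_comp_plateProj (memLp_xCell_slab htr.1)).1 ?_
  refine htr.2.congr fun k => ?_
  congr 1
  refine lintegral_congr fun s => ?_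
  refine setLIntegral_congr_fun (measurableSet_Ioo.prod measurableSet_Ioo) fun y hy => ?_
  simp only [topEquiv_apply]
  rw [clampTime_of_mem (Ioo_subset_Icc_self hy.2)]

lemma IsBottomTrace.layerSmall {g : ℝ × ℝ × ℝ → ℝ} {γ : ℝ × ℝ → ℝ}
    (h : FluidGeometry T c η ηx ηt) (hθ : IsTest 0 T θ)
    (hg : MemLp g 2 (volume.restrict (xCell (fluidDomain T η) 0))) (htr : IsBottomTrace T g γ) :
    LayerSmall (layerMeasure T η θ fun q => q.2.1) 2 (fun q => g q - γ (plateProj q)) :=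
  h.bottomChart.layerSmall h hθ hg.1 (h.memLp_comp_plateProj (memLp_xCell_slab htr.1)).1 htr.2

/-- Smallness in the boundary layer is preserved by bounded factors. -/
lemma LayerSmall.mul_top {d F g : ℝ × ℝ × ℝ → ℝ} {p : ℕ}
    (hs : LayerSmall (layerMeasure T η θ d) p F)
    (hg : MemLp g ⊤ (volume.restrict (xCell (fluidDomain T η) 0))) :
    LayerSmall (layerMeasure T η θ d) p (fun q => g q * F q) := by
  have hfin := hg.eLpNorm_lt_top
  refine hs.of_le (C := eLpNorm g ⊤ (volume.restrict (xCell (fluidDomain T η) 0)) ^ p)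
    (by finiteness) (Eventually.of_forall fun k => ?_)
  have h1 := ae_le_eLpNormEssSup (f := g) (μ := volume.restrict (xCell (fluidDomain T η) 0))
  filter_upwards [layerMeasure_ac.ae_le h1] with q hq
  rw [enorm_mul, mul_pow, eLpNorm_exponent_top]
  gcongr

end Trace

/-- A velocity field `v` on the fluid domain with gradient `G i j = ∂_j v_i` and time derivative `vt`,
that is divergence free, vanishes on the bottom, and moves vertically with the plate, at speed
`κ ηt`. -/
structure FlowField (T c κ : ℝ) (η ηx ηt : ℝ × ℝ → ℝ) (v : Fin 2 → ℝ × ℝ × ℝ → ℝ)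
    (G : Fin 2 → Fin 2 → ℝ × ℝ × ℝ → ℝ) (vt : Fin 2 → ℝ × ℝ × ℝ → ℝ) : Prop where
  geom : FluidGeometry T c η ηx ηt
  cell_v : ∀ i, CellL2 (fluidDomain T η) (v i)
  cell_G : ∀ i j, CellL2 (fluidDomain T η) (G i j)
  cell_vt : ∀ i, CellL2 (fluidDomain T η) (vt i)
  grad : ∀ i j, HasWeakDeriv (fluidDomain T η) (fluidDir j) (v i) (G i j)
  grad_t : ∀ i, HasWeakDeriv (fluidDomain T η) fluidT (v i) (vt i)
  div_free : ∀ᵐ q ∂volume.restrict (xCell (fluidDomain T η) 0), G 0 0 q + G 1 1 q = 0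
  top_horizontal : IsTopTrace T η (v 0) 0
  top_vertical : IsTopTrace T η (v 1) fun y => κ * ηt y
  bottom : ∀ i, IsBottomTrace T (v i) 0

namespace FlowField

open FluidGeometry

variable {T c κ : ℝ} {η ηx ηt : ℝ × ℝ → ℝ} {v : Fin 2 → ℝ × ℝ × ℝ → ℝ}
  {G : Fin 2 → Fin 2 → ℝ × ℝ × ℝ → ℝ} {vt : Fin 2 → ℝ × ℝ × ℝ → ℝ} {θ : ℝ → ℝ}

lemma small_bottom (hf : FlowField T c κ η ηx ηt v G vt) (hθ : IsTest 0 T θ) (i : Fin 2) :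
    LayerSmall (layerMeasure T η θ fun q => q.2.1) 2 (v i) := by
  simpa using (hf.bottom i).layerSmall hf.geom hθ (hf.cell_v i).2

lemma small_top_horizontal (hf : FlowField T c κ η ηx ηt v G vt) (hθ : IsTest 0 T θ) :
    LayerSmall (layerMeasure T η θ (depth η)) 2 (v 0) := by
  simpa using hf.top_horizontal.layerSmall hf.geom hθ (hf.cell_v 0).2

lemma small_top_vertical (hf : FlowField T c κ η ηx ηt v G vt) (hθ : IsTest 0 T θ) :
    LayerSmall (layerMeasure T η θ (depth η)) 2 (fun q => v 1 q - κ * ηt (plateProj q)) := by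
  have := hf.top_vertical.layerSmall hf.geom hθ (hf.cell_v 1).2
  exact this

lemma aestronglyMeasurable_speed (hf : FlowField T c κ η ηx ηt v G vt) :
    AEStronglyMeasurable (fun q => κ * ηt (plateProj q))
    (volume.restrict (xCell (fluidDomain T η) 0)) := (hf.geom.memLp_speed.const_mul κ).1

lemma bounded_speed (hf : FlowField T c κ η ηx ηt v G vt) (hθ : IsTest 0 T θ) :
    LayerBounded (layerMeasure T η θ (depth η)) (fun q => κ * ηt (plateProj q)) :=
  hf.geom.topChart.layerBounded_plate hf.geom hθ (γ := fun y => κ * ηt y) hf.top_vertical.1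

lemma layerBounded_one (hf : FlowField T c κ η ηx ηt v G vt) {d : ℝ × ℝ × ℝ → ℝ} {S : (ℝ × ℝ) × ℝ ≃ᵐ ℝ × ℝ × ℝ}
    (hS : BoundaryChart T c η d S) (hθ : IsTest 0 T θ) :
    LayerBounded (layerMeasure T η θ d) (fun _ => (1 : ℝ)) := by
  have : IsFiniteMeasure (volume.restrict (plateCell T)) := by
    rw [plateCell, Measure.volume_eq_prod, ← Measure.prod_restrict]; infer_instance
  exact hS.layerBounded_plate hf.geom hθ (γ := fun _ => 1) (memLp_const 1)

lemma small_one (hf : FlowField T c κ η ηx ηt v G vt) {d F : ℝ × ℝ × ℝ → ℝ} {S : (ℝ × ℝ) × ℝ ≃ᵐ ℝ × ℝ × ℝ}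
    (hS : BoundaryChart T c η d S) (hθ : IsTest 0 T θ)
    (hF : AEStronglyMeasurable F (volume.restrict (xCell (fluidDomain T η) 0)))
    (hs : LayerSmall (layerMeasure T η θ d) 2 F) : LayerSmall (layerMeasure T η θ d) 1 F := by
  simpa using hs.mul (hf.layerBounded_one hS hθ) (aemeasurable_layer hF) fun _ => aemeasurable_const

/-- A bounded function `g` is transported by the flow: the vector field `(v₀ g, v₁ g, κ g)` is
tangent to the boundary of the space-time domain, and has divergence `v · ∇g + κ ∂_t g`. -/
theorem transport (hf : FlowField T c κ η ηx ηt v G vt) (hθ : IsTest 0 T θ) (hθ0 : ∀ t, 0 ≤ θ t) {g g0 g1 gt : ℝ × ℝ × ℝ → ℝ}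
    (hg : MemLp g ⊤ (volume.restrict (xCell (fluidDomain T η) 0)))
    (hp : AEPeriodic (fluidDomain T η) g)
    (h0 : HasWeakDeriv (fluidDomain T η) (fluidDir 0) g g0)
    (h1 : HasWeakDeriv (fluidDomain T η) (fluidDir 1) g g1)
    (ht : HasWeakDeriv (fluidDomain T η) fluidT g gt)
    (i0 : MemLp g0 2 (volume.restrict (xCell (fluidDomain T η) 0)))
    (i1 : MemLp g1 2 (volume.restrict (xCell (fluidDomain T η) 0)))
    (it : MemLp gt 2 (volume.restrict (xCell (fluidDomain T η) 0))) :
    ∫ q in xCell (fluidDomain T η) 0,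
      (θ q.2.2 * (v 0 q * g0 q + v 1 q * g1 q + κ * gt q) + deriv θ q.2.2 * (κ * g q)) = 0 := by
  have h := hf.geom
  have hfin := h.isFiniteMeasure
  have c2 : CellL2 (fluidDomain T η) g := ⟨hp, hg.mono_exponent le_top⟩
  have c0 : CellL2 (fluidDomain T η) g0 := ⟨h0.aePeriodic h.isOpen h.isXPeriodic hp, i0⟩
  have c1 : CellL2 (fluidDomain T η) g1 := ⟨h1.aePeriodic h.isOpen h.isXPeriodic hp, i1⟩
  have w0 := (hf.grad 0 0).mul_cellL2 h.isOpen h.isXPeriodic h0 (hf.cell_v 0) (hf.cell_G 0 0) c2 c0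
  have w1 := (hf.grad 1 1).mul_cellL2 h.isOpen h.isXPeriodic h1 (hf.cell_v 1) (hf.cell_G 1 1) c2 c1
  have hF : Flux T η (fun q => v 0 q * g q) (fun q => v 1 q * g q) (fun q => κ * g q)
      (fun q => v 0 q * g0 q + G 0 0 q * g q) (fun q => v 1 q * g1 q + G 1 1 q * g q)
      (fun q => κ * gt q) :=
    { deriv_x := w0
      deriv_z := w1
      deriv_t := ht.const_mul κ
      per_x := (hf.cell_v 0).1.mul hp
      per_z := (hf.cell_v 1).1.mul hp
      per_t := hp.comp fun s => κ * s
      int_x := (hf.cell_v 0).integrable_mul c2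
      int_z := (hf.cell_v 1).integrable_mul c2
      memLp_t := c2.2.const_mul κ
      int_x' := ((hf.cell_v 0).integrable_mul c0).add ((hf.cell_G 0 0).integrable_mul c2)
      int_z' := ((hf.cell_v 1).integrable_mul c1).add ((hf.cell_G 1 1).integrable_mul c2)
      memLp_t' := it.const_mul κ }
  have am0 := (hf.cell_v 0).2.1
  have am1 := (hf.cell_v 1).2.1
  have ams := hf.aestronglyMeasurable_speed
  have sb : LayerSmall (layerMeasure T η θ fun q => q.2.1) 1 (fun q => v 1 q * g q) := by
    simpa only [mul_comm] using (hf.small_one h.bottomChart hθ am1 (hf.small_bottom hθ 1)).mul_top hg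
  have st0 := (hf.small_one h.topChart hθ am0 (hf.small_top_horizontal hθ)).mul_top
    (memLp_top_mul hg h.memLp_slope)
  have st1 := (hf.small_one h.topChart hθ (am1.sub ams) (hf.small_top_vertical hθ)).mul_top hg.neg
  have st : LayerSmall (layerMeasure T η θ (depth η)) 1 fun q => topFlux ηx ηt
      (fun q => v 0 q * g q) (fun q => v 1 q * g q) (fun q => κ * g q) q
        - (fun _ => (0 : ℝ)) (plateProj q) := by
    have := st0.add st1 (aemeasurable_layer ((hg.1.mul h.memLp_slope.1).mul am0))
    refine (congrArg (LayerSmall _ 1) (funext fun q => ?_)).mp this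
    simp only [topFlux, Pi.neg_apply, Pi.sub_apply]
    ring
  have := hF.divergence h hθ hθ0 (integrable_zero _ _ _) sb st
  simp only [Pi.zero_apply, mul_zero, integral_zero, add_zero] at this
  refine (integral_congr_ae ?_).trans this
  filter_upwards [hf.div_free] with q hq
  have : G 1 1 q = - G 0 0 q := by linarith
  rw [this]; ring

/-- Conservation of volume: the transport identity for `g = 1`. -/
theorem volume_eq (hf : FlowField T c κ η ηx ηt v G vt) (hκ : κ ≠ 0) (hθ : IsTest 0 T θ) (hθ0 : ∀ t, 0 ≤ θ t) :
    ∫ q in xCell (fluidDomain T η) 0, deriv θ q.2.2 = 0 := by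
  have := hf.transport hθ hθ0 (g := fun _ => 1) (memLp_top_const 1) (Eventually.of_forall fun _ => rfl)
    (hasWeakDeriv_one _ _) (hasWeakDeriv_one _ _) (hasWeakDeriv_one _ _) MemLp.zero' MemLp.zero'
    MemLp.zero'
  simp only [mul_zero, add_zero, mul_one, zero_add, integral_mul_const] at this
  exact (mul_eq_zero.1 this).resolve_right hκ

end FlowField

/-! ### The kinetic energy of the fluid -/

/-- A bounded smooth substitute for the identity, to which it tends as `δ → 0`. -/
def truncation (δ s : ℝ) : ℝ := Real.arctan (δ * s) / δ

section Truncation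

variable {δ : ℝ}

lemma contDiff_truncation : ContDiff ℝ 1 (truncation δ) :=
  (Real.contDiff_arctan.comp (contDiff_const.mul contDiff_id)).div_const δ

lemma deriv_truncation (hδ : 0 < δ) (s : ℝ) : deriv (truncation δ) s = 1 / (1 + (δ * s) ^ 2) := by
  have h1 := (((hasDerivAt_id s).const_mul δ).arctan.div_const δ).deriv
  have h2 : deriv (truncation δ) s = _ := h1
  rw [h2]; simp; field_simp

lemma deriv_truncation_nonneg (hδ : 0 < δ) (s : ℝ) : 0 ≤ deriv (truncation δ) s := by
  rw [deriv_truncation hδ]; positivity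

lemma deriv_truncation_le (hδ : 0 < δ) (s : ℝ) : deriv (truncation δ) s ≤ 1 := by
  rw [deriv_truncation hδ, div_le_one (by positivity)]; nlinarith [sq_nonneg (δ * s)]

lemma norm_deriv_truncation_le (hδ : 0 < δ) (s : ℝ) : ‖deriv (truncation δ) s‖ ≤ 1 := by
  rw [Real.norm_of_nonneg (deriv_truncation_nonneg hδ s)]; exact deriv_truncation_le hδ s

lemma abs_truncation_le (hδ : 0 < δ) (s : ℝ) : |truncation δ s| ≤ |s| := by
  have := Convex.norm_image_sub_le_of_norm_deriv_le (f := truncation δ) (C := 1) (s := univ) (x := 0)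
    (y := s) (fun x _ => contDiff_truncation.differentiable one_ne_zero x)
    (fun x _ => norm_deriv_truncation_le hδ x) convex_univ trivial trivial
  simpa [truncation, abs_div] using this

lemma abs_truncation_le_const (hδ : 0 < δ) (s : ℝ) : |truncation δ s| ≤ 2 / δ := by
  rw [truncation, abs_div, abs_of_pos hδ]
  gcongr
  have h1 := Real.arctan_lt_pi_div_two (δ * s)
  have h2 := Real.neg_pi_div_two_lt_arctan (δ * s)
  have := Real.pi_lt_four
  rw [abs_le]; constructor <;> linarith

/-- The derivative of the truncation of the kinetic energy compensates one factor of velocity. -/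
lemma deriv_truncation_mul_le (hδ : 0 < δ) {a s : ℝ} (hs : a ^ 2 ≤ 2 * s) :
    |deriv (truncation δ) s * a| ≤ 1 + 1 / δ := by
  have hs0 : 0 ≤ s := by nlinarith [sq_nonneg a]
  rw [deriv_truncation hδ, abs_mul, abs_of_nonneg (by positivity : 0 ≤ 1 / (1 + (δ * s) ^ 2)),
    one_div, inv_mul_le_iff₀ (by positivity)]
  have h1 : |a| ≤ 1 + s := by
    have := sq_abs a
    nlinarith [sq_nonneg (|a| - 1)]
  have h2 : 0 < 1 / δ := by positivity
  have h3 : s ≤ (1 + (δ * s) ^ 2) * (1 / δ) := by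
    rw [mul_one_div, le_div_iff₀ hδ]
    nlinarith [sq_nonneg (δ * s - 1)]
  nlinarith [sq_nonneg (δ * s)]

lemma tendsto_truncation (s : ℝ) : Tendsto (fun δ => truncation δ s) (𝓝[>] 0) (𝓝 s) := by
  have h1 : HasDerivAt (fun δ : ℝ => Real.arctan (δ * s)) s 0 := by
    simpa using ((hasDerivAt_id (0 : ℝ)).mul_const s).arctan
  have := h1.tendsto_slope_zero_right
  simp only [zero_add, zero_mul, Real.arctan_zero, sub_zero, smul_eq_mul] at this
  refine this.congr fun δ => ?_
  rw [truncation]; ring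

lemma tendsto_deriv_truncation (s : ℝ) :
    Tendsto (fun δ => deriv (truncation δ) s) (𝓝[>] 0) (𝓝 1) := by
  have h1 : Tendsto (fun δ : ℝ => 1 / (1 + (δ * s) ^ 2)) (𝓝 0) (𝓝 (1 / (1 + (0 * s) ^ 2))) := by
    apply Continuous.tendsto
    refine continuous_const.div (by fun_prop) fun δ => by positivity
  have h2 := h1.mono_left (nhdsWithin_le_nhds (s := Ioi 0))
  simp only [zero_mul, ne_eq, OfNat.ofNat_ne_zero, not_false_eq_true, zero_pow, add_zero,
    div_one] at h2
  refine h2.congr' ?_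
  filter_upwards [self_mem_nhdsWithin] with δ hδ
  rw [deriv_truncation hδ]

end Truncation

namespace FlowField

open FluidGeometry

variable {T c κ : ℝ} {η ηx ηt : ℝ × ℝ → ℝ} {v : Fin 2 → ℝ × ℝ × ℝ → ℝ}
  {G : Fin 2 → Fin 2 → ℝ × ℝ × ℝ → ℝ} {vt : Fin 2 → ℝ × ℝ × ℝ → ℝ} {θ : ℝ → ℝ}

/-- The density `|v|²/2` of the kinetic energy. -/
def kinetic (v : Fin 2 → ℝ × ℝ × ℝ → ℝ) (q : ℝ × ℝ × ℝ) : ℝ := 1 / 2 * (v 0 q * v 0 q + v 1 q * v 1 q)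

lemma sq_le_kinetic (i : Fin 2) (q : ℝ × ℝ × ℝ) : v i q ^ 2 ≤ 2 * kinetic v q := by
  rw [kinetic]
  fin_cases i <;> dsimp <;> nlinarith [mul_self_nonneg (v 0 q), mul_self_nonneg (v 1 q)]

lemma kinetic_nonneg (q : ℝ × ℝ × ℝ) : 0 ≤ kinetic v q := by
  rw [kinetic]; nlinarith [mul_self_nonneg (v 0 q), mul_self_nonneg (v 1 q)]

lemma integrable_kinetic (hf : FlowField T c κ η ηx ηt v G vt) :
    IntegrableOn (kinetic v) (xCell (fluidDomain T η) 0) :=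
  (((hf.cell_v 0).integrable_mul (hf.cell_v 0)).add
    ((hf.cell_v 1).integrable_mul (hf.cell_v 1))).const_mul (1 / 2)

/-- The truncated kinetic energy and its derivative in one direction. -/
lemma deriv_truncated_kinetic (hf : FlowField T c κ η ηx ηt v G vt) {δ : ℝ} (hδ : 0 < δ)
    {e : ℝ × ℝ × ℝ} {k : Fin 2 → ℝ × ℝ × ℝ → ℝ} (hk : ∀ i, CellL2 (fluidDomain T η) (k i))
    (hd : ∀ i, HasWeakDeriv (fluidDomain T η) e (v i) (k i)) :
    HasWeakDeriv (fluidDomain T η) e (fun q => truncation δ (kinetic v q))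
      (fun q => deriv (truncation δ) (kinetic v q) * (v 0 q * k 0 q + v 1 q * k 1 q)) ∧
    MemLp (fun q => deriv (truncation δ) (kinetic v q) * (v 0 q * k 0 q + v 1 q * k 1 q)) 2
      (volume.restrict (xCell (fluidDomain T η) 0)) := by
  have h := hf.geom
  have hs : ∀ i, HasWeakDeriv (fluidDomain T η) e (fun q => v i q * v i q)
      (fun q => v i q * k i q + k i q * v i q) := fun i =>
    (hd i).mul_cellL2 h.isOpen h.isXPeriodic (hd i) (hf.cell_v i) (hk i) (hf.cell_v i) (hk i)
  have h1 := (((hs 0).add (hs 1)).const_mul (1 / 2)).comp_contDiff h.isOpen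
    (contDiff_truncation (δ := δ)) (norm_deriv_truncation_le hδ)
  constructor
  · refine h1.congr (Eventually.of_forall fun q => rfl) (Eventually.of_forall fun q => ?_)
    simp only [kinetic]; ring
  · have hm : AEStronglyMeasurable (fun q => deriv (truncation δ) (kinetic v q))
        (volume.restrict (xCell (fluidDomain T η) 0)) :=
      (contDiff_truncation.continuous_deriv le_rfl).comp_aestronglyMeasurable
        hf.integrable_kinetic.1
    have hb : ∀ i, MemLp (fun q => deriv (truncation δ) (kinetic v q) * v i q) ⊤
        (volume.restrict (xCell (fluidDomain T η) 0)) := fun i =>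
      memLp_top_of_bound (hm.mul (hf.cell_v i).2.1) (1 + 1 / δ)
        (Eventually.of_forall fun q => deriv_truncation_mul_le hδ (sq_le_kinetic i q))
    refine ((memLp_top_mul (hb 0) (hk 0).2).add (memLp_top_mul (hb 1) (hk 1).2)).ae_eq
      (Eventually.of_forall fun q => ?_)
    simp only [Pi.add_apply]; ring

/-- The acceleration of fluid particles. -/
def acceleration (κ : ℝ) (v : Fin 2 → ℝ × ℝ × ℝ → ℝ) (G : Fin 2 → Fin 2 → ℝ × ℝ × ℝ → ℝ)
    (vt : Fin 2 → ℝ × ℝ × ℝ → ℝ) (i : Fin 2) (q : ℝ × ℝ × ℝ) : ℝ :=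
  v 0 q * G i 0 q + v 1 q * G i 1 q + κ * vt i q

/-- The balance of kinetic energy, for a flow with square integrable acceleration. The kinetic energy
need not be an admissible multiplier for the transport identity, so that identity is applied to its
truncation, and `δ → 0`. -/
theorem kinetic_balance (hf : FlowField T c κ η ηx ηt v G vt) (hθ : IsTest 0 T θ)
    (hθ0 : ∀ t, 0 ≤ θ t)
    (hX : ∀ i, MemLp (acceleration κ v G vt i) 2 (volume.restrict (xCell (fluidDomain T η) 0))) :
    ∫ q in xCell (fluidDomain T η) 0,
      (θ q.2.2 * (v 0 q * acceleration κ v G vt 0 q + v 1 q * acceleration κ v G vt 1 q)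
        + deriv θ q.2.2 * (κ * kinetic v q)) = 0 := by
  have h := hf.geom
  obtain ⟨C, hC⟩ := hθ.exists_bound
  obtain ⟨C', hC'⟩ := hθ.exists_bound_deriv
  have bθ := h.memLp_time hθ.continuous hC
  have bθ' := h.memLp_time hθ.continuous_deriv hC'
  have iA : IntegrableOn (fun q => θ q.2.2 *
      (v 0 q * acceleration κ v G vt 0 q + v 1 q * acceleration κ v G vt 1 q))
      (xCell (fluidDomain T η) 0) :=
    integrable_top_mul bθ (((hf.cell_v 0).2.integrable_mul (hX 0)).add
      ((hf.cell_v 1).2.integrable_mul (hX 1)))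
  have iK : IntegrableOn (fun q => deriv θ q.2.2 * (κ * kinetic v q)) (xCell (fluidDomain T η) 0) :=
    integrable_top_mul bθ' (hf.integrable_kinetic.const_mul κ)
  have hmd : ∀ δ, AEStronglyMeasurable (fun q => deriv (truncation δ) (kinetic v q))
      (volume.restrict (xCell (fluidDomain T η) 0)) := fun δ =>
    (contDiff_truncation.continuous_deriv le_rfl).comp_aestronglyMeasurable hf.integrable_kinetic.1
  have hmt : ∀ δ, AEStronglyMeasurable (fun q => truncation δ (kinetic v q))
      (volume.restrict (xCell (fluidDomain T η) 0)) := fun δ =>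
    contDiff_truncation.continuous.comp_aestronglyMeasurable hf.integrable_kinetic.1
  have key : ∀ δ, 0 < δ → ∫ q in xCell (fluidDomain T η) 0,
      (deriv (truncation δ) (kinetic v q) * (θ q.2.2 *
        (v 0 q * acceleration κ v G vt 0 q + v 1 q * acceleration κ v G vt 1 q))
        + deriv θ q.2.2 * (κ * truncation δ (kinetic v q))) = 0 := fun δ hδ => by
    obtain ⟨d0, m0⟩ := hf.deriv_truncated_kinetic hδ (fun i => hf.cell_G i 0) fun i => hf.grad i 0
    obtain ⟨d1, m1⟩ := hf.deriv_truncated_kinetic hδ (fun i => hf.cell_G i 1) fun i => hf.grad i 1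
    obtain ⟨dt, mt⟩ := hf.deriv_truncated_kinetic hδ hf.cell_vt hf.grad_t
    have hp : AEPeriodic (fluidDomain T η) (fun q => truncation δ (kinetic v q)) := by
      filter_upwards [(hf.cell_v 0).1, (hf.cell_v 1).1] with q h0 h1
      simp only [kinetic, h0, h1]
    refine (integral_congr_ae (Eventually.of_forall fun q => ?_)).trans
      (hf.transport hθ hθ0 (memLp_top_of_bound (hmt δ) (2 / δ)
        (Eventually.of_forall fun q => abs_truncation_le_const hδ _)) hp d0 d1 dt m0 m1 mt)
    simp only [acceleration]; ring
  have lim : Tendsto (fun δ => ∫ q in xCell (fluidDomain T η) 0,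
      (deriv (truncation δ) (kinetic v q) * (θ q.2.2 *
        (v 0 q * acceleration κ v G vt 0 q + v 1 q * acceleration κ v G vt 1 q))
        + deriv θ q.2.2 * (κ * truncation δ (kinetic v q)))) (𝓝[>] 0)
      (𝓝 (∫ q in xCell (fluidDomain T η) 0,
        (θ q.2.2 * (v 0 q * acceleration κ v G vt 0 q + v 1 q * acceleration κ v G vt 1 q)
        + deriv θ q.2.2 * (κ * kinetic v q)))) := by
    refine tendsto_integral_filter_of_dominated_convergence
      (fun q => ‖θ q.2.2 * (v 0 q * acceleration κ v G vt 0 q + v 1 q * acceleration κ v G vt 1 q)‖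
        + ‖deriv θ q.2.2 * (κ * kinetic v q)‖) ?_ ?_ (iA.norm.add iK.norm) ?_
    · exact Eventually.of_forall fun δ => ((hmd δ).mul iA.1).add (bθ'.1.mul ((hmt δ).const_mul κ))
    · filter_upwards [self_mem_nhdsWithin] with δ hδ
      refine Eventually.of_forall fun q => (norm_add_le _ _).trans (add_le_add ?_ ?_)
      · rw [norm_mul]
        exact mul_le_of_le_one_left (norm_nonneg _) (norm_deriv_truncation_le hδ _)
      · rw [norm_mul, norm_mul, norm_mul, norm_mul]
        gcongr
        exact abs_truncation_le hδ _
    · refine Eventually.of_forall fun q => ?_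
      simpa using ((tendsto_deriv_truncation (kinetic v q)).mul_const _).add
        (((tendsto_truncation (kinetic v q)).const_mul κ).const_mul (deriv θ q.2.2))
  refine tendsto_nhds_unique lim (tendsto_const_nhds.congr' ?_)
  filter_upwards [self_mem_nhdsWithin] with δ hδ
  rw [key δ hδ]

end FlowField

/-! ### Work, dissipation and Poincaré's inequality -/

namespace FlowField

open FluidGeometry

variable {T c κ : ℝ} {η ηx ηt : ℝ × ℝ → ℝ} {v : Fin 2 → ℝ × ℝ × ℝ → ℝ}
  {G : Fin 2 → Fin 2 → ℝ × ℝ × ℝ → ℝ} {vt : Fin 2 → ℝ × ℝ × ℝ → ℝ} {θ : ℝ → ℝ}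

/-- The work of a stress tensor `σ` with divergence `D i 0 + D i 1` and trace `S` on the plate. The
boundary term is the power of the plate: `(-ηx, 1)` is the normal times the surface Jacobian. -/
theorem work (hf : FlowField T c κ η ηx ηt v G vt) (hθ : IsTest 0 T θ) (hθ0 : ∀ t, 0 ≤ θ t)
    {σ D : Fin 2 → Fin 2 → ℝ × ℝ × ℝ → ℝ} {S : Fin 2 → Fin 2 → ℝ × ℝ → ℝ}
    (hσ : ∀ i j, CellL2 (fluidDomain T η) (σ i j)) (hD : ∀ i j, CellL2 (fluidDomain T η) (D i j))
    (hd : ∀ i j, HasWeakDeriv (fluidDomain T η) (fluidDir j) (σ i j) (D i j))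
    (hS : ∀ i j, IsTopTrace T η (σ i j) (S i j)) (hηx : MemLp ηx ⊤ (volume.restrict (plateCell T)))
    (hηt : MemLp ηt 2 (volume.restrict (plateCell T))) :
    (∫ q in xCell (fluidDomain T η) 0, θ q.2.2 *
      (σ 0 0 q * G 0 0 q + σ 0 1 q * G 0 1 q + σ 1 0 q * G 1 0 q + σ 1 1 q * G 1 1 q
        + v 0 q * (D 0 0 q + D 0 1 q) + v 1 q * (D 1 0 q + D 1 1 q)))
      + ∫ y in plateCell T, θ y.2 * (κ * ηt y * (S 1 0 y * ηx y - S 1 1 y)) = 0 := by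
  have h := hf.geom
  have w : ∀ i j, HasWeakDeriv (fluidDomain T η) (fluidDir j) (fun q => σ i j q * v i q)
      (fun q => σ i j q * G i j q + D i j q * v i q) := fun i j =>
    (hd i j).mul_cellL2 h.isOpen h.isXPeriodic (hf.grad i j) (hσ i j) (hD i j) (hf.cell_v i)
      (hf.cell_G i j)
  have iw : ∀ i j, IntegrableOn (fun q => σ i j q * v i q) (xCell (fluidDomain T η) 0) :=
    fun i j => (hσ i j).integrable_mul (hf.cell_v i)
  have iw' : ∀ i j, IntegrableOn (fun q => σ i j q * G i j q + D i j q * v i q)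
      (xCell (fluidDomain T η) 0) := fun i j =>
    Integrable.fun_add ((hσ i j).integrable_mul (hf.cell_G i j))
      ((hD i j).integrable_mul (hf.cell_v i))
  have hF : Flux T η (fun q => σ 0 0 q * v 0 q + σ 1 0 q * v 1 q)
      (fun q => σ 0 1 q * v 0 q + σ 1 1 q * v 1 q) (fun _ => 0)
      (fun q => (σ 0 0 q * G 0 0 q + D 0 0 q * v 0 q) + (σ 1 0 q * G 1 0 q + D 1 0 q * v 1 q))
      (fun q => (σ 0 1 q * G 0 1 q + D 0 1 q * v 0 q) + (σ 1 1 q * G 1 1 q + D 1 1 q * v 1 q))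
      (fun _ => 0) :=
    { deriv_x := (w 0 0).add (w 1 0)
      deriv_z := (w 0 1).add (w 1 1)
      deriv_t := hasWeakDeriv_one _ _
      per_x := ((hσ 0 0).1.mul (hf.cell_v 0).1).add ((hσ 1 0).1.mul (hf.cell_v 1).1)
      per_z := ((hσ 0 1).1.mul (hf.cell_v 0).1).add ((hσ 1 1).1.mul (hf.cell_v 1).1)
      per_t := Eventually.of_forall fun _ => rfl
      int_x := (iw 0 0).fun_add (iw 1 0)
      int_z := (iw 0 1).fun_add (iw 1 1)
      memLp_t := MemLp.zero'
      int_x' := (iw' 0 0).fun_add (iw' 1 0)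
      int_z' := (iw' 0 1).fun_add (iw' 1 1)
      memLp_t' := MemLp.zero' }
  have mv : ∀ i, AEStronglyMeasurable (v i) (volume.restrict (xCell (fluidDomain T η) 0)) :=
    fun i => (hf.cell_v i).2.1
  have mσ : ∀ i j, AEStronglyMeasurable (σ i j) (volume.restrict (xCell (fluidDomain T η) 0)) :=
    fun i j => (hσ i j).2.1
  have ms := hf.aestronglyMeasurable_speed
  have mx := h.memLp_slope.1
  have mS : ∀ i j, AEStronglyMeasurable (fun q => S i j (plateProj q))
      (volume.restrict (xCell (fluidDomain T η) 0)) := fun i j =>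
    (h.memLp_comp_plateProj (memLp_xCell_slab (hS i j).1)).1
  have bb : ∀ i, LayerBounded (layerMeasure T η θ fun q => q.2.1) (σ i 1) := fun i =>
    h.layerBounded_bottom hθ hθ0 (hd i 1) (hσ i 1) (hD i 1)
  have sb : LayerSmall (layerMeasure T η θ fun q => q.2.1) 1
      (fun q => σ 0 1 q * v 0 q + σ 1 1 q * v 1 q) := by
    have s : ∀ i, LayerSmall (layerMeasure T η θ fun q => q.2.1) 1
        (fun q => v i q * σ i 1 q) := fun i =>
      (hf.small_bottom hθ i).mul (bb i) (aemeasurable_layer (mv i)) (aemeasurable_layer (mσ i 1))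
    simpa only [mul_comm] using (s 0).add (s 1) (aemeasurable_layer ((mv 0).mul (mσ 0 1)))
  -- on the plate the stress differs little from its trace, which is bounded
  have st : ∀ i j, LayerSmall (layerMeasure T η θ (depth η)) 2
      (fun q => σ i j q - S i j (plateProj q)) := fun i j => (hS i j).layerSmall h hθ (hσ i j).2
  have bt : ∀ i j, LayerBounded (layerMeasure T η θ (depth η)) (σ i j) := fun i j => by
    have := (st i j).layerBounded.add (h.topChart.layerBounded_plate h hθ (hS i j).1)
      (aemeasurable_layer ((mσ i j).sub (mS i j)))
    simpa using this
  have m0 : ∀ j, LayerSmall (layerMeasure T η θ (depth η)) 1 (fun q => v 0 q * σ 0 j q) := fun j =>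
    (hf.small_top_horizontal hθ).mul (bt 0 j) (aemeasurable_layer (mv 0)) (aemeasurable_layer (mσ 0 j))
  have m1 : ∀ j, LayerSmall (layerMeasure T η θ (depth η)) 1
      (fun q => (v 1 q - κ * ηt (plateProj q)) * σ 1 j q) := fun j =>
    (hf.small_top_vertical hθ).mul (bt 1 j) (aemeasurable_layer ((mv 1).sub ms))
      (aemeasurable_layer (mσ 1 j))
  have m2 : ∀ j, LayerSmall (layerMeasure T η θ (depth η)) 1
      (fun q => (σ 1 j q - S 1 j (plateProj q)) * (κ * ηt (plateProj q))) := fun j =>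
    (st 1 j).mul (hf.bounded_speed hθ) (aemeasurable_layer ((mσ 1 j).sub (mS 1 j)))
      (aemeasurable_layer ms)
  have me : ∀ j, AEStronglyMeasurable
      (fun q => v 0 q * σ 0 j q + (v 1 q - κ * ηt (plateProj q)) * σ 1 j q)
      (volume.restrict (xCell (fluidDomain T η) 0)) := fun j =>
    ((mv 0).mul (mσ 0 j)).add (((mv 1).sub ms).mul (mσ 1 j))
  have mm : ∀ j, LayerSmall (layerMeasure T η θ (depth η)) 1
      (fun q => v 0 q * σ 0 j q + (v 1 q - κ * ηt (plateProj q)) * σ 1 j q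
        + (σ 1 j q - S 1 j (plateProj q)) * (κ * ηt (plateProj q))) := fun j =>
    ((m0 j).add (m1 j) (aemeasurable_layer ((mv 0).mul (mσ 0 j)))).add (m2 j)
      (aemeasurable_layer (me j))
  have me' : AEStronglyMeasurable (fun q => ηx (plateProj q) *
        (v 0 q * σ 0 0 q + (v 1 q - κ * ηt (plateProj q)) * σ 1 0 q
        + (σ 1 0 q - S 1 0 (plateProj q)) * (κ * ηt (plateProj q))))
      (volume.restrict (xCell (fluidDomain T η) 0)) :=
    mx.mul ((me 0).add (((mσ 1 0).sub (mS 1 0)).mul ms))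
  have htop : LayerSmall (layerMeasure T η θ (depth η)) 1 fun q => topFlux ηx ηt
      (fun q => σ 0 0 q * v 0 q + σ 1 0 q * v 1 q)
      (fun q => σ 0 1 q * v 0 q + σ 1 1 q * v 1 q) (fun _ => 0) q
        - (fun y => κ * ηt y * (S 1 0 y * ηx y - S 1 1 y)) (plateProj q) := by
    have := ((mm 0).mul_top h.memLp_slope).add ((mm 1).mul_top (memLp_top_const (-1)))
      (aemeasurable_layer me')
    refine (congrArg (LayerSmall _ 1) (funext fun q => ?_)).mp this
    simp only [topFlux]
    ring
  have hR : IntegrableOn (fun y => κ * ηt y * (S 1 0 y * ηx y - S 1 1 y)) (plateCell T) := by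
    have e : MemLp (fun y => S 1 0 y * ηx y - S 1 1 y) 2 (volume.restrict (plateCell T)) := by
      have := (memLp_top_mul hηx (hS 1 0).1).sub (hS 1 1).1
      refine this.ae_eq (Eventually.of_forall fun y => ?_)
      simp only [Pi.sub_apply]; ring
    exact (hηt.const_mul κ).integrable_mul e
  have := hF.divergence h hθ hθ0 hR sb htop
  refine (congrArg (· + _) (integral_congr_ae (Eventually.of_forall fun q => ?_))).trans this
  ring

/-- For a velocity that is vertical on the boundary, the determinant of the gradient has integral
zero: it is the divergence of `v₀ (∂_z v₁, -∂_x v₁)`. -/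
theorem integral_det_eq_zero (hf : FlowField T c κ η ηx ηt v G vt) (hθ : IsTest 0 T θ)
    (hθ0 : ∀ t, 0 ≤ θ t) {H K : ℝ × ℝ × ℝ → ℝ}
    (hH : CellL2 (fluidDomain T η) H) (hK : CellL2 (fluidDomain T η) K)
    (h10 : HasWeakDeriv (fluidDomain T η) (fluidDir 1) (G 1 0) H)
    (h01 : HasWeakDeriv (fluidDomain T η) (fluidDir 0) (G 1 1) H)
    (h11 : HasWeakDeriv (fluidDomain T η) (fluidDir 1) (G 1 1) K) :
    ∫ q in xCell (fluidDomain T η) 0,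
      θ q.2.2 * (G 0 0 q * G 1 1 q - G 0 1 q * G 1 0 q) = 0 := by
  have h := hf.geom
  have w0 := (hf.grad 0 0).mul_cellL2 h.isOpen h.isXPeriodic h01 (hf.cell_v 0) (hf.cell_G 0 0)
    (hf.cell_G 1 1) hH
  have w1 := ((hf.grad 0 1).mul_cellL2 h.isOpen h.isXPeriodic h10 (hf.cell_v 0) (hf.cell_G 0 1)
    (hf.cell_G 1 0) hH).const_mul (-1)
  have hF : Flux T η (fun q => v 0 q * G 1 1 q) (fun q => -1 * (v 0 q * G 1 0 q)) (fun _ => 0)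
      (fun q => v 0 q * H q + G 0 0 q * G 1 1 q)
      (fun q => -1 * (v 0 q * H q + G 0 1 q * G 1 0 q)) (fun _ => 0) :=
    { deriv_x := w0
      deriv_z := w1
      deriv_t := hasWeakDeriv_one _ _
      per_x := (hf.cell_v 0).1.mul (hf.cell_G 1 1).1
      per_z := ((hf.cell_v 0).1.mul (hf.cell_G 1 0).1).comp fun s => -1 * s
      per_t := Eventually.of_forall fun _ => rfl
      int_x := (hf.cell_v 0).integrable_mul (hf.cell_G 1 1)
      int_z := ((hf.cell_v 0).integrable_mul (hf.cell_G 1 0)).const_mul (-1)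
      memLp_t := MemLp.zero'
      int_x' := Integrable.fun_add ((hf.cell_v 0).integrable_mul hH)
        ((hf.cell_G 0 0).integrable_mul (hf.cell_G 1 1))
      int_z' := (Integrable.fun_add ((hf.cell_v 0).integrable_mul hH)
        ((hf.cell_G 0 1).integrable_mul (hf.cell_G 1 0))).const_mul (-1)
      memLp_t' := MemLp.zero' }
  have mv := (hf.cell_v 0).2.1
  have mG : ∀ i j, AEStronglyMeasurable (G i j) (volume.restrict (xCell (fluidDomain T η) 0)) :=
    fun i j => (hf.cell_G i j).2.1
  have sb : LayerSmall (layerMeasure T η θ fun q => q.2.1) 1 (fun q => -1 * (v 0 q * G 1 0 q)) :=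
    ((hf.small_bottom hθ 0).mul (h.layerBounded_bottom hθ hθ0 h10 (hf.cell_G 1 0) hH)
      (aemeasurable_layer mv) (aemeasurable_layer (mG 1 0))).mul_top (memLp_top_const (-1))
  have t0 := ((hf.small_top_horizontal hθ).mul (h.layerBounded_top hθ hθ0 h11 (hf.cell_G 1 1) hK)
      (aemeasurable_layer mv) (aemeasurable_layer (mG 1 1))).mul_top h.memLp_slope
  have t1 := (hf.small_top_horizontal hθ).mul (h.layerBounded_top hθ hθ0 h10 (hf.cell_G 1 0) hH)
      (aemeasurable_layer mv) (aemeasurable_layer (mG 1 0))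
  have st : LayerSmall (layerMeasure T η θ (depth η)) 1 fun q => topFlux ηx ηt
      (fun q => v 0 q * G 1 1 q) (fun q => -1 * (v 0 q * G 1 0 q)) (fun _ => 0) q
        - (fun _ => (0 : ℝ)) (plateProj q) := by
    have := t0.add t1 (aemeasurable_layer (h.memLp_slope.1.mul (mv.mul (mG 1 1))))
    refine (congrArg (LayerSmall _ 1) (funext fun q => ?_)).mp this
    simp only [topFlux]
    ring
  have := hF.divergence h hθ hθ0 (integrable_zero _ _ _) sb st
  simp only [Pi.zero_apply, mul_zero, integral_zero, add_zero] at this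
  refine (integral_congr_ae (Eventually.of_forall fun q => ?_)).trans this
  ring

end FlowField

namespace FluidGeometry

variable {T c : ℝ} {η ηx ηt : ℝ × ℝ → ℝ} {θ : ℝ → ℝ} {w wz : ℝ × ℝ × ℝ → ℝ}

/-- In the boundary layer at the plate the distance to the plate is small. -/
lemma layerSmall_depth (h : FluidGeometry T c η ηx ηt) (hθ : Continuous θ)
    (hw : LayerBounded (layerMeasure T η θ (depth η)) w) :
    LayerSmall (layerMeasure T η θ (depth η)) 1 (fun q => depth η q * (w q * w q)) := by
  obtain ⟨C, hC, hb⟩ := hw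
  have h0 : Tendsto (fun k : ℝ => ENNReal.ofReal k * C) (𝓝[>] 0) (𝓝 0) := by
    have h1 : Tendsto (fun k : ℝ => ENNReal.ofReal k) (𝓝[>] 0) (𝓝 0) := by
      simpa using (ENNReal.continuous_ofReal.tendsto 0).mono_left nhdsWithin_le_nhds
    simpa using ENNReal.Tendsto.mul_const h1 (Or.inr hC)
  refine tendsto_of_tendsto_of_tendsto_of_le_of_le' tendsto_const_nhds h0
    (Eventually.of_forall fun _ => zero_le) ?_
  filter_upwards [hb, self_mem_nhdsWithin] with k hk hk0
  refine le_trans ?_ (mul_le_mul_right hk (ENNReal.ofReal k))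
  rw [← lintegral_const_mul' _ _ (by simp)]
  refine lintegral_mono_ae ?_
  have hd : ∀ᵐ q ∂layerMeasure T η θ (depth η) k,
      q ∈ xCell (fluidDomain T η) 0 ∧ depth η q < k := by
    refine (ae_withDensity_iff' (h.topChart.aemeasurable_density h hθ k)).2 ?_
    filter_upwards [ae_restrict_mem (measurableSet_xCell h.isOpen.measurableSet 0)] with q hq h0
    refine ⟨hq, not_le.1 fun hk => h0 ?_⟩
    rw [layer_eq_zero_of_ge hk0 hk, mul_zero, ENNReal.ofReal_zero]
  filter_upwards [hd] with q hq
  rw [pow_one, enorm_mul, enorm_mul, ← sq]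
  gcongr
  rw [Real.enorm_eq_ofReal (depth_pos hq.1.1).le]
  exact ENNReal.ofReal_le_ofReal hq.2.le

/-- Poincaré's inequality in the vertical direction, for a function that vanishes on the bottom. The
weight makes the constant independent of the thickness. -/
theorem poincare (h : FluidGeometry T c η ηx ηt) (hθ : IsTest 0 T θ) (hθ0 : ∀ t, 0 ≤ θ t)
    (hw : HasWeakDeriv (fluidDomain T η) (fluidDir 1) w wz)
    (w2 : CellL2 (fluidDomain T η) w) (wz2 : CellL2 (fluidDomain T η) wz)
    (hb : LayerSmall (layerMeasure T η θ fun q => q.2.1) 2 w) :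
    IntegrableOn (fun q => θ q.2.2 * (w q ^ 2 / η (plateProj q) ^ 2))
      (xCell (fluidDomain T η) 0) ∧
    ∫ q in xCell (fluidDomain T η) 0, θ q.2.2 * (w q ^ 2 / η (plateProj q) ^ 2)
      ≤ 4 * ∫ q in xCell (fluidDomain T η) 0, θ q.2.2 * wz q ^ 2 := by
  have hfin := h.isFiniteMeasure
  have hU := h.isOpen
  have hper := h.isXPeriodic
  have hc := h.pos
  have hmc := measurableSet_xCell hU.measurableSet 0
  obtain ⟨C, hC⟩ := hθ.exists_bound
  have bθ := h.memLp_time hθ.continuous hC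
  have hηc : ContinuousOn (fun q => η (plateProj q)) (fluidDomain T η) :=
    h.cont.comp continuous_plateProj.continuousOn fun q hq => ⟨trivial, Ioo_subset_Icc_self hq.1⟩
  have hlow : ∀ q ∈ fluidDomain T η, c ≤ η (plateProj q) := fun q hq =>
    h.lower _ (plateProj_mem hq)
  -- the multiplier `(η - z) / η²` vanishes on the plate and has vertical derivative `- 1 / η²`
  have ca : ContinuousOn (fun y => (η y ^ 2)⁻¹) (slab 0 T) :=
    ((h.cont.mono (prod_mono subset_rfl Ioo_subset_Icc_self)).pow 2).inv₀ fun y hy =>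
      (pow_pos (hc.trans_le (h.lower y hy)) 2).ne'
  have da := h.hasWeakDeriv_z_plate
    (ca.locallyIntegrableOn (μ := volume) isOpen_slab.measurableSet)
  have ba : MemLp (fun q => (η (plateProj q) ^ 2)⁻¹) ⊤
      (volume.restrict (xCell (fluidDomain T η) 0)) :=
    h.memLp_top_of_continuousOn (C := (c ^ 2)⁻¹)
      ((hηc.pow 2).inv₀ fun q hq => (pow_pos (hc.trans_le (hlow q hq)) 2).ne') fun q hq => by
        have := hlow q hq
        rw [abs_of_nonneg (by positivity)]
        gcongr
  have pa : AEPeriodic (fluidDomain T η) (fun q => (η (plateProj q) ^ 2)⁻¹) :=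
    Eventually.of_forall fun q => by simp [plateProj, h.per]
  obtain ⟨H, hH0, hH⟩ := h.exists_upper
  have hup : ∀ q ∈ xCell (fluidDomain T η) 0, η (plateProj q) ≤ H := fun q hq =>
    hH _ ⟨hq.2.1.le, by have := hq.2.2; linarith⟩ _ (Ioo_subset_Icc_self hq.1.1)
  have bd : MemLp (depth η) ⊤ (volume.restrict (xCell (fluidDomain T η) 0)) := by
    refine memLp_top_of_bound ((h.continuousOn_depth.mono inter_subset_left).aestronglyMeasurable hmc)
      H ?_
    filter_upwards [ae_restrict_mem hmc] with q hq
    rw [Real.norm_of_nonneg (depth_pos hq.1).le, depth]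
    linarith [hup q hq, hq.1.2.1]
  have bm := memLp_top_mul ba bd
  have dm : HasWeakDeriv (fluidDomain T η) (fluidDir 1)
      (fun q => (η (plateProj q) ^ 2)⁻¹ * depth η q) (fun q => -(η (plateProj q) ^ 2)⁻¹) := by
    have := da.mul_cellL2 hU hper h.depth_z ⟨pa, ba.mono_exponent le_top⟩
      ⟨Eventually.of_forall fun _ => rfl, MemLp.zero'⟩ ⟨h.aePeriodic_depth, bd.mono_exponent le_top⟩
      ⟨Eventually.of_forall fun _ => rfl, memLp_const _⟩
    simpa using this
  have pm := pa.mul h.aePeriodic_depth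
  have i1 := w2.integrable_mul w2
  have i2 : IntegrableOn (fun q => w q * wz q + wz q * w q) (xCell (fluidDomain T η) 0) :=
    (w2.integrable_mul wz2).add (wz2.integrable_mul w2)
  have p1 := w2.1.mul w2.1
  have hsq := hw.mul_cellL2 hU hper hw w2 wz2 w2 wz2
  have p2 := hsq.aePeriodic hU hper p1
  have hF := Flux.vertical (η := η) (T := T)
    (hsq.mul_of_holder (p := 1) (r := ⊤) (by simp) hU dm
      (p1.memLpLoc hU.measurableSet hper (memLp_one_iff_integrable.2 i1))
      (p2.memLpLoc hU.measurableSet hper (memLp_one_iff_integrable.2 i2))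
      (pm.memLpLoc hU.measurableSet hper bm)
      ((dm.aePeriodic hU hper pm).memLpLoc hU.measurableSet hper ba.neg)) (p1.mul pm)
    ((integrable_top_mul bm i1).congr (Eventually.of_forall fun q => mul_comm _ _))
    ((Integrable.fun_sub (integrable_top_mul bm i2) (integrable_top_mul ba i1)).congr
      (Eventually.of_forall fun q => by ring))
  have mw := w2.2.1
  have sb := (hb.mul hb.layerBounded (aemeasurable_layer mw) (aemeasurable_layer mw)).mul_top bm
  have st := (h.layerSmall_depth hθ.continuous (h.layerBounded_top hθ hθ0 hw w2 wz2)).mul_top ba.neg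
  have key := hF.divergence h hθ hθ0 (R := fun _ => 0) (integrable_zero _ _ _)
    (by simpa only [mul_comm] using sb)
    (by
      refine (congrArg (LayerSmall _ 1) (funext fun q => ?_)).mp st
      simp only [topFlux, Pi.neg_apply]
      ring)
  simp only [mul_zero, integral_zero, add_zero, zero_add] at key
  have ia : IntegrableOn (fun q => θ q.2.2 * (w q ^ 2 / η (plateProj q) ^ 2))
      (xCell (fluidDomain T η) 0) :=
    (integrable_top_mul bθ (integrable_top_mul ba i1)).congr
      (Eventually.of_forall fun q => by simp only [div_eq_mul_inv]; ring)
  have ib : IntegrableOn (fun q => θ q.2.2 * wz q ^ 2) (xCell (fluidDomain T η) 0) :=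
    (integrable_top_mul bθ (wz2.integrable_mul wz2)).congr
      (Eventually.of_forall fun q => by simp only [sq])
  have ik := hF.integrable_interior h hθ
  simp only [mul_zero, add_zero, zero_add] at ik
  refine ⟨ia, ?_⟩
  have e : ∫ q in xCell (fluidDomain T η) 0, (θ q.2.2 * (w q ^ 2 / η (plateProj q) ^ 2)
      + 2 * (θ q.2.2 * (w q * w q * -(η (plateProj q) ^ 2)⁻¹
        + (w q * wz q + wz q * w q) * ((η (plateProj q) ^ 2)⁻¹ * depth η q))))
      ≤ ∫ q in xCell (fluidDomain T η) 0, 4 * (θ q.2.2 * wz q ^ 2) := by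
    refine setIntegral_mono_on (Integrable.fun_add ia (ik.const_mul 2)) (ib.const_mul 4) hmc
      fun q hq => ?_
    have h1 := hlow q hq.1
    have h2 : depth η q ≤ η (plateProj q) := by rw [depth]; linarith [hq.1.2.1]
    have h3 := depth_pos hq.1
    have h4 : 0 < η (plateProj q) := hc.trans_le h1
    set a := (η (plateProj q))⁻¹ with ha
    have ha0 : 0 < a := inv_pos.2 h4
    have h5 : a * depth η q ≤ 1 := by
      rw [ha, inv_mul_le_iff₀ h4, mul_one]; exact h2
    have h6 : 0 ≤ a * depth η q := by positivity
    have e1 : w q ^ 2 / η (plateProj q) ^ 2 = (a * w q) ^ 2 := by rw [ha]; field_simp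
    have e2 : (η (plateProj q) ^ 2)⁻¹ = a ^ 2 := by rw [ha]; simp
    rw [e1, e2]
    have : (a * w q) ^ 2 + 2 * (w q * w q * -a ^ 2 + (w q * wz q + wz q * w q) *
        (a ^ 2 * depth η q)) ≤ 4 * wz q ^ 2 := by
      have h7 : (a * depth η q) ^ 2 ≤ 1 := pow_le_one₀ h6 h5
      nlinarith [sq_nonneg (a * w q - 2 * (wz q * (a * depth η q))),
        mul_le_mul_of_nonneg_right h7 (sq_nonneg (wz q))]
    nlinarith [mul_le_mul_of_nonneg_left this (hθ0 q.2.2)]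
  rw [integral_add ia (ik.const_mul 2), integral_const_mul, key, integral_const_mul] at e
  linarith

end FluidGeometry

/-! ### The energy inequality -/

/-- The integral over the fluid column above a point of the plate. -/
def column (η : ℝ × ℝ → ℝ) (H : ℝ × ℝ × ℝ → ℝ) (y : ℝ × ℝ) : ℝ :=
  ∫ z in Ioo 0 (η y), H (y.1, z, y.2)

lemma column_time_mul {η : ℝ × ℝ → ℝ} (θ : ℝ → ℝ) (H : ℝ × ℝ × ℝ → ℝ) :
    column η (fun q => θ q.2.2 * H q) = fun y => θ y.2 * column η H y := by
  funext y
  simp only [column, integral_const_mul]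

lemma column_plate {η : ℝ × ℝ → ℝ} (u : ℝ × ℝ → ℝ) {y : ℝ × ℝ} (hy : 0 ≤ η y) :
    column η (fun q => u (plateProj q)) y = u y * η y := by
  simp [column, plateProj, hy, mul_comm]

lemma column_nonneg {η : ℝ × ℝ → ℝ} {H : ℝ × ℝ × ℝ → ℝ} (hH : ∀ q, 0 ≤ H q) (y : ℝ × ℝ) :
    0 ≤ column η H y := integral_nonneg fun _ => hH _

/-- Fubini's theorem on the fluid cell. -/
theorem FluidGeometry.integral_column {T c : ℝ} {η ηx ηt : ℝ × ℝ → ℝ} (h : FluidGeometry T c η ηx ηt)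
    {H : ℝ × ℝ × ℝ → ℝ} (hH : IntegrableOn H (xCell (fluidDomain T η) 0)) :
    IntegrableOn (column η H) (plateCell T) ∧
      ∫ q in xCell (fluidDomain T η) 0, H q = ∫ y in plateCell T, column η H y := by
  have hm := measurableSet_xCell h.isOpen.measurableSet 0
  have hm' : MeasurableSet (plateCell T) := measurableSet_Ioo.prod measurableSet_Ioo
  rw [← integrable_indicator_iff hm] at hH
  have h1 := measurePreserving_fluidEquiv.integrable_comp_of_integrable hH
  rw [Measure.volume_eq_prod] at h1
  have e : ∀ y, ∫ z, (xCell (fluidDomain T η) 0).indicator H (fluidEquiv (y, z))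
      = (plateCell T).indicator (column η H) y := fun y => by
    by_cases hy : y ∈ plateCell T
    · rw [indicator_of_mem hy, column, ← integral_indicator measurableSet_Ioo]
      congr 1
      funext z
      by_cases hz : z ∈ Ioo 0 (η y)
      · have : fluidEquiv (y, z) ∈ xCell (fluidDomain T η) 0 :=
          FluidGeometry.mem_cell_iff.2 ⟨hy, hz.1, sub_pos.2 hz.2⟩
        rw [indicator_of_mem hz, indicator_of_mem this]; rfl
      · have : fluidEquiv (y, z) ∉ xCell (fluidDomain T η) 0 := fun hq =>
          hz ⟨(FluidGeometry.mem_cell_iff.1 hq).2.1, sub_pos.1 (FluidGeometry.mem_cell_iff.1 hq).2.2⟩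
        rw [indicator_of_notMem hz, indicator_of_notMem this]
    · rw [indicator_of_notMem hy]
      refine integral_eq_zero_of_ae (Eventually.of_forall fun z => ?_)
      refine indicator_of_notMem (fun hq => hy (FluidGeometry.mem_cell_iff.1 hq).1) _
  constructor
  · rw [← integrable_indicator_iff hm']
    have := h1.integral_prod_left
    simp only [Function.comp_def] at this
    exact this.congr (Eventually.of_forall e)
  · rw [← integral_indicator hm, ← integral_indicator hm',
      ← measurePreserving_fluidEquiv.integral_comp' (f := fluidEquiv), Measure.volume_eq_prod,
      ← Function.comp_def, integral_prod _ h1]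
    exact integral_congr_ae (Eventually.of_forall e)

/-- The interaction of a fluid with a plate, in terms of the displacement `ηx 0`, its derivatives
`ηx k = ∂_x^k η`, `sx k = ∂_x^k ∂_t η` and `s' = ∂_tt η`, the velocity `v` and its derivatives `G`
and `vt`, the force `f`, the stress tensor `σ` with derivatives `D i j = ∂_j σ_ij` and trace `S` on
the plate, and the pressure `p`. -/
structure Interaction (T c ρ δ β κ M : ℝ) (ηx sx : ℕ → ℝ × ℝ → ℝ) (s' : ℝ × ℝ → ℝ)
    (v : Fin 2 → ℝ × ℝ × ℝ → ℝ) (G : Fin 2 → Fin 2 → ℝ × ℝ × ℝ → ℝ) (vt f : Fin 2 → ℝ × ℝ × ℝ → ℝ)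
    (σ D : Fin 2 → Fin 2 → ℝ × ℝ × ℝ → ℝ) (S : Fin 2 → Fin 2 → ℝ × ℝ → ℝ)
    (p : ℝ × ℝ × ℝ → ℝ) : Prop where
  plate : PlateField 0 T ηx sx s'
  flow : FlowField T c κ (ηx 0) (ηx 1) (sx 0) v G vt
  second : ∃ H K, CellL2 (fluidDomain T (ηx 0)) H ∧ CellL2 (fluidDomain T (ηx 0)) K ∧
    HasWeakDeriv (fluidDomain T (ηx 0)) (fluidDir 1) (G 1 0) H ∧
    HasWeakDeriv (fluidDomain T (ηx 0)) (fluidDir 0) (G 1 1) H ∧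
    HasWeakDeriv (fluidDomain T (ηx 0)) (fluidDir 1) (G 1 1) K
  cell_σ : ∀ i j, CellL2 (fluidDomain T (ηx 0)) (σ i j)
  cell_D : ∀ i j, CellL2 (fluidDomain T (ηx 0)) (D i j)
  deriv_σ : ∀ i j, HasWeakDeriv (fluidDomain T (ηx 0)) (fluidDir j) (σ i j) (D i j)
  trace_σ : ∀ i j, IsTopTrace T (ηx 0) (σ i j) (S i j)
  stress_eq : ∀ᵐ q ∂volume.restrict (xCell (fluidDomain T (ηx 0)) 0), ∀ i j,
    σ i j q = G i j q + G j i q - if i = j then p q else 0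
  memLp_f : ∀ i, MemLp (f i) 2 (volume.restrict (xCell (fluidDomain T (ηx 0)) 0))
  force_le : ∀ᵐ q ∂volume.restrict (xCell (fluidDomain T (ηx 0)) 0), f 0 q ^ 2 + f 1 q ^ 2 ≤ M ^ 2
  momentum : ∀ᵐ q ∂volume.restrict (xCell (fluidDomain T (ηx 0)) 0), ∀ i,
    FlowField.acceleration κ v G vt i q = f i q + (D i 0 q + D i 1 q)
  plate_eq : ∀ᵐ y ∂volume.restrict (plateCell T),
    ρ * κ ^ 2 * s' y - δ * κ * sx 2 y + β * ηx 4 y = S 1 0 y * ηx 1 y - S 1 1 y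

namespace Interaction

variable {T c ρ δ β κ M : ℝ} {ηx sx : ℕ → ℝ × ℝ → ℝ} {s' : ℝ × ℝ → ℝ}
    {v : Fin 2 → ℝ × ℝ × ℝ → ℝ} {G : Fin 2 → Fin 2 → ℝ × ℝ × ℝ → ℝ} {vt f : Fin 2 → ℝ × ℝ × ℝ → ℝ}
    {σ D : Fin 2 → Fin 2 → ℝ × ℝ × ℝ → ℝ} {S : Fin 2 → Fin 2 → ℝ × ℝ → ℝ}
    {p : ℝ × ℝ × ℝ → ℝ} {θ : ℝ → ℝ}

/-- The density of the inertial and bending energies of the plate. -/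
def plateEnergy (ρ β κ : ℝ) (ηx sx : ℕ → ℝ × ℝ → ℝ) (y : ℝ × ℝ) : ℝ :=
  ρ * κ ^ 2 / 2 * sx 0 y ^ 2 + β / 2 * ηx 2 y ^ 2

lemma integrableOn_plateEnergy (h : Interaction T c ρ δ β κ M ηx sx s' v G vt f σ D S p) :
    IntegrableOn (plateEnergy ρ β κ ηx sx) (plateCell T) := by
  have c0 := (h.plate.cell_s 0 (by norm_num)).2.integrable_sq
  have c2 := (h.plate.cell_η 2 (by norm_num)).2.integrable_sq
  rw [← xCell_plateDomain, plateDomain_eq_slab]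
  exact (c0.const_mul _).add (c2.const_mul _)

/-- The energy inequality over the space-time cell. The integral of `σ : ∇v` is that of `|∇v|²`, since
the determinant of `∇v` has integral zero; with Poincaré's inequality it controls the power of the
force up to a multiple of the square of the thickness. -/
theorem energy_cell (h : Interaction T c ρ δ β κ M ηx sx s' v G vt f σ D S p) (hκ : 0 ≤ κ)
    (hδ : 0 ≤ δ) (hθ : IsTest 0 T θ) (hθ0 : ∀ t, 0 ≤ θ t) :
    - (∫ q in xCell (fluidDomain T (ηx 0)) 0, deriv θ q.2.2 * (κ * FlowField.kinetic v q))
      - κ * ∫ y in plateCell T, deriv θ y.2 * plateEnergy ρ β κ ηx sx y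
      ≤ M ^ 2 * ∫ q in xCell (fluidDomain T (ηx 0)) 0, θ q.2.2 * ηx 0 (plateProj q) ^ 2 := by
  have hf := h.flow
  have hg := hf.geom
  have hm := measurableSet_xCell hg.isOpen.measurableSet 0
  obtain ⟨C, hC⟩ := hθ.exists_bound
  obtain ⟨C', hC'⟩ := hθ.exists_bound_deriv
  have bθ := hg.memLp_time hθ.continuous hC
  have bθ' := hg.memLp_time hθ.continuous_deriv hC'
  obtain ⟨H, K, cH, cK, d10, d01, d11⟩ := h.second
  have hX : ∀ i, MemLp (FlowField.acceleration κ v G vt i) 2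
      (volume.restrict (xCell (fluidDomain T (ηx 0)) 0)) := fun i => by
    refine ((h.memLp_f i).add ((h.cell_D i 0).2.add (h.cell_D i 1).2)).ae_eq ?_
    filter_upwards [h.momentum] with q hq
    rw [hq i]; rfl
  have kin := hf.kinetic_balance hθ hθ0 hX
  have wk := hf.work hθ hθ0 h.cell_σ h.cell_D h.deriv_σ h.trace_σ
    (by rw [← xCell_plateDomain, plateDomain_eq_slab]; exact hg.bdd_x)
    (by rw [← xCell_plateDomain, plateDomain_eq_slab]; exact hg.memLp_t)
  have det := hf.integral_det_eq_zero hθ hθ0 cH cK d10 d01 d11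
  have pc := fun i => hg.poincare hθ hθ0 (hf.grad i 1) (hf.cell_v i) (hf.cell_G i 1)
    (hf.small_bottom hθ i)
  have pe := h.plate.energy hg.time_pos hθ (ρ * κ ^ 2) (δ * κ) β
  have iA : IntegrableOn (fun q => θ q.2.2 * (v 0 q * FlowField.acceleration κ v G vt 0 q
      + v 1 q * FlowField.acceleration κ v G vt 1 q)) (xCell (fluidDomain T (ηx 0)) 0) :=
    integrable_top_mul bθ (((hf.cell_v 0).2.integrable_mul (hX 0)).add
      ((hf.cell_v 1).2.integrable_mul (hX 1)))
  have iN : IntegrableOn (fun q => deriv θ q.2.2 * (κ * FlowField.kinetic v q))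
      (xCell (fluidDomain T (ηx 0)) 0) :=
    integrable_top_mul bθ' (hf.integrable_kinetic.const_mul κ)
  rw [integral_add iA iN] at kin
  have iσ := fun i j => (h.cell_σ i j).integrable_mul (hf.cell_G i j)
  have iD := fun i => (hf.cell_v i).2.integrable_mul ((h.cell_D i 0).2.add (h.cell_D i 1).2)
  have iW : IntegrableOn (fun q => θ q.2.2 *
      (σ 0 0 q * G 0 0 q + σ 0 1 q * G 0 1 q + σ 1 0 q * G 1 0 q + σ 1 1 q * G 1 1 q
        + v 0 q * (D 0 0 q + D 0 1 q) + v 1 q * (D 1 0 q + D 1 1 q)))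
      (xCell (fluidDomain T (ηx 0)) 0) :=
    integrable_top_mul bθ ((((((iσ 0 0).add (iσ 0 1)).add (iσ 1 0)).add (iσ 1 1)).add
      (iD 0)).add (iD 1))
  have iG := fun i j k l => (hf.cell_G i j).integrable_mul (hf.cell_G k l)
  have iDet : IntegrableOn (fun q => θ q.2.2 * (G 0 0 q * G 1 1 q - G 0 1 q * G 1 0 q))
      (xCell (fluidDomain T (ηx 0)) 0) :=
    integrable_top_mul bθ ((iG 0 0 1 1).sub (iG 0 1 1 0))
  have iQ : ∀ i, IntegrableOn (fun q => θ q.2.2 * G i 1 q ^ 2)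
      (xCell (fluidDomain T (ηx 0)) 0) := fun i =>
    integrable_top_mul bθ (hf.cell_G i 1).2.integrable_sq
  have iE : IntegrableOn (fun q => θ q.2.2 * ηx 0 (plateProj q) ^ 2)
      (xCell (fluidDomain T (ηx 0)) 0) :=
    integrable_top_mul bθ
      (hg.memLp_comp_plateProj (h.plate.cell_η 0 (by norm_num)).2).integrable_sq
  have main : ∫ q in xCell (fluidDomain T (ηx 0)) 0, θ q.2.2 *
      (v 0 q * FlowField.acceleration κ v G vt 0 q + v 1 q * FlowField.acceleration κ v G vt 1 q)
      ≤ ∫ q in xCell (fluidDomain T (ηx 0)) 0, (θ q.2.2 *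
      (σ 0 0 q * G 0 0 q + σ 0 1 q * G 0 1 q + σ 1 0 q * G 1 0 q + σ 1 1 q * G 1 1 q
        + v 0 q * (D 0 0 q + D 0 1 q) + v 1 q * (D 1 0 q + D 1 1 q))
      + 2 * (θ q.2.2 * (G 0 0 q * G 1 1 q - G 0 1 q * G 1 0 q))
      - (θ q.2.2 * G 0 1 q ^ 2 + θ q.2.2 * G 1 1 q ^ 2)
      + 1 / 4 * (θ q.2.2 * (v 0 q ^ 2 / ηx 0 (plateProj q) ^ 2)
        + θ q.2.2 * (v 1 q ^ 2 / ηx 0 (plateProj q) ^ 2))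
      + M ^ 2 * (θ q.2.2 * ηx 0 (plateProj q) ^ 2)) := by
    refine integral_mono_ae iA ((((iW.fun_add (iDet.const_mul 2)).fun_sub
      ((iQ 0).fun_add (iQ 1))).fun_add (((pc 0).1.fun_add (pc 1).1).const_mul (1 / 4))).fun_add
      (iE.const_mul (M ^ 2))) ?_
    filter_upwards [h.stress_eq, h.force_le, h.momentum, hf.div_free, ae_restrict_mem hm] with
      q hs hfl hmo hdv hq
    have hη : 0 < ηx 0 (plateProj q) :=
      hg.pos.trans_le (hg.lower _ (FluidGeometry.plateProj_mem hq.1))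
    have s00 := hs 0 0
    have s01 := hs 0 1
    have s10 := hs 1 0
    have s11 := hs 1 1
    simp only [Fin.isValue, if_true, zero_ne_one, one_ne_zero, if_false] at s00 s01 s10 s11
    have hd : G 1 1 q = - G 0 0 q := by linarith
    -- Young's inequality for the power of the force; the factor `1 / 4` matches the constant `4` of
    -- Poincaré's inequality
    have hy : ∀ i, v i q * f i q ≤ 1 / 4 * (v i q ^ 2 / ηx 0 (plateProj q) ^ 2)
        + ηx 0 (plateProj q) ^ 2 * f i q ^ 2 := fun i => by
      have e : v i q = ηx 0 (plateProj q) * (v i q / ηx 0 (plateProj q)) := by field_simp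
      rw [← div_pow]
      set r := v i q / ηx 0 (plateProj q)
      rw [e]
      nlinarith [sq_nonneg (1 / 2 * r - ηx 0 (plateProj q) * f i q)]
    have hη2 := mul_le_mul_of_nonneg_left hfl (sq_nonneg (ηx 0 (plateProj q)))
    have hpt : v 0 q * FlowField.acceleration κ v G vt 0 q
        + v 1 q * FlowField.acceleration κ v G vt 1 q
        ≤ (σ 0 0 q * G 0 0 q + σ 0 1 q * G 0 1 q + σ 1 0 q * G 1 0 q + σ 1 1 q * G 1 1 q
        + v 0 q * (D 0 0 q + D 0 1 q) + v 1 q * (D 1 0 q + D 1 1 q))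
      + 2 * ((G 0 0 q * G 1 1 q - G 0 1 q * G 1 0 q))
      - (G 0 1 q ^ 2 + G 1 1 q ^ 2)
      + 1 / 4 * ((v 0 q ^ 2 / ηx 0 (plateProj q) ^ 2)
        + (v 1 q ^ 2 / ηx 0 (plateProj q) ^ 2))
      + M ^ 2 * (ηx 0 (plateProj q) ^ 2) := by
      rw [hmo 0, hmo 1, s00, s01, s10, s11, hd]
      nlinarith [hy 0, hy 1, sq_nonneg (G 0 0 q), sq_nonneg (G 1 0 q)]
    have := mul_le_mul_of_nonneg_left hpt (hθ0 q.2.2)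
    linarith
  rw [integral_add ((((iW.fun_add (iDet.const_mul 2)).fun_sub
      ((iQ 0).fun_add (iQ 1))).fun_add (((pc 0).1.fun_add (pc 1).1).const_mul (1 / 4))))
      (iE.const_mul (M ^ 2)), integral_add ((iW.fun_add (iDet.const_mul 2)).fun_sub
      ((iQ 0).fun_add (iQ 1))) (((pc 0).1.fun_add (pc 1).1).const_mul (1 / 4)),
    integral_sub (iW.fun_add (iDet.const_mul 2)) ((iQ 0).fun_add (iQ 1)),
    integral_add iW (iDet.const_mul 2), integral_add (iQ 0) (iQ 1), integral_const_mul,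
    integral_const_mul, integral_const_mul, integral_add (pc 0).1 (pc 1).1, det] at main
  have eP : ∫ y in plateCell T, θ y.2 * (κ * sx 0 y * (S 1 0 y * ηx 1 y - S 1 1 y))
      = κ * (- (∫ y in plateCell T, deriv θ y.2 * plateEnergy ρ β κ ηx sx y)
        + δ * κ * ∫ y in plateCell T, θ y.2 * sx 1 y ^ 2) := by
    rw [← plateDomain_eq_slab, xCell_plateDomain] at pe
    simp only [plateEnergy]
    rw [← pe, ← integral_const_mul]
    refine integral_congr_ae ?_
    filter_upwards [h.plate_eq] with y hy
    rw [← hy]; ring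
  rw [eP] at wk
  have hs1 : 0 ≤ ∫ y in plateCell T, θ y.2 * sx 1 y ^ 2 :=
    integral_nonneg fun y => mul_nonneg (hθ0 _) (sq_nonneg _)
  have := mul_nonneg (mul_nonneg hκ (mul_nonneg hδ hκ)) hs1
  have p0 := (pc 0).2
  have p1 := (pc 1).2
  linarith

/-- The total energy at a given time: the kinetic energy of the fluid and the energy of the plate,
whose velocity is `κ ∂_t η`. -/
def energy (ρ β κ : ℝ) (ηx sx : ℕ → ℝ × ℝ → ℝ) (v : Fin 2 → ℝ × ℝ × ℝ → ℝ) (t : ℝ) : ℝ :=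
  ∫ x in Ioo (0 : ℝ) 1, (column (ηx 0) (FlowField.kinetic v) (x, t) + plateEnergy ρ β κ ηx sx (x, t))

lemma integrableOn_energyDensity (h : Interaction T c ρ δ β κ M ηx sx s' v G vt f σ D S p) :
    IntegrableOn (fun y => column (ηx 0) (FlowField.kinetic v) y + plateEnergy ρ β κ ηx sx y)
      (plateCell T) :=
  (h.flow.geom.integral_column h.flow.integrable_kinetic).1.add h.integrableOn_plateEnergy

lemma integrableOn_cube (h : Interaction T c ρ δ β κ M ηx sx s' v G vt f σ D S p) :
    IntegrableOn (fun y => ηx 0 y ^ 3) (plateCell T) := by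
  have hg := h.flow.geom
  have := (hg.integral_column (hg.memLp_comp_plateProj
    (h.plate.cell_η 0 (by norm_num)).2).integrable_sq).1
  refine this.congr ?_
  filter_upwards [ae_restrict_mem (measurableSet_Ioo.prod measurableSet_Ioo)] with y hy
  rw [column_plate (fun y => ηx 0 y ^ 2) (hg.pos.le.trans (hg.lower_cell hy))]
  ring

/-- The energy inequality, in the sense of distributions. -/
theorem energy_weak (h : Interaction T c ρ δ β κ M ηx sx s' v G vt f σ D S p) (hκ : 0 ≤ κ)
    (hδ : 0 ≤ δ) (hθ : IsTest 0 T θ) (hθ0 : ∀ t, 0 ≤ θ t) :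
    - ∫ t in Ioo 0 T, deriv θ t * (κ * energy ρ β κ ηx sx v t)
      ≤ ∫ t in Ioo 0 T, θ t * (M ^ 2 * ∫ x in Ioo (0 : ℝ) 1, ηx 0 (x, t) ^ 3) := by
  have hg := h.flow.geom
  have key := h.energy_cell hκ hδ hθ hθ0
  obtain ⟨C, hC⟩ := hθ.exists_bound
  obtain ⟨C', hC'⟩ := hθ.exists_bound_deriv
  have hm' : MeasurableSet (plateCell T) := measurableSet_Ioo.prod measurableSet_Ioo
  have iK := integrable_top_mul (hg.memLp_time hθ.continuous_deriv hC') h.flow.integrable_kinetic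
  have iE := integrable_top_mul (hg.memLp_time hθ.continuous hC)
    (hg.memLp_comp_plateProj (h.plate.cell_η 0 (by norm_num)).2).integrable_sq
  obtain ⟨jK, eK⟩ := hg.integral_column iK
  obtain ⟨jE, eE⟩ := hg.integral_column iE
  simp only [column_time_mul (deriv θ), column_time_mul θ] at jK eK jE eE
  have jP : IntegrableOn (fun y => deriv θ y.2 * plateEnergy ρ β κ ηx sx y) (plateCell T) :=
    integrableOn_test_mul hθ.continuous_deriv hC' h.integrableOn_plateEnergy
  have jT := jK.fun_add jP
  simp only [← mul_add] at jT
  have eT := integral_cell_mul_time jT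
  have eE' : ∫ y in plateCell T, θ y.2 * column (ηx 0) (fun q => ηx 0 (plateProj q) ^ 2) y
      = ∫ t in Ioo 0 T, θ t * ∫ x in Ioo (0 : ℝ) 1, ηx 0 (x, t) ^ 3 := by
    have e : ∀ y ∈ plateCell T, θ y.2 * column (ηx 0) (fun q => ηx 0 (plateProj q) ^ 2) y
        = θ y.2 * ηx 0 y ^ 3 := fun y hy => by
      rw [column_plate (fun y => ηx 0 y ^ 2) (hg.pos.le.trans (hg.lower_cell hy))]
      ring
    rw [setIntegral_congr_fun hm' e]
    exact integral_cell_mul_time (jE.congr_fun e hm')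
  rw [eE, eE'] at key
  have e1 : ∫ q in xCell (fluidDomain T (ηx 0)) 0, deriv θ q.2.2 * (κ * FlowField.kinetic v q)
      = κ * ∫ y in plateCell T, deriv θ y.2 * column (ηx 0) (FlowField.kinetic v) y := by
    rw [← eK, ← integral_const_mul]
    refine integral_congr_ae (Eventually.of_forall fun q => ?_)
    ring
  have e2 : ∫ t in Ioo 0 T, deriv θ t * (κ * energy ρ β κ ηx sx v t)
      = κ * ((∫ y in plateCell T, deriv θ y.2 * column (ηx 0) (FlowField.kinetic v) y)
        + ∫ y in plateCell T, deriv θ y.2 * plateEnergy ρ β κ ηx sx y) := by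
    rw [← integral_add jK jP]
    simp only [← mul_add]
    rw [plateCell, eT, ← integral_const_mul]
    refine integral_congr_ae (Eventually.of_forall fun t => ?_)
    simp only [energy]; ring
  have e3 : ∫ t in Ioo 0 T, θ t * (M ^ 2 * ∫ x in Ioo (0 : ℝ) 1, ηx 0 (x, t) ^ 3)
      = M ^ 2 * ∫ t in Ioo 0 T, θ t * ∫ x in Ioo (0 : ℝ) 1, ηx 0 (x, t) ^ 3 := by
    rw [← integral_const_mul]
    refine integral_congr_ae (Eventually.of_forall fun t => ?_)
    ring
  rw [e2, e3]
  rw [e1] at key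
  linarith

/-- The volume of the fluid is constant in time. -/
theorem volume_weak (h : Interaction T c ρ δ β κ M ηx sx s' v G vt f σ D S p) (hκ : κ ≠ 0)
    (hθ : IsTest 0 T θ) (hθ0 : ∀ t, 0 ≤ θ t) :
    ∫ t in Ioo 0 T, deriv θ t * ∫ x in Ioo (0 : ℝ) 1, ηx 0 (x, t) = 0 := by
  have hg := h.flow.geom
  have key := h.flow.volume_eq hκ hθ hθ0
  have hfin := hg.isFiniteMeasure
  obtain ⟨C', hC'⟩ := hθ.exists_bound_deriv
  have hm' : MeasurableSet (plateCell T) := measurableSet_Ioo.prod measurableSet_Ioo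
  obtain ⟨j, e⟩ := hg.integral_column
    ((hg.memLp_time hθ.continuous_deriv hC').integrable le_top)
  have e' : ∀ y ∈ plateCell T, column (ηx 0) (fun q => deriv θ q.2.2) y
      = deriv θ y.2 * ηx 0 y := fun y hy =>
    column_plate (fun y => deriv θ y.2) (hg.pos.le.trans (hg.lower_cell hy))
  rw [key, setIntegral_congr_fun hm' e'] at e
  exact (integral_cell_mul_time (j.congr_fun e' hm')).symm.trans e.symm

end Interaction

/-! ### Bounds in time -/

section Time

variable {T : ℝ}

/-- Gronwall's inequality for an integrable function. -/
lemma gronwall_ae {A a : ℝ} {Z : ℝ → ℝ} (hT : 0 < T) (hA : 0 ≤ A) (ha : 0 ≤ a)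
    (hZ : IntegrableOn Z (Ioo 0 T)) (hZ0 : ∀ t, 0 ≤ Z t)
    (h : ∀ᵐ t ∂volume.restrict (Ioo 0 T), Z t ≤ a + A * ∫ τ in 0..t, Z τ) :
    ∀ᵐ t ∂volume.restrict (Ioo 0 T), Z t ≤ a * Real.exp (A * T) := by
  have hi : IntervalIntegrable Z volume 0 T :=
    (intervalIntegrable_iff_integrableOn_Ioo_of_le hT.le).2 hZ
  -- the right-hand side is a continuous function that satisfies the same inequality
  set u : ℝ → ℝ := fun t => a + A * ∫ τ in 0..t, Z τ with hu
  have huc : ContinuousOn u (Icc 0 T) := by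
    have := (hi.absolutelyContinuousOnInterval_intervalIntegral (c := 0) (by simp)).continuousOn
    rw [uIcc_of_le hT.le] at this
    exact continuousOn_const.add (continuousOn_const.mul this)
  have hu0 : ∀ t ∈ Icc 0 T, 0 ≤ u t := fun t ht =>
    add_nonneg ha (mul_nonneg hA (intervalIntegral.integral_nonneg ht.1 fun s _ => hZ0 s))
  have hle : ∀ t ∈ Icc 0 T, ∫ τ in 0..t, Z τ ≤ ∫ τ in 0..t, u τ := fun t ht => by
    have hsub : Ioo 0 t ⊆ Ioo 0 T := Ioo_subset_Ioo_right ht.2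
    rw [intervalIntegral.integral_of_le ht.1, intervalIntegral.integral_of_le ht.1,
      integral_Ioc_eq_integral_Ioo, integral_Ioc_eq_integral_Ioo]
    refine integral_mono_ae (hZ.mono_set hsub) ((huc.integrableOn_compact isCompact_Icc).mono_set
      (hsub.trans Ioo_subset_Icc_self)) ?_
    exact ae_mono (Measure.restrict_mono hsub le_rfl) h
  have hext : Continuous (IccExtend hT.le ((Icc 0 T).domRestrict u)) :=
    (continuousOn_iff_continuous_domRestrict.1 huc).Icc_extend'
  set w := IccExtend hT.le ((Icc 0 T).domRestrict u) with hw
  have hwu : ∀ t ∈ Icc 0 T, w t = u t := fun t ht => by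
    rw [hw, IccExtend_of_mem _ _ ht, Set.domRestrict_apply]
  have hiw : ∀ t ∈ Icc 0 T, ∫ τ in 0..t, u τ = ∫ τ in 0..t, w τ := fun t ht => by
    refine intervalIntegral.integral_congr fun s hs => (hwu s ?_).symm
    rw [uIcc_of_le ht.1] at hs
    exact ⟨hs.1, hs.2.trans ht.2⟩
  have hwle : ∀ t ∈ Icc 0 T, w t ≤ a + A * ∫ τ in 0..t, w τ := fun t ht => by
    rw [hwu t ht, ← hiw t ht]
    have := mul_le_mul_of_nonneg_left (hle t ht) hA
    simp only [hu] at this ⊢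
    linarith
  have hw0 : ∀ t ∈ Icc 0 T, 0 ≤ w t := fun t ht => (hwu t ht).symm ▸ hu0 t ht
  have hd : ∀ t, HasDerivAt (fun t => a + A * ∫ τ in 0..t, w τ) (A * w t) t := fun t =>
    ((intervalIntegral.integral_hasDerivAt_right (hext.intervalIntegrable _ _)
      (hext.stronglyMeasurableAtFilter _ _) hext.continuousAt).const_mul A).const_add a
  have hU0 : ∀ t ∈ Icc 0 T, 0 ≤ a + A * ∫ τ in 0..t, w τ := fun t ht => (hw0 t ht).trans (hwle t ht)
  have hg := norm_le_gronwallBound_of_norm_deriv_right_le (f := fun t => a + A * ∫ τ in 0..t, w τ)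
    (f' := fun t => A * w t) (δ := a) (K := A) (ε := 0) (a := 0) (b := T)
    (fun t _ => (hd t).continuousAt.continuousWithinAt) (fun t _ => (hd t).hasDerivWithinAt)
    (by simp [abs_of_nonneg ha]) fun t ht => by
      have ht' := Ico_subset_Icc_self ht
      rw [add_zero, norm_mul, Real.norm_of_nonneg hA, Real.norm_of_nonneg (hw0 t ht'),
        Real.norm_of_nonneg (hU0 t ht')]
      exact mul_le_mul_of_nonneg_left (hwle t ht') hA
  filter_upwards [h, ae_restrict_mem measurableSet_Ioo] with t ht htT
  have ht' := Ioo_subset_Icc_self htT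
  have h1 := hg t ht'
  rw [Real.norm_of_nonneg (hU0 t ht'), gronwallBound_ε0, sub_zero] at h1
  calc Z t ≤ u t := ht
    _ ≤ a * Real.exp (A * t) := (hwu t ht') ▸ (hwle t ht').trans h1
    _ ≤ a * Real.exp (A * T) := by
      gcongr
      exact htT.2.le

/-- A function whose averages over `(0,k)` tend to zero takes small values arbitrarily near zero. -/
lemma frequently_le_of_tendsto_average {g : ℝ → ℝ} {P : ℝ → Prop} (hT : 0 < T)
    (hg : Tendsto (fun k => (∫⁻ s in Ioo 0 k, ENNReal.ofReal (g s)) / ENNReal.ofReal k) (𝓝[>] 0)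
      (𝓝 0)) (hP : ∀ᵐ s ∂volume.restrict (Ioo 0 T), P s) {ε : ℝ} (hε : 0 < ε) :
    ∃ᶠ s in 𝓝[>] (0 : ℝ), P s ∧ g s ≤ ε := by
  intro hcon
  obtain ⟨k₀, hk₀, hk⟩ := mem_nhdsGT_iff_exists_Ioo_subset.1 hcon
  have h1 := hg.eventually_lt_const (ENNReal.ofReal_pos.2 hε)
  obtain ⟨k, hk1, hk2⟩ := (h1.and (Ioo_mem_nhdsGT (lt_min hk₀ hT))).exists
  refine hk1.not_ge ?_
  rw [ENNReal.le_div_iff_mul_le (by simp [hk2.1]) (by simp)]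
  calc ENNReal.ofReal ε * ENNReal.ofReal k = ∫⁻ s in Ioo 0 k, ENNReal.ofReal ε := by simp
    _ ≤ _ := by
      refine lintegral_mono_ae ?_
      have hsub : Ioo 0 k ⊆ Ioo 0 T := Ioo_subset_Ioo_right (hk2.2.le.trans (min_le_right _ _))
      filter_upwards [ae_restrict_mem measurableSet_Ioo,
        ae_mono (Measure.restrict_mono hsub le_rfl) hP] with s hs hPs
      refine ENNReal.ofReal_le_ofReal ?_
      have : ¬ (P s ∧ g s ≤ ε) := hk ⟨hs.1, hs.2.trans (hk2.2.trans_le (min_le_left _ _))⟩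
      exact (not_le.1 fun h => this ⟨hPs, h⟩).le

end Time

namespace Interaction

variable {T c ρ δ β κ M : ℝ} {ηx sx : ℕ → ℝ × ℝ → ℝ} {s' : ℝ × ℝ → ℝ}
    {v : Fin 2 → ℝ × ℝ × ℝ → ℝ} {G : Fin 2 → Fin 2 → ℝ × ℝ × ℝ → ℝ} {vt f : Fin 2 → ℝ × ℝ × ℝ → ℝ}
    {σ D : Fin 2 → Fin 2 → ℝ × ℝ × ℝ → ℝ} {S : Fin 2 → Fin 2 → ℝ × ℝ → ℝ}
    {p : ℝ × ℝ × ℝ → ℝ} {Y₀ : ℝ}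

/-- The density of the kinetic energies of the fluid and of the plate. -/
def kineticDensity (ρ κ : ℝ) (ηx sx : ℕ → ℝ × ℝ → ℝ) (v : Fin 2 → ℝ × ℝ × ℝ → ℝ) (y : ℝ × ℝ) : ℝ :=
  column (ηx 0) (FlowField.kinetic v) y + ρ * κ ^ 2 / 2 * sx 0 y ^ 2

lemma kineticDensity_nonneg (hρ : 0 ≤ ρ) (y : ℝ × ℝ) : 0 ≤ kineticDensity ρ κ ηx sx v y :=
  add_nonneg (column_nonneg FlowField.kinetic_nonneg y) (by positivity)

lemma ae_energy_eq (h : Interaction T c ρ δ β κ M ηx sx s' v G vt f σ D S p) :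
    ∀ᵐ t ∂volume.restrict (Ioo 0 T), energy ρ β κ ηx sx v t
      = (∫ x in Ioo (0 : ℝ) 1, kineticDensity ρ κ ηx sx v (x, t))
        + β / 2 * ∫ x in Ioo (0 : ℝ) 1, ηx 2 (x, t) ^ 2 := by
  have c0 := (h.plate.cell_s 0 (by norm_num)).2.integrable_sq
  have c2 := (h.plate.cell_η 2 (by norm_num)).2.integrable_sq
  rw [← plateDomain_eq_slab, xCell_plateDomain, plateCell, Measure.volume_eq_prod,
    ← Measure.prod_restrict] at c0 c2
  have iK := (h.flow.geom.integral_column h.flow.integrable_kinetic).1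
  rw [IntegrableOn, plateCell, Measure.volume_eq_prod, ← Measure.prod_restrict] at iK
  have iKD := iK.fun_add (c0.const_mul (ρ * κ ^ 2 / 2))
  filter_upwards [iKD.prod_left_ae, c2.prod_left_ae] with t h1 h2
  simp only [energy, kineticDensity, plateEnergy, ← add_assoc]
  rw [integral_add h1 (h2.const_mul _), integral_const_mul]

/-- The bending energy is controlled by its initial value and the work of the force, for a motion
that starts from rest. -/
theorem bending_le (h : Interaction T c ρ δ β κ M ηx sx s' v G vt f σ D S p)
    (hρ : 0 ≤ ρ) (hδ : 0 ≤ δ) (hβ : 0 < β) (hκ : 0 < κ)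
    (hrest : Tendsto (fun k => (∫⁻ t in Ioo 0 k, ENNReal.ofReal
      (∫ x in Ioo (0 : ℝ) 1, kineticDensity ρ κ ηx sx v (x, t))) / ENNReal.ofReal k) (𝓝[>] 0) (𝓝 0))
    (hbend : ∃ g : ℝ → ℝ, IntegrableOn g (Ioo 0 T) ∧ ∀ᵐ t ∂volume.restrict (Ioo 0 T),
      ∫ x in Ioo (0 : ℝ) 1, ηx 2 (x, t) ^ 2 ≤ Y₀ + ∫ τ in 0..t, g τ) :
    ∀ᵐ t ∂volume.restrict (Ioo 0 T), ∫ x in Ioo (0 : ℝ) 1, ηx 2 (x, t) ^ 2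
      ≤ Y₀ + 2 * M ^ 2 / (κ * β) * ∫ τ in 0..t, ∫ x in Ioo (0 : ℝ) 1, ηx 0 (x, τ) ^ 3 := by
  have hT := h.flow.geom.time_pos
  obtain ⟨g, hg, hbd⟩ := hbend
  have iE : IntegrableOn (fun t => κ * energy ρ β κ ηx sx v t) (Ioo 0 T) :=
    (integrableOn_integral_slice h.integrableOn_energyDensity).const_mul κ
  have iC : IntegrableOn (fun t => M ^ 2 * ∫ x in Ioo (0 : ℝ) 1, ηx 0 (x, t) ^ 3) (Ioo 0 T) :=
    (integrableOn_integral_slice h.integrableOn_cube).const_mul (M ^ 2)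
  obtain ⟨A, hA, hAa, hle⟩ := exists_le_add_integral_of_weak hT iE iC
    fun θ hθ hθ0 => h.energy_weak hκ.le hδ hθ hθ0
  have hgi : IntervalIntegrable g volume 0 T :=
    (intervalIntegrable_iff_integrableOn_Ioo_of_le hT.le).2 hg
  have hCi : IntervalIntegrable (fun t => M ^ 2 * ∫ x in Ioo (0 : ℝ) 1, ηx 0 (x, t) ^ 3) volume 0 T :=
    (intervalIntegrable_iff_integrableOn_Ioo_of_le hT.le).2 iC
  have lim0 : ∀ {F : ℝ → ℝ}, IntervalIntegrable F volume 0 T →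
      Tendsto (fun s => ∫ τ in 0..s, F τ) (𝓝[>] 0) (𝓝 0) := fun {F} hF => by
    have h1 := (hF.absolutelyContinuousOnInterval_intervalIntegral (c := 0) (by simp)).continuousOn
    rw [uIcc_of_le hT.le] at h1
    have h2 := h1 0 ⟨le_rfl, hT.le⟩
    rw [ContinuousWithinAt, intervalIntegral.integral_same] at h2
    refine h2.mono_left ?_
    rw [← nhdsWithin_Ioo_eq_nhdsGT hT]
    exact nhdsWithin_mono _ Ioo_subset_Icc_self
  filter_upwards [hAa, h.ae_energy_eq, ae_restrict_mem measurableSet_Ioo] with t htA htE htT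
  set Y := ∫ x in Ioo (0 : ℝ) 1, ηx 2 (x, t) ^ 2
  have hkin0 : 0 ≤ ∫ x in Ioo (0 : ℝ) 1, kineticDensity ρ κ ηx sx v (x, t) :=
    integral_nonneg fun x => kineticDensity_nonneg hρ _
  -- let the initial time tend to zero, along times at which the kinetic energy is small
  have key : κ * (β / 2 * Y) ≤ κ * (β / 2 * Y₀)
      + ∫ τ in 0..t, M ^ 2 * ∫ x in Ioo (0 : ℝ) 1, ηx 0 (x, τ) ^ 3 := by
    refine le_of_forall_pos_le_add fun ε hε => ?_
    have hfr := frequently_le_of_tendsto_average hT hrest (hAa.and (hbd.and h.ae_energy_eq))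
      (show 0 < ε / 2 / κ by positivity)
    have hlim : Tendsto (fun s => κ * (β / 2) * (∫ τ in 0..s, g τ)
        - ∫ τ in 0..s, M ^ 2 * ∫ x in Ioo (0 : ℝ) 1, ηx 0 (x, τ) ^ 3) (𝓝[>] 0) (𝓝 0) := by
      simpa using ((lim0 hgi).const_mul (κ * (β / 2))).sub (lim0 hCi)
    obtain ⟨s, ⟨⟨hsA, hsb, hsE⟩, hsk⟩, hsl, hst⟩ := (hfr.and_eventually
      ((hlim.eventually_lt_const (show 0 < ε / 2 by positivity)).and
        (Ioo_mem_nhdsGT htT.1))).exists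
    have h1 := hle s hsA t htA hst.2.le
    have h2 : (∫ τ in s..t, M ^ 2 * ∫ x in Ioo (0 : ℝ) 1, ηx 0 (x, τ) ^ 3)
        = (∫ τ in 0..t, M ^ 2 * ∫ x in Ioo (0 : ℝ) 1, ηx 0 (x, τ) ^ 3)
          - ∫ τ in 0..s, M ^ 2 * ∫ x in Ioo (0 : ℝ) 1, ηx 0 (x, τ) ^ 3 := by
      refine (intervalIntegral.integral_interval_sub_left
        (hCi.mono_set ?_) (hCi.mono_set ?_)).symm
      · rw [uIcc_of_le htT.1.le, uIcc_of_le hT.le]; exact Icc_subset_Icc_right htT.2.le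
      · rw [uIcc_of_le hst.1.le, uIcc_of_le hT.le]
        exact Icc_subset_Icc_right (hst.2.le.trans htT.2.le)
    rw [htE, hsE, h2] at h1
    have h3 : κ * (∫ x in Ioo (0 : ℝ) 1, kineticDensity ρ κ ηx sx v (x, s)) ≤ ε / 2 := by
      rw [mul_comm]; exact (le_div_iff₀ hκ).1 hsk
    have h4 := mul_le_mul_of_nonneg_left hsb (show 0 ≤ κ * (β / 2) by positivity)
    have h5 := mul_nonneg hκ.le hkin0
    linarith
  rw [intervalIntegral.integral_const_mul] at key
  have hp : 0 < κ * β := by positivity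
  rw [div_mul_eq_mul_div, ← sub_le_iff_le_add', le_div_iff₀ hp]
  linarith

/-- The mean displacement is constant in time. -/
theorem ae_integral_eq (h : Interaction T c ρ δ β κ M ηx sx s' v G vt f σ D S p) (hκ : κ ≠ 0) :
    ∀ᵐ t ∂volume.restrict (Ioo 0 T),
      ∫ x in Ioo (0 : ℝ) 1, ηx 0 (x, t) = ∫ x in Ioo (0 : ℝ) 1, ηx 0 (x, 0) := by
  have hg := h.flow.geom
  have hT := hg.time_pos
  have hc := hg.continuous_clampTime
  have hcm : Continuous fun t => ∫ x in Icc (0 : ℝ) 1, clampTime T (ηx 0) (x, t) :=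
    continuous_parametric_integral_of_continuous
      (f := fun t x => clampTime T (ηx 0) (x, t)) (by simp only [Function.uncurry_def]; fun_prop)
      isCompact_Icc
  have hm : ∀ t ∈ Icc 0 T, ∫ x in Icc (0 : ℝ) 1, clampTime T (ηx 0) (x, t)
      = ∫ x in Ioo (0 : ℝ) 1, ηx 0 (x, t) := fun t ht => by
    rw [integral_Icc_eq_integral_Ioc, integral_Ioc_eq_integral_Ioo]
    exact integral_congr_ae (Eventually.of_forall fun x => clampTime_of_mem ht)
  have i1 : IntegrableOn (fun t => ∫ x in Ioo (0 : ℝ) 1, ηx 0 (x, t)) (Ioo 0 T) :=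
    ((hcm.continuousOn.integrableOn_compact (isCompact_Icc (a := 0) (b := T))).congr_fun
      hm measurableSet_Icc).mono_set Ioo_subset_Icc_self
  obtain ⟨A, hA, hAa, hle⟩ := exists_le_add_integral_of_weak hT i1 integrableOn_zero
    fun θ hθ hθ0 => by
      rw [h.volume_weak hκ hθ hθ0]; simp
  obtain ⟨B, hB, hBa, hle'⟩ := exists_le_add_integral_of_weak hT i1.neg integrableOn_zero
    fun θ hθ hθ0 => by
      simp only [Pi.neg_apply, mul_neg, integral_neg, h.volume_weak hκ hθ hθ0]; simp
  simp only [intervalIntegral.integral_zero, Pi.neg_apply, add_zero, neg_le_neg_iff] at hle hle'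
  filter_upwards [hAa, hBa, ae_restrict_mem measurableSet_Ioo] with t htA htB htT
  have hfr : ∃ᶠ s in 𝓝[>] (0 : ℝ), (s ∈ A ∧ s ∈ B) ∧ (0 : ℝ) ≤ 1 :=
    frequently_le_of_tendsto_average (g := fun _ => 0) hT (by simp) (hAa.and hBa) one_pos
  have hlim : Tendsto (fun s => ∫ x in Icc (0 : ℝ) 1, clampTime T (ηx 0) (x, s)) (𝓝[>] 0)
      (𝓝 (∫ x in Ioo (0 : ℝ) 1, ηx 0 (x, 0))) := by
    rw [← hm 0 ⟨le_rfl, hT.le⟩]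
    exact (hcm.tendsto 0).mono_left nhdsWithin_le_nhds
  have hfr2 : ∃ᶠ s in 𝓝[>] (0 : ℝ), ∫ x in Icc (0 : ℝ) 1, clampTime T (ηx 0) (x, s)
      = ∫ x in Ioo (0 : ℝ) 1, ηx 0 (x, t) := by
    refine (hfr.and_eventually (Ioo_mem_nhdsGT htT.1)).mono fun s hs => ?_
    rw [hm s ⟨hs.2.1.le, (hs.2.2.trans htT.2).le⟩]
    exact le_antisymm (hle' s hs.1.1.2 t htB hs.2.2.le) (hle s hs.1.1.1 t htA hs.2.2.le)
  by_contra hne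
  exact hfr2 ((hlim.eventually_ne (Ne.symm hne)).mono fun s hs => hs)

/-- The bound on the bending of the plate, by Gronwall's inequality: the mean displacement `m` is
constant, so that the thickness is bounded by `m` and the bending energy. One power of the thickness
is integrated to `m`, so that the right-hand side is linear in the bending energy. -/
theorem bending_le_exp (h : Interaction T c ρ δ β κ M ηx sx s' v G vt f σ D S p)
    (hρ : 0 ≤ ρ) (hδ : 0 ≤ δ) (hβ : 0 < β) (hκ : 0 < κ)
    (hrest : Tendsto (fun k => (∫⁻ t in Ioo 0 k, ENNReal.ofReal
      (∫ x in Ioo (0 : ℝ) 1, kineticDensity ρ κ ηx sx v (x, t))) / ENNReal.ofReal k) (𝓝[>] 0) (𝓝 0))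
    (hbend : ∃ g : ℝ → ℝ, IntegrableOn g (Ioo 0 T) ∧ ∀ᵐ t ∂volume.restrict (Ioo 0 T),
      ∫ x in Ioo (0 : ℝ) 1, ηx 2 (x, t) ^ 2 ≤ Y₀ + ∫ τ in 0..t, g τ) (hY₀ : 0 ≤ Y₀) {m : ℝ}
    (hm0 : 0 ≤ m) (hm : ∫ x in Ioo (0 : ℝ) 1, ηx 0 (x, 0) = m) :
    ∀ᵐ t ∂volume.restrict (Ioo 0 T), (∫ x in Ioo (0 : ℝ) 1, ηx 2 (x, t) ^ 2) + m ^ 2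
      ≤ (Y₀ + m ^ 2) * Real.exp (4 * M ^ 2 * m / (κ * β) * T) := by
  have hg := h.flow.geom
  have hT := hg.time_pos
  have c2 := (h.plate.cell_η 2 (by norm_num)).2.integrable_sq
  rw [← plateDomain_eq_slab, xCell_plateDomain, plateCell] at c2
  have iY := integrableOn_integral_slice c2
  have i3 := integrableOn_integral_slice h.integrableOn_cube
  have hY0 : ∀ t, 0 ≤ ∫ x in Ioo (0 : ℝ) 1, ηx 2 (x, t) ^ 2 := fun t =>
    integral_nonneg fun x => sq_nonneg _
  have hcube : ∀ᵐ t ∂volume.restrict (Ioo 0 T), ∫ x in Ioo (0 : ℝ) 1, ηx 0 (x, t) ^ 3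
      ≤ 2 * m * ((∫ x in Ioo (0 : ℝ) 1, ηx 2 (x, t) ^ 2) + m ^ 2) := by
    have c0 := h.plate.cell_η 0 (by norm_num)
    filter_upwards [h.plate.ae_bounds hT, h.ae_integral_eq hκ.ne', c0.ae_memLp_slice,
      ae_restrict_mem measurableSet_Ioo] with t hb hvol hs htT
    rw [hvol, hm] at hb
    have hint : IntegrableOn (fun x => ηx 0 (x, t)) (Ioo 0 1) := hs.integrable (by norm_num)
    set Y := ∫ x in Ioo (0 : ℝ) 1, ηx 2 (x, t) ^ 2 with hY
    have hsq : √Y ^ 2 = Y := Real.sq_sqrt (hY0 t)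
    have hpt : ∀ᵐ x ∂volume.restrict (Ioo (0 : ℝ) 1),
        ηx 0 (x, t) ^ 3 ≤ 2 * (Y + m ^ 2) * ηx 0 (x, t) := by
      filter_upwards [hb.2] with x hx
      have h1 : 0 < ηx 0 (x, t) := hg.pos.trans_le (hg.lower _ ⟨trivial, htT⟩)
      have h2 : ηx 0 (x, t) ≤ m + √Y := by linarith [(abs_le.1 hx).2]
      have h3 : ηx 0 (x, t) ^ 2 ≤ 2 * (Y + m ^ 2) := by
        have := pow_le_pow_left₀ h1.le h2 2
        nlinarith [sq_nonneg (m - √Y)]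
      calc ηx 0 (x, t) ^ 3 = ηx 0 (x, t) ^ 2 * ηx 0 (x, t) := by ring
        _ ≤ _ := mul_le_mul_of_nonneg_right h3 h1.le
    refine (integral_mono_of_nonneg (Eventually.of_forall fun x => ?_) (hint.const_mul _) hpt).trans
      ?_
    · exact pow_nonneg (hg.pos.le.trans (hg.lower _ ⟨trivial, htT⟩)) 3
    · rw [integral_const_mul, hvol, hm]
      linarith
  refine gronwall_ae hT (by positivity) (by positivity) (iY.fun_add
    (integrable_const _)) (fun t => add_nonneg (hY0 t) (sq_nonneg m)) ?_
  filter_upwards [h.bending_le hρ hδ hβ hκ hrest hbend, ae_restrict_mem measurableSet_Ioo] with t ht htT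
  have hsub : Ioo 0 t ⊆ Ioo 0 T := Ioo_subset_Ioo_right htT.2.le
  have h1 : ∫ τ in 0..t, ∫ x in Ioo (0 : ℝ) 1, ηx 0 (x, τ) ^ 3
      ≤ ∫ τ in 0..t, 2 * m * ((∫ x in Ioo (0 : ℝ) 1, ηx 2 (x, τ) ^ 2) + m ^ 2) := by
    rw [intervalIntegral.integral_of_le htT.1.le, intervalIntegral.integral_of_le htT.1.le,
      integral_Ioc_eq_integral_Ioo, integral_Ioc_eq_integral_Ioo]
    exact integral_mono_ae (i3.mono_set hsub) (((iY.mono_set hsub).fun_add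
      (integrable_const _)).const_mul _) (ae_mono (Measure.restrict_mono hsub le_rfl) hcube)
  rw [intervalIntegral.integral_const_mul] at h1
  have h2 := mul_le_mul_of_nonneg_left h1 (show 0 ≤ 2 * M ^ 2 / (κ * β) by positivity)
  have e : 4 * M ^ 2 * m / (κ * β) * ∫ τ in 0..t, ((∫ x in Ioo (0 : ℝ) 1, ηx 2 (x, τ) ^ 2) + m ^ 2)
      = 2 * M ^ 2 / (κ * β) * (2 * m * ∫ τ in 0..t,
        ((∫ x in Ioo (0 : ℝ) 1, ηx 2 (x, τ) ^ 2) + m ^ 2)) := by ring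
  rw [e]
  linarith

end Interaction

/-! ### Strong solutions -/

namespace IsStrongSolution

variable {ρ δ β κ T : ℝ} {φ : ℝ → ℝ} {f v : ℝ × ℝ × ℝ → EuclideanSpace ℝ (Fin 2)}
  {p : ℝ × ℝ × ℝ → ℝ} {η : ℝ × ℝ → ℝ}

lemma plateDx_succ (k : ℕ) (u : ℝ × ℝ → ℝ) :
    plateDx T (k + 1) u = weakDeriv (slab 0 T) plateX (plateDx T k u) :=
  Function.iterate_succ_apply' _ _ _

lemma plateDt_succ (k : ℕ) (u : ℝ × ℝ → ℝ) :
    plateDt T (k + 1) u = weakDeriv (slab 0 T) plateT (plateDt T k u) :=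
  Function.iterate_succ_apply' _ _ _

lemma cellL2_weakDeriv {u : ℝ × ℝ → ℝ} {e : ℝ × ℝ}
    (h : HasL2WeakDeriv (plateDomain T) (plateCell T) e u) (hu : AEPeriodic (slab 0 T) u) :
    CellL2 (slab 0 T) (weakDeriv (slab 0 T) e u) := by
  rw [← xCell_plateDomain] at h
  exact h.cellL2 isOpen_slab isXPeriodic_slab hu

lemma cellL2_displacement (h : IsStrongSolution ρ δ β κ T φ f v p η) : CellL2 (slab 0 T) η := by
  refine ⟨Eventually.of_forall fun q => ?_, memLp_xCell_slab h.displacement_memL2⟩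
  have e : q + (1, 0) = (q.1 + 1, q.2) := by ext <;> simp
  rw [e, h.displacement_periodic]

lemma cellL2_plateDx (h : IsStrongSolution ρ δ β κ T φ f v p η) {k : ℕ} (hk : k ≤ 4) :
    CellL2 (slab 0 T) (plateDx T k η) := by
  induction k with
  | zero => exact h.cellL2_displacement
  | succ k ih =>
    rw [plateDx_succ]
    exact cellL2_weakDeriv (h.displacement_dx k (by omega)) (ih (by omega)).1

lemma cellL2_plateDt (h : IsStrongSolution ρ δ β κ T φ f v p η) {k : ℕ} (hk : k ≤ 2) :
    CellL2 (slab 0 T) (plateDt T k η) := by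
  induction k with
  | zero => exact h.cellL2_displacement
  | succ k ih =>
    rw [plateDt_succ]
    exact cellL2_weakDeriv (h.displacement_dt k (by omega)) (ih (by omega)).1

lemma cellL2_plateDx_plateDt (h : IsStrongSolution ρ δ β κ T φ f v p η) {k : ℕ} (hk : k ≤ 2) :
    CellL2 (slab 0 T) (plateDx T k (plateDt T 1 η)) := by
  induction k with
  | zero => exact h.cellL2_plateDt (by norm_num)
  | succ k ih =>
    rw [plateDx_succ]
    exact cellL2_weakDeriv (h.displacement_dtx k (by omega)) (ih (by omega)).1

lemma plateField (h : IsStrongSolution ρ δ β κ T φ f v p η) :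
    PlateField 0 T (fun k => plateDx T k η) (fun k => plateDx T k (plateDt T 1 η))
      (plateDt T 2 η) where
  cell_η k hk := h.cellL2_plateDx hk
  cell_s k hk := h.cellL2_plateDx_plateDt hk
  cell_s' := h.cellL2_plateDt le_rfl
  deriv_η k hk := by
    simp only [plateDx_succ]; exact (h.displacement_dx k hk).hasWeakDeriv
  deriv_s k hk := by
    simp only [plateDx_succ]; exact (h.displacement_dtx k hk).hasWeakDeriv
  deriv_t := (h.displacement_dt 0 (by norm_num)).hasWeakDeriv
  deriv_tt := (h.displacement_dt 1 (by norm_num)).hasWeakDeriv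

lemma hasWeakDeriv_weakDerivX {m : ℕ} (hφ : MemHSharp m φ) {k : ℕ} (hk : k < m) :
    HasWeakDeriv univ (1 : ℝ) (weakDerivX k φ) (weakDerivX (k + 1) φ) := by
  have : weakDerivX (k + 1) φ = weakDeriv univ 1 (weakDerivX k φ) :=
    Function.iterate_succ_apply' _ _ _
  rw [this]
  exact hasWeakDeriv_weakDeriv (hφ.2.2 k hk).1

lemma memLp_weakDerivX {m : ℕ} (hφ : MemHSharp m φ) {k : ℕ} (hk : k ≤ m) :
    MemLp (weakDerivX k φ) 2 (volume.restrict (Ioo 0 1)) := by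
  rcases k with _ | k
  · exact hφ.2.1
  · have : weakDerivX (k + 1) φ = weakDeriv univ 1 (weakDerivX k φ) :=
      Function.iterate_succ_apply' _ _ _
    rw [this]
    exact (hφ.2.2 k hk).2

lemma ae_periodic_weakDerivX {m : ℕ} (hφ : MemHSharp m φ) {k : ℕ} (hk : k ≤ m) :
    ∀ᵐ x, weakDerivX k φ (x + 1) = weakDerivX k φ x := by
  induction k with
  | zero => exact Eventually.of_forall hφ.1
  | succ k ih =>
    have h := hasWeakDeriv_weakDerivX hφ hk
    have := ((h.comp_add_right isOpen_univ 1 (by simp)).congr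
      (by simpa using ih (by omega)) (Eventually.of_forall fun _ => rfl)).unique isOpen_univ h
    simpa using this

lemma exists_bending_le (h : IsStrongSolution ρ δ β κ T φ f v p η) (hT : 0 < T)
    (hφ : MemHSharp 2 φ) :
    ∃ g : ℝ → ℝ, IntegrableOn g (Ioo 0 T) ∧ ∀ᵐ t ∂volume.restrict (Ioo 0 T),
      ∫ x in Ioo (0 : ℝ) 1, plateDx T 2 η (x, t) ^ 2
        ≤ (∫ x in Ioo (0 : ℝ) 1, weakDerivX 2 φ x ^ 2) + ∫ τ in 0..t, g τ :=
  h.plateField.exists_bending_le hT h.displacement_continuous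
    (φ := fun k => weakDerivX k φ) h.initial_displacement
    (fun _ hk => hasWeakDeriv_weakDerivX hφ hk) (fun _ hk => ae_periodic_weakDerivX hφ hk)
    fun _ hk => memLp_weakDerivX hφ hk

/-- The slope of a strong solution is bounded, since its bending energy is. -/
lemma exists_geometry (h : IsStrongSolution ρ δ β κ T φ f v p η) (hT : 0 < T)
    (hφ : MemHSharp 2 φ) :
    ∃ c, FluidGeometry T c η (plateDx T 1 η) (plateDt T 1 η) := by
  obtain ⟨c, hc0, hc⟩ := h.displacement_lower
  obtain ⟨g, hg, hb⟩ := h.exists_bending_le hT hφ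
  refine ⟨c, hT, h.displacement_continuous, h.displacement_periodic, hc0, hc,
    h.plateField.deriv_η 0 (by norm_num), h.plateField.deriv_t,
    h.plateField.exists_slope_le hT (L := (∫ x in Ioo (0 : ℝ) 1, weakDerivX 2 φ x ^ 2)
      + ∫ τ in 0..T, |g τ|) ?_, (h.cellL2_plateDt (k := 1) (by norm_num)).2⟩
  have hgi : IntervalIntegrable g volume 0 T :=
    (intervalIntegrable_iff_integrableOn_Ioo_of_le hT.le).2 hg
  filter_upwards [hb, ae_restrict_mem measurableSet_Ioo] with t ht htT
  refine ht.trans (add_le_add_right ?_ _)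
  have hsub : uIcc 0 t ⊆ uIcc 0 T := by
    rw [uIcc_of_le htT.1.le, uIcc_of_le hT.le]; exact Icc_subset_Icc_right htT.2.le
  refine (le_abs_self _).trans ((intervalIntegral.abs_integral_le_integral_abs htT.1.le).trans ?_)
  exact intervalIntegral.integral_mono_interval le_rfl htT.1.le htT.2.le
    (Eventually.of_forall fun _ => abs_nonneg _) hgi.abs

section Fluid

variable {c : ℝ}

lemma cellL2_weakDeriv_fluid (hg : FluidGeometry T c η (plateDx T 1 η) (plateDt T 1 η))
    {u : ℝ × ℝ × ℝ → ℝ} {e : ℝ × ℝ × ℝ}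
    (h : HasL2WeakDeriv (fluidDomain T η) (fluidCell T η) e u)
    (hu : AEPeriodic (fluidDomain T η) u) :
    CellL2 (fluidDomain T η) (weakDeriv (fluidDomain T η) e u) := by
  rw [← FluidGeometry.xCell_eq] at h
  exact h.cellL2 hg.isOpen hg.isXPeriodic hu

lemma aePeriodic_velocity (h : IsStrongSolution ρ δ β κ T φ f v p η) (i : Fin 2) :
    AEPeriodic (fluidDomain T η) (fun q => v q i) :=
  Eventually.of_forall fun q => by
    have e : q + (1, 0) = (q.1 + 1, q.2.1, q.2.2) := by ext <;> simp
    simp only [e, h.velocity_periodic]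

lemma flowField (h : IsStrongSolution ρ δ β κ T φ f v p η)
    (hg : FluidGeometry T c η (plateDx T 1 η) (plateDt T 1 η)) :
    FlowField T c κ η (plateDx T 1 η) (plateDt T 1 η) (fun i q => v q i)
      (fun i j q => velGrad T η v q i j)
      (fun i => weakDeriv (fluidDomain T η) fluidT fun q => v q i) where
  geom := hg
  cell_v i := ⟨h.aePeriodic_velocity i, by
    rw [FluidGeometry.xCell_eq]; exact h.velocity_memL2 i⟩
  cell_G i j := cellL2_weakDeriv_fluid hg (h.velocity_dx i j) (h.aePeriodic_velocity i)
  cell_vt i := cellL2_weakDeriv_fluid hg (h.velocity_dt i) (h.aePeriodic_velocity i)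
  grad i j := (h.velocity_dx i j).hasWeakDeriv
  grad_t i := (h.velocity_dt i).hasWeakDeriv
  div_free := by
    rw [FluidGeometry.xCell_eq]
    filter_upwards [h.divergence_free] with q hq
    simpa [Fin.sum_univ_two] using hq
  top_horizontal := h.kinematic_horizontal
  top_vertical := h.kinematic_vertical
  bottom i := h.no_slip i

lemma stress_apply (i j : Fin 2) (q : ℝ × ℝ × ℝ) : stress T η v p q i j
    = velGrad T η v q i j + velGrad T η v q j i - if i = j then p q else 0 := by
  simp only [stress, symGrad, Matrix.sub_apply, Matrix.smul_apply, Matrix.add_apply,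
    Matrix.transpose_apply, smul_eq_mul, Matrix.one_apply]
  split_ifs <;> ring

lemma cellL2_pressure (h : IsStrongSolution ρ δ β κ T φ f v p η) : CellL2 (fluidDomain T η) p := by
  refine ⟨Eventually.of_forall fun q => ?_, by
    rw [FluidGeometry.xCell_eq]; exact h.pressure_memL2⟩
  have := h.pressure_periodic q.1 q.2.1 q.2.2
  have e : q + (1, 0) = (q.1 + 1, q.2.1, q.2.2) := by ext <;> simp
  rw [e, this]

/-- The stress tensor is square integrable, with its derivatives. -/
lemma exists_deriv_stress (h : IsStrongSolution ρ δ β κ T φ f v p η)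
    (hg : FluidGeometry T c η (plateDx T 1 η) (plateDt T 1 η)) (i j k : Fin 2) :
    CellL2 (fluidDomain T η) (fun q => stress T η v p q i j) ∧
    HasWeakDeriv (fluidDomain T η) (fluidDir k) (fun q => stress T η v p q i j)
      (weakDeriv (fluidDomain T η) (fluidDir k) fun q => stress T η v p q i j) ∧
    CellL2 (fluidDomain T η)
      (weakDeriv (fluidDomain T η) (fluidDir k) fun q => stress T η v p q i j) := by
  have hf := h.flowField hg
  have cp := h.cellL2_pressure
  have dG := fun i j => (h.velocity_dxx i j k).hasWeakDeriv
  have cG := fun i j => cellL2_weakDeriv_fluid hg (h.velocity_dxx i j k) (hf.cell_G i j).1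
  have dp := (h.pressure_dx k).hasWeakDeriv
  have cdp := cellL2_weakDeriv_fluid hg (h.pressure_dx k) cp.1
  obtain ⟨P, P', hP, hP', hPP, hPe⟩ : ∃ P P', CellL2 (fluidDomain T η) P ∧
      CellL2 (fluidDomain T η) P' ∧ HasWeakDeriv (fluidDomain T η) (fluidDir k) P P' ∧
      ∀ q, P q = if i = j then p q else 0 := by
    by_cases hij : i = j
    · exact ⟨p, _, cp, cdp, dp, fun q => by simp [hij]⟩
    · exact ⟨fun _ => 0, fun _ => 0, ⟨Eventually.of_forall fun _ => rfl, MemLp.zero'⟩,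
        ⟨Eventually.of_forall fun _ => rfl, MemLp.zero'⟩, FluidGeometry.hasWeakDeriv_one _ _,
        fun q => by simp [hij]⟩
  have es : (fun q => stress T η v p q i j)
      = fun q => velGrad T η v q i j + velGrad T η v q j i - P q := funext fun q => by
    rw [stress_apply, hPe]
  have c1 : CellL2 (fluidDomain T η) (fun q => stress T η v p q i j) := by
    rw [es]
    refine ⟨?_, ((hf.cell_G i j).2.add (hf.cell_G j i).2).sub hP.2⟩
    filter_upwards [(hf.cell_G i j).1, (hf.cell_G j i).1, hP.1] with q h1 h2 h3
    rw [h1, h2, h3]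
  have d := ((dG i j).add (dG j i)).sub hPP
  rw [← es] at d
  have d' := hasWeakDeriv_weakDeriv ⟨_, d⟩
  refine ⟨c1, d', d'.aePeriodic hg.isOpen hg.isXPeriodic c1.1, ?_⟩
  refine (((cG i j).2.add (cG j i).2).sub hP'.2).ae_eq ?_
  have := d.weakDeriv_ae hg.isOpen
  filter_upwards [ae_mono (Measure.restrict_mono inter_subset_left le_rfl) this] with q hq
  exact hq.symm

/-- A strong solution with a bounded force. -/
lemma exists_interaction (h : IsStrongSolution ρ δ β κ T φ f v p η)
    (hg : FluidGeometry T c η (plateDx T 1 η) (plateDt T 1 η)) {M : ℝ} (hM : 0 ≤ M)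
    (hfm : AEStronglyMeasurable f (volume.restrict (fluidCell T η)))
    (hfM : eLpNorm f ⊤ (volume.restrict (fluidCell T η)) ≤ ENNReal.ofReal M) :
    ∃ S, Interaction T c ρ δ β κ M (fun k => plateDx T k η)
      (fun k => plateDx T k (plateDt T 1 η)) (plateDt T 2 η) (fun i q => v q i)
      (fun i j q => velGrad T η v q i j)
      (fun i => weakDeriv (fluidDomain T η) fluidT fun q => v q i) (fun i q => f q i)
      (fun i j q => stress T η v p q i j)
      (fun i j => weakDeriv (fluidDomain T η) (fluidDir j) fun q => stress T η v p q i j) S p := by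
  obtain ⟨S, hS, hpl⟩ := h.plate
  have hf := h.flowField hg
  have hfin := hg.isFiniteMeasure
  rw [FluidGeometry.xCell_eq] at hfin
  rw [eLpNorm_exponent_top] at hfM
  have hfle : ∀ᵐ q ∂volume.restrict (fluidCell T η), ‖f q‖ ≤ M := by
    have := ae_le_eLpNormEssSup (f := f) (μ := volume.restrict (fluidCell T η))
    filter_upwards [this] with q hq
    have h1 := hq.trans hfM
    rw [← ofReal_norm] at h1
    exact (ENNReal.ofReal_le_ofReal_iff hM).1 h1
  refine ⟨fun i j y => S y i j, ?_⟩
  refine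
    { plate := h.plateField
      flow := hf
      second := ⟨weakDeriv (fluidDomain T η) (fluidDir 1) fun q => velGrad T η v q 1 0,
        weakDeriv (fluidDomain T η) (fluidDir 1) fun q => velGrad T η v q 1 1,
        cellL2_weakDeriv_fluid hg (h.velocity_dxx 1 0 1) (hf.cell_G 1 0).1,
        cellL2_weakDeriv_fluid hg (h.velocity_dxx 1 1 1) (hf.cell_G 1 1).1,
        (h.velocity_dxx 1 0 1).hasWeakDeriv,
        (hf.grad 1 1).comm (hf.grad 1 0) (h.velocity_dxx 1 0 1).hasWeakDeriv,
        (h.velocity_dxx 1 1 1).hasWeakDeriv⟩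
      cell_σ := fun i j => (h.exists_deriv_stress hg i j 0).1
      cell_D := fun i j => (h.exists_deriv_stress hg i j j).2.2
      deriv_σ := fun i j => (h.exists_deriv_stress hg i j j).2.1
      trace_σ := hS
      stress_eq := Eventually.of_forall fun q i j => stress_apply i j q
      memLp_f := fun i => ?_
      force_le := ?_
      momentum := ?_
      plate_eq := ?_ }
  · rw [FluidGeometry.xCell_eq]
    have hf2 : MemLp f 2 (volume.restrict (fluidCell T η)) := MemLp.of_bound hfm M hfle
    exact (EuclideanSpace.proj (𝕜 := ℝ) i).comp_memLp' hf2
  · rw [FluidGeometry.xCell_eq]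
    filter_upwards [hfle] with q hq
    have := pow_le_pow_left₀ (norm_nonneg _) hq 2
    rwa [EuclideanSpace.real_norm_sq_eq, Fin.sum_univ_two] at this
  · rw [FluidGeometry.xCell_eq]
    filter_upwards [h.momentum] with q hq i
    have := hq i
    simp only [Fin.sum_univ_two] at this
    simp only [FlowField.acceleration]
    linarith
  · filter_upwards [hpl] with y hy
    have e : plateDx T 2 (plateDt T 1 η) y = (fun k => plateDx T k (plateDt T 1 η)) 2 y := rfl
    rw [hy, outerNormal]
    have hJ : 0 < surfaceJacobian T η y := Real.sqrt_pos.2 (by positivity)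
    simp only [Matrix.mulVec, dotProduct, Fin.sum_univ_two, Matrix.cons_val_zero,
      Matrix.cons_val_one]
    field_simp
    ring

end Fluid

end IsStrongSolution

/-! ### Initial conditions and norms -/

/-- The integral of a nonnegative function over part of a set, as an integral with a weight. -/
lemma ofReal_integral_indicator_mul {α : Type*} [MeasurableSpace α] {μ : Measure α} {A B : Set α}
    (hB : MeasurableSet B) {H : α → ℝ} (hH : IntegrableOn H A μ) (h0 : ∀ x, 0 ≤ H x) :
    IntegrableOn (fun x => B.indicator 1 x * H x) A μ ∧
    ENNReal.ofReal (∫ x in A, B.indicator 1 x * H x ∂μ) = ∫⁻ x in A ∩ B, ENNReal.ofReal (H x) ∂μ := by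
  have e : (fun x => B.indicator 1 x * H x) = B.indicator H := by
    funext x
    by_cases hx : x ∈ B <;> simp [hx]
  rw [e, setIntegral_indicator hB,
    ofReal_integral_eq_lintegral_ofReal (hH.mono_set inter_subset_left) (Eventually.of_forall h0)]
  exact ⟨hH.indicator hB, rfl⟩

namespace Interaction

variable {T c ρ δ β κ M : ℝ} {ηx sx : ℕ → ℝ × ℝ → ℝ} {s' : ℝ × ℝ → ℝ}
    {v : Fin 2 → ℝ × ℝ × ℝ → ℝ} {G : Fin 2 → Fin 2 → ℝ × ℝ × ℝ → ℝ} {vt f : Fin 2 → ℝ × ℝ × ℝ → ℝ}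
    {σ D : Fin 2 → Fin 2 → ℝ × ℝ × ℝ → ℝ} {S : Fin 2 → Fin 2 → ℝ × ℝ → ℝ}
    {p : ℝ × ℝ × ℝ → ℝ}

/-- The time averages of the kinetic energy tend to zero, for a motion that starts from rest. -/
theorem tendsto_kinetic (h : Interaction T c ρ δ β κ M ηx sx s' v G vt f σ D S p) (hρ : 0 ≤ ρ)
    (hs : Tendsto (fun k : ℝ => (∫⁻ y in plateCell T ∩ {y | y.2 < k}, ‖sx 0 y‖ₑ ^ 2)
      / ENNReal.ofReal k) (𝓝[>] 0) (𝓝 0))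
    (hv : Tendsto (fun k : ℝ => (∫⁻ q in xCell (fluidDomain T (ηx 0)) 0 ∩ {q | q.2.2 < k},
      ENNReal.ofReal (FlowField.kinetic v q)) / ENNReal.ofReal k) (𝓝[>] 0) (𝓝 0)) :
    Tendsto (fun k => (∫⁻ t in Ioo 0 k, ENNReal.ofReal
      (∫ x in Ioo (0 : ℝ) 1, kineticDensity ρ κ ηx sx v (x, t))) / ENNReal.ofReal k)
      (𝓝[>] 0) (𝓝 0) := by
  have hg := h.flow.geom
  have iK := h.flow.integrable_kinetic
  have iS := (h.plate.cell_s 0 (by norm_num)).2.integrable_sq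
  rw [← plateDomain_eq_slab, xCell_plateDomain] at iS
  have iD : IntegrableOn (kineticDensity ρ κ ηx sx v) (plateCell T) :=
    (hg.integral_column iK).1.add (iS.const_mul (ρ * κ ^ 2 / 2))
  have iY := integrableOn_integral_slice iD
  have hlim := hv.add (ENNReal.Tendsto.const_mul (a := ENNReal.ofReal (ρ * κ ^ 2 / 2)) hs
    (Or.inr (by simp)))
  rw [mul_zero, add_zero] at hlim
  refine hlim.congr' ?_
  filter_upwards [Ioo_mem_nhdsGT hg.time_pos] with k hk
  -- all the integrals up to the time `k` are integrals with the weight `χ`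
  set χ : ℝ → ℝ := (Iio k).indicator 1 with hχ
  have m1 : MeasurableSet {y : ℝ × ℝ | y.2 < k} := measurable_snd measurableSet_Iio
  have m2 : MeasurableSet {q : ℝ × ℝ × ℝ | q.2.2 < k} :=
    (measurable_snd.comp measurable_snd) measurableSet_Iio
  have e1 : ∀ y : ℝ × ℝ, {y : ℝ × ℝ | y.2 < k}.indicator (1 : ℝ × ℝ → ℝ) y = χ y.2 := fun y => rfl
  have e2 : ∀ q : ℝ × ℝ × ℝ,
      {q : ℝ × ℝ × ℝ | q.2.2 < k}.indicator (1 : ℝ × ℝ × ℝ → ℝ) q = χ q.2.2 := fun q => rfl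
  obtain ⟨jK, eK⟩ := ofReal_integral_indicator_mul m2 iK FlowField.kinetic_nonneg
  obtain ⟨jS, eS⟩ := ofReal_integral_indicator_mul m1 iS fun y => sq_nonneg (sx 0 y)
  obtain ⟨jD, -⟩ := ofReal_integral_indicator_mul m1 iD fun y => kineticDensity_nonneg hρ y
  obtain ⟨-, eY⟩ := ofReal_integral_indicator_mul (B := Iio k) measurableSet_Iio iY fun t =>
    integral_nonneg fun x => kineticDensity_nonneg hρ (x, t)
  simp only [e1, e2] at jK eK jS eS jD
  obtain ⟨jC, eC⟩ := hg.integral_column jK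
  rw [column_time_mul] at jC eC
  have eD := integral_cell_mul_time jD
  have hI : Ioo 0 T ∩ Iio k = Ioo 0 k := by
    ext t; simp only [mem_inter_iff, mem_Ioo, mem_Iio]
    exact ⟨fun h => ⟨h.1.1, h.2⟩, fun h => ⟨⟨h.1, h.2.trans hk.2⟩, h.2⟩⟩
  rw [hI, ← eD] at eY
  have hsum : ∫ y in Ioo 0 1 ×ˢ Ioo 0 T, χ y.2 * kineticDensity ρ κ ηx sx v y
      = (∫ q in xCell (fluidDomain T (ηx 0)) 0, χ q.2.2 * FlowField.kinetic v q)
        + ρ * κ ^ 2 / 2 * ∫ y in plateCell T, χ y.2 * sx 0 y ^ 2 := by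
    rw [eC, ← integral_const_mul, ← integral_add jC (jS.const_mul _)]
    refine integral_congr_ae (Eventually.of_forall fun y => ?_)
    simp only [kineticDensity]; ring
  have hS : ∫⁻ y in plateCell T ∩ {y | y.2 < k}, ENNReal.ofReal (sx 0 y ^ 2)
      = ∫⁻ y in plateCell T ∩ {y | y.2 < k}, ‖sx 0 y‖ₑ ^ 2 := lintegral_congr fun y => by
    rw [← sq_abs, ENNReal.ofReal_pow (abs_nonneg _), Real.enorm_eq_ofReal_abs]
  have hχ0 : ∀ t, 0 ≤ χ t := fun t => indicator_nonneg (fun _ _ => zero_le_one) t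
  rw [← eY, hsum, ENNReal.ofReal_add
    (integral_nonneg fun q => mul_nonneg (hχ0 _) (FlowField.kinetic_nonneg q))
    (mul_nonneg (by positivity) (integral_nonneg fun y => mul_nonneg (hχ0 _) (sq_nonneg _))),
    ENNReal.ofReal_mul (by positivity), eK, eS, hS, ENNReal.add_div, mul_div_assoc (ENNReal.ofReal _)]

end Interaction

/-- A criterion for `H^m_#`, which determines the weak derivatives. -/
lemma memHSharp_of_hasWeakDeriv {m : ℕ} {u : ℝ → ℝ} {w : ℕ → ℝ → ℝ} (h0 : w 0 = u)
    (hp : Function.Periodic u 1) (hw : ∀ k < m, HasWeakDeriv univ (1 : ℝ) (w k) (w (k + 1)))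
    (h2 : ∀ k ≤ m, MemLp (w k) 2 (volume.restrict (Ioo 0 1))) :
    MemHSharp m u ∧ ∀ k ≤ m, ∀ᵐ x, weakDerivX k u x = w k x := by
  have hs : ∀ k, weakDerivX (k + 1) u = weakDeriv univ 1 (weakDerivX k u) := fun k =>
    Function.iterate_succ_apply' _ _ _
  have hae : ∀ k ≤ m, ∀ᵐ x, weakDerivX k u x = w k x := fun k hk => by
    induction k with
    | zero => exact Eventually.of_forall fun x => by rw [h0]; rfl
    | succ k ih =>
      have := ((hw k hk).congr (v := weakDerivX k u)
        (by simpa using (ih (by omega)).mono fun x hx => hx.symm)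
        (Eventually.of_forall fun _ => rfl)).weakDeriv_ae isOpen_univ
      rw [hs]
      simpa using this
  refine ⟨⟨hp, h0 ▸ h2 0 (by omega), fun k hk => ⟨⟨w (k + 1), (hw k hk).congr
    (by simpa using (hae k hk.le).mono fun x hx => hx.symm)
    (Eventually.of_forall fun _ => rfl)⟩, ?_⟩⟩, hae⟩
  rw [← hs]
  exact (h2 (k + 1) hk).ae_eq (ae_restrict_of_ae ((hae (k + 1) hk).mono fun x hx => hx.symm))

lemma MemHSharp.const_mul {m : ℕ} {u : ℝ → ℝ} (h : MemHSharp m u) (a : ℝ) :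
    MemHSharp m (fun x => a * u x) ∧
      ∀ k ≤ m, ∀ᵐ x, weakDerivX k (fun x => a * u x) x = a * weakDerivX k u x :=
  memHSharp_of_hasWeakDeriv (w := fun k x => a * weakDerivX k u x) rfl
    (fun x => by simp only [h.1 x])
    (fun _ hk => (IsStrongSolution.hasWeakDeriv_weakDerivX h hk).const_mul a)
    fun _ hk => (IsStrongSolution.memLp_weakDerivX h hk).const_mul a

lemma MemHSharp.mono {m n : ℕ} {u : ℝ → ℝ} (h : MemHSharp n u) (hmn : m ≤ n) : MemHSharp m u :=
  ⟨h.1, h.2.1, fun k hk => h.2.2 k (hk.trans_le hmn)⟩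

namespace IsStrongSolution

variable {ρ δ β κ T : ℝ} {φ : ℝ → ℝ} {f v : ℝ × ℝ × ℝ → EuclideanSpace ℝ (Fin 2)}
  {p : ℝ × ℝ × ℝ → ℝ} {η : ℝ × ℝ → ℝ}

lemma tendsto_kinetic_velocity (h : IsStrongSolution ρ δ β κ T φ f v p η) :
    Tendsto (fun k : ℝ => (∫⁻ q in xCell (fluidDomain T η) 0 ∩ {q | q.2.2 < k},
      ENNReal.ofReal (FlowField.kinetic (fun i q => v q i) q)) / ENNReal.ofReal k)
      (𝓝[>] 0) (𝓝 0) := by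
  have := ENNReal.Tendsto.const_mul (a := ENNReal.ofReal (1 / 2)) h.initial_velocity
    (Or.inr (by simp))
  rw [mul_zero] at this
  refine this.congr fun k => ?_
  rw [← mul_div_assoc, ← lintegral_const_mul' _ _ (by simp), FluidGeometry.xCell_eq]
  congr 1
  refine lintegral_congr fun q => ?_
  rw [← ofReal_norm, ← ENNReal.ofReal_pow (norm_nonneg _), ← ENNReal.ofReal_mul (by norm_num),
    EuclideanSpace.real_norm_sq_eq, Fin.sum_univ_two, FlowField.kinetic]
  ring_nf

/-- The norm of the displacement in terms of its second derivative and its mean value `m`. -/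
lemma linftyHSharpNorm_le (h : IsStrongSolution ρ δ β κ T φ f v p η) (hT : 0 < T) {m B C : ℝ}
    (hm : ∀ᵐ t ∂volume.restrict (Ioo 0 T), ∫ x in Ioo (0 : ℝ) 1, η (x, t) = m)
    (hB : ∀ᵐ t ∂volume.restrict (Ioo 0 T),
      (∫ x in Ioo (0 : ℝ) 1, plateDx T 2 η (x, t) ^ 2) + m ^ 2 ≤ B)
    (hC : 0 ≤ C) (hBC : 4 * B ≤ C ^ 2) : linftyHSharpNorm 2 T η ≤ ENNReal.ofReal C := by
  have hp := h.plateField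
  refine essSup_le_of_ae_le _ ?_
  have hsl : ∀ k ≤ 2, ∀ᵐ t ∂volume.restrict (Ioo 0 T),
      MemLp (fun x => plateDx T k η (x, t)) 2 (volume.restrict (Ioo 0 1)) := fun k hk =>
    (hp.cell_η k (by omega)).ae_memLp_slice
  filter_upwards [hm, hB, hsl 0 (by norm_num), hsl 1 (by norm_num), hsl 2 (by norm_num),
    (hp.deriv_η 0 (by norm_num)).ae_slice, (hp.deriv_η 1 (by norm_num)).ae_slice,
    hp.ae_bounds hT] with t hm hB s0 s1 s2 d0 d1 hb
  obtain ⟨hmem, hae⟩ := memHSharp_of_hasWeakDeriv (m := 2) (u := fun x => η (x, t))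
    (w := fun k x => plateDx T k η (x, t)) rfl (fun x => h.displacement_periodic x t)
    (fun k hk => by interval_cases k; exacts [d0, d1])
    (fun k hk => by interval_cases k; exacts [s0, s1, s2])
  set Y := ∫ x in Ioo (0 : ℝ) 1, plateDx T 2 η (x, t) ^ 2 with hY
  have hY0 : 0 ≤ Y := integral_nonneg fun x => sq_nonneg _
  have e : ∀ k ≤ 2, ∫⁻ x in Ioo (0 : ℝ) 1, ‖weakDerivX k (fun x => η (x, t)) x‖ₑ ^ 2
      = ∫⁻ x in Ioo (0 : ℝ) 1, ENNReal.ofReal (plateDx T k η (x, t) ^ 2) := fun k hk => by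
    refine lintegral_congr_ae (ae_restrict_of_ae ((hae k hk).mono fun x hx => ?_))
    simp only [hx]
    rw [Real.enorm_eq_ofReal_abs, ← ENNReal.ofReal_pow (abs_nonneg _), sq_abs]
  have hle : ∀ {F : ℝ → ℝ} {K : ℝ}, (∀ᵐ x ∂volume.restrict (Ioo (0 : ℝ) 1), F x ≤ K) →
      ∫⁻ x in Ioo (0 : ℝ) 1, ENNReal.ofReal (F x) ≤ ENNReal.ofReal K := fun {F K} hF => by
    refine (lintegral_mono_ae (hF.mono fun x hx => ENNReal.ofReal_le_ofReal hx)).trans ?_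
    simp
  have l0 : ∫⁻ x in Ioo (0 : ℝ) 1, ENNReal.ofReal (plateDx T 0 η (x, t) ^ 2)
      ≤ ENNReal.ofReal (2 * (Y + m ^ 2)) := by
    refine hle (hb.2.mono fun x hx => ?_)
    change |plateDx T 0 η (x, t) - ∫ s in Ioo (0 : ℝ) 1, η (s, t)| ≤ √Y at hx
    rw [hm] at hx
    have h1 := pow_le_pow_left₀ (abs_nonneg _) hx 2
    rw [sq_abs, Real.sq_sqrt hY0] at h1
    nlinarith [sq_nonneg (plateDx T 0 η (x, t) - 2 * m)]
  have l1 : ∫⁻ x in Ioo (0 : ℝ) 1, ENNReal.ofReal (plateDx T 1 η (x, t) ^ 2)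
      ≤ ENNReal.ofReal Y := by
    refine hle (hb.1.mono fun x hx => ?_)
    have h1 := pow_le_pow_left₀ (abs_nonneg _) hx 2
    rwa [sq_abs, Real.sq_sqrt hY0] at h1
  have l2 : ∫⁻ x in Ioo (0 : ℝ) 1, ENNReal.ofReal (plateDx T 2 η (x, t) ^ 2)
      = ENNReal.ofReal Y :=
    (ofReal_integral_eq_lintegral_ofReal s2.integrable_sq
      (Eventually.of_forall fun x => sq_nonneg _)).symm
  have hsum : ∑ k ∈ Finset.range (2 + 1),
      ∫⁻ x in Ioo (0 : ℝ) 1, ‖weakDerivX k (fun x => η (x, t)) x‖ₑ ^ 2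
      ≤ ENNReal.ofReal C ^ (2 : ℝ) := by
    rw [Finset.sum_range_succ, Finset.sum_range_succ, Finset.sum_range_one, e 0 (by norm_num),
      e 1 (by norm_num), e 2 le_rfl, l2, ENNReal.rpow_two, ← ENNReal.ofReal_pow hC]
    refine (add_le_add (add_le_add l0 l1) le_rfl).trans ?_
    rw [← ENNReal.ofReal_add (by positivity) hY0, ← ENNReal.ofReal_add (by positivity) hY0]
    refine ENNReal.ofReal_le_ofReal ?_
    nlinarith [sq_nonneg m]
  rw [hSharpNorm, if_pos hmem]
  calc _ ≤ (ENNReal.ofReal C ^ (2 : ℝ)) ^ (1 / 2 : ℝ) := ENNReal.rpow_le_rpow hsum (by norm_num)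
    _ = ENNReal.ofReal C := by rw [← ENNReal.rpow_mul]; norm_num

/-- The bound on the displacement in terms of the initial displacement `φ` and the coefficients. -/
theorem displacement_le (h : IsStrongSolution ρ δ β κ T φ f v p η) (hT : 0 < T) (hρ : 0 ≤ ρ)
    (hδ : 0 ≤ δ) (hβ : 0 < β) (hκ : 0 < κ) {M C : ℝ} (hM : 0 ≤ M) (hφ : MemHSharp 2 φ)
    (hφ0 : ∀ x, 0 ≤ φ x)
    (hfm : AEStronglyMeasurable f (volume.restrict (fluidCell T η)))
    (hfM : eLpNorm f ⊤ (volume.restrict (fluidCell T η)) ≤ ENNReal.ofReal M) (hC : 0 ≤ C)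
    (hBC : 4 * (((∫ x in Ioo (0 : ℝ) 1, weakDerivX 2 φ x ^ 2) + (∫ x in Ioo (0 : ℝ) 1, φ x) ^ 2)
      * Real.exp (4 * M ^ 2 * (∫ x in Ioo (0 : ℝ) 1, φ x) / (κ * β) * T)) ≤ C ^ 2) :
    linftyHSharpNorm 2 T η ≤ ENNReal.ofReal C := by
  obtain ⟨c, hg⟩ := h.exists_geometry hT hφ
  obtain ⟨S, hi⟩ := h.exists_interaction hg hM hfm hfM
  have hm : ∫ x in Ioo (0 : ℝ) 1, η (x, 0) = ∫ x in Ioo (0 : ℝ) 1, φ x := by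
    simp only [h.initial_displacement]
  have hvol := hi.ae_integral_eq hκ.ne'
  have hb := hi.bending_le_exp hρ hδ hβ hκ
    (hi.tendsto_kinetic hρ h.initial_plate_velocity h.tendsto_kinetic_velocity)
    (h.exists_bending_le hT hφ) (integral_nonneg fun x => sq_nonneg _)
    (integral_nonneg hφ0) hm
  exact h.linftyHSharpNorm_le hT (hvol.mono fun t ht => ht.trans hm) hb hC hBC

end IsStrongSolution

end ThinFSI

end

theorem mainTheorem6 (ρ δ β r T M : ℝ) (η₀ : ℝ → ℝ)
    (hρ : 0 < ρ) (hδ : 0 < δ) (hβ : 0 < β) (hr : r ∈ Set.Icc (1 : ℝ) 3) (hT : 0 < T) (hM : 0 < M)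
    (hη₀ : ThinFSI.MemHSharp 3 η₀) (hη₀_cont : Continuous η₀) (hη₀_pos : ∀ x, 0 < η₀ x) :
    ∃ C : ℝ, 0 < C ∧
      ∀ (ε : ℝ) (f v : ℝ × ℝ × ℝ → EuclideanSpace ℝ (Fin 2)) (p : ℝ × ℝ × ℝ → ℝ)
        (η : ℝ × ℝ → ℝ),
        0 < ε →
        ThinFSI.IsStrongSolution (ρ * ε) (δ * ε ^ (-r)) (β * ε⁻¹) (ε ^ 2) T
          (fun x => ε * η₀ x) f v p η →
        AEStronglyMeasurable f (volume.restrict (ThinFSI.fluidCell T η)) →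
        eLpNorm f ∞ (volume.restrict (ThinFSI.fluidCell T η)) ≤ ENNReal.ofReal M →
        ThinFSI.linftyHSharpNorm 2 T η ≤ ENNReal.ofReal (C * ε) := by
  have h2 := hη₀.mono (show 2 ≤ 3 by norm_num)
  set Y := ∫ x in Ioo (0 : ℝ) 1, ThinFSI.weakDerivX 2 η₀ x ^ 2 with hY
  set m := ∫ x in Ioo (0 : ℝ) 1, η₀ x with hm
  have hY0 : 0 ≤ Y := integral_nonneg fun x => sq_nonneg _
  set B := (Y + m ^ 2) * Real.exp (4 * M ^ 2 * m / β * T) with hB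
  have hB0 : 0 ≤ B := by positivity
  refine ⟨2 * √B + 1, by positivity, fun ε f v p η hε h hfm hfM => ?_⟩
  obtain ⟨hφ, hae⟩ := h2.const_mul ε
  refine h.displacement_le hT (by positivity) (by positivity) (by positivity) (by positivity)
    hM.le hφ (fun x => (mul_pos hε (hη₀_pos x)).le) hfm hfM (by positivity) ?_
  have e2 : ∫ x in Ioo (0 : ℝ) 1, ThinFSI.weakDerivX 2 (fun x => ε * η₀ x) x ^ 2 = ε ^ 2 * Y := by
    rw [hY, ← integral_const_mul]
    refine integral_congr_ae (ae_restrict_of_ae ((hae 2 le_rfl).mono fun x hx => ?_))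
    simp only [hx]; ring
  -- the coefficients are scaled so that the rate of growth does not depend on `ε`
  have e3 : 4 * M ^ 2 * (ε * m) / (ε ^ 2 * (β * ε⁻¹)) = 4 * M ^ 2 * m / β := by field_simp
  rw [e2, integral_const_mul, ← hm, e3]
  have e4 : 4 * ((ε ^ 2 * Y + (ε * m) ^ 2) * Real.exp (4 * M ^ 2 * m / β * T)) = 4 * B * ε ^ 2 := by
    rw [hB]; ring
  rw [e4, mul_pow]
  gcongr
  nlinarith [Real.sq_sqrt hB0, Real.sqrt_nonneg B]
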